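/- Let $V=\{1,\dots,27\}$ and let $\mathrm{S}_{27}$ be the group of permutations of $V$. Consider the following properties of a subgroup $G\subset\mathrm{S}_{27}$: (a) The order of every element of $G$ belongs to $\{1,2,3,4,9,11,13\}$. (b) $G$ does not contain a subgroup isomorphic to $\mathrm{C}_2\times\mathrm{C}_4$ or to $\mathrm{C}_3\times\mathrm{C}_9$. (c) If $H\subset G$ is a $2$-subgroup, then $|H|\le 8$, and $V$ consists of exactly $15$, $9$, or $6$ $H$-orbits in the cases $|H|=2$, $4$, or $8$, respectively. (d) Every $3$-subgroup $H\subset G$ acts freely on $V$. (e) Every element $g\in G$ of order $11$ acts on $V$ with two orbits of length $11$ and five fixed points. (f) If $H\subset G$ is a subgroup isomorphic to $\mathrm{D}_{11}$, then $H$ acts on $V$ with two orbits of length $11$, two orbits of length $2$, and one fixed point. (g) Every element $g\in G$ of order $13$ acts on $V$ with two orbits of length $13$ and one fixed point. Here $\mathrm{C}_n$ is the cyclic group of order $n$ and $\mathrm{D}_n$ is the dihedral group of order $2n$. Consider the following list, whose entries prescribe the isomorphism type of a subgroup $G\subset \mathrm{S}_{27}$ and its action on $V$ (a multiset of numbers is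 the multiset of orbit lengths). A semidirect product $N\rtimes H$ without further comment is one with non-trivial action of $H$ on $N$. $\mathrm{Q}_8$ is the quaternion group; $\mathrm{He}_3=3^{1+2}_+$ and $3^{1+2}_-$ are the groups with centre $Z\cong\mathrm{C}_3$ and quotient by $Z$ isomorphic to $\mathrm{C}_3^2$ that have exponent $3$ and contain an element of order $9$, respectively; $\mathrm{PSU}(3,2)$ is the quotient by its centre of $\mathrm{SU}(3,2)=\{U\in\mathrm{SL}(3,\mathbb{F}_4) : F(U)^tU=I\}$, where $F$ is $x\mapsto x^2$ applied entrywise. 1. $\mathrm{C}_3^3\rtimes\mathrm{C}_{13}$, transitive. 2. $\mathrm{C}_3^3$, regular transitive. 3. $\mathrm{He}_3$, regular transitive. 4. $3^{1+2}_-$, regular transitive. 5. $\mathrm{C}_{13}\rtimes\mathrm{C}_4$ with $\mathrm{C}_4$ acting faithfully on $\mathrm{C}_{13}$; $13,13,1$. 6. $\mathrm{C}_3^2\rtimes\mathrm{C}_4$ with $\mathrm{C}_4$ acting faithfully on $\mathrm{C}_3^2$; $9,9,9$. 7. $\mathrm{D}_{13}$; $13,13,1$. 8. $\mathrm{D}_{11}$;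 $11,11,2,2,1$. 9. $\mathrm{C}_3\rtimes\mathrm{S}_3$; $9,9,9$. 10. $\mathrm{D}_9$; $9,9,9$. 11. $\mathrm{C}_{13}$; $13,13,1$. 12. $\mathrm{A}_4$; $12,12,3$. 13. $\mathrm{C}_{11}$; $11,11,1,1,1,1,1$. 14. $\mathrm{C}_3^2$; $9,9,9$. 15. $\mathrm{C}_9$; $9,9,9$. 16. $\mathrm{C}_2^3$; $8,8,8,1,1,1$. 17. $\mathrm{D}_4$; $8,8,8,1,1,1$. 18. $\mathrm{D}_4$; $8,8,4,4,2,1$, where the stabilizers of points in the two different orbits of length $4$ are not conjugate to each other and none of them is the centre of $\mathrm{D}_4$, and the stabilizer of a point in the orbit of length $2$ is the subgroup $\mathrm{C}_4\subset\mathrm{D}_4$. 19. $\mathrm{Q}_8$; $8,8,8,1,1,1$. 20. $\mathrm{S}_3$; $6,6,6,3,3,3$. 21. $\mathrm{C}_2^2$; $4,4,4,4,4,4,1,1,1$. 22. $\mathrm{C}_2^2$; $4,4,4,4,4,2,2,2,1$, where the stabilizers of points in the three orbits of length $2$ are the three pairwise different subgroups of $\mathrm{C}_2^2$ isomorphic to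 $\mathrm{C}_2$. 23. $\mathrm{C}_4$; $4,4,4,4,4,4,1,1,1$. 24. $\mathrm{C}_3$, acting freely. 25. $\mathrm{C}_2$, with exactly $3$ fixed points. 26. The trivial group. 27. $\mathrm{PSU}(3,2)$; $9,9,9$. Then each of the $27$ entries describes exactly one (non-empty) conjugacy class of subgroups of $\mathrm{S}_{27}$; no subgroup is described by two different entries; and a subgroup $G\subset\mathrm{S}_{27}$ satisfies (a)–(g) if and only if it is described by one of the entries. In particular, up to conjugation there are exactly $27$ subgroups of $\mathrm{S}_{27}$ that satisfy (a)–(g). Moreover, $\mathrm{PSU}(3,2)\cong\mathrm{C}_3^2\rtimes\mathrm{Q}_8$ with $\mathrm{Q}_8$ acting faithfully on $\mathrm{C}_3^2$. -/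

import Mathlib

namespace PermGroups27

/-- The symmetric group `S_27`, acting on the 27-point set `V = Fin 27`. -/
abbrev S27 : Type := Equiv.Perm (Fin 27)

/-- The cyclic group `C_n` (for `n > 0`), written multiplicatively. -/
abbrev Cyc (n : ℕ) : Type := Multiplicative (ZMod n)

/-- Two subgroups of a group are conjugate. -/
def AreConjugate {Γ : Type*} [Group Γ] (H K : Subgroup Γ) : Prop :=
  ∃ g : Γ, H.map (MulAut.conj g).toMonoidHom = K

/-- The two groups are isomorphic. -/
def Iso (A B : Type*) [Group A] [Group B] : Prop := Nonempty (A ≃* B)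

/-! ### Orbits -/

/-- The set of `H`-orbits in `V`. -/
def orbitSet (H : Subgroup S27) : Set (Set (Fin 27)) :=
  Set.range fun v : Fin 27 => MulAction.orbit H v

/-- The multiset of lengths of all `H`-orbits in `V` (one entry for each orbit). -/
noncomputable def orbitLengths (H : Subgroup S27) : Multiset ℕ :=
  (Set.toFinite (orbitSet H)).toFinset.val.map Set.ncard

/-- `H` acts freely on `V`. -/
def ActsFreely (H : Subgroup S27) : Prop :=
  ∀ v : Fin 27, MulAction.stabilizer H v = ⊥

/-- `H` acts transitively on `V`. -/
def ActsTransitively (H : Subgroup S27) : Prop :=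
  MulAction.IsPretransitive H (Fin 27)

/-- `H` acts regularly and transitively on `V`. -/
def ActsRegularly (H : Subgroup S27) : Prop :=
  ActsTransitively H ∧ ActsFreely H

/-! ### The properties (a)–(g) -/

/-- The properties (a)–(g) of a subgroup `G ⊂ S_27`. -/
structure HasPropertiesAG (G : Subgroup S27) : Prop where
  /-- the order of every element of `G` belongs to `{1, 2, 3, 4, 9, 11, 13}` -/
  a : ∀ g ∈ G, orderOf g ∈ ({1, 2, 3, 4, 9, 11, 13} : Set ℕ)
  /-- `G` contains no subgroup isomorphic to `C_2 × C_4` or to `C_3 × C_9` -/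
  b : ∀ H : Subgroup S27, H ≤ G → ¬ Iso H (Cyc 2 × Cyc 4) ∧ ¬ Iso H (Cyc 3 × Cyc 9)
  /-- every 2-subgroup has order at most 8, and has 15, 9, 6 orbits if its order is 2, 4, 8 -/
  c : ∀ H : Subgroup S27, H ≤ G → IsPGroup 2 H →
    Nat.card H ≤ 8 ∧
    (Nat.card H = 2 → (orbitSet H).ncard = 15) ∧
    (Nat.card H = 4 → (orbitSet H).ncard = 9) ∧
    (Nat.card H = 8 → (orbitSet H).ncard = 6)
  /-- every 3-subgroup acts freely -/
  d : ∀ H : Subgroup S27, H ≤ G → IsPGroup 3 H → ActsFreely H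
  /-- elements of order 11 have two orbits of length 11 and five fixed points -/
  e : ∀ g ∈ G, orderOf g = 11 → orbitLengths (Subgroup.zpowers g) = {11, 11, 1, 1, 1, 1, 1}
  /-- subgroups isomorphic to the dihedral group of order 22 have orbit lengths
  11, 11, 2, 2, 1 -/
  f : ∀ H : Subgroup S27, H ≤ G → Iso H (DihedralGroup 11) → orbitLengths H = {11, 11, 2, 2, 1}
  /-- elements of order 13 have two orbits of length 13 and one fixed point -/
  g : ∀ g ∈ G, orderOf g = 13 → orbitLengths (Subgroup.zpowers g) = {13, 13, 1}

/-! ### Groups that occur in the list -/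

/-- `A` is isomorphic to a semidirect product `N ⋊ H` that is not direct. -/
def IsNontrivialSemidirect (A N H : Type*) [Group A] [Group N] [Group H] : Prop :=
  ∃ φ : H →* MulAut N, φ ≠ 1 ∧ Iso A (N ⋊[φ] H)

/-- `A` is isomorphic to a semidirect product `N ⋊ H` with `H` acting faithfully on `N`. -/
def IsFaithfulSemidirect (A N H : Type*) [Group A] [Group N] [Group H] : Prop :=
  ∃ φ : H →* MulAut N, Function.Injective φ ∧ Iso A (N ⋊[φ] H)

/-- `A` is an extraspecial group of order 27: its centre `Z` is isomorphic to `C_3`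
and `A / Z` is isomorphic to `C_3 × C_3`. -/
def IsExtraspecial27 (A : Type*) [Group A] : Prop :=
  Iso (Subgroup.center A) (Cyc 3) ∧ Iso (A ⧸ Subgroup.center A) (Cyc 3 × Cyc 3)

/-- The Heisenberg group `He_3 = 3_+^{1+2}`: the extraspecial group of order 27 and exponent 3. -/
def IsHeisenberg3 (A : Type*) [Group A] : Prop :=
  IsExtraspecial27 A ∧ Monoid.exponent A = 3

/-- The group `3_-^{1+2}`: the extraspecial group of order 27 with an element of order 9. -/
def IsExtraspecialMinus3 (A : Type*) [Group A] : Prop :=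
  IsExtraspecial27 A ∧ ∃ a : A, orderOf a = 9

/-- The special unitary group `SU(n, p)`: matrices `U` of determinant 1 over the field of `p ^ 2`
elements with `F(U)ᵗ U = I`, where `F` is the Frobenius automorphism `x ↦ x ^ p`. -/
def SU (n p : ℕ) [Fact p.Prime] :
    Subgroup (Matrix.SpecialLinearGroup (Fin n) (GaloisField p 2)) where
  carrier := {U | ((U : Matrix (Fin n) (Fin n) (GaloisField p 2)).map
    (frobenius (GaloisField p 2) p)).transpose * (U : Matrix (Fin n) (Fin n) _) = 1}
  one_mem' := by
    simp [Matrix.map_one]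
  mul_mem' := by
    intro A B hA hB
    simp only [Set.mem_ofPred_eq] at hA hB ⊢
    rw [Matrix.SpecialLinearGroup.coe_mul, Matrix.map_mul, Matrix.transpose_mul,
      Matrix.mul_assoc, ← Matrix.mul_assoc _ A.val B.val, hA, Matrix.one_mul, hB]
  inv_mem' := by
    intro A hA
    simp only [Set.mem_ofPred_eq] at hA ⊢
    have h1 : A.val * (A⁻¹).val = 1 := by
      rw [← Matrix.SpecialLinearGroup.coe_mul, mul_inv_cancel, Matrix.SpecialLinearGroup.coe_one]
    have h2 : (A.val.map (frobenius (GaloisField p 2) p)).transpose = (A⁻¹).val := by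
      calc _ = (A.val.map (frobenius (GaloisField p 2) p)).transpose * (A.val * (A⁻¹).val) := by
            rw [h1, Matrix.mul_one]
        _ = _ := by rw [← Matrix.mul_assoc, hA, Matrix.one_mul]
    rw [← h2, ← Matrix.transpose_one, ← Matrix.map_one (frobenius (GaloisField p 2) p)
      (map_zero _) (map_one _), ← h1, Matrix.map_mul, Matrix.transpose_mul, ← h2]

/-- The projective special unitary group `PSU(n, p)`, the quotient of `SU(n, p)` by its centre. -/
abbrev PSU (n p : ℕ) [Fact p.Prime] : Type := SU n p ⧸ Subgroup.center (SU n p)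

/-! ### The list -/

/-- Names of the 27 entries of the list: 26 table rows and `PSU(3, 2)`. -/
inductive Entry : Type
  | row1 | row2 | row3 | row4 | row5 | row6 | row7 | row8 | row9 | row10 | row11 | row12 | row13
  | row14 | row15 | row16 | row17 | row18 | row19 | row20 | row21 | row22 | row23 | row24
  | row25 | row26 | psu

/-- `G` has the isomorphism type and the action on `V` prescribed by the entry. -/
def Entry.Describes : Entry → Subgroup S27 → Prop
  | row1, G => IsNontrivialSemidirect G (Fin 3 → Cyc 3) (Cyc 13) ∧ ActsTransitively G
  | row2, G => Iso G (Fin 3 → Cyc 3) ∧ ActsRegularly G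
  | row3, G => IsHeisenberg3 G ∧ ActsRegularly G
  | row4, G => IsExtraspecialMinus3 G ∧ ActsRegularly G
  | row5, G => IsFaithfulSemidirect G (Cyc 13) (Cyc 4) ∧ orbitLengths G = {13, 13, 1}
  | row6, G => IsFaithfulSemidirect G (Fin 2 → Cyc 3) (Cyc 4) ∧ orbitLengths G = {9, 9, 9}
  | row7, G => Iso G (DihedralGroup 13) ∧ orbitLengths G = {13, 13, 1}
  | row8, G => Iso G (DihedralGroup 11) ∧ orbitLengths G = {11, 11, 2, 2, 1}
  | row9, G => IsNontrivialSemidirect G (Cyc 3) (Equiv.Perm (Fin 3)) ∧ orbitLengths G = {9, 9, 9}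
  | row10, G => Iso G (DihedralGroup 9) ∧ orbitLengths G = {9, 9, 9}
  | row11, G => Iso G (Cyc 13) ∧ orbitLengths G = {13, 13, 1}
  | row12, G => Iso G (alternatingGroup (Fin 4)) ∧ orbitLengths G = {12, 12, 3}
  | row13, G => Iso G (Cyc 11) ∧ orbitLengths G = {11, 11, 1, 1, 1, 1, 1}
  | row14, G => Iso G (Fin 2 → Cyc 3) ∧ orbitLengths G = {9, 9, 9}
  | row15, G => Iso G (Cyc 9) ∧ orbitLengths G = {9, 9, 9}
  | row16, G => Iso G (Fin 3 → Cyc 2) ∧ orbitLengths G = {8, 8, 8, 1, 1, 1}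
  | row17, G => Iso G (DihedralGroup 4) ∧ orbitLengths G = {8, 8, 8, 1, 1, 1}
  | row18, G => Iso G (DihedralGroup 4) ∧ orbitLengths G = {8, 8, 4, 4, 2, 1} ∧
      (∀ u v : Fin 27, (MulAction.orbit G u).ncard = 4 → (MulAction.orbit G v).ncard = 4 →
        MulAction.orbit G u ≠ MulAction.orbit G v →
        ¬ AreConjugate (MulAction.stabilizer G u) (MulAction.stabilizer G v)) ∧
      (∀ u : Fin 27, (MulAction.orbit G u).ncard = 4 →
        MulAction.stabilizer G u ≠ Subgroup.center G) ∧
      (∀ w : Fin 27, (MulAction.orbit G w).ncard = 2 → Iso (MulAction.stabilizer G w) (Cyc 4))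
  | row19, G => Iso G (QuaternionGroup 2) ∧ orbitLengths G = {8, 8, 8, 1, 1, 1}
  | row20, G => Iso G (Equiv.Perm (Fin 3)) ∧ orbitLengths G = {6, 6, 6, 3, 3, 3}
  | row21, G => Iso G (Fin 2 → Cyc 2) ∧ orbitLengths G = {4, 4, 4, 4, 4, 4, 1, 1, 1}
  | row22, G => Iso G (Fin 2 → Cyc 2) ∧ orbitLengths G = {4, 4, 4, 4, 4, 2, 2, 2, 1} ∧
      (∀ u v : Fin 27, (MulAction.orbit G u).ncard = 2 → (MulAction.orbit G v).ncard = 2 →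
        MulAction.orbit G u ≠ MulAction.orbit G v →
        MulAction.stabilizer G u ≠ MulAction.stabilizer G v) ∧
      (∀ u : Fin 27, (MulAction.orbit G u).ncard = 2 → Iso (MulAction.stabilizer G u) (Cyc 2))
  | row23, G => Iso G (Cyc 4) ∧ orbitLengths G = {4, 4, 4, 4, 4, 4, 1, 1, 1}
  | row24, G => Iso G (Cyc 3) ∧ ActsFreely G
  | row25, G => Iso G (Cyc 2) ∧ (MulAction.fixedPoints G (Fin 27)).ncard = 3
  | row26, G => G = ⊥
  | psu, G => Iso G (PSU 3 2) ∧ orbitLengths G = {9, 9, 9}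

end PermGroups27

open PermGroups27

/-!
The properties (a)–(g) can be expressed through single elements of a group `A` that acts on a set
of 27 points: the number of fixed points of an element is a function of its order, a few pairs of
commuting elements are excluded, and generators of a dihedral subgroup of order 22 have exactly one
common fixed point (`Good`, `HasPropertiesAG.good`, `Good.hasPropertiesAG`). In this form the
properties pass to subgroups and to isomorphic actions, and the main tool is to count the pairs
`(a, v)` with `a • v = v` in two ways.

*Structure* (`Good.exists_isoType`). The order divides `8 * 27 * 11 * 13`. If 13 divides the order,
the Sylow 13-subgroup is self-centralizing, so its number is 1 or 27; in the second case the group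
is transitive of order 351, because otherwise an involution would normalize a regular normal
subgroup of order 27. If 11 divides the order, the Sylow 11-subgroup is normal of index at most 2.
Otherwise the order is `2 ^ i * 3 ^ j`. If both primes occur, involutions invert the core `D` of a
Sylow 3-subgroup; for `D ≠ 1` this makes the Sylow 3-subgroup normal of order 3 or 9 and the group
a (generalized) dihedral group or a Frobenius group, and for `D = 1` there are four Sylow
3-subgroups and the group is alternating of degree 4. Groups of prime power order are classified
directly.

*Actions* (`Good.describes`). The count of fixed points determines the orbit lengths, except for the
Klein four-group and the dihedral group of order 8, which have one or three common fixed points.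

*Uniqueness* (`Entry.Describes.areConjugate`). Two finite sets with an action of the same group are
isomorphic if a bijection preserves the conjugacy classes of stabilizers. Where all orbit lengths
are 1, the order of the group, or the index of a Sylow subgroup, the length of an orbit determines
the class of its stabilizers; the two remaining actions are treated by the conditions on stabilizers
in the list. The isomorphism types are unique (`Entry.IsoType.iso`) and pairwise different, up to
the two actions just mentioned (`eq_of_isoType`).

*Existence* (`Entry.realized`). Most entries are subgroups of a few Frobenius groups that act by
affine transformations on copies of their kernel (`good_affine`) or of groups that act regularly
on copies of themselves (`good_regular`); the alternating group and two dihedral groups are given by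
explicit actions.

*The unitary group* (`isFaithfulSemidirect_PSU`). Counting orthonormal pairs bounds the order of
`SU(3, 2)` by 216, and explicit matrices show that the quotient by the centre contains elements
that satisfy the relations of the semidirect product of order 72.
-/

namespace PermGroups27

open MulAction

/-! ### Recognition of small groups -/

theorem Iso.symm {A B : Type*} [Group A] [Group B] (h : Iso A B) : Iso B A :=
  h.map MulEquiv.symm

theorem Iso.trans {A B C : Type*} [Group A] [Group B] [Group C] (h : Iso A B) (h' : Iso B C) :
    Iso A C :=
  ⟨h.some.trans h'.some⟩

theorem Iso.card_eq {A B : Type*} [Group A] [Group B] (h : Iso A B) : Nat.card A = Nat.card B :=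
  Nat.card_congr h.some.toEquiv

theorem iso_of_injective {A B : Type*} [Group A] [Group B] [Finite A] (f : B →* A)
    (hf : Function.Injective f) (h : Nat.card A ≤ Nat.card B) : Iso A B := by
  have : Finite B := Finite.of_injective f hf
  exact ⟨(MulEquiv.ofBijective f
    ((Nat.bijective_iff_injective_and_card f).2 ⟨hf, le_antisymm
      (Nat.card_le_card_of_injective f hf) h⟩)).symm⟩

theorem SemidirectProduct.lift_injective {A N H : Type*} [Group A] [Group N] [Group H]
    {φ : H →* MulAut N} (f : N →* A) (g : H →* A)
    (hc : ∀ h, f.comp (φ h).toMonoidHom = (MulAut.conj (g h)).toMonoidHom.comp f)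
    (hf : Function.Injective f)
    (hd : ∀ n h, f n * g h = 1 → h = 1) :
    Function.Injective (SemidirectProduct.lift f g hc) := by
  rw [injective_iff_map_eq_one]
  rintro ⟨n, h⟩ hx
  have hx' : f n * g h = 1 := hx
  have := hd n h hx'
  subst this
  rw [map_one, mul_one] at hx'
  have := (injective_iff_map_eq_one f).1 hf n hx'
  subst this
  rfl

theorem iso_semidirect {A N H : Type*} [Group A] [Finite A] [Group N] [Group H]
    {φ : H →* MulAut N} (f : N →* A) (g : H →* A)
    (hc : ∀ h n, f (φ h n) = g h * f n * (g h)⁻¹) (hf : Function.Injective f)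
    (hd : ∀ n h, f n * g h = 1 → h = 1)
    (hcard : Nat.card A = Nat.card N * Nat.card H) : Iso A (N ⋊[φ] H) :=
  iso_of_injective (SemidirectProduct.lift f g fun h => MonoidHom.ext fun n => hc h n)
    (SemidirectProduct.lift_injective f g _ hf hd) (by rw [SemidirectProduct.card, hcard])

/-- The homomorphism from the cyclic group `C_n` that sends the generator to `x`, for
`x ^ n = 1`. -/
def cycHom {A : Type*} [Group A] (n : ℕ) (x : A) (hx : x ^ n = 1) : Cyc n →* A :=
  AddMonoidHom.toMultiplicativeLeft (ZMod.lift n ⟨zmultiplesHom (Additive A) (Additive.ofMul x), by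
    simpa using congrArg Additive.ofMul hx⟩)

theorem cycHom_intCast {A : Type*} [Group A] (n : ℕ) (x : A) (hx : x ^ n = 1) (k : ℤ) :
    cycHom n x hx (Multiplicative.ofAdd (k : ZMod n)) = x ^ k := by
  have := ZMod.lift_coe n (⟨zmultiplesHom (Additive A) (Additive.ofMul x), by
    simpa using congrArg Additive.ofMul hx⟩ : {f : ℤ →+ Additive A // f n = 0}) k
  exact congrArg Additive.toMul this

theorem cycHom_natCast {A : Type*} [Group A] (n : ℕ) (x : A) (hx : x ^ n = 1) (k : ℕ) :
    cycHom n x hx (Multiplicative.ofAdd (k : ZMod n)) = x ^ k := by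
  simpa using cycHom_intCast n x hx k

theorem cycHom_gen {A : Type*} [Group A] (n : ℕ) (x : A) (hx : x ^ n = 1) :
    cycHom n x hx (Multiplicative.ofAdd 1) = x := by
  simpa using cycHom_natCast n x hx 1

theorem cycHom_injective {A : Type*} [Group A] (n : ℕ) (x : A) (hx : orderOf x = n) :
    Function.Injective (cycHom n x (hx ▸ pow_orderOf_eq_one x)) := by
  rw [injective_iff_map_eq_one]
  intro a ha
  obtain ⟨k, hk⟩ := ZMod.intCast_surjective (Multiplicative.toAdd a)
  have h1 : a = Multiplicative.ofAdd (k : ZMod n) := by rw [hk]; rfl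
  rw [h1, cycHom_intCast, ← orderOf_dvd_iff_zpow_eq_one, hx] at ha
  rw [h1, (ZMod.intCast_zmod_eq_zero_iff_dvd k n).2 ha]
  rfl

theorem cycHom_mem_zpowers {A : Type*} [Group A] (n : ℕ) (x : A) (hx : x ^ n = 1) (a : Cyc n) :
    cycHom n x hx a ∈ Subgroup.zpowers x := by
  obtain ⟨k, hk⟩ := ZMod.intCast_surjective (Multiplicative.toAdd a)
  have h1 : a = Multiplicative.ofAdd (k : ZMod n) := by rw [hk]; rfl
  rw [h1, cycHom_intCast]
  exact Subgroup.zpow_mem_zpowers x k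

theorem Cyc.eq_pow {n : ℕ} (a : Cyc n) : ∃ k : ℕ, a = (Multiplicative.ofAdd (1 : ZMod n)) ^ k ∨
    a = ((Multiplicative.ofAdd (1 : ZMod n)) ^ k)⁻¹ := by
  obtain ⟨k, hk⟩ := ZMod.intCast_surjective (Multiplicative.toAdd a)
  have h1 : a = Multiplicative.ofAdd (1 : ZMod n) ^ k := by
    rw [← ofAdd_zsmul, zsmul_one, hk]; rfl
  obtain ⟨m, rfl | rfl⟩ := Int.eq_nat_or_neg k
  · exact ⟨m, Or.inl (by rw [h1, zpow_natCast])⟩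
  · exact ⟨m, Or.inr (by rw [h1, zpow_neg, zpow_natCast])⟩

/-- Two homomorphisms from a cyclic group that agree on the generator are equal. -/
theorem Cyc.hom_ext {n : ℕ} {M : Type*} [Group M] {f g : Cyc n →* M}
    (h : f (Multiplicative.ofAdd 1) = g (Multiplicative.ofAdd 1)) : f = g := by
  refine MonoidHom.ext fun a => ?_
  obtain ⟨k, rfl | rfl⟩ := Cyc.eq_pow a <;> simp [h]

theorem Cyc.natCard (n : ℕ) : Nat.card (Cyc n) = n := Nat.card_zmod n

theorem Cyc.orderOf_gen (n : ℕ) : orderOf (Multiplicative.ofAdd (1 : ZMod n)) = n := by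
  rw [orderOf_ofAdd_eq_addOrderOf, ZMod.addOrderOf_one]

theorem iso_cyc {A : Type*} [Group A] [Finite A] {n : ℕ} {x : A} (hx : orderOf x = n)
    (hA : Nat.card A = n) : Iso A (Cyc n) :=
  iso_of_injective _ (cycHom_injective n x hx) (by rw [hA, Cyc.natCard])

theorem iso_cyc_of_prime {A : Type*} [Group A] [Finite A] {p : ℕ} [hp : Fact p.Prime]
    (hA : Nat.card A = p) : Iso A (Cyc p) := by
  obtain ⟨x, hx⟩ := exists_prime_orderOf_dvd_card' (G := A) p (by rw [hA])
  exact iso_cyc hx hA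

/-- The homomorphism from a dihedral group given by elements that satisfy the defining relations. -/
theorem exists_dihedralHom {A : Type*} [Group A] {n : ℕ} {x t : A}
    (hx : orderOf x = n) (ht : t * t = 1) (htx : t * x * t⁻¹ = x⁻¹)
    (hmem : t ∉ Subgroup.zpowers x) :
    ∃ f : DihedralGroup n →* A, Function.Injective f ∧ f (.r 1) = x ∧ f (.sr 0) = t ∧
      ∀ d, f d ∈ Subgroup.closure {x, t} := by
  have hxn : x ^ n = 1 := hx ▸ pow_orderOf_eq_one x
  set X : ZMod n → A := fun i => cycHom n x hxn (Multiplicative.ofAdd i) with hX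
  have hadd : ∀ i j, X (i + j) = X i * X j := fun i j => by simp [hX, ofAdd_add]
  have hconj : ∀ i, t * X i * t⁻¹ = X (-i) := by
    intro i
    have : (MulAut.conj t).toMonoidHom.comp (cycHom n x hxn) =
        (cycHom n x hxn).comp (invMonoidHom) := by
      apply Cyc.hom_ext
      simp [cycHom_gen, htx]
    simpa [hX] using DFunLike.congr_fun this (Multiplicative.ofAdd i)
  have htt : t⁻¹ = t := inv_eq_of_mul_eq_one_left ht
  have hconj' : ∀ i, X i * t = t * X (-i) := by
    intro i
    rw [← hconj i, htt, ← mul_assoc, ← mul_assoc, ht, one_mul]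
  have hXmem : ∀ i, X i ∈ Subgroup.zpowers x := fun i => cycHom_mem_zpowers _ _ _ _
  have hXinj : ∀ i, X i = 1 → i = 0 := fun i hi =>
    (injective_iff_map_eq_one _).1 (cycHom_injective n x hx) _ hi
  -- Mathlib's convention is `sr i = s r ^ i`, so the relation is `X i * t = t * X (-i)`
  let F : DihedralGroup n → A := fun d => match d with
    | .r i => X i
    | .sr i => t * X i
  have hF : ∀ a b, F (a * b) = F a * F b := by
    rintro (i | i) (j | j)
    · exact hadd i j
    · change t * X (j - i) = X i * (t * X j)
      rw [← mul_assoc, hconj', mul_assoc, ← hadd]; congr 2; ring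
    · change t * X (i + j) = t * X i * X j
      rw [hadd, mul_assoc]
    · change X (j - i) = t * X i * (t * X j)
      rw [mul_assoc, ← mul_assoc (X i), hconj', ← mul_assoc, ← mul_assoc, ht, one_mul, ← hadd]
      congr 1; ring
  have hcl : Subgroup.zpowers x ≤ Subgroup.closure {x, t} := by
    rw [Subgroup.zpowers_le]; exact Subgroup.subset_closure (by simp)
  refine ⟨MonoidHom.mk' F hF, ?_, cycHom_gen n x hxn, ?_, ?_⟩
  · rw [injective_iff_map_eq_one]
    rintro (i | i) h
    · have := hXinj i h
      subst this
      rfl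
    · exfalso
      have h' : t * X i = 1 := h
      exact hmem (by rw [eq_inv_of_mul_eq_one_left h']; exact inv_mem (hXmem i))
  · change t * cycHom n x hxn 1 = t
    rw [map_one, mul_one]
  · rintro (i | i)
    · exact hcl (hXmem i)
    · exact mul_mem (Subgroup.subset_closure (by simp)) (hcl (hXmem i))

theorem iso_dihedral {A : Type*} [Group A] [Finite A] {n : ℕ} {x t : A}
    (hx : orderOf x = n) (ht : t * t = 1) (htx : t * x * t⁻¹ = x⁻¹)
    (hmem : t ∉ Subgroup.zpowers x) (hA : Nat.card A = 2 * n) : Iso A (DihedralGroup n) := by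
  obtain ⟨f, hf, -⟩ := exists_dihedralHom hx ht htx hmem
  exact iso_of_injective f hf (by rw [hA, DihedralGroup.nat_card])

theorem exists_cyc_prod_hom {A : Type*} [Group A] {m n : ℕ} {x y : A} (hx : orderOf x = m)
    (hy : orderOf y = n) (hxy : Commute x y)
    (hd : Disjoint (Subgroup.zpowers x) (Subgroup.zpowers y)) :
    ∃ f : Cyc m × Cyc n →* A, Function.Injective f ∧ ∀ c, f c ∈ Subgroup.closure {x, y} := by
  have hx1 : ∀ a, cycHom m x (hx ▸ pow_orderOf_eq_one x) a ∈ Subgroup.zpowers x :=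
    fun a => cycHom_mem_zpowers _ _ _ _
  have hy1 : ∀ a, cycHom n y (hy ▸ pow_orderOf_eq_one y) a ∈ Subgroup.zpowers y :=
    fun a => cycHom_mem_zpowers _ _ _ _
  refine ⟨MonoidHom.noncommCoprod (cycHom m x (hx ▸ pow_orderOf_eq_one x))
    (cycHom n y (hy ▸ pow_orderOf_eq_one y)) ?_, ?_, ?_⟩
  · intro a b
    obtain ⟨i, hi⟩ := hx1 a
    obtain ⟨j, hj⟩ := hy1 b
    rw [← hi, ← hj]
    exact (hxy.zpow_zpow i j)
  · rw [injective_iff_map_eq_one]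
    rintro ⟨a, b⟩ h
    rw [MonoidHom.noncommCoprod_apply] at h
    have h1 : cycHom m x (hx ▸ pow_orderOf_eq_one x) a = 1 := by
      have h2 := eq_inv_of_mul_eq_one_left h
      have h3 := hx1 a
      exact Subgroup.disjoint_def.1 hd h3 (h2 ▸ inv_mem (hy1 b))
    rw [h1, one_mul] at h
    rw [(injective_iff_map_eq_one _).1 (cycHom_injective m x hx) a h1,
      (injective_iff_map_eq_one _).1 (cycHom_injective n y hy) b h]
    rfl
  · rintro ⟨a, b⟩
    rw [MonoidHom.noncommCoprod_apply]
    exact mul_mem ((Subgroup.zpowers_le.2 (Subgroup.subset_closure (by simp))) (hx1 a))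
      ((Subgroup.zpowers_le.2 (Subgroup.subset_closure (by simp))) (hy1 b))

theorem disjoint_zpowers_of_prime {A : Type*} [Group A] {x y : A} {p : ℕ} (hp : p.Prime)
    (hy : orderOf y = p) (hxy : y ∉ Subgroup.zpowers x) :
    Disjoint (Subgroup.zpowers x) (Subgroup.zpowers y) := by
  rw [Subgroup.disjoint_def]
  intro z hzx hzy
  by_contra hz
  refine hxy ?_
  have : Fact p.Prime := ⟨hp⟩
  have hfin : IsOfFinOrder y := orderOf_pos_iff.1 (hy ▸ hp.pos)
  have h1 : Nat.card (Subgroup.zpowers y) = p := by rw [Nat.card_zpowers, hy]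
  have h2 : (⟨y, Subgroup.mem_zpowers y⟩ : Subgroup.zpowers y) ∈
      Subgroup.zpowers (⟨z, hzy⟩ : Subgroup.zpowers y) :=
    mem_zpowers_of_prime_card h1 (fun h => hz (congrArg Subtype.val h))
  obtain ⟨k, hk⟩ := h2
  have h3 : z ^ k = y := congrArg Subtype.val hk
  exact h3 ▸ zpow_mem hzx k

/-- The homomorphism from the quaternion group `Q_8` to `A` given by a pair of elements that
satisfies the defining relations. -/
def quaternionHom {A : Type*} [Group A] {x y : A} (hx : x ^ 4 = 1) (hxy : y * x * y⁻¹ = x⁻¹)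
    (hy : y * y = x ^ 2) : QuaternionGroup 2 →* A :=
  MonoidHom.mk' (fun q => match q with
    | .a i => cycHom (2 * 2) x hx (Multiplicative.ofAdd i)
    | .xa i => y * cycHom (2 * 2) x hx (Multiplicative.ofAdd i)) <| by
  set X : ZMod (2 * 2) → A := fun i => cycHom (2 * 2) x hx (Multiplicative.ofAdd i) with hX
  have hadd : ∀ i j, X (i + j) = X i * X j := fun i j => by simp [hX, ofAdd_add]
  have hconj : ∀ i, X i * y = y * X (-i) := by
    intro i
    have : (MulAut.conj y).toMonoidHom.comp (cycHom (2 * 2) x hx) =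
        (cycHom (2 * 2) x hx).comp (invMonoidHom) := by
      apply Cyc.hom_ext
      simp [cycHom_gen, hxy]
    have := DFunLike.congr_fun this (Multiplicative.ofAdd (-i))
    simp only [MonoidHom.comp_apply, invMonoidHom_apply, ← ofAdd_neg, neg_neg] at this
    change y * X (-i) * y⁻¹ = X i at this
    rw [← this]; simp
  have hX2 : X 2 = y * y := by
    rw [hy]; exact cycHom_natCast (2 * 2) x hx 2
  rintro (i | i) (j | j)
  · exact hadd i j
  · change y * X (j - i) = X i * (y * X j)
    rw [← mul_assoc, hconj, mul_assoc, ← hadd]; congr 2; ring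
  · change y * X (i + j) = y * X i * X j
    rw [hadd, mul_assoc]
  · change X (2 + j - i) = y * X i * (y * X j)
    rw [mul_assoc, ← mul_assoc (X i), hconj, ← mul_assoc, ← mul_assoc, ← hX2, mul_assoc, ← hadd,
      ← hadd]
    congr 1; ring

theorem quaternionHom_a_one {A : Type*} [Group A] {x y : A} (hx : x ^ 4 = 1)
    (hxy : y * x * y⁻¹ = x⁻¹) (hy : y * y = x ^ 2) :
    quaternionHom hx hxy hy (.a 1) = x :=
  cycHom_gen (2 * 2) x hx

theorem quaternionHom_xa_zero {A : Type*} [Group A] {x y : A} (hx : x ^ 4 = 1)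
    (hxy : y * x * y⁻¹ = x⁻¹) (hy : y * y = x ^ 2) :
    quaternionHom hx hxy hy (.xa 0) = y := by
  change y * cycHom (2 * 2) x hx 1 = y
  rw [map_one, mul_one]

theorem quaternionHom_injective {A : Type*} [Group A] {x y : A} (hx : orderOf x = 4)
    (hxy : y * x * y⁻¹ = x⁻¹) (hy : y * y = x ^ 2) (hmem : y ∉ Subgroup.zpowers x) :
    Function.Injective (quaternionHom (hx ▸ pow_orderOf_eq_one x) hxy hy) := by
  have hx4 : x ^ 4 = 1 := hx ▸ pow_orderOf_eq_one x
  rw [injective_iff_map_eq_one]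
  rintro (i | i) h
  · have : i = 0 := (injective_iff_map_eq_one _).1 (cycHom_injective (2 * 2) x hx) _ h
    subst this
    rfl
  · exfalso
    have h' : y * cycHom (2 * 2) x hx4 (Multiplicative.ofAdd i) = 1 := h
    refine hmem ?_
    rw [eq_inv_of_mul_eq_one_left h']
    exact inv_mem (cycHom_mem_zpowers _ _ _ _)

theorem iso_quaternion {A : Type*} [Group A] [Finite A] {x y : A} (hx : orderOf x = 4)
    (hxy : y * x * y⁻¹ = x⁻¹) (hy : y * y = x ^ 2) (hmem : y ∉ Subgroup.zpowers x)
    (hA : Nat.card A = 8) : Iso A (QuaternionGroup 2) :=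
  iso_of_injective _ (quaternionHom_injective hx hxy hy hmem)
    (by rw [hA, Nat.card_eq_fintype_card, QuaternionGroup.card])

theorem nonempty_addEquiv_pi_zmod {V : Type*} [AddCommGroup V] [Finite V] {p : ℕ}
    [hp : Fact p.Prime] [Module (ZMod p) V] {n : ℕ} (hV : Nat.card V = p ^ n) :
    Nonempty (V ≃+ (Fin n → ZMod p)) := by
  have : Module.Finite (ZMod p) V := Module.Finite.of_finite
  have h1 : Nat.card V = Nat.card (ZMod p) ^ Module.finrank (ZMod p) V :=
    Module.natCard_eq_pow_finrank
  rw [Nat.card_zmod] at h1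
  have h2 := (Nat.pow_right_injective hp.out.two_le (hV.symm.trans h1)).symm
  have h3 : Module.finrank (ZMod p) V = Module.finrank (ZMod p) (Fin n → ZMod p) := by
    rw [h2]; simp
  exact ⟨(LinearEquiv.ofFinrankEq V (Fin n → ZMod p) h3).toAddEquiv⟩

theorem iso_pi_cyc_of_commGroup {A : Type*} [CommGroup A] [Finite A] {p : ℕ} [hp : Fact p.Prime]
    {n : ℕ} (hexp : ∀ a : A, a ^ p = 1) (hA : Nat.card A = p ^ n) : Iso A (Fin n → Cyc p) := by
  let _ : Module (ZMod p) (Additive A) :=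
    AddCommGroup.zmodModule fun a => congrArg Additive.ofMul (hexp a.toMul)
  obtain ⟨e⟩ := nonempty_addEquiv_pi_zmod (V := Additive A) (p := p) (n := n) hA
  exact ⟨{ toFun := fun a i => Multiplicative.ofAdd (e (Additive.ofMul a) i)
           invFun := fun f => (e.symm fun i => (f i).toAdd).toMul
           left_inv := fun a => by simp
           right_inv := fun f => by simp
           map_mul' := fun a b => by
             ext i
             simp }⟩

theorem iso_pi_cyc {A : Type*} [Group A] [Finite A] {p : ℕ} [Fact p.Prime] {n : ℕ}
    (hcomm : ∀ a b : A, a * b = b * a) (hexp : ∀ a : A, a ^ p = 1) (hA : Nat.card A = p ^ n) :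
    Iso A (Fin n → Cyc p) :=
  @iso_pi_cyc_of_commGroup A { (inferInstance : Group A) with mul_comm := hcomm } _ p _ n hexp hA

theorem pi_cyc_natCard (n p : ℕ) [NeZero p] : Nat.card (Fin n → Cyc p) = p ^ n := by
  simp

theorem pi_cyc_pow (n p : ℕ) (a : Fin n → Cyc p) : a ^ p = 1 := by
  ext i
  change p • (a i).toAdd = 0
  simp

/-- An involution that acts without fixed points on a finite group inverts every element. -/
theorem conj_eq_inv_of_fixedPointFree {A : Type*} [Group A] {P : Subgroup A} [Finite P]
    {t : A} (ht : t * t = 1) (hP : ∀ p ∈ P, t * p * t⁻¹ ∈ P)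
    (hfree : ∀ p ∈ P, t * p = p * t → p = 1) : ∀ p ∈ P, t * p * t⁻¹ = p⁻¹ := by
  have htt : t⁻¹ = t := inv_eq_of_mul_eq_one_left ht
  let F : P → P := fun p => ⟨(p : A)⁻¹ * (t * p * t⁻¹), mul_mem (inv_mem p.2) (hP p p.2)⟩
  have hinj : Function.Injective F := by
    intro p q hpq
    have h1 : (p : A)⁻¹ * (t * p * t⁻¹) = (q : A)⁻¹ * (t * q * t⁻¹) := congrArg Subtype.val hpq
    have h2 : (q : A) * (p : A)⁻¹ = 1 := by
      refine hfree _ (mul_mem q.2 (inv_mem p.2)) ?_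
      calc t * (q * (p : A)⁻¹) = q * ((q : A)⁻¹ * (t * q * t⁻¹)) * t * (p : A)⁻¹ := by group
        _ = q * ((p : A)⁻¹ * (t * p * t⁻¹)) * t * (p : A)⁻¹ := by rw [h1]
        _ = q * (p : A)⁻¹ * t := by group
    exact (Subtype.ext (mul_inv_eq_one.1 h2)).symm
  intro p hp
  obtain ⟨q, hq⟩ := Finite.surjective_of_injective hinj ⟨p, hp⟩
  have h1 : (q : A)⁻¹ * (t * q * t⁻¹) = p := congrArg Subtype.val hq
  rw [← h1, htt]
  calc t * ((q : A)⁻¹ * (t * q * t)) * t = t * (q : A)⁻¹ * t * q * (t * t) := by group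
    _ = ((q : A)⁻¹ * (t * q * t))⁻¹ := by
      rw [ht, mul_inv_rev, mul_inv_rev, mul_inv_rev, inv_inv, htt]; group

/-! ### Counting orbits and comparing actions -/

/-- Both sides count the pairs `(a, v)` with `a • v = v`. -/
theorem sum_card_stabilizer_eq_sum_card_fixedBy (A X : Type*) [Group A] [MulAction A X]
    [Fintype A] [Fintype X] :
    ∑ v : X, Nat.card (stabilizer A v) = ∑ a : A, Nat.card (fixedBy X a) := by
  classical
  have h1 : ∀ v : X, Nat.card (stabilizer A v) = ∑ a : A, if a • v = v then 1 else 0 := by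
    intro v
    rw [Finset.sum_boole, Nat.cast_id, Nat.card_eq_fintype_card, ← Fintype.card_subtype]
    rfl
  have h2 : ∀ a : A, Nat.card (fixedBy X a) = ∑ v : X, if a • v = v then 1 else 0 := by
    intro a
    rw [Finset.sum_boole, Nat.cast_id, Nat.card_eq_fintype_card, ← Fintype.card_subtype]
    rfl
  simp only [h1, h2]
  exact Finset.sum_comm

theorem sum_card_fixedBy_eq_card_orbits_mul (A X : Type*) [Group A] [MulAction A X]
    [Fintype A] [Finite X] :
    ∑ a : A, Nat.card (fixedBy X a) = Nat.card (orbitRel.Quotient A X) * Nat.card A := by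
  classical
  have := Fintype.ofFinite X
  have h := sum_card_fixedBy_eq_card_orbits_mul_card_group A X
  simp only [Nat.card_eq_fintype_card]
  convert h

theorem smul_mem_orbit_iff' {A X : Type*} [Group A] [MulAction A X] {a : A} {x y : X} :
    a • y ∈ orbit A x ↔ y ∈ orbit A x := by
  rw [← orbit_eq_iff, ← orbit_eq_iff, orbit_smul]

theorem stabilizer_eq_comm {A X Y : Type*} [Group A] [MulAction A X] [MulAction A Y] {x : X}
    {y : Y} (h : stabilizer A x = stabilizer A y) (a : A) :
    stabilizer A (a • x) = stabilizer A (a • y) := by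
  rw [stabilizer_smul_eq_stabilizer_map_conj, stabilizer_smul_eq_stabilizer_map_conj, h]

theorem smul_eq_smul_iff_of_stabilizer_eq {A X Y : Type*} [Group A] [MulAction A X]
    [MulAction A Y] {x : X} {y : Y} (h : stabilizer A x = stabilizer A y) (a b : A) :
    a • x = b • x ↔ a • y = b • y := by
  have h1 : a • x = b • x ↔ b⁻¹ * a ∈ stabilizer A x := by
    rw [mem_stabilizer_iff, mul_smul, inv_smul_eq_iff]
  have h2 : a • y = b • y ↔ b⁻¹ * a ∈ stabilizer A y := by
    rw [mem_stabilizer_iff, mul_smul, inv_smul_eq_iff]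
  rw [h1, h2, h]

/-- The orbits of two points with the same stabilizer are isomorphic `A`-sets. -/
theorem exists_bijOn_orbit {A X Y : Type*} [Group A] [MulAction A X] [MulAction A Y] {x : X}
    {y : Y} (h : stabilizer A x = stabilizer A y) :
    ∃ f : X → Y, Set.BijOn f (orbit A x) (orbit A y) ∧ ∀ a : A, f (a • x) = a • y := by
  classical
  let f : X → Y := fun z => if hz : ∃ a : A, a • x = z then hz.choose • y else y
  have hf : ∀ a : A, f (a • x) = a • y := by
    intro a
    have hz : ∃ b : A, b • x = a • x := ⟨a, rfl⟩
    have h1 : f (a • x) = hz.choose • y := dif_pos hz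
    rw [h1]
    exact (smul_eq_smul_iff_of_stabilizer_eq h _ _).1 hz.choose_spec
  refine ⟨f, ⟨?_, ?_, ?_⟩, hf⟩
  · rintro _ ⟨a, rfl⟩
    exact ⟨a, (hf a).symm⟩
  · rintro _ ⟨a, rfl⟩ _ ⟨b, rfl⟩ hab
    simp only [hf] at hab
    exact (smul_eq_smul_iff_of_stabilizer_eq h _ _).2 hab
  · rintro _ ⟨a, rfl⟩
    exact ⟨a • x, ⟨a, rfl⟩, hf a⟩

/-- If the fibres of two invariant labels have the same size, and points with the same label have
conjugate stabilizers, then there is an equivariant bijection: match one orbit with an orbit of the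
same label, and remove both. -/
theorem exists_equivariant_bijOn {A X Y L : Type*} [Group A] [MulAction A X] [MulAction A Y]
    [Finite X] [Finite Y] [Nonempty Y] (l : X → L) (l' : Y → L)
    (hl : ∀ (a : A) x, l (a • x) = l x) (hl' : ∀ (a : A) y, l' (a • y) = l' y)
    (hs : ∀ x y, l x = l' y → ∃ a : A, stabilizer A x = stabilizer A (a • y)) (n : ℕ) :
    ∀ (S : Set X) (T : Set Y), S.ncard ≤ n → (∀ (a : A), ∀ x ∈ S, a • x ∈ S) →
      (∀ (a : A), ∀ y ∈ T, a • y ∈ T) →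
      (∀ c, {x ∈ S | l x = c}.ncard = {y ∈ T | l' y = c}.ncard) →
      ∃ f : X → Y, Set.BijOn f S T ∧ ∀ (a : A), ∀ x ∈ S, f (a • x) = a • f x := by
  classical
  induction n with
  | zero =>
    intro S T hS _ _ hc
    have hS' : S = ∅ := (Set.ncard_eq_zero (Set.toFinite _)).1 (Nat.le_zero.1 hS)
    have hT : T = ∅ := by
      rw [Set.eq_empty_iff_forall_notMem]
      intro y hy
      have h1 := hc (l' y)
      simp only [hS', Set.mem_empty_iff_false, false_and, Set.ofPred_false, Set.ncard_empty] at h1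
      have := (Set.ncard_eq_zero (Set.toFinite _)).1 h1.symm
      exact (Set.eq_empty_iff_forall_notMem.1 this y) ⟨hy, rfl⟩
    subst hS' hT
    exact ⟨fun _ => Classical.arbitrary Y, Set.bijOn_empty _, by simp⟩
  | succ n ih =>
    intro S T hS hSa hTa hc
    by_cases hSn : S.ncard ≤ n
    · exact ih S T hSn hSa hTa hc
    have hSne : S.Nonempty := by
      rw [← Set.ncard_pos (Set.toFinite _)]; omega
    obtain ⟨x, hx⟩ := hSne
    obtain ⟨y, hyT, hxy⟩ : ∃ y ∈ T, l' y = l x := by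
      have h1 : 0 < {z ∈ S | l z = l x}.ncard :=
        (Set.ncard_pos (Set.toFinite _)).2 ⟨x, hx, rfl⟩
      rw [hc, Set.ncard_pos (Set.toFinite _)] at h1
      exact h1
    obtain ⟨a, ha⟩ := hs x y hxy.symm
    -- the orbits of `x` and of `z` are isomorphic, and the induction hypothesis matches the
    -- remaining points
    set z := a • y with hz
    have hzT : z ∈ T := hTa a y hyT
    have hlz : l' z = l x := by rw [hz, hl', hxy]
    obtain ⟨g, hg, hgx⟩ := exists_bijOn_orbit ha
    have hoS : orbit A x ⊆ S := by rintro _ ⟨b, rfl⟩; exact hSa b x hx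
    have hoT : orbit A z ⊆ T := by rintro _ ⟨b, rfl⟩; exact hTa b z hzT
    obtain ⟨f, hf, hfa⟩ := ih (S \ orbit A x) (T \ orbit A z) (by
        have h1 : (S \ orbit A x).ncard < S.ncard := by
          apply Set.ncard_lt_ncard _ (Set.toFinite _)
          refine ⟨Set.sdiff_subset, fun h => ?_⟩
          exact (h hx).2 (mem_orbit_self x)
        omega)
      (fun b w hw => ⟨hSa b w hw.1, fun h => hw.2 ((smul_mem_orbit_iff').1 h)⟩)
      (fun b w hw => ⟨hTa b w hw.1, fun h => hw.2 ((smul_mem_orbit_iff').1 h)⟩)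
      (by
        intro c
        have h1 : {w ∈ S | l w = c}.ncard = {w ∈ S \ orbit A x | l w = c}.ncard +
            {w ∈ orbit A x | l w = c}.ncard := by
          rw [← Set.ncard_union_eq _ (Set.toFinite _) (Set.toFinite _)]
          · congr 1; ext w
            have := @hoS w
            simp only [Set.mem_ofPred_eq, Set.mem_union, Set.mem_sdiff]; tauto
          · rw [Set.disjoint_left]; rintro w ⟨⟨_, h⟩, _⟩ ⟨h', _⟩; exact h h'
        have h2 : {w ∈ T | l' w = c}.ncard = {w ∈ T \ orbit A z | l' w = c}.ncard +
            {w ∈ orbit A z | l' w = c}.ncard := by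
          rw [← Set.ncard_union_eq _ (Set.toFinite _) (Set.toFinite _)]
          · congr 1; ext w
            have := @hoT w
            simp only [Set.mem_ofPred_eq, Set.mem_union, Set.mem_sdiff]; tauto
          · rw [Set.disjoint_left]; rintro w ⟨⟨_, h⟩, _⟩ ⟨h', _⟩; exact h h'
        -- the labels are constant on the two orbits, which have the same size
        have h3 : {w ∈ orbit A x | l w = c}.ncard = {w ∈ orbit A z | l' w = c}.ncard := by
          by_cases hcx : l x = c
          · have e1 : {w ∈ orbit A x | l w = c} = orbit A x := by
              ext w
              refine ⟨fun h => h.1, ?_⟩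
              rintro ⟨b, rfl⟩; exact ⟨⟨b, rfl⟩, by simp only [hl, hcx]⟩
            have e2 : {w ∈ orbit A z | l' w = c} = orbit A z := by
              ext w
              refine ⟨fun h => h.1, ?_⟩
              rintro ⟨b, rfl⟩; exact ⟨⟨b, rfl⟩, by simp only [hl', hlz, hcx]⟩
            rw [e1, e2, ← hg.image_eq, hg.injOn.ncard_image]
          · have e1 : {w ∈ orbit A x | l w = c} = ∅ := by
              rw [Set.eq_empty_iff_forall_notMem]
              rintro w ⟨⟨b, rfl⟩, h⟩; simp only [hl] at h; exact hcx h
            have e2 : {w ∈ orbit A z | l' w = c} = ∅ := by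
              rw [Set.eq_empty_iff_forall_notMem]
              rintro w ⟨⟨b, rfl⟩, h⟩; simp only [hl', hlz] at h; exact hcx h
            rw [e1, e2, Set.ncard_empty, Set.ncard_empty]
        have := hc c
        omega)
    refine ⟨fun w => if w ∈ orbit A x then g w else f w, ?_, ?_⟩
    · have h1 : Set.BijOn (fun w => if w ∈ orbit A x then g w else f w) (orbit A x) (orbit A z) :=
        hg.congr fun w hw => (if_pos hw).symm
      have h2 : Set.BijOn (fun w => if w ∈ orbit A x then g w else f w) (S \ orbit A x)
          (T \ orbit A z) := hf.congr fun w hw => (if_neg hw.2).symm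
      have h3 := h1.union h2 (by
        rw [Set.injOn_union Set.disjoint_sdiff_right]
        refine ⟨h1.injOn, h2.injOn, fun u hu v hv h => ?_⟩
        exact (h2.mapsTo hv).2 (h ▸ h1.mapsTo hu))
      rwa [Set.union_sdiff_cancel hoS, Set.union_sdiff_cancel hoT] at h3
    · intro b w hw
      by_cases hwo : w ∈ orbit A x
      · have h1 : b • w ∈ orbit A x := smul_mem_orbit_iff'.2 hwo
        simp only [if_pos hwo, if_pos h1]
        obtain ⟨d, rfl⟩ := hwo
        simp only [hgx, smul_smul]
      · have h1 : b • w ∉ orbit A x := fun h => hwo (smul_mem_orbit_iff'.1 h)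
        simp only [if_neg hwo, if_neg h1]
        exact hfa b w ⟨hw, hwo⟩

/-- Two finite `A`-sets are isomorphic if some bijection between them preserves the conjugacy
classes of the stabilizers. -/
theorem exists_equivariant_equiv {A X Y : Type*} [Group A] [MulAction A X] [MulAction A Y]
    [Finite X] [Nonempty Y] (e : X ≃ Y)
    (he : ∀ x, ∃ a : A, stabilizer A x = stabilizer A (a • e x)) :
    ∃ f : X ≃ Y, ∀ (a : A) x, f (a • x) = a • f x := by
  have : Finite Y := Finite.of_equiv X e
  -- label each point with the conjugacy class of its stabilizer
  let l : X → Set (Subgroup A) := fun x => {K | ∃ a : A, K = stabilizer A (a • x)}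
  let l' : Y → Set (Subgroup A) := fun y => {K | ∃ a : A, K = stabilizer A (a • y)}
  have hl : ∀ (a : A) x, l (a • x) = l x := by
    intro a x
    ext K
    refine ⟨fun ⟨b, hb⟩ => ⟨b * a, by rw [hb, smul_smul]⟩, fun ⟨b, hb⟩ => ⟨b * a⁻¹, ?_⟩⟩
    rw [hb, smul_smul, inv_mul_cancel_right]
  have hl' : ∀ (a : A) y, l' (a • y) = l' y := by
    intro a x
    ext K
    refine ⟨fun ⟨b, hb⟩ => ⟨b * a, by rw [hb, smul_smul]⟩, fun ⟨b, hb⟩ => ⟨b * a⁻¹, ?_⟩⟩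
    rw [hb, smul_smul, inv_mul_cancel_right]
  have hle : ∀ x, l x = l' (e x) := by
    intro x
    obtain ⟨a, ha⟩ := he x
    rw [← hl' a]
    ext K
    exact ⟨fun ⟨b, hb⟩ => ⟨b, by rw [hb, stabilizer_eq_comm ha]⟩,
      fun ⟨b, hb⟩ => ⟨b, by rw [hb, stabilizer_eq_comm ha]⟩⟩
  obtain ⟨f, hf, hfa⟩ := exists_equivariant_bijOn (A := A) l l' hl hl'
    (fun x y hxy => by
      have : stabilizer A x ∈ l x := ⟨1, by rw [one_smul]⟩
      rw [hxy] at this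
      exact this) (Set.univ : Set X).ncard Set.univ Set.univ le_rfl
    (fun _ _ _ => Set.mem_univ _) (fun _ _ _ => Set.mem_univ _) (fun c => by
      rw [← Set.ncard_image_of_injective _ e.injective]
      congr 1
      ext y
      constructor
      · rintro ⟨x, ⟨-, hx⟩, rfl⟩
        exact ⟨Set.mem_univ _, (hle x).symm.trans hx⟩
      · rintro ⟨-, hy⟩
        refine ⟨e.symm y, ⟨Set.mem_univ _, ?_⟩, e.apply_symm_apply y⟩
        rw [hle, e.apply_symm_apply, hy])
  exact ⟨Equiv.ofBijective f (Set.bijOn_univ.1 hf), fun a x => hfa a x trivial⟩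

/-- Two functions on finite types with fibres of the same size differ by a bijection. -/
theorem exists_equiv_of_card_fiber_eq {X Y L : Type*} [Finite X] [Finite Y] (f : X → L) (g : Y → L)
    (h : ∀ c, {x | f x = c}.ncard = {y | g y = c}.ncard) : ∃ e : X ≃ Y, ∀ x, g (e x) = f x := by
  have h' : ∀ c, Nonempty ({x // f x = c} ≃ {y // g y = c}) := fun c =>
    Finite.card_eq.1 (h c)
  let E := fun c => (h' c).some
  refine ⟨((Equiv.sigmaFiberEquiv f).symm.trans (Equiv.sigmaCongrRight E)).trans
    (Equiv.sigmaFiberEquiv g), fun x => ?_⟩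
  exact (E (f x) ⟨x, rfl⟩).2

theorem areConjugate_of_equiv {G G' : Subgroup S27} (φ : G ≃* G') (e : Fin 27 ≃ Fin 27)
    (he : ∀ v, ∃ a : G, ∀ g : G, g • v = v ↔ φ g • φ a • e v = φ a • e v) :
    AreConjugate G G' := by
  obtain ⟨f, hf⟩ := @exists_equivariant_equiv G (Fin 27) (Fin 27) _ _
    (MulAction.compHom _ φ.toMonoidHom) _ _ e (fun v => by
      obtain ⟨a, ha⟩ := he v
      exact ⟨a, Subgroup.ext ha⟩)
  have hf' : ∀ (a : G) (v : Fin 27), f ((a : S27) v) = (φ a : S27) (f v) := fun a v => hf a v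
  have key : ∀ a : G, f * (a : S27) * f⁻¹ = (φ a : S27) := by
    intro a
    ext v : 1
    have := hf' a (f⁻¹ v)
    simpa using this
  refine ⟨f, Subgroup.ext fun g => ⟨?_, fun hg => ?_⟩⟩
  · rintro ⟨a, ha, rfl⟩
    have := key ⟨a, ha⟩
    change f * a * f⁻¹ ∈ G'
    rw [this]
    exact (φ ⟨a, ha⟩).2
  · refine ⟨(φ.symm ⟨g, hg⟩ : G), (φ.symm ⟨g, hg⟩).2, ?_⟩
    change f * (φ.symm ⟨g, hg⟩ : G) * f⁻¹ = g
    rw [key, MulEquiv.apply_symm_apply]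

theorem count_orbitLengths (H : Subgroup S27) (n : ℕ) :
    (orbitLengths H).count n * n = {v : Fin 27 | (orbit H v).ncard = n}.ncard := by
  classical
  have h1 : {v : Fin 27 | (orbit H v).ncard = n}.ncard =
      (Finset.univ.filter fun v : Fin 27 => (orbit H v).ncard = n).card := by
    rw [← Set.ncard_coe_finset]; congr 1; ext v; simp
  have h2 : (orbitLengths H).count n =
      ((Set.toFinite (orbitSet H)).toFinset.filter fun O => n = O.ncard).card := by
    rw [orbitLengths, Multiset.count_map]; rfl
  rw [h1, h2, Finset.card_eq_sum_card_fiberwise (f := fun v : Fin 27 => orbit H v)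
    (t := (Set.toFinite (orbitSet H)).toFinset.filter fun O => n = O.ncard), Finset.sum_const_nat]
  · intro O hO
    rw [Finset.mem_filter, Set.Finite.mem_toFinset] at hO
    obtain ⟨⟨w, rfl⟩, hn⟩ := hO
    rw [hn, ← Set.ncard_coe_finset]
    congr 1
    ext v
    simp only [Finset.coe_filter, Finset.mem_univ, true_and, Finset.mem_filter,
      Set.mem_ofPred_eq]
    constructor
    · rintro ⟨-, h⟩
      exact orbit_eq_iff.1 h
    · intro h
      have h' := orbit_eq_iff.2 h
      exact ⟨by rw [h'], h'⟩
  · intro v hv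
    simp only [Finset.coe_filter, Finset.mem_univ, true_and, Set.mem_ofPred_eq,
      Set.Finite.mem_toFinset] at hv ⊢
    exact ⟨⟨v, rfl⟩, hv.symm⟩

theorem mem_orbitLengths {H : Subgroup S27} {n : ℕ} :
    n ∈ orbitLengths H ↔ ∃ v : Fin 27, (orbit H v).ncard = n := by
  simp only [orbitLengths, orbitSet, Multiset.mem_map, Finset.mem_val, Set.Finite.mem_toFinset,
    Set.mem_range, exists_exists_eq_and]

theorem orbitLengths_eq_of_ncard {H : Subgroup S27} {s : Multiset ℕ} (h0 : 0 ∉ s)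
    (h : ∀ n, n ≠ 0 → {v : Fin 27 | (orbit H v).ncard = n}.ncard = s.count n * n) :
    orbitLengths H = s := by
  ext n
  rcases Nat.eq_zero_or_pos n with rfl | hn
  · rw [Multiset.count_eq_zero_of_notMem h0, Multiset.count_eq_zero_of_notMem]
    rw [mem_orbitLengths]
    rintro ⟨v, hv⟩
    rw [Set.ncard_eq_zero (Set.toFinite _)] at hv
    exact Set.eq_empty_iff_forall_notMem.1 hv v (mem_orbit_self v)
  · have := h n hn.ne'
    rw [← count_orbitLengths] at this
    exact Nat.eq_of_mul_eq_mul_right hn this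

theorem ncard_orbit_mul_card_stabilizer {A X : Type*} [Group A] [MulAction A X] (v : X) :
    (orbit A v).ncard * Nat.card (stabilizer A v) = Nat.card A := by
  rw [← index_stabilizer, Subgroup.index_mul_card]

open Pointwise in
/-- In a finite group, two subgroups of the same order are conjugate if the order is `1`, the
order of the group, or the order of a Sylow subgroup. -/
theorem exists_conj_of_card_eq {A : Type*} [Group A] [Finite A] {K L : Subgroup A} {n : ℕ}
    (hK : n * Nat.card K = Nat.card A) (hL : n * Nat.card L = Nat.card A)
    (hn : n = Nat.card A ∨ n = 1 ∨ ∃ p k, p.Prime ∧ n * p ^ k = Nat.card A ∧ ¬ p ∣ n) :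
    ∃ a : A, ∀ g, g ∈ K ↔ a⁻¹ * g * a ∈ L := by
  have hpos : 0 < Nat.card A := Nat.card_pos
  rcases hn with rfl | rfl | ⟨p, k, hp, hnk, hpn⟩
  · have h1 : Nat.card K = 1 := Nat.eq_of_mul_eq_mul_left hpos (by rw [hK, mul_one])
    have h2 : Nat.card L = 1 := Nat.eq_of_mul_eq_mul_left hpos (by rw [hL, mul_one])
    rw [Subgroup.card_eq_one] at h1 h2
    exact ⟨1, by simp [h1, h2]⟩
  · rw [one_mul, Subgroup.card_eq_iff_eq_top] at hK hL
    exact ⟨1, by simp [hK, hL]⟩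
  · have : Fact p.Prime := ⟨hp⟩
    have hn0 : 0 < n := by
      rcases Nat.eq_zero_or_pos n with rfl | h
      · simp at hpn
      · exact h
    have h1 : Nat.card K = p ^ k := Nat.eq_of_mul_eq_mul_left hn0 (by rw [hK, hnk])
    have h2 : Nat.card L = p ^ k := Nat.eq_of_mul_eq_mul_left hn0 (by rw [hL, hnk])
    have hf : (Nat.card A).factorization p = k := by
      rw [← hnk, Nat.factorization_mul hn0.ne' (pow_ne_zero _ hp.ne_zero)]
      simp [hp.factorization_self, Nat.factorization_eq_zero_of_not_dvd hpn]
    let P : Sylow p A := Sylow.ofCard K (by rw [h1, hf])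
    let Q : Sylow p A := Sylow.ofCard L (by rw [h2, hf])
    obtain ⟨a, ha⟩ := MulAction.exists_smul_eq A Q P
    refine ⟨a, fun g => ?_⟩
    have h3 : MulAut.conj a • L = K := congrArg Sylow.toSubgroup ha
    rw [← h3, Subgroup.mem_pointwise_smul_iff_inv_smul_mem]
    simp [MulAut.smul_def]

/-- Isomorphic subgroups of `S_27` with the same orbit lengths are conjugate if every orbit length
is `1`, the order of the group, or the index of a Sylow subgroup: such an orbit is determined up
to isomorphism by its length. -/
theorem areConjugate_of_orbitLengths_eq {G G' : Subgroup S27} (h : Iso G G')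
    (hl : orbitLengths G = orbitLengths G')
    (hn : ∀ n ∈ orbitLengths G, n = Nat.card G ∨ n = 1 ∨
      ∃ p k, p.Prime ∧ n * p ^ k = Nat.card G ∧ ¬ p ∣ n) : AreConjugate G G' := by
  obtain ⟨φ⟩ := h
  obtain ⟨e, he⟩ := exists_equiv_of_card_fiber_eq (fun v : Fin 27 => (orbit G v).ncard)
    (fun v : Fin 27 => (orbit G' v).ncard) (fun n => by
      rw [← count_orbitLengths, ← count_orbitLengths, hl])
  refine areConjugate_of_equiv φ e fun v => ?_
  have hev : (orbit G' (e v)).ncard = (orbit G v).ncard := he v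
  obtain ⟨a, ha⟩ := exists_conj_of_card_eq (n := (orbit G v).ncard) (K := stabilizer G v)
    (L := (stabilizer G' (e v)).comap φ.toMonoidHom) (ncard_orbit_mul_card_stabilizer v) (by
      rw [← hev, Nat.card_congr φ.toEquiv, ← ncard_orbit_mul_card_stabilizer (A := G') (e v)]
      congr 1
      exact Nat.card_congr ((φ.toEquiv).subtypeEquiv fun a => Iff.rfl))
    (hn _ (mem_orbitLengths.2 ⟨v, rfl⟩))
  refine ⟨a, fun g => ?_⟩
  have := ha g
  rw [mem_stabilizer_iff, Subgroup.mem_comap, mem_stabilizer_iff] at this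
  rw [this]
  simp only [MulEquiv.toMonoidHom_eq_coe, MonoidHom.coe_coe, map_mul, map_inv, mul_smul,
    inv_smul_eq_iff]

/-! ### The properties (a)–(g) in terms of single elements -/

/-- The properties (a)–(g) expressed through the elements of an abstract group `A` that acts
on a set `X`: the number of fixed points of an element is a function of its order. Taking `a = 1`
in `card_fixedBy` shows that `X` has 27 points. -/
structure Good (A X : Type*) [Group A] [MulAction A X] : Prop where
  card_dvd : Nat.card A ∣ 8 * 27 * 11 * 13
  card_fixedBy : ∀ a : A, (orderOf a = 1 ∧ Nat.card (fixedBy X a) = 27) ∨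
    (orderOf a = 2 ∧ Nat.card (fixedBy X a) = 3) ∨ (orderOf a = 3 ∧ Nat.card (fixedBy X a) = 0) ∨
    (orderOf a = 4 ∧ Nat.card (fixedBy X a) = 3) ∨ (orderOf a = 9 ∧ Nat.card (fixedBy X a) = 0) ∨
    (orderOf a = 11 ∧ Nat.card (fixedBy X a) = 5) ∨
    (orderOf a = 13 ∧ Nat.card (fixedBy X a) = 1)
  mem_zpowers_of_four : ∀ x y : A, orderOf x = 4 → orderOf y = 2 → Commute x y →
    y ∈ Subgroup.zpowers x
  mem_zpowers_of_nine : ∀ x y : A, orderOf x = 9 → orderOf y = 3 → Commute x y →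
    y ∈ Subgroup.zpowers x
  fixed_of_dihedral : ∀ x t : A, orderOf x = 11 → orderOf t = 2 → t * x * t⁻¹ = x⁻¹ →
    ∃! v : X, x • v = v ∧ t • v = v

theorem Good.of_injective {A B X Y : Type*} [Group A] [Group B] [MulAction A X] [MulAction B Y]
    (h : Good A X) (f : B →* A) (hf : Function.Injective f) (e : Y ≃ X)
    (he : ∀ (b : B) y, e (b • y) = f b • e y) : Good B Y := by
  have hfix : ∀ b : B, Nat.card (fixedBy Y b) = Nat.card (fixedBy X (f b)) := fun b =>
    Nat.card_congr (e.subtypeEquiv fun y => by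
      rw [mem_fixedBy, mem_fixedBy, ← he, e.apply_eq_iff_eq])
  refine ⟨(Subgroup.card_dvd_of_injective f hf).trans h.card_dvd, fun b => ?_,
    fun x y hx hy hxy => ?_, fun x y hx hy hxy => ?_, fun x t hx ht hxt => ?_⟩
  · rw [hfix, ← orderOf_injective f hf]
    exact h.card_fixedBy (f b)
  · obtain ⟨k, hk⟩ := h.mem_zpowers_of_four (f x) (f y) (by rwa [orderOf_injective f hf])
      (by rwa [orderOf_injective f hf]) (hxy.map f)
    exact ⟨k, hf (by simpa using hk)⟩
  · obtain ⟨k, hk⟩ := h.mem_zpowers_of_nine (f x) (f y) (by rwa [orderOf_injective f hf])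
      (by rwa [orderOf_injective f hf]) (hxy.map f)
    exact ⟨k, hf (by simpa using hk)⟩
  · obtain ⟨v, hv, hv'⟩ := h.fixed_of_dihedral (f x) (f t) (by rwa [orderOf_injective f hf])
      (by rwa [orderOf_injective f hf]) (by rw [← map_inv, ← map_inv, ← map_mul, ← map_mul, hxt])
    have key : ∀ y, (x • y = y ∧ t • y = y) ↔ (f x • e y = e y ∧ f t • e y = e y) := fun y => by
      rw [← he, ← he, e.apply_eq_iff_eq, e.apply_eq_iff_eq]
    refine ⟨e.symm v, (key _).2 (by simpa using hv), fun w hw => ?_⟩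
    rw [← hv' _ ((key w).1 hw), e.symm_apply_apply]

section
variable {A X : Type*} [Group A] [MulAction A X]

theorem Good.natCard (h : Good A X) : Nat.card X = 27 := by
  have h1 := h.card_fixedBy 1
  rw [orderOf_one] at h1
  have h2 : Nat.card (fixedBy X (1 : A)) = Nat.card X := by
    rw [fixedBy_one_eq_univ]; exact Nat.card_congr (Equiv.Set.univ X)
  omega

theorem Good.finite (h : Good A X) : Finite A :=
  Nat.finite_of_card_ne_zero fun h0 => by
    have := h.card_dvd
    rw [h0] at this
    norm_num at this

theorem Good.finite_set (h : Good A X) : Finite X :=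
  Nat.finite_of_card_ne_zero (by rw [h.natCard]; norm_num)

theorem Good.subgroup (h : Good A X) (K : Subgroup A) : Good K X :=
  h.of_injective K.subtype K.subtype_injective (Equiv.refl X) fun _ _ => rfl

end

theorem ncard_orbitSet (H : Subgroup S27) :
    (orbitSet H).ncard = Nat.card (orbitRel.Quotient H (Fin 27)) := by
  have h1 : orbitSet H = Set.range (orbitRel.Quotient.orbit (G := H) (α := Fin 27)) := by
    ext O
    constructor
    · rintro ⟨v, rfl⟩
      exact ⟨Quotient.mk'' v, orbitRel.Quotient.orbit_mk v⟩
    · rintro ⟨q, rfl⟩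
      induction q using Quotient.inductionOn' with
      | h v => exact ⟨v, (orbitRel.Quotient.orbit_mk v).symm⟩
  rw [h1, ← Set.image_univ, Set.ncard_image_of_injective _ orbitRel.Quotient.orbit_injective,
    Set.ncard_univ]

theorem sum_card_fixedBy_eq_ncard_orbitSet_mul (H : Subgroup S27) [Fintype H] :
    ∑ h : H, Nat.card (fixedBy (Fin 27) h) = (orbitSet H).ncard * Nat.card H := by
  rw [ncard_orbitSet]
  exact sum_card_fixedBy_eq_card_orbits_mul H (Fin 27)

theorem sum_zpowers {A M : Type*} [Group A] [AddCommMonoid M] (x : A) [Fintype (Subgroup.zpowers x)]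
    (hx : IsOfFinOrder x) (F : A → M) :
    ∑ a : Subgroup.zpowers x, F a = ∑ i ∈ Finset.range (orderOf x), F (x ^ i) := by
  rw [Finset.sum_range]
  exact (Equiv.sum_comp (finEquivZPowers hx) (fun a : Subgroup.zpowers x => F a)).symm.trans
    (Finset.sum_congr rfl fun i _ => by rw [finEquivZPowers_apply])

theorem sum_range_card_fixedBy (g : S27) :
    ∑ i ∈ Finset.range (orderOf g), Nat.card (fixedBy (Fin 27) (g ^ i)) =
      (orbitSet (Subgroup.zpowers g)).ncard * orderOf g := by
  have := Fintype.ofFinite (Subgroup.zpowers g)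
  rw [← Nat.card_zpowers, ← sum_card_fixedBy_eq_ncard_orbitSet_mul, Nat.card_zpowers,
    ← sum_zpowers g (isOfFinOrder_of_finite g) (fun a => Nat.card (fixedBy (Fin 27) a))]
  rfl

theorem card_fixedBy_inv {A X : Type*} [Group A] [MulAction A X] (a : A) :
    Nat.card (fixedBy X a⁻¹) = Nat.card (fixedBy X a) := by
  rw [fixedBy_inv]

theorem card_fixedBy_one_fin : Nat.card (fixedBy (Fin 27) (1 : S27)) = 27 := by
  rw [fixedBy_one_eq_univ]; simp

theorem ncard_orbit_zpowers_eq_one_iff (g : S27) (v : Fin 27) :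
    (orbit (Subgroup.zpowers g) v).ncard = 1 ↔ v ∈ fixedBy (Fin 27) g := by
  rw [Set.ncard_eq_one, mem_fixedBy]
  constructor
  · rintro ⟨w, hw⟩
    have h1 : v ∈ orbit (Subgroup.zpowers g) v := mem_orbit_self v
    have h2 : g • v ∈ orbit (Subgroup.zpowers g) v := ⟨⟨g, Subgroup.mem_zpowers g⟩, rfl⟩
    rw [hw] at h1 h2
    rw [Set.mem_singleton_iff.1 h2, Set.mem_singleton_iff.1 h1]
  · intro hv
    refine ⟨v, Set.eq_singleton_iff_unique_mem.2 ⟨mem_orbit_self v, ?_⟩⟩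
    rintro _ ⟨⟨a, ha⟩, rfl⟩
    have : Subgroup.zpowers g ≤ stabilizer S27 v := by
      rw [Subgroup.zpowers_le]; exact hv
    exact this ha

theorem card_fixedBy_eq_count (g : S27) :
    Nat.card (fixedBy (Fin 27) g) = (orbitLengths (Subgroup.zpowers g)).count 1 := by
  have h1 := count_orbitLengths (Subgroup.zpowers g) 1
  rw [mul_one] at h1
  rw [h1]
  simp only [ncard_orbit_zpowers_eq_one_iff]
  rfl

section
variable {G : Subgroup S27}

theorem HasPropertiesAG.card_fixedBy_two (h : HasPropertiesAG G) {g : S27} (hg : g ∈ G)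
    (ho : orderOf g = 2) : Nat.card (fixedBy (Fin 27) g) = 3 := by
  have hc : Nat.card (Subgroup.zpowers g) = 2 := by rw [Nat.card_zpowers, ho]
  have h1 := (h.c (Subgroup.zpowers g) (by rwa [Subgroup.zpowers_le])
    (IsPGroup.of_card (n := 1) (by rw [hc, pow_one]))).2.1 hc
  have h2 := sum_range_card_fixedBy g
  rw [h1, ho, Finset.sum_range_succ, Finset.sum_range_one, pow_zero, pow_one,
    card_fixedBy_one_fin] at h2
  omega

theorem HasPropertiesAG.card_fixedBy_four (h : HasPropertiesAG G) {g : S27} (hg : g ∈ G)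
    (ho : orderOf g = 4) : Nat.card (fixedBy (Fin 27) g) = 3 := by
  have hc : Nat.card (Subgroup.zpowers g) = 4 := by rw [Nat.card_zpowers, ho]
  have h1 := (h.c (Subgroup.zpowers g) (by rwa [Subgroup.zpowers_le])
    (IsPGroup.of_card (n := 2) (by rw [hc]; norm_num))).2.2.1 hc
  have h2 := sum_range_card_fixedBy g
  have h3 : g ^ 3 = g⁻¹ := by
    rw [eq_inv_iff_mul_eq_one, ← pow_succ, orderOf_dvd_iff_pow_eq_one.1 (by rw [ho])]
  have h4 : Nat.card (fixedBy (Fin 27) (g ^ 2)) = 3 :=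
    h.card_fixedBy_two (pow_mem hg 2) (by rw [orderOf_pow, ho]; norm_num)
  rw [h1, ho, Finset.sum_range_succ, Finset.sum_range_succ, Finset.sum_range_succ,
    Finset.sum_range_one, pow_zero, pow_one, card_fixedBy_one_fin, h3, card_fixedBy_inv, h4] at h2
  omega

theorem HasPropertiesAG.card_fixedBy_three (h : HasPropertiesAG G) {g : S27} (hg : g ∈ G)
    (k : ℕ) (hk : k ≠ 0) (ho : orderOf g = 3 ^ k) : Nat.card (fixedBy (Fin 27) g) = 0 := by
  have hc : Nat.card (Subgroup.zpowers g) = 3 ^ k := by rw [Nat.card_zpowers, ho]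
  have h1 := h.d (Subgroup.zpowers g) (by rwa [Subgroup.zpowers_le]) (IsPGroup.of_card hc)
  rw [Finite.card_eq_zero_iff]
  refine ⟨fun ⟨v, hv⟩ => ?_⟩
  have h2 : (⟨g, Subgroup.mem_zpowers g⟩ : Subgroup.zpowers g) ∈
      stabilizer (Subgroup.zpowers g) v := hv
  rw [h1 v, Subgroup.mem_bot] at h2
  have h3 : g = 1 := congrArg Subtype.val h2
  rw [h3, orderOf_one] at ho
  have := Nat.one_lt_pow hk (show 1 < 3 by norm_num)
  omega

theorem HasPropertiesAG.card_fixedBy (h : HasPropertiesAG G) {g : S27} (hg : g ∈ G) :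
    (orderOf g = 1 ∧ Nat.card (fixedBy (Fin 27) g) = 27) ∨
    (orderOf g = 2 ∧ Nat.card (fixedBy (Fin 27) g) = 3) ∨
    (orderOf g = 3 ∧ Nat.card (fixedBy (Fin 27) g) = 0) ∨
    (orderOf g = 4 ∧ Nat.card (fixedBy (Fin 27) g) = 3) ∨
    (orderOf g = 9 ∧ Nat.card (fixedBy (Fin 27) g) = 0) ∨
    (orderOf g = 11 ∧ Nat.card (fixedBy (Fin 27) g) = 5) ∨
    (orderOf g = 13 ∧ Nat.card (fixedBy (Fin 27) g) = 1) := by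
  have h1 := h.a g hg
  simp only [Set.mem_insert_iff, Set.mem_singleton_iff] at h1
  rcases h1 with h1 | h1 | h1 | h1 | h1 | h1 | h1
  · rw [orderOf_eq_one_iff.1 h1, card_fixedBy_one_fin, orderOf_one]; simp
  · have := h.card_fixedBy_two hg h1; tauto
  · have := h.card_fixedBy_three hg 1 one_ne_zero (by rw [h1]; norm_num); tauto
  · have := h.card_fixedBy_four hg h1; tauto
  · have := h.card_fixedBy_three hg 2 two_ne_zero (by rw [h1]; norm_num); tauto
  · have h2 : Nat.card (fixedBy (Fin 27) g) = 5 := by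
      rw [card_fixedBy_eq_count, h.e g hg h1]; decide
    tauto
  · have h2 : Nat.card (fixedBy (Fin 27) g) = 1 := by
      rw [card_fixedBy_eq_count, h.g g hg h1]; decide
    tauto

/-- By Burnside's lemma, a group of order `p ^ 2`, for `p = 11` or `p = 13`, in which every
nontrivial element has the number of fixed points required by (e) or (g), does not exist:
`27 + 120 * 5` is not divisible by `121`, and `27 + 168` is not divisible by `169`. -/
theorem HasPropertiesAG.not_sq_dvd (h : HasPropertiesAG G) {p m : ℕ} (hp : p.Prime)
    (hpm : p = 11 ∧ m = 5 ∨ p = 13 ∧ m = 1) : ¬ p ^ 2 ∣ Nat.card G := by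
  intro hdvd
  have : Fact p.Prime := ⟨hp⟩
  obtain ⟨K, hK⟩ := Sylow.exists_subgroup_card_pow_prime p hdvd
  have := Fintype.ofFinite K
  have h1 := sum_card_fixedBy_eq_card_orbits_mul K (Fin 27)
  classical
  have h2 : ∀ a ∈ (Finset.univ : Finset K).erase 1, Nat.card (fixedBy (Fin 27) a) = m := by
    intro a ha
    have ha1 : a ≠ 1 := (Finset.mem_erase.1 ha).1
    have h3 : orderOf a ∣ p ^ 2 := hK ▸ orderOf_dvd_natCard a
    have h5 : orderOf ((a : G) : S27) = orderOf a := by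
      rw [Subgroup.orderOf_coe, Subgroup.orderOf_coe]
    have h6 : orderOf a ≠ 1 := fun h => ha1 (orderOf_eq_one_iff.1 h)
    have h7 := h.card_fixedBy (a : G).2
    rw [h5] at h7
    have h8 : Nat.card (fixedBy (Fin 27) ((a : G) : S27)) = Nat.card (fixedBy (Fin 27) a) := rfl
    rw [h8] at h7
    rcases hpm with ⟨rfl, rfl⟩ | ⟨rfl, rfl⟩ <;>
      rcases h7 with ⟨h7, h9⟩ | ⟨h7, h9⟩ | ⟨h7, h9⟩ | ⟨h7, h9⟩ | ⟨h7, h9⟩ | ⟨h7, h9⟩ | ⟨h7, h9⟩ <;>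
      rw [h7] at h3 h6 <;> first | exact h9 | exact absurd rfl h6 | (exfalso; revert h3; norm_num)
  rw [← Finset.add_sum_erase _ _ (Finset.mem_univ 1), Finset.sum_const_nat h2,
    Finset.card_erase_of_mem (Finset.mem_univ _), Finset.card_univ, ← Nat.card_eq_fintype_card,
    hK] at h1
  have h3 : Nat.card (fixedBy (Fin 27) (1 : K)) = 27 := card_fixedBy_one_fin
  rw [h3] at h1
  rcases hpm with ⟨rfl, rfl⟩ | ⟨rfl, rfl⟩ <;> omega

/-- Sylow subgroups have order at most 8, 27, 11 or 13: for 2 by (c), for 3 because they act freely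
on 27 points, and for 11 and 13 by counting fixed points. -/
theorem HasPropertiesAG.card_dvd (h : HasPropertiesAG G) : Nat.card G ∣ 8 * 27 * 11 * 13 := by
  rw [Nat.dvd_iff_prime_pow_dvd_dvd]
  intro p k hp hk
  rcases Nat.eq_zero_or_pos k with rfl | hk0
  · simp
  have : Fact p.Prime := ⟨hp⟩
  have hp1 : p ∣ Nat.card G := (dvd_pow_self p hk0.ne').trans hk
  obtain ⟨g, hg⟩ := exists_prime_orderOf_dvd_card' p hp1
  have h1 := h.a g g.2
  rw [Subgroup.orderOf_coe, hg] at h1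
  simp only [Set.mem_insert_iff, Set.mem_singleton_iff] at h1
  obtain ⟨K, hK⟩ := Sylow.exists_subgroup_card_pow_prime p hk
  have hK' : Nat.card (K.map G.subtype) = p ^ k := by
    rw [Subgroup.card_map_of_injective G.subtype_injective, hK]
  have hKG : K.map G.subtype ≤ G := Subgroup.map_subtype_le K
  have hpK : IsPGroup p (K.map G.subtype) := IsPGroup.of_card hK'
  have hpow : ∀ j, j ≤ k → p ^ j ∣ Nat.card G := fun j hj => (pow_dvd_pow p hj).trans hk
  rcases h1 with rfl | rfl | rfl | rfl | rfl | rfl | rfl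
  · exact absurd hp (by norm_num)
  · have h2 := (h.c _ hKG hpK).1
    rw [hK'] at h2
    have h3 : k ≤ 3 := (Nat.pow_le_pow_iff_right (show 1 < 2 by norm_num)).1 h2
    exact (pow_dvd_pow 2 h3).trans (by norm_num)
  -- a free action of a 3-group on 27 points has `27 / 3 ^ k` orbits
  · have h2 := h.d _ hKG hpK
    have := Fintype.ofFinite (K.map G.subtype)
    have h3 := sum_card_stabilizer_eq_sum_card_fixedBy (K.map G.subtype) (Fin 27)
    rw [sum_card_fixedBy_eq_card_orbits_mul, hK',
      Finset.sum_const_nat (m := 1) (fun v _ => by rw [h2 v, Subgroup.card_bot]),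
      Finset.card_univ, Fintype.card_fin, mul_one] at h3
    have h4 : 3 ^ k ∣ 27 := ⟨_, h3.trans (mul_comm _ _)⟩
    exact h4.trans (by norm_num)
  · exact absurd hp (by norm_num)
  · exact absurd hp (by norm_num)
  · have h3 : k ≤ 1 := by
      by_contra hk1
      exact h.not_sq_dvd hp (Or.inl ⟨rfl, rfl⟩) (hpow 2 (by omega))
    exact (pow_dvd_pow 11 h3).trans (by norm_num)
  · have h3 : k ≤ 1 := by
      by_contra hk1
      exact h.not_sq_dvd hp (Or.inr ⟨rfl, rfl⟩) (hpow 2 (by omega))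
    exact (pow_dvd_pow 13 h3).trans (by norm_num)

theorem iso_range_of_injective {A B : Type*} [Group A] [Group B] {f : B →* A}
    (hf : Function.Injective f) : Iso f.range B :=
  ⟨(MonoidHom.ofInjective hf).symm⟩

theorem Cyc.prod_swap (m n : ℕ) : Iso (Cyc m × Cyc n) (Cyc n × Cyc m) := ⟨MulEquiv.prodComm⟩

theorem HasPropertiesAG.good (h : HasPropertiesAG G) : Good G (Fin 27) := by
  have hord : ∀ g : G, orderOf (g : S27) = orderOf g := fun g => Subgroup.orderOf_coe g
  have hcl : ∀ x y : G, Subgroup.closure {(x : S27), (y : S27)} ≤ G := fun x y => by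
    rw [Subgroup.closure_le]
    rintro z (rfl | rfl)
    · exact x.2
    · exact y.2
  have hdisj : ∀ (x y : G) (p : ℕ), p.Prime → orderOf y = p → y ∉ Subgroup.zpowers x →
      Disjoint (Subgroup.zpowers (x : S27)) (Subgroup.zpowers (y : S27)) := by
    intro x y p hp hy hxy
    refine disjoint_zpowers_of_prime hp (by rw [hord, hy]) ?_
    rintro ⟨k, hk⟩
    exact hxy ⟨k, Subtype.ext hk⟩
  refine ⟨h.card_dvd, fun a => ?_, fun x y hx hy hxy => ?_, fun x y hx hy hxy => ?_,
    fun x t hx ht hxt => ?_⟩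
  · rw [← hord]; exact h.card_fixedBy a.2
  · by_contra hmem
    -- otherwise `x` and `y` generate a subgroup isomorphic to `C_4 × C_2`
    obtain ⟨f, hf, hfc⟩ := exists_cyc_prod_hom (m := 4) (n := 2) (x := (x : S27)) (y := (y : S27))
      (by rw [hord, hx]) (by rw [hord, hy]) (hxy.map G.subtype) (hdisj x y 2 (by norm_num) hy hmem)
    refine (h.b f.range ?_).1 ((iso_range_of_injective hf).trans (Cyc.prod_swap _ _))
    rintro _ ⟨c, rfl⟩
    exact hcl x y (hfc c)
  · by_contra hmem
    -- otherwise `x` and `y` generate a subgroup isomorphic to `C_9 × C_3`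
    obtain ⟨f, hf, hfc⟩ := exists_cyc_prod_hom (m := 9) (n := 3) (x := (x : S27)) (y := (y : S27))
      (by rw [hord, hx]) (by rw [hord, hy]) (hxy.map G.subtype) (hdisj x y 3 (by norm_num) hy hmem)
    refine (h.b f.range ?_).2 ((iso_range_of_injective hf).trans (Cyc.prod_swap _ _))
    rintro _ ⟨c, rfl⟩
    exact hcl x y (hfc c)
  · obtain ⟨f, hf, hfx, hft, hfc⟩ := exists_dihedralHom (n := 11) (x := (x : S27)) (t := (t : S27))
      (by rw [hord, hx]) (by rw [← pow_two, ← ht, ← hord, pow_orderOf_eq_one])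
      (congrArg Subtype.val hxt) (by
        intro hmem
        have h1 := Subgroup.orderOf_dvd_natCard _ hmem
        rw [Nat.card_zpowers, hord, hord, hx, ht] at h1
        norm_num at h1)
    have h1 := h.f f.range (by rintro _ ⟨c, rfl⟩; exact hcl x t (hfc c)) (iso_range_of_injective hf)
    have h2 := count_orbitLengths f.range 1
    rw [h1] at h2
    have h3 : Multiset.count 1 ({11, 11, 2, 2, 1} : Multiset ℕ) = 1 := by decide
    rw [h3, mul_one] at h2
    obtain ⟨v, hv⟩ := Set.ncard_eq_one.1 h2.symm
    -- `x` and `t` generate a dihedral group of order 22, so their common fixed points are the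
    -- orbits of length 1 in (f)
    have key : ∀ w : Fin 27, (orbit f.range w).ncard = 1 ↔ x • w = w ∧ t • w = w := by
      intro w
      rw [Set.ncard_eq_one]
      constructor
      · rintro ⟨u, hu⟩
        have hw : w = u := by
          have : w ∈ orbit f.range w := mem_orbit_self w
          rwa [hu] at this
        subst hw
        have h4 : ∀ g ∈ f.range, g w = w := by
          intro g hg
          have : g w ∈ orbit f.range w := ⟨⟨g, hg⟩, rfl⟩
          rwa [hu] at this
        exact ⟨h4 _ ⟨_, hfx⟩, h4 _ ⟨_, hft⟩⟩
      · rintro ⟨hxw, htw⟩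
        refine ⟨w, Set.eq_singleton_iff_unique_mem.2 ⟨mem_orbit_self w, ?_⟩⟩
        rintro _ ⟨⟨_, ⟨d, rfl⟩⟩, rfl⟩
        have : Subgroup.closure {(x : S27), (t : S27)} ≤ stabilizer S27 w := by
          rw [Subgroup.closure_le]
          rintro z (rfl | rfl)
          · exact hxw
          · exact htw
        exact this (hfc d)
    refine ⟨v, (key v).1 ?_, fun w hw => ?_⟩
    · have : v ∈ {w : Fin 27 | (orbit f.range w).ncard = 1} := by rw [hv]; rfl
      exact this
    · have : w ∈ {w : Fin 27 | (orbit f.range w).ncard = 1} := (key w).2 hw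
      rw [hv] at this
      exact this

end

theorem sum_comp_eq_sum_ncard_mul {X : Type*} [Fintype X] (f : X → ℕ) (D : Finset ℕ)
    (hD : ∀ x, f x ∈ D) (F : ℕ → ℕ) :
    ∑ x, F (f x) = ∑ n ∈ D, {x | f x = n}.ncard * F n := by
  classical
  rw [← Finset.sum_fiberwise_of_maps_to (s := Finset.univ) (t := D) (g := f) (fun x _ => hD x)]
  refine Finset.sum_congr rfl fun n _ => ?_
  rw [Finset.sum_const_nat (m := F n) (fun x hx => by rw [(Finset.mem_filter.1 hx).2]),
    ← Set.ncard_coe_finset]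
  congr 2
  ext x
  simp

theorem orbitLengths_eq_of_finset {H : Subgroup S27} {s : Multiset ℕ} {D : Finset ℕ}
    (hD : ∀ v : Fin 27, (orbit H v).ncard ∈ D) (h0 : 0 ∉ s) (hs : ∀ n ∈ s, n ∈ D)
    (h : ∀ n ∈ D, {v : Fin 27 | (orbit H v).ncard = n}.ncard = s.count n * n) :
    orbitLengths H = s := by
  refine orbitLengths_eq_of_ncard h0 fun n _ => ?_
  by_cases hn : n ∈ D
  · exact h n hn
  · rw [Multiset.count_eq_zero_of_notMem (fun h => hn (hs n h)), zero_mul,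
      Set.ncard_eq_zero (Set.toFinite _), Set.eq_empty_iff_forall_notMem]
    rintro v rfl
    exact hn (hD v)

theorem card_stabilizer_eq_div {A X : Type*} [Group A] [Finite A] [MulAction A X] (v : X) :
    Nat.card (stabilizer A v) = Nat.card A / (orbit A v).ncard := by
  have h := ncard_orbit_mul_card_stabilizer (A := A) v
  rw [← h, Nat.mul_div_cancel_left]
  refine Nat.pos_of_ne_zero fun h0 => ?_
  rw [h0, zero_mul] at h
  exact Nat.card_pos.ne h

/-- The numbers of points in orbits of given lengths satisfy two linear equations: the first counts
the points, the second counts the pairs of a group element and a fixed point. -/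
theorem sum_ncard_orbit {A X : Type*} [Group A] [Fintype A] [MulAction A X] [Fintype X]
    {D : Finset ℕ} (hD : ∀ v : X, (orbit A v).ncard ∈ D) :
    ∑ n ∈ D, {v : X | (orbit A v).ncard = n}.ncard = Fintype.card X ∧
    ∑ n ∈ D, {v : X | (orbit A v).ncard = n}.ncard * (Nat.card A / n) =
      ∑ a : A, Nat.card (fixedBy X a) := by
  constructor
  · have := sum_comp_eq_sum_ncard_mul _ D hD fun _ => 1
    simpa using this.symm
  · rw [← sum_card_stabilizer_eq_sum_card_fixedBy]
    have := sum_comp_eq_sum_ncard_mul _ D hD fun n => Nat.card A / n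
    rw [← this]
    exact Finset.sum_congr rfl fun v _ => (card_stabilizer_eq_div v).symm

theorem ncard_orbit_dvd_card {A X : Type*} [Group A] [MulAction A X] (v : X) :
    (orbit A v).ncard ∣ Nat.card A := ⟨_, (ncard_orbit_mul_card_stabilizer v).symm⟩

theorem orbitLengths_zpowers_of_prime {g : S27} {p m k : ℕ} (hp : p.Prime) (hg : orderOf g = p)
    (hm : Nat.card (fixedBy (Fin 27) g) = m) (hk : m + k * p = 27) :
    orbitLengths (Subgroup.zpowers g) = Multiset.replicate k p + Multiset.replicate m 1 := by
  have hD : ∀ v : Fin 27, (orbit (Subgroup.zpowers g) v).ncard ∈ ({1, p} : Finset ℕ) := by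
    intro v
    have h1 := ncard_orbit_dvd_card (A := Subgroup.zpowers g) v
    rw [Nat.card_zpowers, hg, Nat.dvd_prime hp] at h1
    simpa using h1
  have h1p : (1 : ℕ) ≠ p := hp.one_lt.ne
  have hc1 : {v : Fin 27 | (orbit (Subgroup.zpowers g) v).ncard = 1}.ncard = m := by
    rw [← hm]; simp only [ncard_orbit_zpowers_eq_one_iff]; rfl
  have := Fintype.ofFinite (Subgroup.zpowers g)
  have h2 := (sum_ncard_orbit hD).1
  rw [Finset.sum_pair h1p, hc1, Fintype.card_fin] at h2
  refine orbitLengths_eq_of_finset hD ?_ ?_ ?_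
  · simp [Multiset.mem_replicate, hp.ne_zero.symm]
  · intro n hn
    rw [Multiset.mem_add, Multiset.mem_replicate, Multiset.mem_replicate] at hn
    simp only [Finset.mem_insert, Finset.mem_singleton]
    tauto
  · intro n hn
    simp only [Finset.mem_insert, Finset.mem_singleton] at hn
    rcases hn with rfl | rfl
    · rw [hc1, Multiset.count_add, Multiset.count_replicate, Multiset.count_replicate,
        if_neg h1p.symm, if_pos rfl]; ring
    · rw [Multiset.count_add, Multiset.count_replicate, Multiset.count_replicate,
        if_neg h1p, if_pos rfl, add_zero]; omega

section
variable {A X : Type*} [Group A] [MulAction A X]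

theorem Good.card_fixedBy_one (h : Good A X) : Nat.card (fixedBy X (1 : A)) = 27 := by
  have h1 := h.card_fixedBy 1
  rw [orderOf_one] at h1
  omega

theorem Good.sum_card_fixedBy_eq [Fintype A] (h : Good A X) {m : ℕ}
    (hm : ∀ a : A, a ≠ 1 → Nat.card (fixedBy X a) = m) :
    ∑ a : A, Nat.card (fixedBy X a) = 27 + (Nat.card A - 1) * m := by
  classical
  rw [← Finset.add_sum_erase _ _ (Finset.mem_univ 1), h.card_fixedBy_one,
    Finset.sum_const_nat (m := m) (fun a ha => hm a (Finset.mem_erase.1 ha).1),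
    Finset.card_erase_of_mem (Finset.mem_univ _), Finset.card_univ, Nat.card_eq_fintype_card]

theorem pow_dvd_of_dvd {p k l m : ℕ} (hp : p.Prime) (hm : ¬ p ∣ m) (hk : p ^ k ∣ p ^ l * m) :
    k ≤ l := by
  by_contra hlt
  have h1 : p ^ l * p ∣ p ^ l * m := by
    rw [← pow_succ]; exact (pow_dvd_pow p (by omega)).trans hk
  exact hm (Nat.dvd_of_mul_dvd_mul_left (pow_pos hp.pos l) h1)

theorem Good.card_of_two_group (h : Good A X) (hA : IsPGroup 2 A) :
    ∃ k ≤ 3, Nat.card A = 2 ^ k := by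
  have := h.finite
  obtain ⟨k, hk⟩ := IsPGroup.iff_card.1 hA
  have h1 := h.card_dvd
  rw [hk] at h1
  exact ⟨k, pow_dvd_of_dvd (p := 2) (l := 3) (m := 27 * 11 * 13) Nat.prime_two (by norm_num)
    (h1.trans (by norm_num)), hk⟩

theorem Good.card_fixedBy_of_two_dvd (h : Good A X) {a : A} (ha : 2 ∣ orderOf a) :
    Nat.card (fixedBy X a) = 3 := by
  have := h.card_fixedBy a
  omega

theorem Good.card_fixedBy_of_three_dvd (h : Good A X) {a : A} (ha : 3 ∣ orderOf a) :
    Nat.card (fixedBy X a) = 0 := by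
  have := h.card_fixedBy a
  omega

theorem Good.card_fixedBy_of_eleven (h : Good A X) {a : A} (ha : orderOf a = 11) :
    Nat.card (fixedBy X a) = 5 := by
  have := h.card_fixedBy a
  omega

theorem Good.card_fixedBy_of_thirteen (h : Good A X) {a : A} (ha : orderOf a = 13) :
    Nat.card (fixedBy X a) = 1 := by
  have := h.card_fixedBy a
  omega

theorem Good.smul_ne_of_three_dvd (h : Good A X) {a : A} (ha : 3 ∣ orderOf a) (v : X) :
    a • v ≠ v := by
  have := h.finite_set
  intro hv
  have h1 := h.card_fixedBy_of_three_dvd ha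
  rw [Finite.card_eq_zero_iff] at h1
  exact h1.elim ⟨v, hv⟩

/-- In terms of the dihedral group of order 22: each rotation has 5 fixed points, each reflection
has 3, so there are `27 + 10 * 5 + 11 * 3 = 110` pairs of an element and a fixed point. -/
theorem Good.sum_card_fixedBy_dihedral [Fintype A] (h : Good A X) (φ : DihedralGroup 11 ≃* A) :
    ∑ a : A, Nat.card (fixedBy X a) = 110 := by
  have h1 : ∀ d : DihedralGroup 11, Nat.card (fixedBy X (φ d)) =
      if d = 1 then 27 else if d ^ 11 = 1 then 5 else 3 := by
    intro d
    have hp : Fact (Nat.Prime 11) := ⟨by norm_num⟩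
    split_ifs with h1 h2
    · rw [h1, map_one, h.card_fixedBy_one]
    · exact h.card_fixedBy_of_eleven
        (by rw [MulEquiv.orderOf_eq, orderOf_eq_prime h2 h1])
    · refine h.card_fixedBy_of_two_dvd ?_
      rw [MulEquiv.orderOf_eq]
      rcases d with i | i
      · exfalso
        refine h2 ?_
        rw [DihedralGroup.r_pow, DihedralGroup.one_def]
        congr 1
      · rw [DihedralGroup.orderOf_sr]
  rw [← Equiv.sum_comp φ.toEquiv]
  simp only [MulEquiv.toEquiv_eq_coe, EquivLike.coe_coe, h1]
  decide +kernel

end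

/-- The common fixed point of the rotations and a reflection is the only orbit of length 1. The five
points fixed by the rotations lie in the orbits of length 1 and 2; together with the count of pairs
of an element and a fixed point this determines all orbit lengths. -/
theorem Good.orbitLengths_dihedral {H : Subgroup S27} (h : Good H (Fin 27))
    (hH : Iso H (DihedralGroup 11)) : orbitLengths H = {11, 11, 2, 2, 1} := by
  obtain ⟨φ⟩ := hH
  set x := φ.symm (.r 1) with hx
  set t := φ.symm (.sr 0) with ht
  have hox : orderOf x = 11 := by rw [hx, MulEquiv.orderOf_eq, DihedralGroup.orderOf_r_one]
  have hot : orderOf t = 2 := by rw [ht, MulEquiv.orderOf_eq, DihedralGroup.orderOf_sr]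
  obtain ⟨v, ⟨hv1, hv2⟩, hv'⟩ := h.fixed_of_dihedral x t hox hot (by
    rw [hx, ht, ← map_inv, ← map_inv, ← map_mul, ← map_mul]; rfl)
  have hcard : Nat.card H = 22 := by
    rw [Nat.card_congr φ.toEquiv, DihedralGroup.nat_card]
  have := Fintype.ofFinite H
  have hD : ∀ v : Fin 27, (orbit H v).ncard ∈ ({1, 2, 11, 22} : Finset ℕ) := by
    intro v
    have h1 := ncard_orbit_dvd_card (A := H) v
    rw [hcard] at h1
    have h2 : (orbit H v).ncard ∈ Nat.divisors 22 := Nat.mem_divisors.2 ⟨h1, by norm_num⟩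
    exact h2
  -- the points fixed by the rotation `x` are those whose stabilizer has order 11 or 22
  have hmem : ∀ w : Fin 27, 11 ∣ Nat.card (stabilizer H w) → x • w = w := by
    intro w hw
    have hp : Fact (Nat.Prime 11) := ⟨by norm_num⟩
    obtain ⟨y, hy⟩ := exists_prime_orderOf_dvd_card' 11 hw
    have hyx : φ y ∈ Subgroup.zpowers (φ x) := by
      have h1 : orderOf (φ y) = 11 := by rw [MulEquiv.orderOf_eq, Subgroup.orderOf_coe, hy]
      rw [hx, MulEquiv.apply_symm_apply]
      rcases hd : φ y with i | i
      · refine ⟨(i.val : ℤ), ?_⟩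
        simp only [DihedralGroup.r_one_zpow]
        simp
      · rw [hd, DihedralGroup.orderOf_sr] at h1
        norm_num at h1
    have hyx' : (y : H) ∈ Subgroup.zpowers x := by
      obtain ⟨k, hk⟩ := hyx
      exact ⟨k, φ.injective (by simpa using hk)⟩
    have hxy : x ∈ Subgroup.zpowers (y : H) := by
      have h2 : Subgroup.zpowers (y : H) = Subgroup.zpowers x :=
        Subgroup.eq_of_le_of_card_ge (by rwa [Subgroup.zpowers_le])
          (by rw [Nat.card_zpowers, Nat.card_zpowers, Subgroup.orderOf_coe, hy, hox])
      rw [h2]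
      exact Subgroup.mem_zpowers x
    have h3 : Subgroup.zpowers (y : H) ≤ stabilizer H w := by
      rw [Subgroup.zpowers_le]; exact y.2
    exact h3 hxy
  have hmem' : ∀ w : Fin 27, x • w = w → 11 ∣ Nat.card (stabilizer H w) := by
    intro w hw
    have h1 : x ∈ stabilizer H w := hw
    rw [← hox]
    exact Subgroup.orderOf_dvd_natCard _ h1
  have hstab : ∀ w : Fin 27, (orbit H w).ncard * Nat.card (stabilizer H w) = 22 := fun w => by
    rw [ncard_orbit_mul_card_stabilizer, hcard]
  have hc1 : {w : Fin 27 | (orbit H w).ncard = 1}.ncard = 1 := by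
    rw [Set.ncard_eq_one]
    refine ⟨v, Set.eq_singleton_iff_unique_mem.2 ⟨?_, fun w hw => hv' w ?_⟩⟩
    · have h1 : 2 ∣ Nat.card (stabilizer H v) := by
        have h1 : t ∈ stabilizer H v := hv2
        rw [← hot]
        exact Subgroup.orderOf_dvd_natCard _ h1
      have h2 := hmem' v hv1
      have h3 : 22 ∣ Nat.card (stabilizer H v) :=
        (Nat.Coprime.mul_dvd_of_dvd_of_dvd (by norm_num) h1 h2)
      have h4 := hstab v
      obtain ⟨c, hc⟩ := h3
      rw [hc] at h4
      have h5 : (orbit H v).ncard * c = 1 := by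
        refine Nat.eq_of_mul_eq_mul_left (show 0 < 22 by norm_num) ?_
        rw [mul_one, mul_left_comm]; exact h4
      exact Nat.eq_one_of_mul_eq_one_right h5
    · have h4 := hstab w
      rw [hw, one_mul, ← hcard, Subgroup.card_eq_iff_eq_top] at h4
      have h5 : ∀ a : H, a • w = w := fun a => by
        have : a ∈ stabilizer H w := by rw [h4]; trivial
        exact this
      exact ⟨h5 x, h5 t⟩
  have hc2 : {w : Fin 27 | (orbit H w).ncard = 1}.ncard +
      {w : Fin 27 | (orbit H w).ncard = 2}.ncard = 5 := by
    rw [← h.card_fixedBy_of_eleven hox, ← Set.ncard_union_eq _ (Set.toFinite _) (Set.toFinite _)]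
    · change _ = Set.ncard (fixedBy (Fin 27) x)
      congr 1
      ext w
      simp only [Set.mem_union, Set.mem_ofPred_eq, mem_fixedBy]
      constructor
      · intro hw
        refine hmem w ?_
        have h4 := hstab w
        rcases hw with hw | hw <;> rw [hw] at h4 <;> omega
      · intro hw
        obtain ⟨c, hc⟩ := hmem' w hw
        have h4 := hstab w
        have h5 := hD w
        simp only [Finset.mem_insert, Finset.mem_singleton] at h5
        rw [hc] at h4
        rcases h5 with h5 | h5 | h5 | h5 <;> rw [h5] at h4 ⊢ <;> omega
    · rw [Set.disjoint_left]
      intro w hw hw'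
      simp only [Set.mem_ofPred_eq] at hw hw'
      omega
  obtain ⟨h1, h2⟩ := sum_ncard_orbit hD
  rw [h.sum_card_fixedBy_dihedral φ.symm, hcard] at h2
  rw [Fintype.card_fin] at h1
  simp only [Finset.sum_insert, Finset.mem_insert, Finset.mem_singleton, Finset.sum_singleton,
    Nat.reduceEqDiff, or_self, not_false_eq_true, Nat.reduceDiv] at h1 h2
  refine orbitLengths_eq_of_finset hD (by decide) (by decide) ?_
  intro n hn
  simp only [Finset.mem_insert, Finset.mem_singleton] at hn
  rcases hn with rfl | rfl | rfl | rfl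
  · rw [show Multiset.count 1 ({11, 11, 2, 2, 1} : Multiset ℕ) = 1 by decide]; omega
  · rw [show Multiset.count 2 ({11, 11, 2, 2, 1} : Multiset ℕ) = 2 by decide]; omega
  · rw [show Multiset.count 11 ({11, 11, 2, 2, 1} : Multiset ℕ) = 2 by decide]; omega
  · rw [show Multiset.count 22 ({11, 11, 2, 2, 1} : Multiset ℕ) = 0 by decide]; omega

theorem Good.of_le {G H : Subgroup S27} (h : Good G (Fin 27)) (hH : H ≤ G) : Good H (Fin 27) :=
  h.of_injective (Subgroup.inclusion hH) (Subgroup.inclusion_injective hH) (Equiv.refl _)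
    fun _ _ => rfl

theorem Good.hasPropertiesAG {G : Subgroup S27} (h : Good G (Fin 27)) : HasPropertiesAG G := by
  have hord : ∀ g : G, orderOf (g : S27) = orderOf g := fun g => Subgroup.orderOf_coe g
  refine ⟨fun g hg => ?_, fun H hH => ⟨?_, ?_⟩, fun H hH h2 => ?_, fun H hH h3 v => ?_,
    fun g hg ho => ?_, fun H hH hi => (h.of_le hH).orbitLengths_dihedral hi, fun g hg ho => ?_⟩
  · have h1 := h.card_fixedBy ⟨g, hg⟩
    rw [← hord] at h1
    simp only [Set.mem_insert_iff, Set.mem_singleton_iff]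
    simp only at h1
    omega
  · rintro ⟨φ⟩
    have h1 := (h.of_le hH).mem_zpowers_of_four (φ.symm (1, .ofAdd 1)) (φ.symm (.ofAdd 1, 1))
      (by rw [MulEquiv.orderOf_eq, Prod.orderOf_mk, orderOf_one, Cyc.orderOf_gen]; norm_num)
      (by rw [MulEquiv.orderOf_eq, Prod.orderOf_mk, orderOf_one, Cyc.orderOf_gen]; norm_num)
      (by
        rw [commute_iff_eq, ← map_mul, ← map_mul]
        simp)
    obtain ⟨k, hk⟩ := h1
    simp only [← map_zpow, Prod.pow_mk, one_zpow] at hk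
    have h2 := congrArg Prod.fst (φ.symm.injective hk)
    have h3 : (1 : Cyc 2) ≠ .ofAdd 1 := by decide
    exact h3 h2
  · rintro ⟨φ⟩
    have h1 := (h.of_le hH).mem_zpowers_of_nine (φ.symm (1, .ofAdd 1)) (φ.symm (.ofAdd 1, 1))
      (by rw [MulEquiv.orderOf_eq, Prod.orderOf_mk, orderOf_one, Cyc.orderOf_gen]; norm_num)
      (by rw [MulEquiv.orderOf_eq, Prod.orderOf_mk, orderOf_one, Cyc.orderOf_gen]; norm_num)
      (by
        rw [commute_iff_eq, ← map_mul, ← map_mul]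
        simp)
    obtain ⟨k, hk⟩ := h1
    simp only [← map_zpow, Prod.pow_mk, one_zpow] at hk
    have h2 := congrArg Prod.fst (φ.symm.injective hk)
    have h3 : (1 : Cyc 3) ≠ .ofAdd 1 := by decide
    exact h3 h2
  · have hg := h.of_le hH
    -- every nontrivial element of a 2-group has 3 fixed points, so Burnside's lemma gives the
    -- number of orbits
    obtain ⟨k, hk, hc⟩ := hg.card_of_two_group h2
    have := Fintype.ofFinite H
    have h3 := sum_card_fixedBy_eq_ncard_orbitSet_mul H
    have : Fact (Nat.Prime 2) := ⟨Nat.prime_two⟩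
    rw [hg.sum_card_fixedBy_eq (m := 3)
      (fun a ha => hg.card_fixedBy_of_two_dvd (h2.dvd_orderOf ha)), hc] at h3
    rw [hc]
    interval_cases k <;> omega
  · rw [eq_bot_iff]
    intro a ha
    have : Fact (Nat.Prime 3) := ⟨Nat.prime_three⟩
    by_contra hne
    exact (h.of_le hH).smul_ne_of_three_dvd (h3.dvd_orderOf hne) v ha
  · have h1 := h.card_fixedBy_of_eleven (a := ⟨g, hg⟩) (by rw [← hord, ho])
    rw [orbitLengths_zpowers_of_prime (p := 11) (m := 5) (k := 2) (by norm_num) ho h1 (by norm_num)]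
    rfl
  · have h1 := h.card_fixedBy_of_thirteen (a := ⟨g, hg⟩) (by rw [← hord, ho])
    rw [orbitLengths_zpowers_of_prime (p := 13) (m := 1) (k := 2) (by norm_num) ho h1 (by norm_num)]
    rfl

theorem HasPropertiesAG.of_areConjugate {G G' : Subgroup S27} (h : HasPropertiesAG G)
    (hG : AreConjugate G G') : HasPropertiesAG G' := by
  obtain ⟨g, rfl⟩ := hG
  refine Good.hasPropertiesAG (h.good.of_injective (G.equivMapOfInjective _
    (MulAut.conj g).injective).symm.toMonoidHom (MulEquiv.injective _)
    (g⁻¹ : S27) fun b v => ?_)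
  obtain ⟨a, rfl⟩ := (G.equivMapOfInjective _ (MulAut.conj g).injective).surjective b
  have h1 : g⁻¹ ((g * (a : S27) * g⁻¹) v) = a • g⁻¹ v :=
    g.symm_apply_apply ((a : S27) (g⁻¹ v))
  exact h1.trans (congrArg (· • g⁻¹ v) (MulEquiv.symm_apply_apply _ a).symm)

/-! ### Sylow subgroups for the primes 11 and 13 -/

section
variable {A X : Type*} [Group A] [MulAction A X]

/-- There are no elements of composite order other than 4 and 9, so commuting nontrivial elements
have orders that are not coprime. -/
theorem Good.not_coprime_of_commute (h : Good A X) {x y : A} (hx : x ≠ 1) (hy : y ≠ 1)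
    (hxy : Commute x y) : ¬ (orderOf x).Coprime (orderOf y) := by
  intro hc
  have h1 := h.card_fixedBy (x * y)
  rw [hxy.orderOf_mul_eq_mul_orderOf_of_coprime hc] at h1
  have hx1 : orderOf x ≠ 1 := fun h => hx (orderOf_eq_one_iff.1 h)
  have hy1 : orderOf y ≠ 1 := fun h => hy (orderOf_eq_one_iff.1 h)
  have ho : ∀ a : A, orderOf a ≠ 1 → orderOf a = 2 ∨ orderOf a = 3 ∨ orderOf a = 4 ∨
      orderOf a = 9 ∨ orderOf a = 11 ∨ orderOf a = 13 := by
    intro a ha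
    have := h.card_fixedBy a
    omega
  rcases ho x hx1 with h2 | h2 | h2 | h2 | h2 | h2 <;>
    rcases ho y hy1 with h3 | h3 | h3 | h3 | h3 | h3 <;>
    rw [h2, h3] at hc h1 <;> first | omega | (revert hc; norm_num)

theorem Good.orderOf_eq_pow (h : Good A X) {p : ℕ} (hp : p.Prime) {y : A} (hy : p ∣ orderOf y) :
    orderOf y = p ∨ orderOf y = p ^ 2 := by
  have h1 := h.card_fixedBy y
  have h2 : orderOf y = 1 ∨ orderOf y = 2 ∨ orderOf y = 3 ∨ orderOf y = 2 ^ 2 ∨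
      orderOf y = 3 ^ 2 ∨ orderOf y = 11 ∨ orderOf y = 13 := by omega
  have key : ∀ q k, q.Prime → orderOf y = q ^ k → p = q := fun q k hq hk =>
    (Nat.prime_dvd_prime_iff_eq hp hq).1 (hp.dvd_of_dvd_pow (hk ▸ hy))
  rcases h2 with h2 | h2 | h2 | h2 | h2 | h2 | h2
  · rw [h2] at hy; exact absurd (Nat.dvd_one.1 hy) hp.one_lt.ne'
  · rw [key 2 1 (by norm_num) (by rw [h2, pow_one])]; exact Or.inl h2
  · rw [key 3 1 (by norm_num) (by rw [h2, pow_one])]; exact Or.inl h2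
  · rw [key 2 2 (by norm_num) h2]; exact Or.inr h2
  · rw [key 3 2 (by norm_num) h2]; exact Or.inr h2
  · rw [key 11 1 (by norm_num) (by rw [h2, pow_one])]; exact Or.inl h2
  · rw [key 13 1 (by norm_num) (by rw [h2, pow_one])]; exact Or.inl h2

theorem Good.isPGroup_centralizer (h : Good A X) {p : ℕ} [hp : Fact p.Prime] {S : Set A} {x : A}
    (hx : orderOf x = p) (hxS : x ∈ S) : IsPGroup p (Subgroup.centralizer S) := by
  rw [IsPGroup.iff_orderOf]
  rintro ⟨c, hc⟩
  rw [Subgroup.orderOf_mk]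
  by_cases hc1 : c = 1
  · exact ⟨0, by rw [hc1, orderOf_one, pow_zero]⟩
  have hx1 : x ≠ 1 := by
    rintro rfl
    rw [orderOf_one] at hx
    exact hp.out.one_lt.ne hx
  have h1 := h.not_coprime_of_commute hx1 hc1 ((Subgroup.mem_centralizer_iff.1 hc) x hxS)
  rw [hx, hp.out.coprime_iff_not_dvd, not_not] at h1
  rcases h.orderOf_eq_pow hp.out h1 with h2 | h2
  · exact ⟨1, by rw [h2, pow_one]⟩
  · exact ⟨2, h2⟩

/-- The subgroups `C_p` for `p = 11, 13`, with the number `m` of fixed points of a generator. -/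
def LargePrime (p m : ℕ) : Prop := p = 11 ∧ m = 5 ∨ p = 13 ∧ m = 1

theorem LargePrime.prime {p m : ℕ} (hp : LargePrime p m) : p.Prime := by
  rcases hp with ⟨rfl, -⟩ | ⟨rfl, -⟩ <;> norm_num

theorem Good.card_sylow (h : Good A X) {p m : ℕ} (hpm : LargePrime p m) (hd : p ∣ Nat.card A)
    (P : Sylow p A) : Nat.card P = p := by
  have := h.finite
  have : Fact p.Prime := ⟨hpm.prime⟩
  obtain ⟨k, hk⟩ := IsPGroup.iff_card.1 P.2
  have h1 := P.dvd_card_of_dvd_card hd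
  have h2 := (hk ▸ Subgroup.card_subgroup_dvd_card (P : Subgroup A)).trans h.card_dvd
  have h3 : k ≤ 1 := by
    rcases hpm with ⟨rfl, -⟩ | ⟨rfl, -⟩
    · exact pow_dvd_of_dvd (m := 8 * 27 * 13) (by norm_num) (by norm_num) (h2.trans (by norm_num))
    · exact pow_dvd_of_dvd (m := 8 * 27 * 11) (by norm_num) (by norm_num) (h2.trans (by norm_num))
  rw [hk] at h1 ⊢
  interval_cases k
  · exact absurd (Nat.dvd_one.1 h1) hpm.prime.one_lt.ne'
  · exact pow_one p

theorem Good.exists_generator (h : Good A X) {p m : ℕ} (hpm : LargePrime p m)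
    (hd : p ∣ Nat.card A) (P : Sylow p A) :
    ∃ x : A, orderOf x = p ∧ (P : Subgroup A) = Subgroup.zpowers x := by
  have := h.finite
  have : Fact p.Prime := ⟨hpm.prime⟩
  have hc := h.card_sylow hpm hd P
  obtain ⟨x, hx⟩ := exists_prime_orderOf_dvd_card' p hc.symm.dvd
  refine ⟨x, by rw [Subgroup.orderOf_coe, hx], ?_⟩
  refine (Subgroup.eq_of_le_of_card_ge (by rw [Subgroup.zpowers_le]; exact x.2) ?_).symm
  rw [Nat.card_zpowers, Subgroup.orderOf_coe, hx]
  exact hc.le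

theorem Good.centralizer_sylow (h : Good A X) {p m : ℕ} (hpm : LargePrime p m)
    (hd : p ∣ Nat.card A) (P : Sylow p A) : Subgroup.centralizer (P : Set A) = P := by
  have := h.finite
  have : Fact p.Prime := ⟨hpm.prime⟩
  obtain ⟨x, hx, hP⟩ := h.exists_generator hpm hd P
  refine P.3 (h.isPGroup_centralizer hx (by
    change x ∈ (P : Subgroup A)
    rw [hP]; exact Subgroup.mem_zpowers x)) ?_
  have : IsCyclic P := isCyclic_of_prime_card (h.card_sylow hpm hd P)
  exact Subgroup.le_centralizer (P : Subgroup A)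

theorem card_eq_card_mul_relIndex {H K : Subgroup A} (hHK : H ≤ K) :
    Nat.card K = Nat.card H * H.relIndex K := by
  rw [← Nat.card_congr (Subgroup.subgroupOfEquivOfLe hHK).toEquiv, Subgroup.relIndex,
    Subgroup.card_mul_index]

theorem Good.card_normalizer_sylow (h : Good A X) {p m : ℕ} (hpm : LargePrime p m)
    (hd : p ∣ Nat.card A) (P : Sylow p A) :
    ∃ k, k ∣ p - 1 ∧ Nat.card (Subgroup.normalizer (P : Set A)) = p * k := by
  have := h.finite
  have : Fact p.Prime := ⟨hpm.prime⟩
  have hc := h.card_sylow hpm hd P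
  have : IsCyclic P := isCyclic_of_prime_card hc
  have key := Subgroup.card_dvd_of_injective _
    (QuotientGroup.kerLift_injective (P : Subgroup A).normalizerMonoidHom)
  rw [Subgroup.normalizerMonoidHom_ker, ← Subgroup.index, ← Subgroup.relIndex,
    IsCyclic.card_mulAut, hc, Nat.totient_prime hpm.prime] at key
  have h1 := h.centralizer_sylow hpm hd P
  change (Subgroup.centralizer (P : Set A)).relIndex _ ∣ _ at key
  rw [h1] at key
  exact ⟨_, key, (card_eq_card_mul_relIndex (P : Subgroup A).le_normalizer).trans (by rw [hc])⟩

theorem card_eq_card_normalizer_mul [Finite A] {p : ℕ} [Fact p.Prime] (P : Sylow p A) :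
    Nat.card A = Nat.card (Subgroup.normalizer (P : Set A)) * Nat.card (Sylow p A) := by
  rw [P.card_eq_index_normalizer, Subgroup.card_mul_index]

/-- The fixed points of different Sylow subgroups are different if no stabilizer contains two of
them; as each has `m` fixed points, this bounds their number. -/
theorem Good.card_sylow_mul_le (h : Good A X) {p m : ℕ} (hpm : LargePrime p m)
    (hd : p ∣ Nat.card A)
    (hs : ∀ v : X, p ∣ Nat.card (stabilizer A v) → Nat.card (Sylow p (stabilizer A v)) = 1) :
    Nat.card (Sylow p A) * m ≤ 27 := by
  have := h.finite
  have := h.finite_set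
  have : Fact p.Prime := ⟨hpm.prime⟩
  choose x hx hP using fun P : Sylow p A => h.exists_generator hpm hd P
  have hfix : ∀ P, Nat.card (fixedBy X (x P)) = m := by
    intro P
    rcases hpm with ⟨rfl, rfl⟩ | ⟨rfl, rfl⟩
    · exact h.card_fixedBy_of_eleven (hx P)
    · exact h.card_fixedBy_of_thirteen (hx P)
  have hle : ∀ (P : Sylow p A) (v : X), v ∈ fixedBy X (x P) →
      (P : Subgroup A) ≤ stabilizer A v := by
    intro P v hv
    rw [hP, Subgroup.zpowers_le]
    exact hv
  let F : (Σ P : Sylow p A, fixedBy X (x P)) → X := fun s => s.2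
  have hF : Function.Injective F := by
    rintro ⟨P, v, hv⟩ ⟨Q, w, hw⟩ hvw
    have hvw' : v = w := hvw
    subst hvw'
    have h1 := hs v (by
      rw [← h.card_sylow hpm hd P]
      exact Subgroup.card_dvd_of_le (hle P v hv))
    have : Subsingleton (Sylow p (stabilizer A v)) := (Nat.card_eq_one_iff_unique.1 h1).1
    have h2 := Subsingleton.elim (P.subtype (hle P v hv)) (Q.subtype (hle Q v hw))
    have h3 := Sylow.subtype_injective h2
    subst h3
    rfl
  have := Fintype.ofFinite (Sylow p A)
  have h2 := Nat.card_le_card_of_injective F hF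
  rw [Nat.card_sigma, h.natCard] at h2
  rw [Finset.sum_const_nat (m := m) (fun P _ => hfix P), Finset.card_univ,
    ← Nat.card_eq_fintype_card] at h2
  exact h2

theorem Good.not_three_dvd_stabilizer (h : Good A X) (v : X) : ¬ 3 ∣ Nat.card (stabilizer A v) := by
  have := h.finite
  intro hd
  have : Fact (Nat.Prime 3) := ⟨Nat.prime_three⟩
  obtain ⟨y, hy⟩ := exists_prime_orderOf_dvd_card' 3 hd
  exact h.smul_ne_of_three_dvd (a := (y : A)) (by rw [Subgroup.orderOf_coe, hy]) v y.2

/-- The normalizer of a Sylow 13-subgroup fixes its unique fixed point. -/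
theorem Good.not_three_dvd_normalizer (h : Good A X) (hd : 13 ∣ Nat.card A) (P : Sylow 13 A) :
    ¬ 3 ∣ Nat.card (Subgroup.normalizer (P : Set A)) := by
  have := h.finite
  obtain ⟨x, hx, hP⟩ := h.exists_generator (Or.inr ⟨rfl, rfl⟩) hd P
  have h1 := h.card_fixedBy_of_thirteen hx
  obtain ⟨⟨v, hv⟩, hu⟩ := (Nat.card_eq_one_iff_exists).1 h1
  have hle : Subgroup.normalizer (P : Set A) ≤ stabilizer A v := by
    intro n hn
    have h2 : n⁻¹ * x * n ∈ (P : Subgroup A) := by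
      have h3 := (Subgroup.mem_normalizer_iff.1 (inv_mem hn) x).1
        (by rw [hP]; exact Subgroup.mem_zpowers x)
      simpa using h3
    have h3 : (P : Subgroup A) ≤ stabilizer A v := by
      rw [hP, Subgroup.zpowers_le]; exact hv
    have h4 : (n⁻¹ * x * n) • v = v := h3 h2
    have h5 : x • n • v = n • v := by
      rw [mul_smul, mul_smul, inv_smul_eq_iff] at h4
      exact h4
    exact congrArg Subtype.val (hu ⟨n • v, h5⟩)
  intro h3
  exact h.not_three_dvd_stabilizer v (h3.trans (Subgroup.card_dvd_of_le hle))

theorem Good.card_sylow_thirteen (h : Good A X) (hd : 13 ∣ Nat.card A) :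
    ∃ k, k ∣ 4 ∧ Nat.card A = 13 * k * Nat.card (Sylow 13 A) ∧
      (Nat.card (Sylow 13 A) = 1 ∨ Nat.card (Sylow 13 A) = 27 ∨ Nat.card (Sylow 13 A) = 66) := by
  have := h.finite
  have : Fact (Nat.Prime 13) := ⟨by norm_num⟩
  obtain ⟨P⟩ : Nonempty (Sylow 13 A) := inferInstance
  obtain ⟨k, hk, hN⟩ := h.card_normalizer_sylow (Or.inr ⟨rfl, rfl⟩) hd P
  have h3 := h.not_three_dvd_normalizer hd P
  rw [hN] at h3
  have hk4 : k ∣ 4 := by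
    have h4 : k ∈ Nat.divisors 12 := Nat.mem_divisors.2 ⟨hk, by norm_num⟩
    have h5 : Nat.divisors 12 = {1, 2, 3, 4, 6, 12} := by decide
    rw [h5] at h4
    simp only [Finset.mem_insert, Finset.mem_singleton] at h4
    rcases h4 with rfl | rfl | rfl | rfl | rfl | rfl <;> omega
  have hA := card_eq_card_normalizer_mul P
  rw [hN] at hA
  refine ⟨k, hk4, hA, ?_⟩
  have h6 := card_sylow_modEq_one 13 A
  have h7 : Nat.card (Sylow 13 A) ∣ 2376 := by
    have h8 := h.card_dvd
    rw [hA, mul_assoc] at h8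
    have h9 : k * Nat.card (Sylow 13 A) ∣ 2376 :=
      Nat.dvd_of_mul_dvd_mul_left (show 0 < 13 by norm_num) (h8.trans (by norm_num))
    exact (dvd_mul_left _ _).trans h9
  have h8 : ∀ n ∈ Nat.divisors 2376, n % 13 = 1 → n = 1 ∨ n = 27 ∨ n = 66 := by
    have : Nat.divisors 2376 = (Finset.range 4).biUnion fun a => (Finset.range 4).biUnion fun b =>
      (Finset.range 2).image fun c => 2 ^ a * 3 ^ b * 11 ^ c := by decide +kernel
    rw [this]; decide
  exact h8 _ (Nat.mem_divisors.2 ⟨h7, by norm_num⟩) h6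

theorem Good.card_of_thirteen_dvd (h : Good A X) (hd : 13 ∣ Nat.card A) :
    ∃ k, k ∣ 4 ∧ (Nat.card (Sylow 13 A) = 1 ∧ Nat.card A = 13 * k ∨
      Nat.card (Sylow 13 A) = 27 ∧ Nat.card A = 351 * k) := by
  obtain ⟨k, hk, hA, hn⟩ := h.card_sylow_thirteen hd
  refine ⟨k, hk, ?_⟩
  rcases hn with hn | hn | hn
  · left; rw [hn, mul_one] at hA; exact ⟨hn, hA⟩
  · right; rw [hn] at hA; exact ⟨hn, by omega⟩
  · exfalso
    have h1 := h.card_sylow_mul_le (Or.inr ⟨rfl, rfl⟩) hd fun v hv => by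
      obtain ⟨k', -, hA', hn'⟩ := (h.subgroup (stabilizer A v)).card_sylow_thirteen hv
      have h3 := h.not_three_dvd_stabilizer v
      rcases hn' with hn' | hn' | hn'
      · exact hn'
      · rw [hn'] at hA'; omega
      · rw [hn'] at hA'; omega
    omega

theorem Good.card_sylow_eleven (h : Good A X) (hd : 11 ∣ Nat.card A) (hd' : ¬ 13 ∣ Nat.card A) :
    ∃ k, k ∣ 2 ∧ Nat.card A = 11 * k * Nat.card (Sylow 11 A) ∧
      (Nat.card (Sylow 11 A) = 1 ∨ Nat.card (Sylow 11 A) = 12) := by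
  have := h.finite
  have : Fact (Nat.Prime 11) := ⟨by norm_num⟩
  obtain ⟨P⟩ : Nonempty (Sylow 11 A) := inferInstance
  obtain ⟨k, hk, hN⟩ := h.card_normalizer_sylow (Or.inl ⟨rfl, rfl⟩) hd P
  have hA := card_eq_card_normalizer_mul P
  rw [hN] at hA
  have h8 : 11 * (k * Nat.card (Sylow 11 A)) ∣ 11 * 2808 := by
    rw [← mul_assoc, ← hA]; exact h.card_dvd
  have h9 : k * Nat.card (Sylow 11 A) ∣ 2808 := Nat.dvd_of_mul_dvd_mul_left (by norm_num) h8
  have hk2 : k ∣ 2 := by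
    have h4 : k ∈ Nat.divisors 10 := Nat.mem_divisors.2 ⟨hk, by norm_num⟩
    have h5 : Nat.divisors 10 = {1, 2, 5, 10} := by decide
    rw [h5] at h4
    simp only [Finset.mem_insert, Finset.mem_singleton] at h4
    have h6 : k ∣ 2808 := (dvd_mul_right _ _).trans h9
    rcases h4 with rfl | rfl | rfl | rfl
    · norm_num
    · norm_num
    · norm_num at h6
    · norm_num at h6
  refine ⟨k, hk2, hA, ?_⟩
  have h6 := card_sylow_modEq_one 11 A
  have h7 : Nat.card (Sylow 11 A) ∣ 216 := by
    have h10 : Nat.card (Sylow 11 A) ∣ 216 * 13 := (dvd_mul_left _ _).trans h9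
    refine Nat.Coprime.dvd_of_dvd_mul_right ?_ h10
    rw [Nat.coprime_comm, Nat.Prime.coprime_iff_not_dvd (by norm_num)]
    intro h11
    exact hd' (h11.trans ⟨11 * k, by rw [hA]; ring⟩)
  have h8 : ∀ n ∈ Nat.divisors 216, n % 11 = 1 → n = 1 ∨ n = 12 := by decide
  exact h8 _ (Nat.mem_divisors.2 ⟨h7, by norm_num⟩) h6

theorem Good.card_of_eleven_dvd (h : Good A X) (hd : 11 ∣ Nat.card A) (hd' : ¬ 13 ∣ Nat.card A) :
    ∃ k, k ∣ 2 ∧ Nat.card (Sylow 11 A) = 1 ∧ Nat.card A = 11 * k := by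
  obtain ⟨k, hk, hA, hn⟩ := h.card_sylow_eleven hd hd'
  refine ⟨k, hk, ?_⟩
  rcases hn with hn | hn
  · rw [hn, mul_one] at hA; exact ⟨hn, hA⟩
  · exfalso
    have h1 := h.card_sylow_mul_le (Or.inl ⟨rfl, rfl⟩) hd fun v hv => by
      obtain ⟨k', -, hA', hn'⟩ := (h.subgroup (stabilizer A v)).card_sylow_eleven hv
        fun h13 => hd' (h13.trans (Subgroup.card_subgroup_dvd_card _))
      have h3 := h.not_three_dvd_stabilizer v
      rcases hn' with hn' | hn'
      · exact hn'
      · rw [hn'] at hA'; omega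
    omega

end

/-! ### Groups of order divisible by 11 or 13 -/

theorem card_sylow_eq {A : Type*} [Group A] [Finite A] {p k m : ℕ} [hp : Fact p.Prime]
    (hA : Nat.card A = p ^ k * m) (hm : ¬ p ∣ m) (P : Sylow p A) : Nat.card P = p ^ k := by
  obtain ⟨j, hj⟩ := IsPGroup.iff_card.1 P.2
  have h1 : p ^ j ∣ p ^ k * m := by rw [← hA, ← hj]; exact Subgroup.card_subgroup_dvd_card _
  have h2 : p ^ k ∣ p ^ j := by
    rw [← hj]; exact P.pow_dvd_card_of_pow_dvd_card (by rw [hA]; exact dvd_mul_right _ _)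
  rw [hj, le_antisymm (pow_dvd_of_dvd hp.out hm h1)
    ((Nat.pow_dvd_pow_iff_le_right hp.out.one_lt).1 h2)]

/-- A group with a normal subgroup `N` and a complement is a semidirect product, and the kernel of
the action on `N` is the centralizer of `N` in the complement. -/
theorem exists_iso_semidirect {A N' K' : Type*} [Group A] [Group N'] [Group K'] {N K : Subgroup A}
    [N.Normal] (hNK : N.IsComplement' K) (f : N ≃* N') (g : K ≃* K') :
    ∃ φ : K' →* MulAut N', Iso A (N' ⋊[φ] K') ∧
      ∀ k : K, φ (g k) = 1 ↔ ∀ n ∈ N, (k : A) * n = n * k := by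
  refine ⟨_, ⟨(SemidirectProduct.mulEquivSubgroup hNK).symm.trans
    (SemidirectProduct.congr' f g)⟩, fun k => ?_⟩
  rw [MulEquiv.ext_iff]
  let e : MulAut N := N.normalizerMonoidHom
    (Subgroup.inclusion (N.normalizer_eq_top ▸ le_top : K ≤ Subgroup.normalizer (N : Set A)) k)
  have key : ∀ n : N, e n = n ↔ (k : A) * n = n * k := by
    intro n
    rw [Subtype.ext_iff, ← mul_inv_eq_iff_eq_mul]
    rfl
  constructor
  · intro hn n hnN
    refine (key ⟨n, hnN⟩).1 ?_
    have := hn (f ⟨n, hnN⟩)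
    simpa using this
  · intro hn n'
    obtain ⟨n, rfl⟩ := f.surjective n'
    have := (key n).2 (hn n n.2)
    simpa using this

section
variable {A X : Type*} [Group A] [MulAction A X]

theorem Good.conj_eq_inv (h : Good A X) {p : ℕ} (hp : Odd p) {T : Subgroup A} (hT : IsPGroup p T)
    {z : A} (hz : orderOf z = 2) (hn : ∀ t ∈ T, z * t * z⁻¹ ∈ T) : ∀ t ∈ T, z * t * z⁻¹ = t⁻¹ := by
  have := h.finite
  refine conj_eq_inv_of_fixedPointFree (by rw [← pow_two, ← hz, pow_orderOf_eq_one]) hn ?_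
  intro t ht hzt
  by_contra ht1
  refine h.not_coprime_of_commute (x := t) (y := z) ht1 ?_ hzt.symm ?_
  · rintro rfl; rw [orderOf_one] at hz; omega
  · rw [hz, ← Subgroup.orderOf_mk t ht]
    exact hT.orderOf_coprime (Nat.coprime_two_right.2 hp) _

/-- An involution `z` that normalizes a 3-subgroup `T` inverts it, so a `T`-orbit contains at most
one of the fixed points of `z`. -/
theorem Good.injective_smul (h : Good A X) {T : Subgroup A} (hT : IsPGroup 3 T)
    {z : A} (hz : orderOf z = 2) (hn : ∀ t ∈ T, z * t * z⁻¹ ∈ T) :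
    Function.Injective fun s : T × fixedBy X z => s.1 • (s.2 : X) := by
  have hinv := h.conj_eq_inv (by decide) hT hz hn
  have : Fact (Nat.Prime 3) := ⟨Nat.prime_three⟩
  rintro ⟨⟨s, hs⟩, ⟨v, hv⟩⟩ ⟨⟨t, ht⟩, ⟨w, hw⟩⟩ hst
  have hst' : s • v = t • w := hst
  rw [mem_fixedBy] at hv hw
  set r := t⁻¹ * s with hr
  have hrT : r ∈ T := mul_mem (inv_mem ht) hs
  have hrv : r • v = w := by rw [hr, mul_smul, hst', inv_smul_smul]
  have h1 : r⁻¹ • v = w := by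
    rw [← hinv r hrT, mul_smul, mul_smul, inv_smul_eq_iff.2 hv.symm, hrv, hw]
  have h2 : (r * r) • v = v := by
    rw [mul_smul, hrv, ← h1, smul_inv_smul]
  have h3 : r = 1 := by
    by_contra hne
    have h4 : 3 ∣ orderOf r := by
      rw [← Subgroup.orderOf_mk r hrT]
      exact hT.dvd_orderOf fun h => hne (congrArg Subtype.val h)
    refine h.smul_ne_of_three_dvd (a := r * r) ?_ v h2
    rw [← pow_two, Nat.Coprime.orderOf_pow]
    · exact h4
    · rw [← Subgroup.orderOf_mk r hrT]
      exact hT.orderOf_coprime (by norm_num) _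
  have h4 : s = t := (inv_mul_eq_one.1 h3).symm
  subst h4
  rw [hr, inv_mul_cancel, one_smul] at hrv
  subst hrv
  rfl

theorem Good.card_mul_three_le (h : Good A X) {T : Subgroup A} (hT : IsPGroup 3 T)
    {z : A} (hz : orderOf z = 2) (hn : ∀ t ∈ T, z * t * z⁻¹ ∈ T) : Nat.card T * 3 ≤ 27 := by
  have := h.finite_set
  have h1 := Nat.card_le_card_of_injective _ (h.injective_smul hT hz hn)
  rwa [Nat.card_prod, h.card_fixedBy_of_two_dvd hz.symm.dvd, h.natCard] at h1

theorem isCyclic_mulAut_of_prime {B : Type*} [Group B] {p : ℕ} [hp : Fact p.Prime]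
    (hB : Nat.card B = p) : IsCyclic (MulAut B) := by
  have : IsCyclic B := isCyclic_of_prime_card hB
  have e : MulAut B ≃* (ZMod p)ˣ := hB ▸ IsCyclic.mulAutMulEquiv B
  exact isCyclic_of_injective e.toMonoidHom e.injective

/-- A 2-subgroup of the normalizer acts faithfully on the Sylow subgroup. -/
theorem Good.isCyclic_of_le_normalizer (h : Good A X) {p m : ℕ} (hpm : LargePrime p m)
    (hd : p ∣ Nat.card A) (P : Sylow p A) {Q : Subgroup A} (hQ : IsPGroup 2 Q)
    (hQP : Q ≤ Subgroup.normalizer (P : Set A)) : IsCyclic Q := by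
  have := h.finite
  have : Fact p.Prime := ⟨hpm.prime⟩
  have : Fact (Nat.Prime 2) := ⟨Nat.prime_two⟩
  have : IsCyclic (MulAut P) := isCyclic_mulAut_of_prime (h.card_sylow hpm hd P)
  refine isCyclic_of_injective ((P : Subgroup A).normalizerMonoidHom.comp
    (Subgroup.inclusion hQP)) ?_
  rw [injective_iff_map_eq_one]
  intro q hq
  have h1 : Subgroup.inclusion hQP q ∈ ((P : Subgroup A).normalizerMonoidHom).ker := hq
  rw [Subgroup.normalizerMonoidHom_ker] at h1
  have h2 : (q : A) ∈ Subgroup.centralizer (P : Set A) := h1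
  rw [h.centralizer_sylow hpm hd P] at h2
  have h3 : Disjoint Q (P : Subgroup A) := by
    refine IsPGroup.disjoint_of_ne 2 p ?_ _ _ hQ P.2
    rcases hpm with ⟨rfl, -⟩ | ⟨rfl, -⟩ <;> norm_num
  exact Subtype.ext (Subgroup.disjoint_def.1 h3 q.2 h2)

theorem Good.normal_sylow_three_of_card_eq (h : Good A X) (hA : Nat.card A = 351)
    (hn : Nat.card (Sylow 13 A) = 27) [Fact (Nat.Prime 3)] (T : Sylow 3 A) :
    (T : Subgroup A).Normal ∧ Nat.card T = 27 := by
  have := h.finite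
  have : Fact (Nat.Prime 13) := ⟨by norm_num⟩
  have hd : 13 ∣ Nat.card A := by rw [hA]; norm_num
  have hT : Nat.card T = 3 ^ 3 :=
    card_sylow_eq (m := 13) (by rw [hA]; norm_num) (by norm_num) T
  -- there are 324 elements of order 13, and the other 27 elements form the Sylow 3-subgroup
  let S : Set A := {a | orderOf a ≠ 13}
  have hTS : (T : Set A) ⊆ S := by
    intro t ht h13
    have h1 := Subgroup.orderOf_dvd_natCard _ ht
    change orderOf t ∣ Nat.card T at h1
    rw [h13, hT] at h1
    norm_num at h1
  have hS : Sᶜ.ncard ≥ 324 := by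
    -- the 27 Sylow 13-subgroups have 12 nontrivial elements each, and intersect trivially
    let F : (Σ P : Sylow 13 A, {a : P // a ≠ 1}) → (Sᶜ : Set A) := fun s => ⟨(s.2 : s.1), by
      intro h1
      have h2 : orderOf (s.2 : s.1) ∣ 13 := by
        exact (orderOf_dvd_natCard _).trans (h.card_sylow (Or.inr ⟨rfl, rfl⟩) hd s.1).dvd
      rw [Nat.dvd_prime (by norm_num)] at h2
      rcases h2 with h2 | h2
      · exact s.2.2 (orderOf_eq_one_iff.1 h2)
      · exact h1 (by rw [Subgroup.orderOf_coe, h2])⟩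
    have hF : Function.Injective F := by
      rintro ⟨P, ⟨⟨a, ha⟩, ha1⟩⟩ ⟨Q, ⟨⟨b, hb⟩, hb1⟩⟩ hab
      have hab' : a = b := congrArg Subtype.val hab
      subst hab'
      have key : ∀ R : Sylow 13 A, a ∈ (R : Subgroup A) → Subgroup.zpowers a = R := by
        intro R haR
        have h1 : orderOf a ∣ 13 := by
          exact (Subgroup.orderOf_dvd_natCard _ haR).trans
            (h.card_sylow (Or.inr ⟨rfl, rfl⟩) hd R).dvd
        rw [Nat.dvd_prime (by norm_num)] at h1
        refine Subgroup.eq_of_le_of_card_ge (by rwa [Subgroup.zpowers_le]) ?_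
        rw [Nat.card_zpowers, h.card_sylow (Or.inr ⟨rfl, rfl⟩) hd R]
        rcases h1 with h1 | h1
        · exact absurd (Subtype.ext (orderOf_eq_one_iff.1 h1)) ha1
        · exact h1.ge
      have hPQ : P = Q := Sylow.ext ((key P ha).symm.trans (key Q hb))
      subst hPQ
      rfl
    have h2 := Nat.card_le_card_of_injective F hF
    have := Fintype.ofFinite (Sylow 13 A)
    rw [Nat.card_sigma, Finset.sum_const_nat (m := 12) (fun P _ => by
      have := Fintype.ofFinite P
      classical
      rw [Nat.card_eq_fintype_card, Fintype.card_subtype_compl, Fintype.card_subtype_eq,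
        ← Nat.card_eq_fintype_card]
      change Nat.card P - 1 = 12
      rw [h.card_sylow (Or.inr ⟨rfl, rfl⟩) hd P]),
      Finset.card_univ, ← Nat.card_eq_fintype_card, hn] at h2
    exact h2
  have hSc : S.ncard + Sᶜ.ncard = 351 := by rw [Set.ncard_add_ncard_compl, hA]
  have hTS' : (T : Set A) = S := Set.eq_of_subset_of_ncard_le hTS (by
    have : (T : Set A).ncard = 27 := hT
    omega) (Set.toFinite _)
  refine ⟨⟨fun t ht g => ?_⟩, hT⟩
  change t ∈ (T : Set A) at ht
  change g * t * g⁻¹ ∈ (T : Set A)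
  rw [hTS'] at ht ⊢
  change orderOf (g * t * g⁻¹) ≠ 13
  rw [← MulAut.conj_apply, MulEquiv.orderOf_eq]
  exact ht

/-- If 13 divides the order and the Sylow 13-subgroup is not normal, the order is 351. Otherwise a
cyclic Sylow 2-subgroup has a normal complement of order 351, whose normal subgroup of order 27
cannot be normalized by an involution. -/
theorem Good.card_eq_of_thirteen_dvd (h : Good A X) (hd : 13 ∣ Nat.card A)
    (hn : Nat.card (Sylow 13 A) ≠ 1) :
    Nat.card A = 351 ∧ Nat.card (Sylow 13 A) = 27 := by
  have := h.finite
  have : Fact (Nat.Prime 13) := ⟨by norm_num⟩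
  have : Fact (Nat.Prime 3) := ⟨by norm_num⟩
  have : Fact (Nat.Prime 2) := ⟨by norm_num⟩
  obtain ⟨k, hk, ⟨h1, -⟩ | ⟨hn27, hA⟩⟩ := h.card_of_thirteen_dvd hd
  · exact absurd h1 hn
  have hk' : k = 1 ∨ k = 2 ∨ k = 4 := by
    have : k ∈ Nat.divisors 4 := Nat.mem_divisors.2 ⟨hk, by norm_num⟩
    have h5 : Nat.divisors 4 = {1, 2, 4} := by decide
    rw [h5] at this
    simpa using this
  by_cases hk1 : k = 1
  · rw [hk1] at hA; exact ⟨hA, hn27⟩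
  exfalso
  have h2A : 2 ∣ Nat.card A := by rcases hk' with rfl | rfl | rfl <;> omega
  obtain ⟨Q⟩ : Nonempty (Sylow 2 A) := inferInstance
  -- a Sylow 2-subgroup `Q` fixes one of the 27 Sylow 13-subgroups, hence it is cyclic and has a
  -- normal complement by Burnside's transfer theorem
  obtain ⟨P, hP⟩ := Q.2.nonempty_fixed_point_of_prime_not_dvd_card (Sylow 13 A)
    (by rw [hn27]; norm_num)
  have hQP : (Q : Subgroup A) ≤ Subgroup.normalizer (P : Set A) := by
    intro q hq
    exact Sylow.smul_eq_iff_mem_normalizer.1 (hP ⟨q, hq⟩)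
  have hcyc := h.isCyclic_of_le_normalizer (Or.inr ⟨rfl, rfl⟩) hd P Q.2 hQP
  have hmin : (Nat.card A).minFac = 2 := (Nat.minFac_eq_two_iff _).2 h2A
  have hcompl := IsCyclic.isComplement' hmin hcyc
  set M := (MonoidHom.transferSylow Q (hcyc.normalizer_le_centralizer hmin)).ker with hM
  have hQc : Nat.card Q = k := by
    rcases hk' with rfl | rfl | rfl
    · omega
    · exact card_sylow_eq (k := 1) (m := 351) (by rw [hA]; norm_num) (by norm_num) Q
    · exact card_sylow_eq (k := 2) (m := 351) (by rw [hA]; norm_num) (by norm_num) Q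
  have hMc : Nat.card M = 351 := by
    have h1 := hcompl.card_mul_card
    change Nat.card M * Nat.card Q = _ at h1
    rw [hQc, hA] at h1
    exact Nat.eq_of_mul_eq_mul_right (by omega) h1
  have hM27 : Nat.card (Sylow 13 M) = 27 := by
    obtain ⟨k', hk', ⟨-, h1⟩ | ⟨h1, -⟩⟩ := (h.subgroup M).card_of_thirteen_dvd
      (by rw [hMc]; norm_num)
    · rw [hMc] at h1
      have := Nat.le_of_dvd (by norm_num) hk'
      omega
    · exact h1
  obtain ⟨T⟩ : Nonempty (Sylow 3 M) := inferInstance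
  obtain ⟨hTn, hTc⟩ := (h.subgroup M).normal_sylow_three_of_card_eq hMc hM27 T
  have := T.characteristic_of_normal hTn
  -- the Sylow 3-subgroup is characteristic in the complement, hence normal
  have hN : ((T : Subgroup M).map M.subtype).Normal := inferInstance
  obtain ⟨z, hz⟩ := exists_prime_orderOf_dvd_card' 2 h2A
  have h1 := h.card_mul_three_le (T.2.map M.subtype) hz fun t ht => hN.conj_mem t ht z
  rw [Subgroup.card_map_of_injective M.subtype_injective] at h1
  change Nat.card T * 3 ≤ 27 at h1
  omega

/-- A subgroup of order 13 acts without fixed points on a normal 3-subgroup `K`, which forces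
`|K| ≡ 1` modulo 13. -/
theorem Good.card_normal_three (h : Good A X) (hA : Nat.card A = 351) (K : Subgroup A) [K.Normal]
    (hK : IsPGroup 3 K) : Nat.card K = 1 ∨ Nat.card K = 27 := by
  have := h.finite
  have : Fact (Nat.Prime 13) := ⟨by norm_num⟩
  have : Fact (Nat.Prime 3) := ⟨by norm_num⟩
  obtain ⟨x, hx⟩ := exists_prime_orderOf_dvd_card' (G := A) 13 (by rw [hA]; norm_num)
  obtain ⟨j, hj⟩ := IsPGroup.iff_card.1 hK
  set Z := Subgroup.zpowers x with hZ
  have hZc : Nat.card Z = 13 := by rw [Nat.card_zpowers, hx]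
  have h13 : 13 ∣ Nat.card ↥(Z ⊔ K) := by
    rw [← hZc]; exact Subgroup.card_dvd_of_le le_sup_left
  have h13K : (13).Coprime (Nat.card K) := by
    rw [hj]; exact Nat.Coprime.pow_right _ (by norm_num)
  have h1 : Nat.card ↥(Z ⊔ K) = Nat.card K * K.relIndex Z := by
    rw [card_eq_card_mul_relIndex (le_sup_right : K ≤ Z ⊔ K), Subgroup.relIndex_sup_right]
  have h2 : K.relIndex Z ∣ 13 := hZc ▸ Subgroup.relIndex_dvd_card K Z
  have h3 : K.relIndex Z = 13 := by
    rw [Nat.dvd_prime (by norm_num)] at h2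
    rcases h2 with h2 | h2
    · rw [h2, mul_one] at h1
      rw [h1] at h13
      exact absurd (Nat.Coprime.eq_one_of_dvd h13K h13) (by norm_num)
    · exact h2
  rw [h3, hj] at h1
  obtain ⟨k, hk, ⟨-, h4⟩ | ⟨-, h4⟩⟩ := (h.subgroup (Z ⊔ K)).card_of_thirteen_dvd h13
  · have hk1 : k ∣ 3 ^ j := ⟨1, by omega⟩
    have hk2 : k = 1 := Nat.Coprime.eq_one_of_dvd
      (Nat.Coprime.coprime_dvd_left hk (Nat.Coprime.pow_right _ (by norm_num))) hk1
    left; rw [hj]; omega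
  · have hk1 : k ∣ 3 ^ j := ⟨27, by omega⟩
    have hk2 : k = 1 := Nat.Coprime.eq_one_of_dvd
      (Nat.Coprime.coprime_dvd_left hk (Nat.Coprime.pow_right _ (by norm_num))) hk1
    right; rw [hj]; omega

/-- The Sylow 3-subgroup `T` is normal of order 27, and has no proper nontrivial subgroup that is
normal in the whole group. Hence its centre and its subgroup of elements with trivial cube are equal
to `T`, and `T` is elementary abelian. -/
theorem Good.semidirect_of_card_eq (h : Good A X) (hA : Nat.card A = 351) :
    IsNontrivialSemidirect A (Fin 3 → Cyc 3) (Cyc 13) := by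
  have := h.finite
  have : Fact (Nat.Prime 13) := ⟨by norm_num⟩
  have : Fact (Nat.Prime 3) := ⟨by norm_num⟩
  have hd : 13 ∣ Nat.card A := by rw [hA]; norm_num
  have hn : Nat.card (Sylow 13 A) = 27 := by
    obtain ⟨k, hk, ⟨-, h1⟩ | ⟨h1, -⟩⟩ := h.card_of_thirteen_dvd hd
    · have := Nat.le_of_dvd (by norm_num) hk
      omega
    · exact h1
  obtain ⟨T⟩ : Nonempty (Sylow 3 A) := inferInstance
  obtain ⟨P⟩ : Nonempty (Sylow 13 A) := inferInstance
  obtain ⟨hTn, hTc⟩ := h.normal_sylow_three_of_card_eq hA hn T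
  -- characteristic subgroups of `T` are trivial or equal to `T`
  have hcard : ∀ K : Subgroup T, Nat.card K ≠ 1 → (K.map (T : Subgroup A).subtype).Normal →
      K = ⊤ := by
    intro K hK hKn
    have h1 := h.card_normal_three hA (K.map (T : Subgroup A).subtype)
      ((T.2.to_subgroup K).map _)
    rw [Subgroup.card_map_of_injective (T : Subgroup A).subtype_injective] at h1
    rw [← Subgroup.card_eq_iff_eq_top]
    omega
  have hnt : Nontrivial T := Finite.one_lt_card_iff_nontrivial.1 (by
    omega)
  have hcomm : ∀ a b : T, a * b = b * a := by
    have h1 := hcard (Subgroup.center T) (by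
      have := T.2.center_nontrivial
      exact (Finite.one_lt_card).ne') inferInstance
    intro a b
    exact (Subgroup.mem_center_iff.1 (h1 ▸ Subgroup.mem_top b : b ∈ Subgroup.center T) a)
  have hexp : ∀ a : T, a ^ 3 = 1 := by
    let K : Subgroup T :=
      { carrier := {a | a ^ 3 = 1}
        one_mem' := one_pow 3
        mul_mem' := fun {a b} ha hb => by
          change (a * b) ^ 3 = 1
          rw [(show Commute a b from hcomm a b).mul_pow, ha, hb, one_mul]
        inv_mem' := fun {a} ha => by
          change a⁻¹ ^ 3 = 1
          rw [inv_pow, ha, inv_one] }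
    have h1 : K = ⊤ := by
      refine hcard K ?_ ⟨?_⟩
      · obtain ⟨a, ha⟩ := exists_prime_orderOf_dvd_card' (G := T) 3
          (by rw [hTc]; norm_num)
        intro h1
        rw [Subgroup.card_eq_one] at h1
        have h2 : a ∈ K := orderOf_dvd_iff_pow_eq_one.1 ha.dvd
        rw [h1, Subgroup.mem_bot] at h2
        rw [h2, orderOf_one] at ha
        omega
      · rintro _ ⟨a, ha, rfl⟩ g
        refine ⟨⟨g * a * g⁻¹, hTn.conj_mem a a.2 g⟩, ?_, rfl⟩
        have h2 : (a : A) ^ 3 = 1 := congrArg Subtype.val (ha : a ^ 3 = 1)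
        refine Subtype.ext ?_
        change (g * a * g⁻¹) ^ 3 = 1
        rw [conj_pow, h2, mul_one, mul_inv_cancel]
    intro a
    exact (h1 ▸ Subgroup.mem_top a : a ∈ K)
  obtain ⟨f⟩ := iso_pi_cyc (p := 3) (n := 3) hcomm hexp hTc
  have hPc := h.card_sylow (Or.inr ⟨rfl, rfl⟩) hd P
  obtain ⟨g⟩ := iso_cyc_of_prime (p := 13) hPc
  have hc : (T : Subgroup A).IsComplement' P := Subgroup.isComplement'_of_coprime
    (by
      rw [hTc, hPc, hA]) (by
      rw [hTc, hPc]; norm_num)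
  obtain ⟨φ, hi, hφ⟩ := exists_iso_semidirect hc f g
  refine ⟨φ, ?_, hi⟩
  rintro rfl
  obtain ⟨x, hx⟩ := exists_prime_orderOf_dvd_card' (G := P) 13 hPc.symm.dvd
  -- a trivial action would give commuting elements of orders 13 and 3
  obtain ⟨y, hy⟩ := exists_prime_orderOf_dvd_card' (G := T) 3
          (by rw [hTc]; norm_num)
  have h1 := (hφ x).1 rfl y y.2
  refine h.not_coprime_of_commute (x := (x : A)) (y := (y : A)) ?_ ?_ h1 ?_
  · rw [Ne, ← orderOf_eq_one_iff, Subgroup.orderOf_coe, hx]; norm_num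
  · rw [Ne, ← orderOf_eq_one_iff, Subgroup.orderOf_coe, hy]; norm_num
  · rw [Subgroup.orderOf_coe, Subgroup.orderOf_coe, hx, hy]; norm_num

theorem Good.normal_sylow_of_card_sylow [Fact (Nat.Prime 13)] (h : Good A X)
    (hn : Nat.card (Sylow 13 A) = 1) (P : Sylow 13 A) : (P : Subgroup A).Normal := by
  have := h.finite
  have : Subsingleton (Sylow 13 A) := (Nat.card_eq_one_iff_unique.1 hn).1
  exact P.normal_of_subsingleton

theorem Good.faithful_semidirect_thirteen (h : Good A X) (hA : Nat.card A = 52) :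
    IsFaithfulSemidirect A (Cyc 13) (Cyc 4) := by
  have := h.finite
  have : Fact (Nat.Prime 13) := ⟨by norm_num⟩
  have : Fact (Nat.Prime 2) := ⟨by norm_num⟩
  have hd : 13 ∣ Nat.card A := by rw [hA]; norm_num
  have hn : Nat.card (Sylow 13 A) = 1 := by
    by_contra hn
    have := (h.card_eq_of_thirteen_dvd hd hn).1
    omega
  obtain ⟨P⟩ : Nonempty (Sylow 13 A) := inferInstance
  obtain ⟨Q⟩ : Nonempty (Sylow 2 A) := inferInstance
  have hPn := h.normal_sylow_of_card_sylow hn P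
  have hPc := h.card_sylow (Or.inr ⟨rfl, rfl⟩) hd P
  have hQc : Nat.card Q = 4 :=
    card_sylow_eq (k := 2) (m := 13) (by rw [hA]; norm_num) (by norm_num) Q
  have hcyc : IsCyclic Q := h.isCyclic_of_le_normalizer (Or.inr ⟨rfl, rfl⟩) hd P Q.2
    (by
      change (Q : Subgroup A) ≤ Subgroup.normalizer ((P : Subgroup A) : Set A)
      rw [Subgroup.normalizer_eq_top]; exact le_top)
  obtain ⟨q, hq⟩ := hcyc.exists_ofOrder_eq_natCard
  obtain ⟨g⟩ := iso_cyc (hq.trans hQc) hQc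
  obtain ⟨f⟩ := iso_cyc_of_prime (p := 13) hPc
  have hc : (P : Subgroup A).IsComplement' Q := Subgroup.isComplement'_of_coprime
    (by
      rw [hQc, hPc, hA]) (by
      rw [hQc, hPc]; norm_num)
  obtain ⟨φ, hi, hφ⟩ := exists_iso_semidirect hc f g
  refine ⟨φ, ?_, hi⟩
  rw [injective_iff_map_eq_one]
  intro a ha
  obtain ⟨k, rfl⟩ := g.surjective a
  have h1 := (hφ k).1 ha
  have h2 : (k : A) ∈ Subgroup.centralizer (P : Set A) := by
    rw [Subgroup.mem_centralizer_iff]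
    intro n hn
    exact (h1 n hn).symm
  rw [h.centralizer_sylow (Or.inr ⟨rfl, rfl⟩) hd P] at h2
  -- an element of `Q` that acts trivially on `P` lies in the centralizer of `P`, which is `P`
  have h3 : k = 1 := Subtype.ext (Subgroup.disjoint_def.1 hc.disjoint h2 k.2)
  rw [h3, map_one]

/-- A group of order `2 * p`, for `p = 11` or `13`, is dihedral: a cyclic group of
order `2 * p` is excluded. -/
theorem Good.iso_dihedral_of_card_eq (h : Good A X) {p : ℕ} [hp : Fact p.Prime] (hodd : Odd p)
    (hA : Nat.card A = 2 * p) : Iso A (DihedralGroup p) := by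
  have := h.finite
  have : Fact (Nat.Prime 2) := ⟨by norm_num⟩
  obtain ⟨x, hx⟩ := exists_prime_orderOf_dvd_card' (G := A) p (by rw [hA]; exact dvd_mul_left _ _)
  obtain ⟨t, ht⟩ := exists_prime_orderOf_dvd_card' (G := A) 2 (by rw [hA]; exact dvd_mul_right _ _)
  have hZ : Nat.card (Subgroup.zpowers x) = p ^ 1 := by rw [Nat.card_zpowers, hx, pow_one]
  have hindex : (Subgroup.zpowers x).index = 2 := by
    have h1 := Subgroup.card_mul_index (Subgroup.zpowers x)
    rw [hA, hZ, pow_one, mul_comm 2 p] at h1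
    exact Nat.eq_of_mul_eq_mul_left hp.out.pos h1
  have hN := Subgroup.normal_of_index_eq_two hindex
  have h1 := h.conj_eq_inv hodd (IsPGroup.of_card hZ) ht (fun y hy => hN.conj_mem y hy t) x
    (Subgroup.mem_zpowers x)
  refine iso_dihedral hx (by rw [← pow_two, ← ht, pow_orderOf_eq_one]) h1 ?_ hA
  intro hmem
  have h2 := Subgroup.orderOf_dvd_natCard _ hmem
  rw [hZ, ht, pow_one] at h2
  exact (Nat.not_even_iff_odd.2 hodd) (even_iff_two_dvd.2 h2)

end

/-! ### Groups of order 8, 9 and 27 -/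

section
variable {A X : Type*} [Group A] [MulAction A X]

theorem Good.orderOf_mem (h : Good A X) (a : A) : orderOf a = 1 ∨ orderOf a = 2 ∨ orderOf a = 3 ∨
    orderOf a = 4 ∨ orderOf a = 9 ∨ orderOf a = 11 ∨ orderOf a = 13 := by
  have := h.card_fixedBy a
  omega

theorem mul_comm_of_mul_self {G : Type*} [Group G] (h : ∀ a : G, a * a = 1) (a b : G) :
    a * b = b * a := by
  have hi : ∀ c : G, c⁻¹ = c := fun c => inv_eq_of_mul_eq_one_left (h c)
  rw [← hi (a * b), mul_inv_rev, hi, hi]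

theorem conj_eq_or_of_index_two {G : Type*} [Group G] {x : G} (hx : orderOf x = 4)
    (hN : (Subgroup.zpowers x).index = 2) (y : G) : y * x * y⁻¹ = x ∨ y * x * y⁻¹ = x⁻¹ := by
  have hn := Subgroup.normal_of_index_eq_two hN
  have h1 : y * x * y⁻¹ ∈ Subgroup.zpowers x := hn.conj_mem x (Subgroup.mem_zpowers x) y
  have hfin : IsOfFinOrder x := orderOf_pos_iff.1 (by omega)
  have hx4 : x ^ 4 = 1 := hx ▸ pow_orderOf_eq_one x
  obtain ⟨k, hk⟩ := (hfin.mem_powers_iff_mem_zpowers).2 h1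
  have hk' : x ^ k = y * x * y⁻¹ := hk
  have ho : orderOf (x ^ k) = 4 := by
    rw [hk', ← MulAut.conj_apply, MulEquiv.orderOf_eq, hx]
  have h2 : x ^ k = x ^ (k % 4) := by rw [← hx, pow_mod_orderOf]
  have h3 : k % 4 < 4 := Nat.mod_lt _ (by norm_num)
  rw [← hk']
  rw [h2] at ho ⊢
  generalize k % 4 = j at ho h3
  interval_cases j
  · simp at ho
  · left; rw [pow_one]
  · exfalso
    have h5 : orderOf (x ^ 2) ∣ 2 := orderOf_dvd_of_pow_eq_one (by rw [← pow_mul]; exact hx4)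
    rw [ho] at h5
    norm_num at h5
  · right; exact eq_inv_of_mul_eq_one_left (by rw [← pow_succ, hx4])

/-- For an element `x` of order 4 and `y ∉ ⟨x⟩`, property (b) excludes that `y` centralizes `x`, so
`y` inverts `x`; the two possible values of `y ^ 2` give the dihedral and the quaternion group. -/
theorem Good.iso_of_card_eight (h : Good A X) (hA : Nat.card A = 8) :
    Iso A (Fin 3 → Cyc 2) ∨ Iso A (DihedralGroup 4) ∨ Iso A (QuaternionGroup 2) := by
  have := h.finite
  have : Fact (Nat.Prime 2) := ⟨Nat.prime_two⟩
  have hord : ∀ a : A, orderOf a = 1 ∨ orderOf a = 2 ∨ orderOf a = 4 := by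
    intro a
    have h1 := h.orderOf_mem a
    have h2 : orderOf a ∣ 8 := hA ▸ orderOf_dvd_natCard a
    have h3 := Nat.le_of_dvd (by norm_num) h2
    rcases h1 with h1 | h1 | h1 | h1 | h1 | h1 | h1 <;> rw [h1] at h2 h3 ⊢ <;> omega
  by_cases hex : ∃ x : A, orderOf x = 4
  swap
  · left
    have hsq : ∀ a : A, a ^ 2 = 1 := fun a => orderOf_dvd_iff_pow_eq_one.1 (by
      rcases hord a with h1 | h1 | h1
      · rw [h1]; norm_num
      · rw [h1]
      · exact absurd ⟨a, h1⟩ hex)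
    exact iso_pi_cyc (mul_comm_of_mul_self fun a => by rw [← pow_two, hsq]) hsq hA
  right
  obtain ⟨x, hx⟩ := hex
  have hx4 : x ^ 4 = 1 := hx ▸ pow_orderOf_eq_one x
  have hc : Nat.card (Subgroup.zpowers x) = 4 := by rw [Nat.card_zpowers, hx]
  have hN : (Subgroup.zpowers x).index = 2 := by
    have h1 := Subgroup.card_mul_index (Subgroup.zpowers x)
    rw [hc, hA] at h1
    omega
  obtain ⟨y, hy⟩ : ∃ y, y ∉ Subgroup.zpowers x := by
    by_contra hall
    push Not at hall
    have : Subgroup.zpowers x = ⊤ := (Subgroup.eq_top_iff' _).2 hall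
    rw [this, Subgroup.index_top] at hN
    omega
  have hyy : y * y ∈ Subgroup.zpowers x := by
    rw [Subgroup.mul_mem_iff_of_index_two hN]
  obtain ⟨k, hk⟩ := ((orderOf_pos_iff.1 (by omega)).mem_powers_iff_mem_zpowers (x := x)).2 hyy
  -- the square of `y` is a power of `x` and satisfies `(y ^ 2) ^ 2 = 1`
  have hy2 : y * y = 1 ∨ y * y = x ^ 2 := by
    have h4 : (y * y) ^ 2 = 1 := by
      rw [← pow_two, ← pow_mul]
      refine orderOf_dvd_iff_pow_eq_one.1 ?_
      rcases hord y with h1 | h1 | h1 <;> rw [h1] <;> norm_num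
    have h5 : x ^ k = y * y := hk
    rw [← h5, ← pow_mul, ← orderOf_dvd_iff_pow_eq_one, hx] at h4
    rw [← h5, ← pow_mod_orderOf, hx]
    have : k % 4 = 0 ∨ k % 4 = 2 := by omega
    rcases this with h6 | h6 <;> rw [h6]
    · left; rw [pow_zero]
    · right; rfl
  -- an involution that commutes with `x` is a power of `x`
  have hnc : ∀ w : A, w ∉ Subgroup.zpowers x → Commute x w → w * w ≠ 1 := by
    intro w hw hxw h1
    refine hw (h.mem_zpowers_of_four x w hx (orderOf_eq_prime (by rw [pow_two, h1]) ?_) hxw)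
    rintro rfl
    exact hw (one_mem _)
  rcases conj_eq_or_of_index_two hx hN y with hxy | hxy
  · exfalso
    have hcom : Commute x y := (mul_inv_eq_iff_eq_mul.1 hxy).symm
    rcases hy2 with h1 | h1
    · exact hnc y hy hcom h1
    · refine hnc (y * x⁻¹) (fun h2 => hy ?_)
          (hcom.mul_right (Commute.inv_right (Commute.refl x))) ?_
      · simpa using mul_mem h2 (Subgroup.mem_zpowers x)
      · rw [← pow_two, hcom.symm.inv_right.mul_pow, pow_two, h1, inv_pow, mul_inv_cancel]
  · rcases hy2 with h1 | h1
    · exact Or.inl (iso_dihedral hx h1 hxy hy hA)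
    · exact Or.inr (iso_quaternion hx hxy h1 hy hA)

theorem Good.iso_of_card_nine (h : Good A X) (hA : Nat.card A = 9) :
    Iso A (Cyc 9) ∨ Iso A (Fin 2 → Cyc 3) := by
  have := h.finite
  have : Fact (Nat.Prime 3) := ⟨Nat.prime_three⟩
  by_cases hex : ∃ x : A, orderOf x = 9
  · obtain ⟨x, hx⟩ := hex
    exact Or.inl (iso_cyc hx hA)
  · right
    refine iso_pi_cyc (p := 3) (n := 2) ?_ ?_ hA
    · exact fun a b => (IsPGroup.isMulCommutative_of_card_eq_prime_sq (p := 3) hA).1.1 a b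
    · intro a
      refine orderOf_dvd_iff_pow_eq_one.1 ?_
      have h2 : orderOf a ∣ 9 := hA ▸ orderOf_dvd_natCard a
      have h3 := h.orderOf_mem a
      have h4 : orderOf a ≠ 9 := fun h5 => hex ⟨a, h5⟩
      rcases h3 with h1 | h1 | h1 | h1 | h1 | h1 | h1 <;> rw [h1] at h2 h4 ⊢ <;> omega

theorem mul_comm_of_quotient_center {G : Type*} [Group G] [IsCyclic (G ⧸ Subgroup.center G)]
    (a b : G) : a * b = b * a :=
  (isMulCommutative_of_isCyclic_quotient_center_self G).1.1 a b

theorem iso_prod_of_iso_pi {G : Type*} [Group G] {n : ℕ} (h : Iso G (Fin 2 → Cyc n)) :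
    Iso G (Cyc n × Cyc n) :=
  h.trans ⟨{ finTwoArrowEquiv (Cyc n) with map_mul' := fun _ _ => rfl }⟩

theorem isExtraspecial27_of_not_comm {G : Type*} [Group G] (hG : Nat.card G = 27) {a b : G}
    (hab : a * b ≠ b * a) : IsExtraspecial27 G := by
  have : Fact (Nat.Prime 3) := ⟨Nat.prime_three⟩
  have : Finite G := Nat.finite_of_card_ne_zero (by omega)
  have hp : IsPGroup 3 G := IsPGroup.of_card (n := 3) hG
  have hnt : Nontrivial G := Finite.one_lt_card_iff_nontrivial.1 (by omega)
  have hcyc : ¬ IsCyclic (G ⧸ Subgroup.center G) := fun _ => hab (mul_comm_of_quotient_center a b)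
  have hZ : Nat.card (Subgroup.center G) = 3 := by
    obtain ⟨k, hk, hc⟩ := (Nat.dvd_prime_pow Nat.prime_three).1
      (hG ▸ Subgroup.card_subgroup_dvd_card (Subgroup.center G) : _ ∣ 3 ^ 3)
    have h1 := Subgroup.card_mul_index (Subgroup.center G)
    rw [hG, hc] at h1
    have h2 := Finite.one_lt_card_iff_nontrivial.2 hp.center_nontrivial
    rw [hc] at h2 ⊢
    interval_cases k
    · omega
    · rfl
    · refine absurd (isCyclic_of_prime_card (p := 3) ?_) hcyc
      rw [← Subgroup.index_eq_card]; omega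
    · refine absurd (@isCyclic_of_subsingleton _ _ ?_) hcyc
      rw [← Finite.card_le_one_iff_subsingleton, ← Subgroup.index_eq_card]; omega
  have hQ : Nat.card (G ⧸ Subgroup.center G) = 9 := by
    have h1 := Subgroup.card_mul_index (Subgroup.center G)
    rw [Subgroup.index_eq_card, hZ, hG] at h1
    omega
  refine ⟨iso_cyc_of_prime hZ, iso_prod_of_iso_pi (iso_pi_cyc (p := 3) (n := 2) ?_ ?_ hQ)⟩
  · exact fun a b => (IsPGroup.isMulCommutative_of_card_eq_prime_sq (p := 3) hQ).1.1 a b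
  · intro q
    refine orderOf_dvd_iff_pow_eq_one.1 ?_
    obtain ⟨k, hk, hc⟩ := (Nat.dvd_prime_pow Nat.prime_three).1
      (hQ ▸ orderOf_dvd_natCard q : _ ∣ 3 ^ 2)
    interval_cases k
    · rw [hc]; norm_num
    · rw [hc]; norm_num
    · exact absurd (isCyclic_of_orderOf_eq_card q (hc.trans hQ.symm)) hcyc

/-- In the commutative case an element `x` of order 9 is excluded by (b): a suitable product `y x ^
(-j)` has order 3 and does not lie in `⟨x⟩`. -/
theorem Good.iso_of_card_twenty_seven (h : Good A X) (hA : Nat.card A = 27) :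
    Iso A (Fin 3 → Cyc 3) ∨ IsHeisenberg3 A ∨ IsExtraspecialMinus3 A := by
  have := h.finite
  have : Fact (Nat.Prime 3) := ⟨Nat.prime_three⟩
  have hord : ∀ a : A, orderOf a = 9 ∨ a ^ 3 = 1 := by
    intro a
    rw [← orderOf_dvd_iff_pow_eq_one]
    have h2 : orderOf a ∣ 27 := hA ▸ orderOf_dvd_natCard a
    have h3 := h.orderOf_mem a
    rcases h3 with h1 | h1 | h1 | h1 | h1 | h1 | h1 <;> rw [h1] at h2 ⊢ <;> omega
  by_cases hcomm : ∀ a b : A, a * b = b * a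
  · left
    refine iso_pi_cyc (p := 3) (n := 3) hcomm (fun x => (hord x).resolve_left fun hx => ?_) hA
    obtain ⟨y, hy⟩ : ∃ y, y ∉ Subgroup.zpowers x := by
      by_contra hall
      push Not at hall
      have h1 : Subgroup.zpowers x = ⊤ := (Subgroup.eq_top_iff' _).2 hall
      have h2 : Nat.card (Subgroup.zpowers x) = 9 := by rw [Nat.card_zpowers, hx]
      rw [h1, Subgroup.card_top] at h2
      omega
    have hno : ∀ w ∉ Subgroup.zpowers x, w ^ 3 ≠ 1 := fun w hw hw3 =>
      hw (h.mem_zpowers_of_nine x w hx (orderOf_eq_prime hw3 (by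
        rintro rfl; exact hw (one_mem _))) (hcomm x w))
    have hcom' : Commute y x := hcomm y x
    have hy9 : orderOf y = 9 := (hord y).resolve_right (hno y hy)
    -- the cube of `y` lies in `⟨x⟩`, hence is a cube there
    obtain ⟨k, hk⟩ := ((orderOf_pos_iff.1 (by omega)).mem_powers_iff_mem_zpowers (x := x)).2
      (h.mem_zpowers_of_nine x (y ^ 3) hx (by rw [orderOf_pow, hy9]; norm_num) (hcomm _ _))
    have hk' : x ^ k = y ^ 3 := hk
    have h9 : x ^ (k * 3) = 1 := by
      rw [pow_mul, hk', ← pow_mul]; exact orderOf_dvd_iff_pow_eq_one.1 (by rw [hy9])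
    rw [← orderOf_dvd_iff_pow_eq_one, hx] at h9
    obtain ⟨j, rfl⟩ : 3 ∣ k := by omega
    refine hno (y * (x ^ j)⁻¹) (fun h2 => hy ?_) ?_
    · simpa using mul_mem h2 (pow_mem (Subgroup.mem_zpowers x) j)
    · rw [((hcom'.pow_right j).inv_right).mul_pow, ← hk', inv_pow, ← pow_mul, mul_comm 3 j,
        mul_inv_cancel]
  · right
    push Not at hcomm
    obtain ⟨a, b, hab⟩ := hcomm
    have hE := isExtraspecial27_of_not_comm hA hab
    by_cases hex : ∃ x : A, orderOf x = 9
    · exact Or.inr ⟨hE, hex⟩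
    · refine Or.inl ⟨hE, Nat.dvd_antisymm ?_ ?_⟩
      · exact Monoid.exponent_dvd_of_forall_pow_eq_one fun a =>
          (hord a).resolve_left fun h1 => hex ⟨a, h1⟩
      · obtain ⟨t, ht⟩ := exists_prime_orderOf_dvd_card' (G := A) 3 (by rw [hA]; norm_num)
        rw [← ht]
        exact Monoid.order_dvd_exponent t

end

/-! ### Groups of order divisible by 6 -/

section
variable {A X : Type*} [Group A] [MulAction A X]

theorem Good.two_three_not_commute (h : Good A X) {z t : A} (hz : orderOf z = 2) {k : ℕ}
    (ht : t ^ 3 ^ k = 1) (hzt : Commute z t) : t = 1 := by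
  by_contra ht1
  refine h.not_coprime_of_commute (x := z) (y := t) ?_ ht1 hzt ?_
  · rintro rfl; rw [orderOf_one] at hz; omega
  · rw [hz]
    exact Nat.Coprime.coprime_dvd_right (orderOf_dvd_of_pow_eq_one ht)
      (Nat.Coprime.pow_right _ (by norm_num))

/-- The involutions invert the core `D` of a Sylow 3-subgroup `P`, so the product of two involutions
centralizes `D`, and for `D ≠ 1` it lies in `D`. As `P` acts freely on the involutions by
conjugation, `|P| ≤ |D|`. -/
theorem Good.normal_sylow_three (h : Good A X) [Fact (Nat.Prime 3)] (h2 : 2 ∣ Nat.card A)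
    (P : Sylow 3 A) (hD : (P : Subgroup A).normalCore ≠ ⊥) : (P : Subgroup A).Normal := by
  have := h.finite
  have : Fact (Nat.Prime 2) := ⟨Nat.prime_two⟩
  obtain ⟨z, hz⟩ := exists_prime_orderOf_dvd_card' 2 h2
  have hDP : IsPGroup 3 (P : Subgroup A).normalCore := P.2.to_le (Subgroup.normalCore_le _)
  set D := (P : Subgroup A).normalCore with hDdef
  have hDn : D.Normal := Subgroup.normalCore_normal _
  have hinv : ∀ w : A, orderOf w = 2 → ∀ t ∈ D, w * t * w⁻¹ = t⁻¹ := fun w hw =>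
    h.conj_eq_inv (by decide) hDP hw fun t ht => hDn.conj_mem t ht w
  -- the centralizer of `D` is a normal 3-subgroup, hence contained in `D`
  have hCD : Subgroup.centralizer (D : Set A) ≤ D := by
    obtain ⟨d, hd⟩ := exists_prime_orderOf_dvd_card' (G := D) 3 (by
      obtain ⟨k, hk⟩ := IsPGroup.iff_card.1 hDP
      rw [hk]
      refine dvd_pow_self 3 ?_
      rintro rfl
      exact hD (Subgroup.card_eq_one.1 hk))
    have hC3 := h.isPGroup_centralizer (S := (D : Set A)) (x := (d : A))
      (by rw [Subgroup.orderOf_coe, hd]) d.2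
    have hCn : (Subgroup.centralizer (D : Set A)).Normal := inferInstance
    exact Subgroup.normal_le_normalCore.2 (hC3.le_sylow_of_normal P)
  -- a product of two involutions centralizes `D`, as both invert `D`
  have hmem : ∀ t : P, ((t : A) * z * (t : A)⁻¹) * z⁻¹ ∈ D := by
    intro t
    refine hCD ?_
    rw [Subgroup.mem_centralizer_iff]
    intro d hd
    have hw : orderOf ((t : A) * z * (t : A)⁻¹) = 2 := by
      rw [← MulAut.conj_apply, MulEquiv.orderOf_eq, hz]
    have h4 := hinv _ hw _ (inv_mem hd)
    have h5 := hinv _ hz d hd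
    have h6 : z⁻¹ * d * z = d⁻¹ := by
      rw [mul_inv_eq_iff_eq_mul] at h5
      rw [mul_assoc, inv_mul_eq_iff_eq_mul]
      have := hinv _ hz _ (inv_mem hd)
      rw [inv_inv, mul_inv_eq_iff_eq_mul] at this
      exact this.symm
    generalize (t : A) * z * (t : A)⁻¹ = w at h4 ⊢
    rw [inv_inv, mul_inv_eq_iff_eq_mul] at h4
    have h7 : d * w = w * d⁻¹ := h4.symm
    rw [← mul_assoc, h7, ← h6]
    group
  -- if `s` and `t` conjugate `z` to the same involution, then `t⁻¹ s` has order a power of 3 and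
  -- commutes with `z`, so it is trivial
  have hinj : Function.Injective fun t : P => (⟨_, hmem t⟩ : D) := by
    intro s t hst
    have h3 : (s : A) * z * (s : A)⁻¹ * z⁻¹ = (t : A) * z * (t : A)⁻¹ * z⁻¹ :=
      congrArg Subtype.val hst
    have h4 : Commute z ((t : A)⁻¹ * s) := by
      have h5 := mul_right_cancel h3
      change z * ((t : A)⁻¹ * s) = (t : A)⁻¹ * s * z
      rw [mul_inv_eq_iff_eq_mul] at h5
      rw [mul_assoc (t : A)⁻¹, h5]
      group
    obtain ⟨k, hk⟩ := P.2 (t⁻¹ * s)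
    have h6 := h.two_three_not_commute hz (congrArg Subtype.val hk) h4
    exact Subtype.ext (inv_mul_eq_one.1 h6).symm
  have h8 : D = P := Subgroup.eq_of_le_of_card_ge (Subgroup.normalCore_le _)
    (Nat.card_le_card_of_injective _ hinj)
  rw [← h8]
  exact hDn

theorem Good.eq_of_orderOf_two (h : Good A X) {P : Subgroup A} [P.Normal] (hP : IsPGroup 3 P)
    (hP1 : P ≠ ⊥) {Q : Subgroup A} (hQ : IsPGroup 2 Q) {w z : A} (hwQ : w ∈ Q) (hzQ : z ∈ Q)
    (hw : orderOf w = 2) (hz : orderOf z = 2) : w = z := by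
  have hPn : P.Normal := inferInstance
  have hinv : ∀ w : A, orderOf w = 2 → ∀ t ∈ P, w * t * w⁻¹ = t⁻¹ := fun w hw =>
    h.conj_eq_inv (by decide) hP hw fun t ht => hPn.conj_mem t ht w
  obtain ⟨⟨t, ht⟩, htne⟩ := Subgroup.ne_bot_iff_exists_ne_one.1 hP1
  have ht1 : t ≠ 1 := fun h1 => htne (Subtype.ext h1)
  have h1 := hinv w hw _ ht
  have h2 := hinv z hz _ ht
  by_contra hne
  refine h.not_coprime_of_commute (x := z⁻¹ * w) (y := t) ?_ ht1 ?_ ?_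
  · exact fun h3 => hne (inv_mul_eq_one.1 h3).symm
  · rw [← h2, mul_inv_eq_iff_eq_mul] at h1
    change z⁻¹ * w * t = t * (z⁻¹ * w)
    rw [mul_assoc, h1]
    group
  · have h3 : z⁻¹ * w ∈ Q := mul_mem (inv_mem hzQ) hwQ
    obtain ⟨k, hk⟩ := hQ ⟨_, h3⟩
    obtain ⟨l, hl⟩ := hP ⟨t, ht⟩
    have hk' : (z⁻¹ * w) ^ 2 ^ k = 1 := congrArg Subtype.val hk
    have hl' : t ^ 3 ^ l = 1 := congrArg Subtype.val hl
    exact Nat.Coprime.of_dvd (orderOf_dvd_of_pow_eq_one hk') (orderOf_dvd_of_pow_eq_one hl')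
      (Nat.Coprime.pow _ _ (by norm_num))

end

theorem Good.fixedBy_eq_of_four {A X : Type*} [Group A] [MulAction A X] (h : Good A X) {c : A}
    (hc : orderOf c = 4) : fixedBy X c = fixedBy X (c ^ 2) := by
  have := h.finite
  have := h.finite_set
  refine Set.eq_of_subset_of_ncard_le (fun x hx => ?_) ?_ (Set.toFinite _)
  · rw [mem_fixedBy] at hx ⊢
    rw [pow_two, mul_smul, hx, hx]
  · change Nat.card _ ≤ Nat.card _
    rw [h.card_fixedBy_of_two_dvd (a := c) (by rw [hc]; norm_num),
      h.card_fixedBy_of_two_dvd (by rw [orderOf_pow, hc]; norm_num)]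

/-- In an action of the symmetric group of degree 4 on 27 points, the Klein group fixes a point;
each 4-cycle fixes the same points as its square, hence this point, and the
product of two 4-cycles can have order 3. -/
theorem not_good_perm_four {X : Type*} [MulAction (Equiv.Perm (Fin 4)) X] :
    ¬ Good (Equiv.Perm (Fin 4)) X := by
  intro h
  have := h.finite_set
  have : Fact (Nat.Prime 2) := ⟨Nat.prime_two⟩
  let r : Equiv.Perm (Fin 4) := c[0, 1, 2, 3]
  let s : Equiv.Perm (Fin 4) := c[0, 2, 1, 3]
  let V : Subgroup (Equiv.Perm (Fin 4)) :=
    { carrier := {a | a ∈ ({1, r ^ 2, s ^ 2, r ^ 2 * s ^ 2} : Finset _)}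
      one_mem' := by decide
      mul_mem' := by
        have : ∀ a b : Equiv.Perm (Fin 4), a ∈ ({1, r ^ 2, s ^ 2, r ^ 2 * s ^ 2} : Finset _) →
          b ∈ ({1, r ^ 2, s ^ 2, r ^ 2 * s ^ 2} : Finset _) →
          a * b ∈ ({1, r ^ 2, s ^ 2, r ^ 2 * s ^ 2} : Finset _) := by decide +kernel
        exact fun {a b} => this a b
      inv_mem' := by
        have : ∀ a : Equiv.Perm (Fin 4), a ∈ ({1, r ^ 2, s ^ 2, r ^ 2 * s ^ 2} : Finset _) →
          a⁻¹ ∈ ({1, r ^ 2, s ^ 2, r ^ 2 * s ^ 2} : Finset _) := by decide +kernel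
        exact fun {a} => this a }
  have hV2 : ∀ a ∈ V, a ^ 2 = 1 := by
    have : ∀ a : Equiv.Perm (Fin 4), a ∈ ({1, r ^ 2, s ^ 2, r ^ 2 * s ^ 2} : Finset _) →
      a ^ 2 = 1 := by decide +kernel
    exact this
  have hVp : IsPGroup 2 V := fun a => ⟨1, Subtype.ext (hV2 a a.2)⟩
  obtain ⟨v, hv⟩ := hVp.nonempty_fixed_point_of_prime_not_dvd_card X (by rw [h.natCard]; norm_num)
  have key : ∀ c : Equiv.Perm (Fin 4), orderOf c = 4 → c ^ 2 • v = v → c • v = v := by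
    intro c hc hcv
    change v ∈ fixedBy X c
    rw [h.fixedBy_eq_of_four hc]
    exact hcv
  have hr : r • v = v := key r (orderOf_eq_prime_pow (p := 2) (n := 1) (by decide) (by decide))
    (hv ⟨r ^ 2, by change r ^ 2 ∈ ({1, r ^ 2, s ^ 2, r ^ 2 * s ^ 2} : Finset _); decide⟩)
  have hs : s • v = v := key s (orderOf_eq_prime_pow (p := 2) (n := 1) (by decide) (by decide))
    (hv ⟨s ^ 2, by change s ^ 2 ∈ ({1, r ^ 2, s ^ 2, r ^ 2 * s ^ 2} : Finset _); decide⟩)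
  refine h.smul_ne_of_three_dvd (a := r * s) ?_ v (by rw [mul_smul, hs, hr])
  rw [orderOf_eq_prime (p := 3) (by decide) (by decide)]

section
variable {A X : Type*} [Group A] [MulAction A X]

/-- The core of a Sylow 3-subgroup is trivial, so there are four Sylow 3-subgroups and the group
acts faithfully on them. Its image in the symmetric group of degree 4 has order divisible by 12, and
the whole symmetric group is excluded. -/
theorem Good.iso_alternating (h : Good A X) (h2 : 2 ∣ Nat.card A) (h3 : 3 ∣ Nat.card A)
    (hd : Nat.card A ∣ 8 * 27) (hn : ∀ [Fact (Nat.Prime 3)] (P : Sylow 3 A),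
      ¬ (P : Subgroup A).Normal) : Iso A (alternatingGroup (Fin 4)) := by
  have := h.finite
  have : Fact (Nat.Prime 2) := ⟨Nat.prime_two⟩
  have : Fact (Nat.Prime 3) := ⟨Nat.prime_three⟩
  obtain ⟨P⟩ : Nonempty (Sylow 3 A) := inferInstance
  have hD : (P : Subgroup A).normalCore = ⊥ := by
    by_contra hD
    exact hn P (h.normal_sylow_three h2 P hD)
  obtain ⟨z, hz⟩ := exists_prime_orderOf_dvd_card' 2 h2
  have hP3 : 3 ∣ Nat.card P := P.dvd_card_of_dvd_card h3
  have hn3 : Nat.card (Sylow 3 A) = 4 := by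
    have h4 := card_sylow_modEq_one 3 A
    have h5 : Nat.card (Sylow 3 A) ∣ 8 := by
      have h6 : Nat.card (Sylow 3 A) ∣ 27 * 8 := by
        rw [mul_comm, P.card_eq_index_normalizer]; exact (Subgroup.index_dvd_card _).trans hd
      refine Nat.Coprime.dvd_of_dvd_mul_left ?_ h6
      have h7 : (3).Coprime (Nat.card (Sylow 3 A)) :=
        (Nat.prime_three.coprime_iff_not_dvd).2 (not_dvd_card_sylow 3 A)
      exact (Nat.Coprime.pow_left 3 h7).symm
    have h6 : Nat.card (Sylow 3 A) ≠ 1 := fun h6 => by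
      have : Subsingleton (Sylow 3 A) := (Nat.card_eq_one_iff_unique.1 h6).1
      exact hn P P.normal_of_subsingleton
    have h7 := Nat.le_of_dvd (by norm_num) h5
    unfold Nat.ModEq at h4
    interval_cases (Nat.card (Sylow 3 A)) <;> omega
  -- the kernel of the action on the set of Sylow 3-subgroups is trivial
  have hker : ∀ a : A, (∀ R : Sylow 3 A, a • R = R) → a = 1 := by
    -- a 3-element of the kernel lies in every Sylow 3-subgroup
    have hmem : ∀ a : A, (∀ R : Sylow 3 A, a • R = R) → ∀ k, a ^ 3 ^ k = 1 → a = 1 := by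
      intro a ha k hk
      have h4 : ∀ R : Sylow 3 A, a ∈ (R : Subgroup A) := by
        intro R
        have h5 := Sylow.smul_eq_iff_mem_normalizer.1 (ha R)
        have h6 : IsPGroup 3 (Subgroup.zpowers a) := by
          rw [IsPGroup.iff_card]
          obtain ⟨j, -, hj⟩ := (Nat.dvd_prime_pow Nat.prime_three).1 (orderOf_dvd_of_pow_eq_one hk)
          exact ⟨j, by rw [Nat.card_zpowers, hj]⟩
        exact Subgroup.zpowers_le.1
          ((le_inf le_rfl (Subgroup.zpowers_le.2 h5)).trans (h6.inf_normalizer_sylow R).le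
            |>.trans inf_le_right)
      have h5 : a ∈ (P : Subgroup A).normalCore := by
        intro g
        have h6 := h4 (g⁻¹ • P)
        rw [Sylow.coe_subgroup_smul, Subgroup.mem_pointwise_smul_iff_inv_smul_mem] at h6
        simpa [MulAut.smul_def] using h6
      rwa [hD, Subgroup.mem_bot] at h5
    intro a ha
    let K : Subgroup A := (MulAction.toPermHom A (Sylow 3 A)).ker
    have hK : ∀ b : A, b ∈ K ↔ ∀ R : Sylow 3 A, b • R = R := fun b => by
      rw [MonoidHom.mem_ker, Equiv.ext_iff]; rfl
    by_contra ha1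
    have hKn : K.Normal := inferInstance
    -- an involution in the kernel would centralize the Sylow 3-subgroups
    have hno : ∀ w ∈ K, orderOf w ≠ 2 := by
      intro w hw hw2
      obtain ⟨t, ht⟩ := exists_prime_orderOf_dvd_card' (G := P) 3 hP3
      have hwP := Sylow.smul_eq_iff_mem_normalizer.1 ((hK w).1 hw P)
      have h4 : w * t * w⁻¹ * (t : A)⁻¹ ∈ (P : Subgroup A) :=
        mul_mem ((Subgroup.mem_normalizer_iff.1 hwP t).1 t.2) (inv_mem t.2)
      have h5 : w * t * w⁻¹ * (t : A)⁻¹ ∈ K := by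
        have := mul_mem hw (hKn.conj_mem _ (inv_mem hw) t)
        simpa [mul_assoc] using this
      obtain ⟨k, hk⟩ := P.2 ⟨_, h4⟩
      have h6 := hmem _ ((hK _).1 h5) k (congrArg Subtype.val hk)
      have h7 : Commute w t := by
        rw [mul_inv_eq_one, mul_inv_eq_iff_eq_mul] at h6
        exact h6
      have h8 := h.two_three_not_commute (k := 1) hw2 (t := (t : A))
        (orderOf_dvd_iff_pow_eq_one.1 (by rw [pow_one, Subgroup.orderOf_coe, ht])) h7
      rw [← Subgroup.orderOf_coe, h8, orderOf_one] at ht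
      omega
    have hKa : a ∈ K := (hK a).2 ha
    have hoa : orderOf a ∣ 8 * 27 := (orderOf_dvd_natCard a).trans hd
    have h4 := h.orderOf_mem a
    rcases h4 with h4 | h4 | h4 | h4 | h4 | h4 | h4
    · exact ha1 (orderOf_eq_one_iff.1 h4)
    · exact hno a hKa h4
    · exact ha1 (hmem a ha 1 (by rw [pow_one, ← h4, pow_orderOf_eq_one]))
    · exact hno (a ^ 2) (pow_mem hKa 2) (by rw [orderOf_pow, h4]; norm_num)
    · exact ha1 (hmem a ha 2 (orderOf_dvd_iff_pow_eq_one.1 (by rw [h4]; norm_num)))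
    · rw [h4] at hoa; norm_num at hoa
    · rw [h4] at hoa; norm_num at hoa
  let e : Sylow 3 A ≃ Fin 4 := Finite.equivFinOfCardEq hn3
  let f : A →* Equiv.Perm (Fin 4) :=
    e.permCongrHom.toMonoidHom.comp (MulAction.toPermHom A (Sylow 3 A))
  have hf : Function.Injective f := by
    refine (MulEquiv.injective e.permCongrHom).comp (g := e.permCongrHom) ?_
    rw [injective_iff_map_eq_one]
    exact fun a ha => hker a fun R => congrArg (fun σ : Equiv.Perm _ => σ R) ha
  have hrange := Subgroup.card_mul_index f.range
  have hcr : Nat.card f.range = Nat.card A := (Nat.card_congr (f.ofInjective hf).toEquiv).symm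
  have hc4 : Nat.card (Equiv.Perm (Fin 4)) = 24 := by
    rw [Nat.card_eq_fintype_card, Fintype.card_perm]; rfl
  rw [hcr, hc4] at hrange
  have h12 : 12 ∣ Nat.card A := by
    refine Nat.Coprime.mul_dvd_of_dvd_of_dvd (m := 4) (n := 3) (by norm_num) ?_ h3
    rw [← hn3, P.card_eq_index_normalizer]; exact Subgroup.index_dvd_card _
  obtain ⟨c, hc⟩ := h12
  have hidx : f.range.index = 2 ∨ f.range.index = 1 := by
    rw [hc, mul_assoc] at hrange
    have h4 : c * f.range.index = 2 := by omega
    have h5 : f.range.index ∣ 2 := ⟨c, by rw [mul_comm]; exact h4.symm⟩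
    rcases (Nat.dvd_prime Nat.prime_two).1 h5 with h6 | h6 <;> omega
  rcases hidx with hi | hi
  · have h4 := Equiv.Perm.eq_alternatingGroup_of_index_eq_two hi
    exact ⟨(f.ofInjective hf).trans (MulEquiv.subgroupCongr h4)⟩
  · exfalso
    have h4 := Subgroup.index_eq_one.1 hi
    let g : Equiv.Perm (Fin 4) ≃* A := (MulEquiv.ofBijective f
      ⟨hf, MonoidHom.range_eq_top.1 h4⟩).symm
    let _ : MulAction (Equiv.Perm (Fin 4)) X := MulAction.compHom X g.toMonoidHom
    exact not_good_perm_four (h.of_injective g.toMonoidHom g.injective (Equiv.refl X)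
      fun _ _ => rfl)

end

theorem iso_dihedral_three_perm : Iso (DihedralGroup 3) (Equiv.Perm (Fin 3)) := by
  have : Fact (Nat.Prime 3) := ⟨Nat.prime_three⟩
  have hx : orderOf (c[0, 1, 2] : Equiv.Perm (Fin 3)) = 3 :=
    orderOf_eq_prime (by decide) (by decide)
  refine (iso_dihedral (x := (c[0, 1, 2] : Equiv.Perm (Fin 3))) (t := c[0, 1]) hx
    (by decide) (by decide) (fun hmem => ?_) (by
      rw [Nat.card_eq_fintype_card, Fintype.card_perm]; rfl)).symm
  have h1 : (c[0, 1] : Equiv.Perm (Fin 3)) ^ 3 = 1 := orderOf_dvd_iff_pow_eq_one.1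
    ((Subgroup.orderOf_dvd_natCard _ hmem).trans (by rw [Nat.card_zpowers, hx]))
  exact absurd h1 (by decide)

section
variable {A X : Type*} [Group A] [MulAction A X] {P Q : Subgroup A}

theorem Good.eq_one_of_commute (h : Good A X) (hP : IsPGroup 3 P) (hQ : IsPGroup 2 Q) {q t : A}
    (hq : q ∈ Q) (ht : t ∈ P) (ht1 : t ≠ 1) (hqt : q * t = t * q) : q = 1 := by
  by_contra hq1
  obtain ⟨k, hk⟩ := hQ ⟨q, hq⟩
  obtain ⟨l, hl⟩ := hP ⟨t, ht⟩
  have hk' : q ^ 2 ^ k = 1 := congrArg Subtype.val hk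
  have hl' : t ^ 3 ^ l = 1 := congrArg Subtype.val hl
  exact h.not_coprime_of_commute hq1 ht1 hqt (Nat.Coprime.of_dvd (orderOf_dvd_of_pow_eq_one hk')
    (orderOf_dvd_of_pow_eq_one hl') (Nat.Coprime.pow _ _ (by norm_num)))

theorem Good.orderOf_of_mem_two_group (h : Good A X) (hQ : IsPGroup 2 Q) {q : A}
    (hq : q ∈ Q) : orderOf q = 1 ∨ orderOf q = 2 ∨ orderOf q = 4 := by
  obtain ⟨k, hk⟩ := hQ ⟨q, hq⟩
  have hk' : q ^ 2 ^ k = 1 := congrArg Subtype.val hk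
  obtain ⟨j, -, hj⟩ := (Nat.dvd_prime_pow Nat.prime_two).1 (orderOf_dvd_of_pow_eq_one hk')
  have h1 := h.orderOf_mem q
  rw [hj] at h1 ⊢
  have h2 : j < 4 := by
    refine (Nat.pow_lt_pow_iff_right (a := 2) (by norm_num)).1 ?_
    omega
  interval_cases j <;> omega

/-- A 2-group that acts on a nontrivial normal 3-subgroup has at most one involution. -/
theorem Good.card_of_exponent_two (h : Good A X) [P.Normal] (hP : IsPGroup 3 P) (hP1 : P ≠ ⊥)
    (hQ : IsPGroup 2 Q) (hQ1 : Q ≠ ⊥) (hsq : ∀ q ∈ Q, orderOf q ≠ 4) : Nat.card Q = 2 := by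
  have hor : ∀ q ∈ Q, q = 1 ∨ orderOf q = 2 := by
    intro q hq
    rcases h.orderOf_of_mem_two_group hQ hq with h1 | h1 | h1
    · exact Or.inl (orderOf_eq_one_iff.1 h1)
    · exact Or.inr h1
    · exact absurd h1 (hsq q hq)
  obtain ⟨⟨z, hz⟩, hzne⟩ := Subgroup.ne_bot_iff_exists_ne_one.1 hQ1
  have hz2 := (hor z hz).resolve_left fun h1 => hzne (Subtype.ext h1)
  have h1 : Q = Subgroup.zpowers z := by
    refine le_antisymm (fun q hq => ?_) (Subgroup.zpowers_le.2 hz)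
    rcases hor q hq with rfl | h1
    · exact one_mem _
    · rw [h.eq_of_orderOf_two hP hP1 hQ hq hz h1 hz2]; exact Subgroup.mem_zpowers z
  rw [h1, Nat.card_zpowers, hz2]

/-- An element `q` of order 4 satisfies `q x q⁻¹ = x ^ k` for a generator `x` of the normal
3-subgroup, and its square inverts `x`, so `k ^ 2 ≡ -1` modulo 3. -/
theorem Good.orderOf_ne_four (h : Good A X) [hn : P.Normal] (hP : IsPGroup 3 P) {x : A}
    (hx : P = Subgroup.zpowers x) (h3 : 3 ∣ orderOf x) (q : A) : orderOf q ≠ 4 := by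
  have := h.finite
  intro hq
  have hq2 : orderOf (q ^ 2) = 2 := by rw [orderOf_pow, hq]; norm_num
  have h1 := h.conj_eq_inv (by decide) hP hq2 (fun t ht => hn.conj_mem t ht _) x
    (hx ▸ Subgroup.mem_zpowers x)
  have h2 : q * x * q⁻¹ ∈ Subgroup.zpowers x := hx ▸ hn.conj_mem x (hx ▸ Subgroup.mem_zpowers x) q
  obtain ⟨k, hk⟩ := Subgroup.mem_zpowers_iff.1 h2
  have h4 : q ^ 2 * x * (q ^ 2)⁻¹ = x ^ (k * k) := by
    rw [zpow_mul, hk, conj_zpow, hk, pow_two]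
    group
  rw [h4, ← zpow_neg_one, ← mul_inv_eq_one, ← zpow_neg, ← zpow_add,
    ← orderOf_dvd_iff_zpow_eq_one] at h1
  have h5 : (3 : ℤ) ∣ k * k + 1 := by
    refine (Int.natCast_dvd_natCast.2 h3).trans ?_
    simpa using h1
  have h6 : k % 3 = 0 ∨ k % 3 = 1 ∨ k % 3 = 2 := by omega
  have h7 : (k * k + 1) % 3 = 0 := Int.emod_eq_zero_of_dvd h5
  rw [Int.add_emod, Int.mul_emod] at h7
  rcases h6 with h6 | h6 | h6 <;> rw [h6] at h7 <;> norm_num at h7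

theorem Good.iso_dihedral_of_cyclic (h : Good A X) [hn : P.Normal] (hP : IsPGroup 3 P)
    (hQ : IsPGroup 2 Q) (hQ1 : Q ≠ ⊥) (hc : P.IsComplement' Q) {x : A}
    (hx : P = Subgroup.zpowers x) (h3 : 3 ∣ orderOf x) :
    Nat.card A = 2 * Nat.card P ∧ Iso A (DihedralGroup (Nat.card P)) := by
  have := h.finite
  have hP1 : P ≠ ⊥ := by
    rintro rfl
    have h1 := Subgroup.zpowers_eq_bot.1 hx.symm
    rw [h1, orderOf_one] at h3
    omega
  have hQc := h.card_of_exponent_two hP hP1 hQ hQ1 fun q _ => h.orderOf_ne_four hP hx h3 q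
  have hA : Nat.card A = 2 * Nat.card P := by rw [← hc.card_mul_card, hQc, mul_comm]
  obtain ⟨⟨z, hz⟩, hzne⟩ := Subgroup.ne_bot_iff_exists_ne_one.1 hQ1
  have hz2 : orderOf z = 2 := by
    have h1 := Subgroup.orderOf_dvd_natCard _ hz
    rw [hQc] at h1
    exact ((Nat.dvd_prime Nat.prime_two).1 h1).resolve_left fun h2 =>
      hzne (Subtype.ext (orderOf_eq_one_iff.1 h2))
  refine ⟨hA, iso_dihedral (x := x) (t := z) ?_ ?_ ?_ ?_ hA⟩
  · rw [hx, Nat.card_zpowers]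
  · rw [← pow_two, ← hz2, pow_orderOf_eq_one]
  · exact h.conj_eq_inv (by decide) hP hz2 (fun t ht => hn.conj_mem t ht _) x
      (hx ▸ Subgroup.mem_zpowers x)
  · intro hmem
    rw [← hx] at hmem
    exact hzne (Subtype.ext (Subgroup.disjoint_def.1 hc.disjoint hmem hz))

/-- The involution inverts `P`, so every subgroup of `P` is normal. A subgroup of order 3 has a
complement, generated by the involution and another subgroup of order 3, which is isomorphic to
`S_3`. -/
theorem Good.semidirect_perm_three (h : Good A X) [hn : P.Normal] (hPp : IsPGroup 3 P)
    (hP : Iso P (Fin 2 → Cyc 3)) (hQc : Nat.card Q = 2) (hc : P.IsComplement' Q) :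
    IsNontrivialSemidirect A (Cyc 3) (Equiv.Perm (Fin 3)) := by
  have := h.finite
  have : Fact (Nat.Prime 2) := ⟨Nat.prime_two⟩
  have : Fact (Nat.Prime 3) := ⟨Nat.prime_three⟩
  obtain ⟨e⟩ := hP
  have hPc : Nat.card P = 9 := by rw [Nat.card_congr e.toEquiv, pi_cyc_natCard]; norm_num
  have hexp : ∀ t ∈ P, t ^ 3 = 1 := by
    intro t ht
    have h1 : (⟨t, ht⟩ : P) ^ 3 = 1 := e.injective (by rw [map_pow, pi_cyc_pow, map_one])
    exact congrArg Subtype.val h1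
  have hcomm : ∀ s ∈ P, ∀ t ∈ P, s * t = t * s := by
    intro s hs t ht
    have h1 : (⟨s, hs⟩ : P) * ⟨t, ht⟩ = ⟨t, ht⟩ * ⟨s, hs⟩ :=
      e.injective (by rw [map_mul, map_mul, mul_comm])
    exact congrArg Subtype.val h1
  have hA : Nat.card A = 18 := by rw [← hc.card_mul_card, hQc, hPc]
  obtain ⟨⟨z, hz⟩, hzo⟩ := exists_prime_orderOf_dvd_card' (G := Q) 2 hQc.symm.dvd
  rw [Subgroup.orderOf_mk] at hzo
  have hzz : z * z = 1 := by rw [← pow_two, ← hzo, pow_orderOf_eq_one]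
  have hinv := h.conj_eq_inv (by decide) hPp hzo (fun t ht => hn.conj_mem t ht _)
  obtain ⟨⟨x, hxP⟩, hxo⟩ := exists_prime_orderOf_dvd_card' (G := P) 3 (by rw [hPc]; norm_num)
  rw [Subgroup.orderOf_mk] at hxo
  obtain ⟨y, hyP, hyx⟩ : ∃ y ∈ P, y ∉ Subgroup.zpowers x := by
    by_contra hall
    push Not at hall
    have h1 := Subgroup.card_le_of_le (hall : P ≤ Subgroup.zpowers x)
    rw [Nat.card_zpowers, hxo, hPc] at h1
    omega
  have hyo : orderOf y = 3 := orderOf_eq_prime (hexp y hyP) (by rintro rfl; exact hyx (one_mem _))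
  have hzP : z ∉ P := fun h1 => by
    have h2 := Subgroup.disjoint_def.1 hc.disjoint h1 hz
    rw [h2, orderOf_one] at hzo
    omega
  obtain ⟨f, hf, hf1, hf2, -⟩ := exists_dihedralHom hyo hzz (hinv y hyP)
    (fun h1 => hzP ((Subgroup.zpowers_le.2 hyP) h1))
  -- every subgroup of `P` is normal
  have hNn : (Subgroup.zpowers x).Normal := by
    have hle : Subgroup.zpowers x ≤ P := Subgroup.zpowers_le.2 hxP
    refine ⟨fun n hnx g => ?_⟩
    obtain ⟨⟨p, q⟩, rfl : (p : A) * q = g⟩ := hc.2 g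
    have hn' := hle hnx
    have hq : (q : A) * n * (q : A)⁻¹ = n ∨ (q : A) * n * (q : A)⁻¹ = n⁻¹ := by
      rcases (Nat.dvd_prime Nat.prime_two).1 (hQc ▸ orderOf_dvd_natCard q) with h1 | h1
      · left; rw [orderOf_eq_one_iff.1 h1]; simp
      · right
        exact h.conj_eq_inv (by decide) hPp (by rw [Subgroup.orderOf_coe, h1])
          (fun t ht => hn.conj_mem t ht _) n hn'
    have h2 : (p : A) * q * n * ((p : A) * q)⁻¹ = p * (q * n * (q : A)⁻¹) * (p : A)⁻¹ := by group
    rw [h2]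
    rcases hq with h3 | h3 <;> rw [h3]
    · rw [hcomm p p.2 n hn', mul_inv_cancel_right]; exact hnx
    · rw [hcomm p p.2 n⁻¹ (inv_mem hn'), mul_inv_cancel_right]; exact inv_mem hnx
  have hfr : ∀ i, f (.r i) ∈ Subgroup.zpowers y := by
    intro i
    refine ⟨(i.val : ℤ), ?_⟩
    change y ^ (i.val : ℤ) = _
    rw [zpow_natCast, ← hf1, ← map_pow, DihedralGroup.r_one_pow, ZMod.natCast_zmod_val]
  have hcard : Nat.card f.range = 6 := by
    rw [← Nat.card_congr (f.ofInjective hf).toEquiv, DihedralGroup.nat_card]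
  have hcompl : (Subgroup.zpowers x).IsComplement' f.range := by
    refine Subgroup.isComplement'_of_card_mul_and_disjoint ?_ ?_
    · rw [Nat.card_zpowers, hxo, hcard, hA]
    · rw [Subgroup.disjoint_def]
      rintro _ h1 ⟨d, rfl⟩
      obtain i | i := d
      · exact Subgroup.disjoint_def.1 (disjoint_zpowers_of_prime Nat.prime_three hyo hyx) h1
          (hfr i)
      · have h2 : f (.sr i) ^ 3 = 1 := hexp _ ((Subgroup.zpowers_le.2 hxP) h1)
        have h3 : f (.sr i) ^ 2 = 1 := by
          rw [← map_pow, pow_two, DihedralGroup.sr_mul_self, map_one]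
        rw [pow_succ, h3, one_mul] at h2
        exact h2
  obtain ⟨g⟩ := iso_cyc (n := 3) (x := (⟨x, Subgroup.mem_zpowers x⟩ : Subgroup.zpowers x))
    (by rw [Subgroup.orderOf_mk, hxo]) (by rw [Nat.card_zpowers, hxo])
  obtain ⟨s⟩ := iso_dihedral_three_perm
  obtain ⟨φ, hi, hφ⟩ := exists_iso_semidirect hcompl g ((f.ofInjective hf).symm.trans s)
  refine ⟨φ, ?_, hi⟩
  rintro rfl
  have h1 := (hφ ⟨z, .sr 0, hf2⟩).1 rfl x (Subgroup.mem_zpowers x)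
  have h2 := h.two_three_not_commute (k := 1) hzo (hexp x hxP) h1
  rw [h2, orderOf_one] at hxo
  omega

theorem Good.faithful_semidirect_of_complement (h : Good A X) [hn : P.Normal] (hPp : IsPGroup 3 P)
    (hQp : IsPGroup 2 Q) (hP1 : P ≠ ⊥) (hc : P.IsComplement' Q) {N H : Type*} [Group N] [Group H]
    (hP : Iso P N) (hQ : Iso Q H) : IsFaithfulSemidirect A N H := by
  obtain ⟨f⟩ := hP
  obtain ⟨g⟩ := hQ
  obtain ⟨φ, hi, hφ⟩ := exists_iso_semidirect hc f g
  refine ⟨φ, ?_, hi⟩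
  rw [injective_iff_map_eq_one]
  intro a ha
  obtain ⟨k, rfl⟩ := g.surjective a
  have h1 := (hφ k).1 ha
  obtain ⟨⟨t, ht⟩, htne⟩ := Subgroup.ne_bot_iff_exists_ne_one.1 hP1
  have h2 := h.eq_one_of_commute hPp hQp k.2 ht (fun h3 => htne (Subtype.ext h3)) (h1 t ht)
  rw [show k = 1 from Subtype.ext h2, map_one]

/-- An involution has one fixed point in each orbit of the normal Sylow 3-subgroup `P`, so `P` has
order at most 9. Involutions invert `P`, so a Sylow 2-subgroup contains only one of them, which
leaves `C_2`, `C_4` and `Q_8`. If `P` is cyclic, its automorphisms of order a power of 2 leave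
only `C_2`. -/
theorem Good.iso_of_normal_sylow_three (h : Good A X) [Fact (Nat.Prime 3)] (h2 : 2 ∣ Nat.card A)
    (h3 : 3 ∣ Nat.card A) (hd : Nat.card A ∣ 8 * 27) (P : Sylow 3 A)
    [hn : (P : Subgroup A).Normal] :
    Iso A (Equiv.Perm (Fin 3)) ∨ Iso A (DihedralGroup 9) ∨
    IsNontrivialSemidirect A (Cyc 3) (Equiv.Perm (Fin 3)) ∨
    IsFaithfulSemidirect A (Fin 2 → Cyc 3) (Cyc 4) ∨
    IsFaithfulSemidirect A (Fin 2 → Cyc 3) (QuaternionGroup 2) := by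
  have := h.finite
  have : Fact (Nat.Prime 2) := ⟨Nat.prime_two⟩
  obtain ⟨Q⟩ : Nonempty (Sylow 2 A) := inferInstance
  obtain ⟨a, ha⟩ := IsPGroup.iff_card.1 P.2
  obtain ⟨b, hb⟩ := IsPGroup.iff_card.1 Q.2
  have hP3 : 3 ∣ Nat.card P := P.dvd_card_of_dvd_card h3
  have hQ2 : 2 ∣ Nat.card Q := Q.dvd_card_of_dvd_card h2
  have hP1 : (P : Subgroup A) ≠ ⊥ := fun h1 => by
    rw [h1, Subgroup.card_bot] at hP3; omega
  have hQ1 : (Q : Subgroup A) ≠ ⊥ := fun h1 => by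
    rw [h1, Subgroup.card_bot] at hQ2; omega
  obtain ⟨z, hz⟩ := exists_prime_orderOf_dvd_card' 2 h2
  have hP9 := h.card_mul_three_le P.2 hz fun t ht => hn.conj_mem t ht z
  have hc : (P : Subgroup A).IsComplement' Q := by
    obtain ⟨i, j, hij⟩ : ∃ i j, Nat.card A = 2 ^ i * 3 ^ j := by
      obtain ⟨m, n, hm, hn, hA⟩ := exists_dvd_and_dvd_of_dvd_mul hd
      obtain ⟨i, -, hi⟩ := (Nat.dvd_prime_pow (m := 3) Nat.prime_two).1 hm
      obtain ⟨j, -, hj⟩ := (Nat.dvd_prime_pow (m := 3) Nat.prime_three).1 hn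
      exact ⟨i, j, by rw [hA, hi, hj]⟩
    have h23 : ∀ k, ¬ 2 ∣ 3 ^ k := fun k h1 =>
      absurd (Nat.prime_two.dvd_of_dvd_pow h1) (by norm_num)
    have h32 : ∀ k, ¬ 3 ∣ 2 ^ k := fun k h1 =>
      absurd (Nat.prime_three.dvd_of_dvd_pow h1) (by norm_num)
    have hPc := card_sylow_eq (hij.trans (mul_comm _ _)) (h32 i) P
    have hQc := card_sylow_eq hij (h23 j) Q
    refine Subgroup.isComplement'_of_coprime ?_ ?_
    · rw [hPc, hQc, hij, mul_comm]
    · rw [hPc, hQc]; exact Nat.Coprime.pow _ _ (by norm_num)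
  have hP' : Nat.card P = 3 ∨ Nat.card P = 9 := by
    rw [ha] at hP3 hP9 ⊢
    have : a < 3 := (Nat.pow_lt_pow_iff_right (a := 3) (by norm_num)).1 (by omega)
    interval_cases a <;> omega
  rcases hP' with hP' | hP'
  · left
    obtain ⟨⟨x, hxP⟩, hx⟩ := exists_prime_orderOf_dvd_card' (G := P) 3 hP'.symm.dvd
    rw [Subgroup.orderOf_mk] at hx
    have hPx : (P : Subgroup A) = Subgroup.zpowers x :=
      (Subgroup.eq_of_le_of_card_ge (Subgroup.zpowers_le.2 hxP) (by
        rw [Nat.card_zpowers, hx, hP'])).symm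
    have h1 := (h.iso_dihedral_of_cyclic P.2 Q.2 hQ1 hc hPx hx.symm.dvd).2
    rw [hP'] at h1
    exact h1.trans iso_dihedral_three_perm
  right
  rcases (h.subgroup P).iso_of_card_nine hP' with hi | hi
  · left
    obtain ⟨e⟩ := hi
    have ho : orderOf (e.symm (Multiplicative.ofAdd 1) : A) = 9 := by
      rw [Subgroup.orderOf_coe, MulEquiv.orderOf_eq, Cyc.orderOf_gen]
    have hPx : (P : Subgroup A) = Subgroup.zpowers (e.symm (Multiplicative.ofAdd 1) : A) :=
      (Subgroup.eq_of_le_of_card_ge (Subgroup.zpowers_le.2 (SetLike.coe_mem _)) (by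
        rw [Nat.card_zpowers, ho, hP'])).symm
    have h1 := (h.iso_dihedral_of_cyclic P.2 Q.2 hQ1 hc hPx (by rw [ho]; norm_num)).2
    rwa [hP'] at h1
  right
  have hb3 : b ≤ 3 := by
    refine pow_dvd_of_dvd (p := 2) (m := 27) Nat.prime_two (by norm_num) ?_
    rw [← hb]
    exact (Subgroup.card_subgroup_dvd_card _).trans hd
  have hb0 : b ≠ 0 := by
    rintro rfl
    rw [hb] at hQ2
    omega
  have hb' : b = 1 ∨ b = 2 ∨ b = 3 := by omega
  have hex : b ≠ 1 → ∃ q : Q, orderOf q = 4 := by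
    intro hb1
    by_contra hall
    push Not at hall
    have h1 := h.card_of_exponent_two P.2 hP1 Q.2 hQ1 fun q hq => by
      rw [← Subgroup.orderOf_mk q hq]; exact hall _
    rw [hb] at h1
    exact hb1 (Nat.pow_right_injective le_rfl (h1.trans (pow_one 2).symm))
  rcases hb' with rfl | rfl | rfl
  · left
    exact h.semidirect_perm_three P.2 hi hb hc
  · right; left
    obtain ⟨q, hq⟩ := hex (by norm_num)
    exact h.faithful_semidirect_of_complement P.2 Q.2 hP1 hc hi (iso_cyc hq hb)
  · right; right
    refine h.faithful_semidirect_of_complement P.2 Q.2 hP1 hc hi ?_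
    rcases (h.subgroup Q).iso_of_card_eight hb with ⟨⟨e⟩⟩ | ⟨⟨e⟩⟩ | hi
    · obtain ⟨q, hq⟩ := hex (by norm_num)
      have h1 : q ^ 2 = 1 := e.injective (by rw [map_pow, pi_cyc_pow, map_one])
      have h2 := orderOf_dvd_of_pow_eq_one h1
      rw [hq] at h2
      norm_num at h2
    · have ho : ∀ i, orderOf (e.symm (.sr i) : A) = 2 := fun i => by
        rw [Subgroup.orderOf_coe, MulEquiv.orderOf_eq, DihedralGroup.orderOf_sr]
      have h1 := h.eq_of_orderOf_two P.2 hP1 Q.2 (SetLike.coe_mem (e.symm (.sr 0)))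
        (SetLike.coe_mem (e.symm (.sr 1))) (ho 0) (ho 1)
      exact absurd (e.symm.injective (Subtype.ext h1)) (by decide)
    · exact hi

end

/-! ### Orbit lengths -/

/-- The number of points that lie in `H`-orbits of length `n`. -/
noncomputable def pointCount (H : Subgroup S27) (n : ℕ) : ℕ :=
  {v : Fin 27 | (orbit H v).ncard = n}.ncard

theorem dvd_pointCount (H : Subgroup S27) (n : ℕ) : n ∣ pointCount H n :=
  ⟨(orbitLengths H).count n, by rw [pointCount, ← count_orbitLengths, mul_comm]⟩

theorem ncard_orbit_eq_one_iff {A X : Type*} [Group A] [MulAction A X] {v : X} :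
    (orbit A v).ncard = 1 ↔ v ∈ fixedPoints A X := by
  rw [Set.ncard_eq_one]
  constructor
  · rintro ⟨w, hw⟩ a
    have h1 : v ∈ orbit A v := mem_orbit_self v
    have h2 : a • v ∈ orbit A v := mem_orbit v a
    rw [hw, Set.mem_singleton_iff] at h1 h2
    rw [h1] at h2 ⊢
    exact h2
  · intro h
    refine ⟨v, Set.eq_singleton_iff_unique_mem.2 ⟨mem_orbit_self v, ?_⟩⟩
    rintro _ ⟨a, rfl⟩
    exact h a

theorem pointCount_one (H : Subgroup S27) :
    pointCount H 1 = (fixedPoints H (Fin 27)).ncard := by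
  rw [pointCount]
  congr 1
  ext v
  exact ncard_orbit_eq_one_iff

theorem orbitLengths_eq_of_pointCount {H : Subgroup S27} {s : Multiset ℕ} {D : Finset ℕ}
    (hD : ∀ v : Fin 27, (orbit H v).ncard ∈ D) (h0 : 0 ∉ s) (hs : ∀ n ∈ s, n ∈ D)
    (h : ∀ n ∈ D, pointCount H n = s.count n * n) : orbitLengths H = s :=
  orbitLengths_eq_of_finset hD h0 hs h

theorem Good.sum_pointCount {H : Subgroup S27} (h : Good H (Fin 27)) [Fintype H] {D : Finset ℕ}
    (hD : ∀ v : Fin 27, (orbit H v).ncard ∈ D) {m n : ℕ} (P : Subgroup H)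
    (hm : ∀ a ∈ P, a ≠ 1 → Nat.card (fixedBy (Fin 27) a) = m)
    (hn : ∀ a ∉ P, Nat.card (fixedBy (Fin 27) a) = n) :
    ∑ d ∈ D, pointCount H d = 27 ∧ ∑ d ∈ D, pointCount H d * (Nat.card H / d) =
      27 + (Nat.card P - 1) * m + (Nat.card H - Nat.card P) * n := by
  classical
  obtain ⟨h1, h2⟩ := sum_ncard_orbit hD
  refine ⟨h1, h2.trans ?_⟩
  have hc : Nat.card P = (Finset.univ.filter fun a => a ∈ P).card := by
    rw [Nat.card_eq_fintype_card, Fintype.card_subtype]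
  rw [← Finset.sum_filter_add_sum_filter_not _ (fun a => a ∈ P),
    ← Finset.add_sum_erase _ _ (Finset.mem_filter.2 ⟨Finset.mem_univ 1, P.one_mem⟩),
    h.card_fixedBy_one, Finset.sum_const_nat (m := m) (fun a ha => by
      rw [Finset.mem_erase, Finset.mem_filter] at ha; exact hm a ha.2.2 ha.1),
    Finset.sum_const_nat (m := n) (fun a ha => hn a (Finset.mem_filter.1 ha).2),
    Finset.card_erase_of_mem (Finset.mem_filter.2 ⟨Finset.mem_univ 1, P.one_mem⟩), ← hc,
    Finset.filter_not, Finset.card_sdiff_of_subset (Finset.filter_subset _ _), ← hc,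
    Finset.card_univ, ← Nat.card_eq_fintype_card]

theorem ncard_orbit_le (H : Subgroup S27) (v : Fin 27) : (orbit H v).ncard ≤ 27 := by
  have h := Set.ncard_le_ncard (Set.subset_univ (orbit H v)) (Set.toFinite _)
  rwa [Set.ncard_univ, Nat.card_eq_fintype_card, Fintype.card_fin] at h

theorem ncard_orbit_pos {A X : Type*} [Group A] [MulAction A X] [Finite X] (v : X) :
    0 < (orbit A v).ncard :=
  (Set.ncard_pos (Set.toFinite _)).2 ⟨v, mem_orbit_self v⟩

theorem mem_sylow_of_pow_eq_one {A : Type*} [Group A] [Finite A] {p k : ℕ} [hp : Fact p.Prime]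
    (P : Sylow p A) [(P : Subgroup A).Normal] {a : A} (ha : a ^ p ^ k = 1) : a ∈ P := by
  have h1 : IsPGroup p (Subgroup.zpowers a) := by
    rw [IsPGroup.iff_card]
    obtain ⟨j, -, hj⟩ := (Nat.dvd_prime_pow hp.out).1 (orderOf_dvd_of_pow_eq_one ha)
    exact ⟨j, by rw [Nat.card_zpowers, hj]⟩
  have h2 := h1.inf_normalizer_sylow P
  have h3 : Subgroup.normalizer ((P : Subgroup A) : Set A) = ⊤ := Subgroup.normalizer_eq_top _
  change Subgroup.zpowers a ⊓ Subgroup.normalizer ((P : Subgroup A) : Set A) = _ at h2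
  rw [h3, inf_top_eq] at h2
  exact (Subgroup.zpowers_le.1 (h2.le.trans inf_le_right))

section
variable {A X : Type*} [Group A] [MulAction A X]

theorem Good.three_pow_dvd_ncard_orbit (h : Good A X) {k : ℕ} (hk : 3 ^ k ∣ Nat.card A) (v : X) :
    3 ^ k ∣ (orbit A v).ncard := by
  have h1 := (Nat.prime_three.coprime_iff_not_dvd).2 (h.not_three_dvd_stabilizer v)
  rw [← ncard_orbit_mul_card_stabilizer v] at hk
  exact Nat.Coprime.dvd_of_dvd_mul_right (Nat.Coprime.pow_left k h1) hk

theorem Good.normal_sylow_three_of_not_iso (h : Good A X) [Fact (Nat.Prime 3)]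
    (hd : Nat.card A ∣ 8 * 27) (h3 : 3 ∣ Nat.card A) (h12 : Nat.card A ≠ 12) (P : Sylow 3 A) :
    (P : Subgroup A).Normal := by
  have := h.finite
  by_cases h2 : 2 ∣ Nat.card A
  · by_contra hn
    have h1 := (h.iso_alternating h2 h3 hd fun P' hP' => hn (by
      have := Sylow.unique_of_normal P' hP'
      rwa [Subsingleton.elim P P'])).card_eq
    rw [nat_card_alternatingGroup] at h1
    simp at h1
    exact h12 h1
  · have h1 : IsPGroup 3 A := by
      have h2' : Nat.card A ∣ 3 ^ 3 := Nat.Coprime.dvd_of_dvd_mul_left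
        (((Nat.prime_two.coprime_iff_not_dvd).2 h2).symm.pow_right 3) hd
      obtain ⟨j, -, hj⟩ := (Nat.dvd_prime_pow Nat.prime_three).1 h2'
      exact IsPGroup.of_card hj
    have h4 : (P : Subgroup A) = ⊤ := P.3 (h1.to_subgroup ⊤) le_top |>.symm
    rw [h4]
    infer_instance

/-- An element outside a normal Sylow 3-subgroup has even order. -/
theorem Good.card_fixedBy_of_notMem (h : Good A X) [Fact (Nat.Prime 3)] (hd : Nat.card A ∣ 8 * 27)
    (P : Sylow 3 A) [(P : Subgroup A).Normal] {a : A} (ha : a ∉ (P : Subgroup A)) :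
    Nat.card (fixedBy X a) = 3 := by
  have := h.finite
  refine h.card_fixedBy_of_two_dvd ?_
  have hoa : orderOf a ∣ 8 * 27 := (orderOf_dvd_natCard a).trans hd
  rcases h.orderOf_mem a with h4 | h4 | h4 | h4 | h4 | h4 | h4
  · rw [orderOf_eq_one_iff.1 h4] at ha; exact absurd (one_mem _) ha
  · rw [h4]
  · exact absurd (mem_sylow_of_pow_eq_one (k := 1) P
      (orderOf_dvd_iff_pow_eq_one.1 (by rw [h4]; norm_num))) ha
  · rw [h4]; norm_num
  · exact absurd (mem_sylow_of_pow_eq_one (k := 2) P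
      (orderOf_dvd_iff_pow_eq_one.1 (by rw [h4]; norm_num))) ha
  · rw [h4] at hoa; norm_num at hoa
  · rw [h4] at hoa; norm_num at hoa

theorem Good.card_fixedBy_of_mem_three_group (h : Good A X) {P : Subgroup A} (hP : IsPGroup 3 P)
    {a : A} (ha : a ∈ P) (ha1 : a ≠ 1) : Nat.card (fixedBy X a) = 0 := by
  have : Fact (Nat.Prime 3) := ⟨Nat.prime_three⟩
  have := h.finite
  refine h.card_fixedBy_of_three_dvd ?_
  rw [← Subgroup.orderOf_mk a ha]
  exact hP.dvd_orderOf fun h1 => ha1 (congrArg Subtype.val h1)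

end

theorem mem_divisors_eight {k : ℕ} (hk : k ∣ 8) : k = 1 ∨ k = 2 ∨ k = 4 ∨ k = 8 := by
  have : k ∈ Nat.divisors 8 := Nat.mem_divisors.2 ⟨hk, by norm_num⟩
  have h5 : Nat.divisors 8 = {1, 2, 4, 8} := by decide
  rw [h5] at this
  simpa using this

section
variable {G : Subgroup S27}

/-- Every orbit length is divisible by 9 and divides the order, so it is 9 or 18. The elements of
the normal Sylow 3-subgroup have no fixed points, the other elements have 3, and this count excludes
orbits of length 18. -/
theorem Good.orbitLengths_nine (h : Good G (Fin 27)) {k : ℕ} (hk : k ∣ 8)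
    (hG : Nat.card G = 9 * k) : orbitLengths G = {9, 9, 9} := by
  have := h.finite
  have := Fintype.ofFinite G
  have : Fact (Nat.Prime 3) := ⟨Nat.prime_three⟩
  obtain ⟨P⟩ : Nonempty (Sylow 3 G) := inferInstance
  have hk' := mem_divisors_eight hk
  have hd : Nat.card G ∣ 8 * 27 := by
    rw [hG, mul_comm 8]; exact mul_dvd_mul (by norm_num) hk
  have hPc : Nat.card P = 9 := card_sylow_eq (p := 3) (k := 2) (m := k) (by rw [hG]; norm_num)
    (by omega) P
  have hPn := h.normal_sylow_three_of_not_iso hd (by omega) (by omega) P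
  have hD : ∀ v : Fin 27, (orbit G v).ncard ∈ ({9, 18} : Finset ℕ) := by
    intro v
    have h1 := h.three_pow_dvd_ncard_orbit (k := 2) (by rw [hG]; norm_num) v
    have h2 := ncard_orbit_le G v
    have h3 := ncard_orbit_pos (A := G) v
    have h4 := ncard_orbit_dvd_card (A := G) v
    have h5 : (orbit G v).ncard ≠ 27 := by
      intro h6
      rw [h6, hG] at h4
      omega
    simp only [Finset.mem_insert, Finset.mem_singleton]
    omega
  obtain ⟨h1, h2⟩ := h.sum_pointCount hD P
    (fun a ha ha1 => h.card_fixedBy_of_mem_three_group P.2 ha ha1)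
    (fun a ha => h.card_fixedBy_of_notMem hd P ha)
  rw [Finset.sum_pair (by norm_num)] at h1 h2
  rw [hG, hPc] at h2
  have h3 : pointCount G 18 = 0 := by
    rcases hk' with rfl | rfl | rfl | rfl <;> norm_num at h2 <;> omega
  refine orbitLengths_eq_of_pointCount hD (by decide) (by decide) ?_
  intro n hn
  simp only [Finset.mem_insert, Finset.mem_singleton] at hn
  rcases hn with rfl | rfl
  · have : Multiset.count 9 ({9, 9, 9} : Multiset ℕ) = 3 := by decide
    omega
  · rw [h3]; decide

/-- The fixed point of the normal Sylow 13-subgroup is fixed by the whole group, and all other orbit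
lengths are divisible by 13. Counting pairs of an element and a fixed point excludes an orbit of
length 26. -/
theorem Good.orbitLengths_thirteen (h : Good G (Fin 27)) {k : ℕ} (hk : k ∣ 4)
    (hG : Nat.card G = 13 * k) : orbitLengths G = {13, 13, 1} := by
  have := h.finite
  have := Fintype.ofFinite G
  have : Fact (Nat.Prime 13) := ⟨by norm_num⟩
  have hk' : k = 1 ∨ k = 2 ∨ k = 4 := by
    have h1 := mem_divisors_eight (hk.trans (by norm_num))
    have h2 := Nat.le_of_dvd (by norm_num) hk
    omega
  have hd : 13 ∣ Nat.card G := by omega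
  have hn : Nat.card (Sylow 13 G) = 1 := by
    by_contra hn
    have := (h.card_eq_of_thirteen_dvd hd hn).1
    omega
  obtain ⟨P⟩ : Nonempty (Sylow 13 G) := inferInstance
  have hPn := h.normal_sylow_of_card_sylow hn P
  have hPc := h.card_sylow (Or.inr ⟨rfl, rfl⟩) hd P
  obtain ⟨x, hx, hPx⟩ := h.exists_generator (Or.inr ⟨rfl, rfl⟩) hd P
  obtain ⟨⟨w, hw⟩, hu⟩ := (Nat.card_eq_one_iff_exists).1 (h.card_fixedBy_of_thirteen hx)
  have hfix : ∀ v : Fin 27, x • v = v → v = w := fun v hv => congrArg Subtype.val (hu ⟨v, hv⟩)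
  have hD : ∀ v : Fin 27, (orbit G v).ncard ∈ ({1, 13, 26} : Finset ℕ) := by
    intro v
    have h2 := ncard_orbit_le G v
    have h3 := ncard_orbit_pos (A := G) v
    by_cases h13 : 13 ∣ (orbit G v).ncard
    · simp only [Finset.mem_insert, Finset.mem_singleton]
      omega
    -- otherwise the stabilizer contains `x`, so `v` is the only fixed point of `x`
    · have h4 : 13 ∣ Nat.card (stabilizer G v) := by
        have h5 : 13 ∣ (orbit G v).ncard * Nat.card (stabilizer G v) := by
          rwa [ncard_orbit_mul_card_stabilizer]
        exact ((Nat.Prime.dvd_mul (by norm_num)).1 h5).resolve_left h13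
      obtain ⟨⟨y, hyv⟩, hy⟩ := exists_prime_orderOf_dvd_card' 13 h4
      rw [Subgroup.orderOf_mk] at hy
      have hyP : y ∈ (P : Subgroup G) := mem_sylow_of_pow_eq_one (k := 1) P
        (orderOf_dvd_iff_pow_eq_one.1 (by rw [hy]; norm_num))
      have hPy : (P : Subgroup G) = Subgroup.zpowers y :=
        (Subgroup.eq_of_le_of_card_ge (Subgroup.zpowers_le.2 hyP) (by
          rw [Nat.card_zpowers, hy, hPc])).symm
      have hPv : ∀ b ∈ (P : Subgroup G), b • v = v := fun b hb => by
        rw [hPy] at hb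
        exact (Subgroup.zpowers_le.2 hyv : Subgroup.zpowers y ≤ stabilizer G v) hb
      have hxP : x ∈ (P : Subgroup G) := hPx ▸ Subgroup.mem_zpowers x
      have h5 : v ∈ fixedPoints G (Fin 27) := by
        intro g
        have h6 : x • g • v = g • v := by
          have h7 := hPv _ (hPn.conj_mem x hxP g⁻¹)
          rw [inv_inv, mul_smul, mul_smul, inv_smul_eq_iff] at h7
          exact h7
        rw [hfix _ h6, hfix v (hPv x hxP)]
      rw [ncard_orbit_eq_one_iff.2 h5]
      simp
  have hfixP : ∀ a ∈ (P : Subgroup G), a ≠ 1 → Nat.card (fixedBy (Fin 27) a) = 1 := by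
    intro a ha ha1
    refine h.card_fixedBy_of_thirteen (orderOf_eq_prime ?_ ha1)
    rw [← orderOf_dvd_iff_pow_eq_one]
    exact (Subgroup.orderOf_dvd_natCard _ ha).trans hPc.dvd
  obtain ⟨h1, h2⟩ := h.sum_pointCount hD P hfixP (fun a ha => by
    refine h.card_fixedBy_of_two_dvd ?_
    have hoa : orderOf a ∣ 13 * 4 :=
      ((orderOf_dvd_natCard a).trans hG.dvd).trans (mul_dvd_mul_left 13 hk)
    rcases h.orderOf_mem a with h4 | h4 | h4 | h4 | h4 | h4 | h4
    · rw [orderOf_eq_one_iff.1 h4] at ha; exact absurd (one_mem _) ha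
    · rw [h4]
    · rw [h4] at hoa; norm_num at hoa
    · rw [h4]; norm_num
    · rw [h4] at hoa; norm_num at hoa
    · rw [h4] at hoa; norm_num at hoa
    · exact absurd (mem_sylow_of_pow_eq_one (k := 1) P
        (orderOf_dvd_iff_pow_eq_one.1 (by rw [h4]; norm_num))) ha)
  simp only [Finset.mem_insert, Finset.mem_singleton, OfNat.one_ne_ofNat, or_self,
    not_false_eq_true, Finset.sum_insert, Finset.sum_singleton, Nat.reduceEqDiff] at h1 h2
  rw [hG, hPc] at h2
  have h13 := dvd_pointCount G 13
  have h26 := dvd_pointCount G 26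
  have h3 : pointCount G 1 = 1 ∧ pointCount G 13 = 26 ∧ pointCount G 26 = 0 := by
    rcases hk' with rfl | rfl | rfl <;> norm_num at h2 <;> omega
  refine orbitLengths_eq_of_pointCount hD (by decide) (by decide) ?_
  intro n hn
  simp only [Finset.mem_insert, Finset.mem_singleton] at hn
  rcases hn with rfl | rfl | rfl
  · rw [h3.1]; decide
  · rw [h3.2.1]; decide
  · rw [h3.2.2]; decide

theorem Good.actsTransitively (h : Good G (Fin 27)) (hG : 27 ∣ Nat.card G) :
    ActsTransitively G := by
  refine ⟨fun v w => ?_⟩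
  have h1 := h.three_pow_dvd_ncard_orbit (k := 3) hG v
  have h2 := Nat.le_of_dvd (ncard_orbit_pos (A := G) v) h1
  have h3 : orbit G v = Set.univ := Set.eq_of_subset_of_ncard_le (Set.subset_univ _)
    (by rw [Set.ncard_univ, Nat.card_eq_fintype_card, Fintype.card_fin]; exact h2) (Set.toFinite _)
  have h4 : w ∈ orbit G v := by rw [h3]; trivial
  exact h4

theorem Good.actsFreely (h : Good G (Fin 27)) {k : ℕ} (hG : Nat.card G = 3 ^ k) :
    ActsFreely G := by
  intro v
  have h1 := (h.three_pow_dvd_ncard_orbit (k := k) hG.symm.dvd v)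
  have h2 := ncard_orbit_mul_card_stabilizer (A := G) v
  have h3 := Nat.le_of_dvd (ncard_orbit_pos (A := G) v) h1
  have := h.finite
  rw [← Subgroup.card_eq_one]
  have h4 : 0 < Nat.card (stabilizer G v) := Nat.card_pos
  rw [hG] at h2
  by_contra hne
  have h5 : 3 ^ k * 2 ≤ (orbit G v).ncard * Nat.card (stabilizer G v) :=
    Nat.mul_le_mul h3 (by omega)
  have h6 : 0 < 3 ^ k := by positivity
  omega

theorem Good.orbitLengths_six (h : Good G (Fin 27)) (hG : Nat.card G = 6) :
    orbitLengths G = {6, 6, 6, 3, 3, 3} := by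
  have := h.finite
  have := Fintype.ofFinite G
  have : Fact (Nat.Prime 3) := ⟨Nat.prime_three⟩
  obtain ⟨P⟩ : Nonempty (Sylow 3 G) := inferInstance
  have hd : Nat.card G ∣ 8 * 27 := by rw [hG]; norm_num
  have hPc : Nat.card P = 3 := card_sylow_eq (p := 3) (k := 1) (m := 2) (by rw [hG]; norm_num)
    (by omega) P
  have hPn := h.normal_sylow_three_of_not_iso hd (by omega) (by omega) P
  have hD : ∀ v : Fin 27, (orbit G v).ncard ∈ ({3, 6} : Finset ℕ) := by
    intro v
    have h1 := h.three_pow_dvd_ncard_orbit (k := 1) (by rw [hG]; norm_num) v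
    have h3 := ncard_orbit_pos (A := G) v
    have h4 := ncard_orbit_dvd_card (A := G) v
    rw [hG] at h4
    have h5 := Nat.le_of_dvd (by norm_num) h4
    simp only [Finset.mem_insert, Finset.mem_singleton]
    omega
  obtain ⟨h1, h2⟩ := h.sum_pointCount hD P
    (fun a ha ha1 => h.card_fixedBy_of_mem_three_group P.2 ha ha1)
    (fun a ha => h.card_fixedBy_of_notMem hd P ha)
  rw [Finset.sum_pair (by norm_num)] at h1 h2
  rw [hG, hPc] at h2
  norm_num at h2
  refine orbitLengths_eq_of_pointCount hD (by decide) (by decide) ?_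
  intro n hn
  simp only [Finset.mem_insert, Finset.mem_singleton] at hn
  have h3 : Multiset.count 3 ({6, 6, 6, 3, 3, 3} : Multiset ℕ) = 3 := by decide
  have h6 : Multiset.count 6 ({6, 6, 6, 3, 3, 3} : Multiset ℕ) = 3 := by decide
  rcases hn with rfl | rfl <;> omega

/-- The number of pairs of an element and a fixed point is `27 + 3 * 3 = 36`, since the alternating
group has three involutions and eight elements of order 3. -/
theorem Good.sum_card_fixedBy_alternating {A X : Type*} [Group A] [MulAction A X] [Fintype A]
    (h : Good A X) (φ : alternatingGroup (Fin 4) ≃* A) :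
    ∑ a : A, Nat.card (fixedBy X a) = 36 := by
  have h1 : ∀ d : alternatingGroup (Fin 4), Nat.card (fixedBy X (φ d)) =
      if d = 1 then 27 else if d ^ 2 = 1 then 3 else 0 := by
    intro d
    split_ifs with h1 h2
    · rw [h1, map_one, h.card_fixedBy_one]
    · refine h.card_fixedBy_of_two_dvd ?_
      rw [MulEquiv.orderOf_eq, orderOf_eq_prime h2 h1]
    · have : Fact (Nat.Prime 3) := ⟨Nat.prime_three⟩
      refine h.card_fixedBy_of_three_dvd ?_
      have h3 : ∀ d : alternatingGroup (Fin 4), d ^ 2 = 1 ∨ d ^ 3 = 1 := by decide +kernel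
      rw [MulEquiv.orderOf_eq, orderOf_eq_prime ((h3 d).resolve_left h2) h1]
  rw [← Equiv.sum_comp φ.toEquiv]
  simp only [MulEquiv.toEquiv_eq_coe, EquivLike.coe_coe, h1]
  decide +kernel

theorem card_alternating_four : Nat.card (alternatingGroup (Fin 4)) = 12 := by
  rw [nat_card_alternatingGroup]; simp [Nat.factorial]

theorem Good.orbitLengths_alternating (h : Good G (Fin 27))
    (hG : Iso G (alternatingGroup (Fin 4))) :
    orbitLengths G = {12, 12, 3} := by
  have := h.finite
  have := Fintype.ofFinite G
  have hc : Nat.card G = 12 := by rw [hG.card_eq, card_alternating_four]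
  have hD : ∀ v : Fin 27, (orbit G v).ncard ∈ ({3, 6, 12} : Finset ℕ) := by
    intro v
    have h1 := h.three_pow_dvd_ncard_orbit (k := 1) (by rw [hc]; norm_num) v
    have h3 := ncard_orbit_pos (A := G) v
    have h4 := ncard_orbit_dvd_card (A := G) v
    rw [hc] at h4
    have h5 := Nat.le_of_dvd (by norm_num) h4
    have h6 : (orbit G v).ncard ≠ 9 := fun h6 => by rw [h6] at h4; norm_num at h4
    simp only [Finset.mem_insert, Finset.mem_singleton]
    omega
  obtain ⟨φ⟩ := hG
  obtain ⟨h1, h2⟩ := sum_ncard_orbit hD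
  rw [h.sum_card_fixedBy_alternating φ.symm] at h2
  change ∑ d ∈ _, pointCount G d = _ at h1
  change ∑ d ∈ _, pointCount G d * _ = _ at h2
  simp only [Finset.mem_insert, Finset.mem_singleton, Nat.reduceEqDiff, or_self,
    not_false_eq_true, Finset.sum_insert, Finset.sum_singleton, Fintype.card_fin, hc,
    Nat.reduceDiv] at h1 h2
  have h3 := dvd_pointCount G 3
  have h6 := dvd_pointCount G 6
  have h12 : pointCount G 3 = 3 ∧ pointCount G 6 = 0 ∧ pointCount G 12 = 24 := by omega
  refine orbitLengths_eq_of_pointCount hD (by decide) (by decide) ?_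
  intro n hn
  simp only [Finset.mem_insert, Finset.mem_singleton] at hn
  rcases hn with rfl | rfl | rfl
  · rw [h12.1]; decide
  · rw [h12.2.1]; decide
  · rw [h12.2.2]; decide

theorem Good.orbitLengths_eleven (h : Good G (Fin 27)) (hG : Nat.card G = 11) :
    orbitLengths G = {11, 11, 1, 1, 1, 1, 1} := by
  have : Fact (Nat.Prime 11) := ⟨by norm_num⟩
  have := h.finite
  obtain ⟨x, hx⟩ := exists_prime_orderOf_dvd_card' 11 hG.symm.dvd
  have hGx : G = Subgroup.zpowers (x : S27) :=
    (Subgroup.eq_of_le_of_card_ge (Subgroup.zpowers_le.2 x.2)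
      (by rw [Nat.card_zpowers, Subgroup.orderOf_coe, hx, hG])).symm
  rw [hGx, orbitLengths_zpowers_of_prime (p := 11) (m := 5) (k := 2) (by norm_num)
    (by rw [Subgroup.orderOf_coe, hx]) (h.card_fixedBy_of_eleven hx) (by norm_num)]
  rfl

end

section
variable {G : Subgroup S27}

theorem Good.two_dvd_orderOf (h : Good G (Fin 27)) {k : ℕ} (hG : Nat.card G = 2 ^ k) {a : G}
    (ha : a ≠ 1) : 2 ∣ orderOf a := by
  have := h.finite
  have : Fact (Nat.Prime 2) := ⟨Nat.prime_two⟩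
  exact (IsPGroup.of_card hG).dvd_orderOf ha

theorem Good.sum_pointCount_two (h : Good G (Fin 27)) {k : ℕ} (hG : Nat.card G = 2 ^ k)
    {D : Finset ℕ} (hD : ∀ v : Fin 27, (orbit G v).ncard ∈ D) :
    ∑ d ∈ D, pointCount G d = 27 ∧ ∑ d ∈ D, pointCount G d * (2 ^ k / d) =
      27 + (2 ^ k - 1) * 3 := by
  have := h.finite
  have := Fintype.ofFinite G
  have h1 := h.sum_pointCount hD (⊥ : Subgroup G) (m := 0) (n := 3)
    (fun a ha ha1 => absurd (Subgroup.mem_bot.1 ha) ha1)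
    (fun a ha => h.card_fixedBy_of_two_dvd (h.two_dvd_orderOf hG fun h1 =>
      ha (Subgroup.mem_bot.2 h1)))
  rw [hG, Subgroup.card_bot] at h1
  simpa using h1

theorem Good.ncard_orbit_mem_four (hG : Nat.card G = 4) (v : Fin 27) :
    (orbit G v).ncard ∈ ({1, 2, 4} : Finset ℕ) := by
  have h1 := ncard_orbit_dvd_card (A := G) v
  rw [hG] at h1
  have h2 : (orbit G v).ncard ∈ Nat.divisors 4 := Nat.mem_divisors.2 ⟨h1, by norm_num⟩
  have h3 : Nat.divisors 4 = {1, 2, 4} := by decide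
  rwa [h3] at h2

theorem Good.ncard_orbit_mem_eight (hG : Nat.card G = 8) (v : Fin 27) :
    (orbit G v).ncard ∈ ({1, 2, 4, 8} : Finset ℕ) := by
  have h1 := ncard_orbit_dvd_card (A := G) v
  rw [hG] at h1
  have h2 := mem_divisors_eight h1
  simpa using h2

theorem Good.pointCount_four (h : Good G (Fin 27)) (hG : Nat.card G = 4) :
    pointCount G 1 = 3 ∧ pointCount G 2 = 0 ∧ pointCount G 4 = 24 ∨
    pointCount G 1 = 1 ∧ pointCount G 2 = 6 ∧ pointCount G 4 = 20 := by
  obtain ⟨h1, h2⟩ := h.sum_pointCount_two (k := 2) hG (Good.ncard_orbit_mem_four hG)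
  simp only [Finset.mem_insert, Finset.mem_singleton, Nat.reduceEqDiff, or_self,
    OfNat.one_ne_ofNat, not_false_eq_true, Finset.sum_insert, Finset.sum_singleton,
    Nat.reducePow, Nat.reduceDiv] at h1 h2
  have h3 := dvd_pointCount G 2
  have h4 := dvd_pointCount G 4
  omega

theorem Good.pointCount_eight (h : Good G (Fin 27)) (hG : Nat.card G = 8) :
    pointCount G 1 = 3 ∧ pointCount G 2 = 0 ∧ pointCount G 4 = 0 ∧ pointCount G 8 = 24 ∨
    pointCount G 1 = 1 ∧ pointCount G 2 = 2 ∧ pointCount G 4 = 8 ∧ pointCount G 8 = 16 := by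
  obtain ⟨h1, h2⟩ := h.sum_pointCount_two (k := 3) hG (Good.ncard_orbit_mem_eight hG)
  simp only [Finset.mem_insert, Finset.mem_singleton, Nat.reduceEqDiff, or_self,
    OfNat.one_ne_ofNat, not_false_eq_true, Finset.sum_insert, Finset.sum_singleton,
    Nat.reducePow, Nat.reduceDiv, Nat.reduceSub, Nat.reduceMul, Nat.reduceAdd] at h1 h2
  have h3 := dvd_pointCount G 2
  have h4 := dvd_pointCount G 4
  generalize pointCount G 1 = a at *
  generalize pointCount G 2 = b at *
  generalize pointCount G 4 = c at *
  generalize pointCount G 8 = d at *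
  obtain ⟨b, rfl⟩ := h3
  obtain ⟨c, rfl⟩ := h4
  have ha : a ≤ 3 := by omega
  interval_cases a <;> omega

theorem Good.orbitLengths_four (h : Good G (Fin 27)) (hG : Nat.card G = 4) :
    ((fixedPoints G (Fin 27)).ncard = 3 ∧ orbitLengths G = {4, 4, 4, 4, 4, 4, 1, 1, 1}) ∨
    ((fixedPoints G (Fin 27)).ncard = 1 ∧ orbitLengths G = {4, 4, 4, 4, 4, 2, 2, 2, 1}) := by
  rw [← pointCount_one]
  refine (h.pointCount_four hG).imp (fun ⟨h1, h2, h4⟩ => ⟨h1, ?_⟩) fun ⟨h1, h2, h4⟩ => ⟨h1, ?_⟩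
  all_goals
    refine orbitLengths_eq_of_pointCount (Good.ncard_orbit_mem_four hG) (by decide) (by decide) ?_
    intro n hn
    simp only [Finset.mem_insert, Finset.mem_singleton] at hn
    rcases hn with rfl | rfl | rfl
    · rw [h1]; decide
    · rw [h2]; decide
    · rw [h4]; decide

theorem Good.orbitLengths_eight (h : Good G (Fin 27)) (hG : Nat.card G = 8) :
    ((fixedPoints G (Fin 27)).ncard = 3 ∧ orbitLengths G = {8, 8, 8, 1, 1, 1}) ∨
    ((fixedPoints G (Fin 27)).ncard = 1 ∧ orbitLengths G = {8, 8, 4, 4, 2, 1}) := by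
  rw [← pointCount_one]
  refine (h.pointCount_eight hG).imp (fun ⟨h1, h2, h4, h8⟩ => ⟨h1, ?_⟩)
    fun ⟨h1, h2, h4, h8⟩ => ⟨h1, ?_⟩
  all_goals
    refine orbitLengths_eq_of_pointCount (Good.ncard_orbit_mem_eight hG) (by decide) (by decide) ?_
    intro n hn
    simp only [Finset.mem_insert, Finset.mem_singleton] at hn
    rcases hn with rfl | rfl | rfl | rfl
    · rw [h1]; decide
    · rw [h2]; decide
    · rw [h4]; decide
    · rw [h8]; decide

/-- A central element fixes the orbits of its fixed points pointwise. -/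
theorem Good.ncard_orbit_le_three (h : Good G (Fin 27)) {t : G} (ht : 2 ∣ orderOf t)
    (hc : ∀ g, g * t = t * g) {v : Fin 27} (hv : t • v = v) : (orbit G v).ncard ≤ 3 := by
  rw [← h.card_fixedBy_of_two_dvd ht]
  refine Set.ncard_le_ncard (t := fixedBy (Fin 27) t) ?_ (Set.toFinite _)
  rintro _ ⟨g, rfl⟩
  change t • g • v = g • v
  rw [smul_smul, ← hc, mul_smul, hv]

theorem Good.exists_mem_stabilizer (h : Good G (Fin 27)) {k : ℕ} (hG : Nat.card G = 2 ^ k)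
    {v : Fin 27} (hv : (orbit G v).ncard < 2 ^ k) : ∃ t : G, 2 ∣ orderOf t ∧ t ≠ 1 ∧ t • v = v := by
  have h1 := ncard_orbit_mul_card_stabilizer (A := G) v
  have h2 : stabilizer G v ≠ ⊥ := by
    intro h2
    rw [h2, Subgroup.card_bot] at h1
    omega
  obtain ⟨⟨t, ht⟩, hne⟩ := Subgroup.ne_bot_iff_exists_ne_one.1 h2
  have hne' : t ≠ 1 := fun h3 => hne (Subtype.ext h3)
  exact ⟨t, h.two_dvd_orderOf hG hne', hne', ht⟩

theorem Good.orbitLengths_eight_of_central (h : Good G (Fin 27)) (hG : Nat.card G = 8)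
    (hc : ∀ t : G, t ^ 2 = 1 → ∀ g, g * t = t * g) : orbitLengths G = {8, 8, 8, 1, 1, 1} := by
  rcases h.orbitLengths_eight hG with h1 | ⟨-, h1⟩
  · exact h1.2
  exfalso
  obtain ⟨v, hv⟩ := mem_orbitLengths.1 (h1 ▸ by decide : 4 ∈ orbitLengths G)
  obtain ⟨t, ht, ht1, htv⟩ := h.exists_mem_stabilizer (k := 3) hG (v := v) (by omega)
  -- the stabilizer has order 2
  have h2 := ncard_orbit_mul_card_stabilizer (A := G) v
  rw [hv, hG] at h2
  have h3 : orderOf t ∣ 2 := by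
    have h4 := Subgroup.orderOf_dvd_natCard (stabilizer G v) htv
    rwa [show Nat.card (stabilizer G v) = 2 by omega] at h4
  have h4 := h.ncard_orbit_le_three ht (hc t (orderOf_dvd_iff_pow_eq_one.1 h3)) htv
  omega

theorem Good.fixedPoints_of_cyclic (h : Good G (Fin 27)) (hG : Iso G (Cyc 4)) :
    (fixedPoints G (Fin 27)).ncard = 3 := by
  obtain ⟨φ⟩ := hG
  have hx : orderOf (φ.symm (Multiplicative.ofAdd 1)) = 4 := by
    rw [MulEquiv.orderOf_eq, Cyc.orderOf_gen]
  rw [← h.card_fixedBy_of_two_dvd (a := φ.symm (Multiplicative.ofAdd 1)) (by rw [hx]; norm_num)]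
  change _ = (fixedBy (Fin 27) _).ncard
  congr 1
  ext v
  refine ⟨fun hv => hv _, fun hv g => ?_⟩
  have hle : (⊤ : Subgroup G) ≤ stabilizer G v := by
    have h1 : Subgroup.zpowers (φ.symm (Multiplicative.ofAdd 1)) = ⊤ := by
      have := h.finite
      rw [← Subgroup.card_eq_iff_eq_top, Nat.card_zpowers, hx, Nat.card_congr φ.toEquiv,
        Cyc.natCard]
    rw [← h1, Subgroup.zpowers_le]
    exact hv
  exact hle (Subgroup.mem_top g)

theorem ncard_union_orbit {u v : Fin 27} (huv : orbit G u ≠ orbit G v) :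
    (orbit G u ∪ orbit G v).ncard = (orbit G u).ncard + (orbit G v).ncard :=
  Set.ncard_union_eq ((orbit.eq_or_disjoint u v).resolve_left huv) (Set.toFinite _) (Set.toFinite _)

theorem Good.stabilizer_ne_of_klein (h : Good G (Fin 27)) (hG : Iso G (Fin 2 → Cyc 2))
    {u v : Fin 27} (hu : (orbit G u).ncard = 2) (hv : (orbit G v).ncard = 2)
    (huv : orbit G u ≠ orbit G v) : stabilizer G u ≠ stabilizer G v := by
  intro hs
  have hc : Nat.card G = 2 ^ 2 := by rw [hG.card_eq, pi_cyc_natCard]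
  obtain ⟨φ⟩ := hG
  have hcomm : ∀ a b : G, a * b = b * a := fun a b =>
    φ.injective (by rw [map_mul, map_mul, mul_comm])
  obtain ⟨t, ht, -, htu⟩ := h.exists_mem_stabilizer hc (v := u) (by omega)
  have htv : t • v = v := (hs ▸ (htu : t ∈ stabilizer G u) : t ∈ stabilizer G v)
  have hsub : ∀ w : Fin 27, t • w = w → orbit G w ⊆ fixedBy (Fin 27) t := by
    rintro w hw _ ⟨g, rfl⟩
    change t • g • w = g • w
    rw [smul_smul, hcomm, mul_smul, hw]
  have h1 := Set.ncard_le_ncard (Set.union_subset (hsub u htu) (hsub v htv)) (Set.toFinite _)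
  rw [ncard_union_orbit huv, hu, hv] at h1
  have h2 : (fixedBy (Fin 27) t).ncard = 3 := h.card_fixedBy_of_two_dvd ht
  omega

theorem orderOf_rotation (φ : G ≃* DihedralGroup 4) : orderOf (φ.symm (.r 1)) = 4 := by
  rw [MulEquiv.orderOf_eq, DihedralGroup.orderOf_r_one]

/-- The square of a rotation of order 4 has the same fixed points as the rotation, so its
fixed points lie in orbits of length at most 2. -/
theorem Good.rotation_mem_stabilizer (h : Good G (Fin 27))
    (φ : G ≃* DihedralGroup 4) {v : Fin 27}
    (hv : φ.symm (.r 1) ^ 2 • v = v) : φ.symm (.r 1) • v = v := by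
  have h1 : v ∈ fixedBy (Fin 27) (φ.symm (.r 1) ^ 2) := hv
  rwa [← h.fixedBy_eq_of_four (orderOf_rotation φ)] at h1

theorem Good.ncard_orbit_of_rotation (h : Good G (Fin 27))
    (φ : G ≃* DihedralGroup 4) {v : Fin 27}
    (hv : φ.symm (.r 1) ^ 2 • v = v) : (orbit G v).ncard ≤ 2 := by
  have := h.finite
  have hG : Nat.card G = 8 := by
    rw [Nat.card_congr φ.toEquiv, DihedralGroup.nat_card]
  have h1 := ncard_orbit_mul_card_stabilizer (A := G) v
  have h2 : 4 ∣ Nat.card (stabilizer G v) := by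
    rw [← orderOf_rotation φ]
    exact Subgroup.orderOf_dvd_natCard _ (h.rotation_mem_stabilizer φ hv)
  obtain ⟨c, hc⟩ := h2
  rw [hG, hc] at h1
  have h3 : 4 * ((orbit G v).ncard * c) = 8 := by rw [← h1]; ring
  have h4 : (orbit G v).ncard * c = 2 := by omega
  exact Nat.le_of_dvd (by norm_num) ⟨c, h4.symm⟩

theorem rotation_sq_central (φ : G ≃* DihedralGroup 4) (g : G) :
    g * φ.symm (.r 1) ^ 2 = φ.symm (.r 1) ^ 2 * g := by
  apply φ.injective
  simp only [map_mul, map_pow, MulEquiv.apply_symm_apply]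
  generalize φ g = d
  revert d
  decide

/-- If the stabilizers of points in two orbits of length 4 were conjugate, they could be assumed to
be equal, and their common involution would have four fixed points. -/
theorem Good.not_areConjugate_stabilizer (h : Good G (Fin 27))
    (φ : G ≃* DihedralGroup 4) {u v : Fin 27}
    (hu : (orbit G u).ncard = 4) (hv : (orbit G v).ncard = 4) (huv : orbit G u ≠ orbit G v) :
    ¬ AreConjugate (stabilizer G u) (stabilizer G v) := by
  rintro ⟨g, hg⟩
  have hG : Nat.card G = 2 ^ 3 := by
    rw [Nat.card_congr φ.toEquiv, DihedralGroup.nat_card]; norm_num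
  rw [← stabilizer_smul_eq_stabilizer_map_conj] at hg
  have hu' : orbit G (g • u) = orbit G u := orbit_smul g u
  rw [← hu'] at hu huv
  generalize g • u = w at hg hu huv
  obtain ⟨t, ht, -, htw⟩ := h.exists_mem_stabilizer hG (v := w) (by omega)
  have htv : t • v = v := (hg ▸ (htw : t ∈ stabilizer G w) : t ∈ stabilizer G v)
  set z := φ.symm (.r 1) ^ 2 with hz
  -- `t` fixes the four points `w, z w, v, z v`
  have hzt : ∀ x : Fin 27, t • x = x → t • z • x = z • x := fun x hx => by
    rw [smul_smul, rotation_sq_central φ, mul_smul, hx]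
  have hzne : ∀ x : Fin 27, (orbit G x).ncard = 4 → x ≠ z • x := fun x hx h1 => by
    have := h.ncard_orbit_of_rotation φ h1.symm
    omega
  have h1 : ({w, z • w} ∪ {v, z • v} : Set (Fin 27)).ncard = 4 := by
    rw [Set.ncard_union_eq ?_ (Set.toFinite _) (Set.toFinite _), Set.ncard_pair (hzne w hu),
      Set.ncard_pair (hzne v hv)]
    refine ((orbit.eq_or_disjoint w v).resolve_left huv).mono ?_ ?_
    · rintro x (rfl | rfl)
      · exact mem_orbit_self _
      · exact mem_orbit _ _
    · rintro x (rfl | rfl)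
      · exact mem_orbit_self _
      · exact mem_orbit _ _
  have h2 : (fixedBy (Fin 27) t).ncard = 3 := h.card_fixedBy_of_two_dvd ht
  have h3 : ({w, z • w} ∪ {v, z • v} : Set (Fin 27)) ⊆ fixedBy (Fin 27) t := by
    rintro x ((rfl | rfl) | (rfl | rfl))
    · exact htw
    · exact hzt _ htw
    · exact htv
    · exact hzt _ htv
  have h4 := Set.ncard_le_ncard h3 (Set.toFinite _)
  omega

theorem Good.stabilizer_ne_center (h : Good G (Fin 27))
    (φ : G ≃* DihedralGroup 4) {u : Fin 27}
    (hu : (orbit G u).ncard = 4) : stabilizer G u ≠ Subgroup.center G := by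
  intro hs
  have h1 : φ.symm (.r 1) ^ 2 ∈ stabilizer G u := by
    rw [hs, Subgroup.mem_center_iff]
    exact rotation_sq_central φ
  have h2 := h.ncard_orbit_of_rotation φ h1
  omega

theorem Good.iso_stabilizer_cyc (h : Good G (Fin 27))
    (φ : G ≃* DihedralGroup 4) {w : Fin 27}
    (hw : (orbit G w).ncard = 2) : Iso (stabilizer G w) (Cyc 4) := by
  have := h.finite
  have hG : Nat.card G = 8 := by
    rw [Nat.card_congr φ.toEquiv, DihedralGroup.nat_card]
  have h1 := ncard_orbit_mul_card_stabilizer (A := G) w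
  rw [hw, hG] at h1
  have h2 : φ.symm (.r 1) ^ 2 ∈ stabilizer G w :=
    Subgroup.sq_mem_of_index_two (by rw [index_stabilizer, hw]) _
  have h3 : φ.symm (.r 1) ∈ stabilizer G w := h.rotation_mem_stabilizer φ h2
  exact iso_cyc (x := ⟨φ.symm (.r 1), h3⟩)
    (by rw [Subgroup.orderOf_mk, orderOf_rotation φ]) (by omega)

theorem Good.ncard_fixedPoints_of_card_two (h : Good G (Fin 27)) (hG : Nat.card G = 2) :
    (fixedPoints G (Fin 27)).ncard = 3 := by
  have hD : ∀ v : Fin 27, (orbit G v).ncard ∈ ({1, 2} : Finset ℕ) := by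
    intro v
    have h1 := ncard_orbit_dvd_card (A := G) v
    rw [hG, Nat.dvd_prime Nat.prime_two] at h1
    simpa using h1
  obtain ⟨h1, h2⟩ := h.sum_pointCount_two (k := 1) hG hD
  rw [Finset.sum_pair (by norm_num)] at h1 h2
  rw [← pointCount_one]
  norm_num at h2
  omega

end

/-! ### The group PSU(3, 2) -/

/-- Relations between generators `v`, `w` of an elementary abelian group of order 9 and generators
`x`, `y` of a quaternion group that acts on it. -/
structure HasFrobeniusRelations {A : Type*} [Group A] (v w x y : A) : Prop where
  v_pow : v ^ 3 = 1
  w_pow : w ^ 3 = 1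
  vw : v * w = w * v
  xv : x * v = w * x
  xw : x * w = v⁻¹ * x
  yv : y * v = v * w * y
  yw : y * w = v * w⁻¹ * y
  x_pow : x ^ 4 = 1
  yx : y * x * y⁻¹ = x⁻¹
  yy : y * y = x ^ 2

/-- The automorphism `v ↦ w`, `w ↦ v⁻¹` of the elementary abelian group of order 9. -/
def autX : MulAut (Fin 2 → Cyc 3) where
  toFun n := ![(n 1)⁻¹, n 0]
  invFun n := ![n 1, (n 0)⁻¹]
  left_inv := by unfold Function.LeftInverse; decide
  right_inv := by unfold Function.RightInverse Function.LeftInverse; decide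
  map_mul' := by decide +kernel

/-- The automorphism `v ↦ v w`, `w ↦ v w⁻¹` of the elementary abelian group of order 9. -/
def autY : MulAut (Fin 2 → Cyc 3) where
  toFun n := ![n 0 * n 1, n 0 * (n 1)⁻¹]
  invFun n := ![(n 0)⁻¹ * (n 1)⁻¹, (n 0)⁻¹ * n 1]
  left_inv := by unfold Function.LeftInverse; decide
  right_inv := by unfold Function.RightInverse Function.LeftInverse; decide
  map_mul' := by decide +kernel

theorem autX_pow : autX ^ 4 = 1 := MulEquiv.ext (by decide +kernel)

theorem autY_conj : autY * autX * autY⁻¹ = autX⁻¹ := MulEquiv.ext (by decide +kernel)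

theorem autY_sq : autY * autY = autX ^ 2 := MulEquiv.ext (by decide +kernel)

/-- The action of the quaternion group on the elementary abelian group of order 9. -/
def quaternionAut : QuaternionGroup 2 →* MulAut (Fin 2 → Cyc 3) :=
  quaternionHom autX_pow autY_conj autY_sq

theorem quaternionAut_a (i : ZMod (2 * 2)) : quaternionAut (.a i) = autX ^ i.val := by
  have h := cycHom_natCast (2 * 2) autX autX_pow i.val
  rw [ZMod.natCast_zmod_val] at h
  exact h

theorem quaternionAut_xa (i : ZMod (2 * 2)) : quaternionAut (.xa i) = autY * autX ^ i.val := by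
  have h := cycHom_natCast (2 * 2) autX autX_pow i.val
  rw [ZMod.natCast_zmod_val] at h
  exact congrArg (autY * ·) h

/-- The first of the two standard generators of the elementary abelian group of order 9. -/
def stdGen : Fin 2 → Cyc 3 := ![Multiplicative.ofAdd 1, 1]

theorem exists_quaternionAut_mul_inv {q : QuaternionGroup 2} (hq : q ≠ 1) :
    ∃ m, quaternionAut q m * m⁻¹ = stdGen := by
  obtain i | i := q
  · have h : ∀ i : ZMod (2 * 2), i ≠ 0 → ∃ m, (autX ^ i.val) m * m⁻¹ = stdGen := by
      decide +kernel
    rw [quaternionAut_a]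
    exact h i fun hi => hq (by rw [hi]; rfl)
  · have h : ∀ i : ZMod (2 * 2), ∃ m, (autY * autX ^ i.val) m * m⁻¹ = stdGen := by
      decide +kernel
    rw [quaternionAut_xa]
    exact h i

theorem exists_quaternionAut_eq {n : Fin 2 → Cyc 3} (hn : n ≠ 1) :
    ∃ q, quaternionAut q n = stdGen := by
  have h : ∀ n : Fin 2 → Cyc 3, n ≠ 1 → (∃ i : ZMod (2 * 2), (autX ^ i.val) n = stdGen) ∨
      ∃ i : ZMod (2 * 2), (autY * autX ^ i.val) n = stdGen := by decide +kernel
  rcases h n hn with ⟨i, hi⟩ | ⟨i, hi⟩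
  · exact ⟨.a i, by rw [quaternionAut_a, hi]⟩
  · exact ⟨.xa i, by rw [quaternionAut_xa, hi]⟩

theorem quaternionAut_injective : Function.Injective quaternionAut := by
  rw [injective_iff_map_eq_one]
  intro q hq
  by_contra hq1
  obtain ⟨m, hm⟩ := exists_quaternionAut_mul_inv hq1
  rw [hq, MulAut.one_apply, mul_inv_cancel] at hm
  exact absurd hm (by decide)

/-- Each nontrivial normal subgroup of the semidirect product contains the standard generator. -/
theorem injective_of_stdGen {A : Type*} [Group A]
    (F : (Fin 2 → Cyc 3) ⋊[quaternionAut] QuaternionGroup 2 →* A)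
    (hF : F (SemidirectProduct.inl stdGen) ≠ 1) : Function.Injective F := by
  rw [injective_iff_map_eq_one]
  intro k hk
  by_cases hq : k.right = 1
  · by_contra hk1
    have hn : k.left ≠ 1 := fun h => hk1 (SemidirectProduct.ext h hq)
    obtain ⟨q, hqn⟩ := exists_quaternionAut_eq hn
    have h1 : k = SemidirectProduct.inl k.left := SemidirectProduct.ext rfl hq
    refine hF ?_
    rw [← hqn, SemidirectProduct.inl_aut, ← h1, map_mul, map_mul, hk, mul_one, ← map_mul,
      ← map_mul, mul_inv_cancel, map_one, map_one]
  · obtain ⟨m, hm⟩ := exists_quaternionAut_mul_inv hq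
    refine absurd ?_ hF
    have h1 : SemidirectProduct.inl stdGen =
        k * SemidirectProduct.inl m * k⁻¹ * (SemidirectProduct.inl m)⁻¹ := by
      rw [← hm]
      refine SemidirectProduct.ext ?_ ?_ <;> simp [mul_comm, mul_left_comm]
    rw [h1, map_mul, map_mul, map_mul, map_inv, hk]
    simp

theorem pi_cyc_hom_ext {M : Type*} [Group M] {f g : (Fin 2 → Cyc 3) →* M}
    (h0 : f ![Multiplicative.ofAdd 1, 1] = g ![Multiplicative.ofAdd 1, 1])
    (h1 : f ![1, Multiplicative.ofAdd 1] = g ![1, Multiplicative.ofAdd 1]) : f = g := by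
  refine MonoidHom.ext fun n => ?_
  have h : ∀ n : Fin 2 → Cyc 3, n = ![Multiplicative.ofAdd 1, 1] ^ (n 0).toAdd.val *
      ![1, Multiplicative.ofAdd 1] ^ (n 1).toAdd.val := by decide +kernel
  rw [h n, map_mul, map_mul, map_pow, map_pow, map_pow, map_pow, h0, h1]

theorem QuaternionGroup.induction_generators {p : QuaternionGroup 2 → Prop} (hx : p (.a 1))
    (hy : p (.xa 0)) (h1 : p 1) (hmul : ∀ a b, p a → p b → p (a * b)) (q) : p q := by
  have h2 : ∀ k : ℕ, p (.a k) := by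
    intro k
    induction k with
    | zero => simpa using h1
    | succ k ih =>
      have := hmul _ _ ih hx
      rwa [QuaternionGroup.a_mul_a, ← Nat.cast_succ] at this
  have h3 : ∀ i : ZMod (2 * 2), p (.a i) := fun i => by
    have := h2 i.val
    rwa [ZMod.natCast_zmod_val] at this
  obtain i | i := q
  · exact h3 i
  · have := hmul _ _ hy (h3 i)
    rwa [QuaternionGroup.xa_mul_a, zero_add] at this

/-- The homomorphism from the elementary abelian group of order 9 that sends the standard
generators to two given commuting elements of exponent 3. -/
def pairHom {A : Type*} [Group A] {v w : A} (hv : v ^ 3 = 1) (hw : w ^ 3 = 1)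
    (hvw : v * w = w * v) : (Fin 2 → Cyc 3) →* A :=
  MonoidHom.mk' (fun n => cycHom 3 v hv (n 0) * cycHom 3 w hw (n 1)) (by
    intro a b
    have hcomm : Commute (cycHom 3 v hv (b 0)) (cycHom 3 w hw (a 1)) := by
      obtain ⟨i, hi⟩ := Subgroup.mem_zpowers_iff.1 (cycHom_mem_zpowers 3 v hv (b 0))
      obtain ⟨j, hj⟩ := Subgroup.mem_zpowers_iff.1 (cycHom_mem_zpowers 3 w hw (a 1))
      rw [← hi, ← hj]
      exact (show Commute v w from hvw).zpow_zpow i j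
    simp only [Pi.mul_apply, map_mul]
    rw [mul_assoc, ← mul_assoc (cycHom 3 v hv (b 0)), hcomm.eq]
    simp only [mul_assoc])

theorem pairHom_fst {A : Type*} [Group A] {v w : A} (hv : v ^ 3 = 1) (hw : w ^ 3 = 1)
    (hvw : v * w = w * v) : pairHom hv hw hvw ![Multiplicative.ofAdd 1, 1] = v := by
  have h1 : cycHom 3 w hw (1 : Cyc 3) = 1 := map_one _
  change cycHom 3 v hv (Multiplicative.ofAdd 1) * cycHom 3 w hw (1 : Cyc 3) = v
  rw [h1, mul_one]
  exact cycHom_gen 3 v hv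

theorem pairHom_snd {A : Type*} [Group A] {v w : A} (hv : v ^ 3 = 1) (hw : w ^ 3 = 1)
    (hvw : v * w = w * v) : pairHom hv hw hvw ![1, Multiplicative.ofAdd 1] = w := by
  have h1 : cycHom 3 v hv (1 : Cyc 3) = 1 := map_one _
  change cycHom 3 v hv (1 : Cyc 3) * cycHom 3 w hw (Multiplicative.ofAdd 1) = w
  rw [h1, one_mul]
  exact cycHom_gen 3 w hw

/-- The relations define a homomorphism from the semidirect product of order 72. It is injective
because `v` is nontrivial, hence an isomorphism. -/
theorem HasFrobeniusRelations.iso {A : Type*} [Group A] [Finite A] {v w x y : A}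
    (h : HasFrobeniusRelations v w x y) (hv : v ≠ 1) (hA : Nat.card A ≤ 72) :
    Iso A ((Fin 2 → Cyc 3) ⋊[quaternionAut] QuaternionGroup 2) := by
  let f : (Fin 2 → Cyc 3) →* A := pairHom h.v_pow h.w_pow h.vw
  have hf0 : f ![Multiplicative.ofAdd 1, 1] = v := pairHom_fst h.v_pow h.w_pow h.vw
  have hf1 : f ![1, Multiplicative.ofAdd 1] = w := pairHom_snd h.v_pow h.w_pow h.vw
  let g : QuaternionGroup 2 →* A := quaternionHom h.x_pow h.yx h.yy
  have hx : g (.a 1) = x := quaternionHom_a_one h.x_pow h.yx h.yy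
  have hy : g (.xa 0) = y := quaternionHom_xa_zero h.x_pow h.yx h.yy
  -- `f` is equivariant; this is checked on generators of both groups
  have hc : ∀ q, f.comp (quaternionAut q).toMonoidHom =
      (MulAut.conj (g q)).toMonoidHom.comp f := by
    refine QuaternionGroup.induction_generators ?_ ?_ ?_ ?_
    · have h1 : quaternionAut (.a 1) = autX := quaternionHom_a_one autX_pow autY_conj autY_sq
      rw [h1, hx]
      refine pi_cyc_hom_ext ?_ ?_
      · change f (autX _) = x * f _ * x⁻¹
        rw [show autX ![Multiplicative.ofAdd 1, 1] = ![1, Multiplicative.ofAdd 1] by decide,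
          hf0, hf1, h.xv, mul_inv_cancel_right]
      · change f (autX _) = x * f _ * x⁻¹
        rw [show autX ![1, Multiplicative.ofAdd 1] = ![Multiplicative.ofAdd 1, 1]⁻¹ by decide,
          map_inv, hf0, hf1, h.xw, mul_inv_cancel_right]
    · have h1 : quaternionAut (.xa 0) = autY := quaternionHom_xa_zero autX_pow autY_conj autY_sq
      rw [h1, hy]
      refine pi_cyc_hom_ext ?_ ?_
      · change f (autY _) = y * f _ * y⁻¹
        rw [show autY ![Multiplicative.ofAdd 1, 1] =
          ![Multiplicative.ofAdd 1, 1] * ![1, Multiplicative.ofAdd 1] by decide,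
          map_mul, hf0, hf1, h.yv, mul_inv_cancel_right]
      · change f (autY _) = y * f _ * y⁻¹
        rw [show autY ![1, Multiplicative.ofAdd 1] =
          ![Multiplicative.ofAdd 1, 1] * ![1, Multiplicative.ofAdd 1]⁻¹ by decide,
          map_mul, map_inv, hf0, hf1, h.yw, mul_inv_cancel_right]
    · ext n
      simp
    · intro a b ha hb
      refine MonoidHom.ext fun n => ?_
      have h1 := DFunLike.congr_fun ha (quaternionAut b n)
      have h2 := DFunLike.congr_fun hb n
      change f (quaternionAut a (quaternionAut b n)) = g a * f (quaternionAut b n) * (g a)⁻¹ at h1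
      change f (quaternionAut b n) = g b * f n * (g b)⁻¹ at h2
      change f (quaternionAut (a * b) n) = g (a * b) * f n * (g (a * b))⁻¹
      rw [map_mul, MulAut.mul_apply, h1, h2, map_mul, mul_inv_rev]
      simp only [mul_assoc]
  refine iso_of_injective (SemidirectProduct.lift f g hc) (injective_of_stdGen _ ?_) ?_
  · rw [SemidirectProduct.lift_inl]
    change f ![Multiplicative.ofAdd 1, 1] ≠ 1
    rwa [hf0]
  · rw [SemidirectProduct.card, pi_cyc_natCard, Nat.card_eq_fintype_card (α := QuaternionGroup 2),
      QuaternionGroup.card]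
    exact hA

set_option synthInstance.maxHeartbeats 400000 in
set_option synthInstance.maxSize 2000 in
/-- In the plane over the field with three elements, a vector outside two distinct lines is
a sum of nonzero vectors on them. -/
theorem mem_of_notMem_lines : ∀ w u : Fin 2 → Cyc 3,
    w ∉ ({1, stdGen, stdGen⁻¹} : Finset (Fin 2 → Cyc 3)) →
    u ∉ ({1, stdGen, stdGen⁻¹, w, w⁻¹} : Finset (Fin 2 → Cyc 3)) →
    u ∈ ({stdGen * w, stdGen * w⁻¹, stdGen⁻¹ * w, stdGen⁻¹ * w⁻¹} : Finset (Fin 2 → Cyc 3)) := by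
  decide +kernel

/-- The quaternion group acts on the normal subgroup of order 9 without fixed
points, hence transitively on its nontrivial elements; this gives the standard relations. -/
theorem Good.exists_frobeniusRelations {A X : Type*} [Group A] [MulAction A X] (h : Good A X)
    (hA : IsFaithfulSemidirect A (Fin 2 → Cyc 3) (QuaternionGroup 2)) :
    ∃ v w x y : A, HasFrobeniusRelations v w x y ∧ v ≠ 1 := by
  have := h.finite
  obtain ⟨φ, -, ⟨ψ⟩⟩ := hA
  let i : (Fin 2 → Cyc 3) →* A := ψ.symm.toMonoidHom.comp SemidirectProduct.inl
  let j : QuaternionGroup 2 →* A := ψ.symm.toMonoidHom.comp SemidirectProduct.inr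
  have hi : Function.Injective i := ψ.symm.injective.comp SemidirectProduct.inl_injective
  have hj : Function.Injective j := ψ.symm.injective.comp SemidirectProduct.inr_injective
  have hij : ∀ q n, j q * i n = i (φ q n) * j q := by
    intro q n
    have h1 := congrArg ψ.symm (SemidirectProduct.inl_aut (φ := φ) q n)
    rw [map_mul, map_mul, map_inv, map_inv, eq_mul_inv_iff_mul_eq] at h1
    exact h1.symm
  have hP : IsPGroup 3 i.range := by
    rintro ⟨_, n, rfl⟩
    exact ⟨1, Subtype.ext (by
      change i n ^ 3 ^ 1 = 1
      rw [pow_one, ← map_pow, pi_cyc_pow, map_one])⟩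
  have hQ : IsPGroup 2 j.range := IsPGroup.of_card (n := 3) (by
    rw [← Nat.card_congr (j.ofInjective hj).toEquiv, Nat.card_eq_fintype_card,
      QuaternionGroup.card]; norm_num)
  -- elements of orders 2 and 3 do not commute, so the quaternion group acts without fixed points
  have hfree : ∀ q n, q ≠ 1 → n ≠ 1 → φ q n ≠ n := by
    intro q n hq hn hqn
    refine hq (hj ?_)
    rw [map_one]
    refine h.eq_one_of_commute hP hQ ⟨q, rfl⟩ ⟨n, rfl⟩ (fun h1 => hn (hi (by rw [h1, map_one]))) ?_
    rw [hij, hqn]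
  have hinv : ∀ n, φ (.a 2) n = n⁻¹ := by
    intro n
    have hz : orderOf (j (.a 2)) = 2 := by
      rw [orderOf_injective j hj]
      exact orderOf_eq_prime (by decide) (by decide)
    have h1 := h.conj_eq_inv (by decide) hP hz (by
      rintro _ ⟨m, rfl⟩
      exact ⟨φ (.a 2) m, by rw [hij, mul_inv_cancel_right]⟩) (i n) ⟨n, rfl⟩
    rw [hij, mul_inv_cancel_right, ← map_inv] at h1
    exact hi h1
  -- `a` and `b` are the automorphisms given by the generators of the quaternion group
  set v : Fin 2 → Cyc 3 := stdGen with hv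
  set a := φ (.a 1) with ha
  set b := φ (.xa 0) with hb
  set w := a v with hw
  have hv1 : v ≠ 1 := by decide
  have haa : ∀ n, a (a n) = n⁻¹ := fun n => by
    rw [← hinv, ha, ← MulAut.mul_apply, ← map_mul]; rfl
  have haw : a w = v⁻¹ := haa v
  have hba : ∀ n, a (b (a n)) = b n := fun n => by
    rw [ha, hb, ← MulAut.mul_apply, ← MulAut.mul_apply, ← map_mul, ← map_mul]
    rfl
  have hbw : a (b w) = b v := hba v
  have hai : ∀ m n, a m = n → m = a n⁻¹ := fun m n hmn => by
    rw [← hmn, ← map_inv, haa, inv_inv]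
  have hbw' : b w = a (b v)⁻¹ := hai _ _ hbw
  have hw1 : w ≠ v := hfree _ _ (by decide) hv1
  have hw2 : w ≠ v⁻¹ := by
    rw [← hinv]
    intro h1
    refine hfree (.a 3) v (by decide) hv1 ?_
    have h2 : φ (.a 3) v = φ (.a 2) (φ (.a 1) v) := by rw [← MulAut.mul_apply, ← map_mul]; rfl
    rw [h2, ← ha, ← hw, h1, hinv, hinv, inv_inv]
  have hw0 : w ≠ 1 := fun h1 => hv1 (a.injective (by rw [← hw, h1, map_one]))
  have hu0 : b v ≠ 1 := fun h1 => hv1 (b.injective (by rw [h1, map_one]))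
  have hu1 : b v ≠ v := hfree _ _ (by decide) hv1
  have hu2 : b v ≠ v⁻¹ := by
    rw [← hinv]
    intro h1
    refine hfree (.xa 2) v (by decide) hv1 ?_
    have h2 : φ (.xa 2) v = φ (.a 2) (φ (.xa 0) v) := by rw [← MulAut.mul_apply, ← map_mul]; rfl
    rw [h2, ← hb, h1, hinv, hinv, inv_inv]
  have hu3 : b v ≠ w := by
    intro h1
    refine hfree (.xa 1) v (by decide) hv1 ?_
    have h2 : φ (.xa 1) v = φ (.a 3) (φ (.xa 0) v) := by rw [← MulAut.mul_apply, ← map_mul]; rfl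
    rw [h2, ← hb, h1, hw, ha, ← MulAut.mul_apply, ← map_mul]
    exact DFunLike.congr_fun (map_one φ) v
  have hu4 : b v ≠ w⁻¹ := by
    intro h1
    refine hfree (.xa 3) v (by decide) hv1 ?_
    have h2 : φ (.xa 3) v = φ (.a 1) (φ (.xa 0) v) := by rw [← MulAut.mul_apply, ← map_mul]; rfl
    rw [h2, ← hb, ← ha, h1, map_inv, haw, inv_inv]
  -- one of the elements `y x ^ k` maps `v` to `v w`
  obtain ⟨k, hk⟩ : ∃ k, φ (.xa k) v = v * w := by
    have h0 := mem_of_notMem_lines w (b v) (by simp [hw0, hw1, hw2, ← hv])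
      (by simp [hu0, hu1, hu2, hu3, hu4, ← hv])
    simp only [Finset.mem_insert, Finset.mem_singleton, ← hv] at h0
    rcases h0 with h1 | h1 | h1 | h1
    · exact ⟨0, h1⟩
    · refine ⟨3, ?_⟩
      have h2 : φ (.xa 3) v = φ (.xa 0) (φ (.a 2) (φ (.a 1) v)) := by
        rw [← MulAut.mul_apply, ← MulAut.mul_apply, ← map_mul, ← map_mul]; rfl
      rw [h2, ← ha, ← hw, hinv, map_inv, ← hb, hbw', h1, mul_inv_rev, inv_inv, map_mul, map_inv,
        haw, ← hw, mul_inv_rev, inv_inv, inv_inv, mul_comm]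
    · refine ⟨1, ?_⟩
      have h2 : φ (.xa 1) v = φ (.xa 0) (φ (.a 1) v) := by
        rw [← MulAut.mul_apply, ← map_mul]; rfl
      rw [h2, ← ha, ← hw, ← hb, hbw', h1, mul_inv_rev, inv_inv, map_mul, map_inv, haw, inv_inv]
    · refine ⟨2, ?_⟩
      have h2 : φ (.xa 2) v = φ (.xa 0) (φ (.a 2) v) := by
        rw [← MulAut.mul_apply, ← map_mul]; rfl
      rw [h2, hinv, map_inv, ← hb, h1, mul_inv_rev, inv_inv, inv_inv, mul_comm]
  have hkw : φ (.xa k) w = v * w⁻¹ := by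
    have h1 : a (φ (.xa k) w) = v * w := by
      rw [← hk, hw, ha, ← MulAut.mul_apply, ← MulAut.mul_apply, ← map_mul, ← map_mul]
      congr 2
      change QuaternionGroup.xa (k - 1 + 1) = .xa k
      rw [sub_add_cancel]
    rw [hai _ _ h1, mul_inv_rev, map_mul, map_inv, map_inv, haw, inv_inv, ← hw]
  refine ⟨i v, i w, j (.a 1), j (.xa k), ?_, fun h1 => hv1 (hi (by rw [h1, map_one]))⟩
  constructor
  · rw [← map_pow, pi_cyc_pow, map_one]
  · rw [← map_pow, pi_cyc_pow, map_one]
  · rw [← map_mul, mul_comm, map_mul]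
  · rw [hij]
  · rw [hij, ← ha, haw, map_inv]
  · rw [hij, hk, map_mul]
  · rw [hij, hkw, map_mul, map_inv]
  · rw [← map_pow, ← map_one j]; rfl
  · have h1 : ∀ k : ZMod (2 * 2), QuaternionGroup.xa k * QuaternionGroup.a 1 *
        (QuaternionGroup.xa k)⁻¹ = (QuaternionGroup.a 1)⁻¹ := by decide
    rw [← map_inv, ← map_inv, ← map_mul, ← map_mul, h1]
  · have h1 : ∀ k : ZMod (2 * 2), QuaternionGroup.xa k * QuaternionGroup.xa k =
        QuaternionGroup.a 1 ^ 2 := by decide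
    rw [← map_pow, ← map_mul, h1]

/-- The field with four elements, in which identities can be checked by evaluation. -/
abbrev F4 : Type := QuadraticAlgebra (ZMod 2) 1 1

instance : Fintype F4 := Fintype.ofEquiv _ (QuadraticAlgebra.equivProd (1 : ZMod 2) 1).symm

instance : Fact (∀ r : ZMod 2, r ^ 2 ≠ 1 + 1 * r) := ⟨by decide⟩

theorem card_F4 : Fintype.card F4 = 4 := by decide +kernel

theorem nonempty_ringEquiv_F4 : Nonempty (F4 ≃+* GaloisField 2 2) := by
  have := Fintype.ofFinite (GaloisField 2 2)
  exact ⟨FiniteField.ringEquivOfCardEq (by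
    rw [card_F4, ← Nat.card_eq_fintype_card, GaloisField.card 2 2 (by norm_num)]; norm_num)⟩

/-- The standard hermitian form on the space of triples over the field with four elements. -/
def herm (u v : F4 × F4 × F4) : F4 := u.1 ^ 2 * v.1 + u.2.1 ^ 2 * v.2.1 + u.2.2 ^ 2 * v.2.2

theorem card_orthonormal_pairs :
    (Finset.univ.filter fun p : (F4 × F4 × F4) × (F4 × F4 × F4) =>
      herm p.1 p.1 = 1 ∧ herm p.1 p.2 = 0 ∧ herm p.2 p.2 = 1).card = 216 := by
  decide +kernel

theorem SU.entry (U : SU 3 2) (i j : Fin 3) :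
    ∑ k, (U : Matrix.SpecialLinearGroup (Fin 3) (GaloisField 2 2)) k i ^ 2 *
      (U : Matrix.SpecialLinearGroup (Fin 3) (GaloisField 2 2)) k j = if i = j then 1 else 0 := by
  have h : _ * _ = (1 : Matrix (Fin 3) (Fin 3) (GaloisField 2 2)) := U.2
  have h1 := congrFun (congrFun h i) j
  rw [Matrix.mul_apply, Matrix.one_apply] at h1
  exact h1

/-- A unitary matrix of determinant 1 is determined by its first two columns. -/
theorem SU.ext_columns {U U' : SU 3 2}
    (h : ∀ k (j : Fin 3), j ≠ 2 → (U : Matrix.SpecialLinearGroup (Fin 3) (GaloisField 2 2)) k j =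
      (U' : Matrix.SpecialLinearGroup (Fin 3) (GaloisField 2 2)) k j) : U = U' := by
  have key : ∀ U : SU 3 2, ∀ k,
      (U : Matrix.SpecialLinearGroup (Fin 3) (GaloisField 2 2)) k 2 ^ 2 =
      ((U : Matrix.SpecialLinearGroup (Fin 3) (GaloisField 2 2)) :
        Matrix (Fin 3) (Fin 3) (GaloisField 2 2)).adjugate 2 k := by
    intro U k
    have h1 : _ * _ = (1 : Matrix (Fin 3) (Fin 3) (GaloisField 2 2)) := U.2
    have h2 := Matrix.mul_adjugate
      ((U : Matrix.SpecialLinearGroup (Fin 3) (GaloisField 2 2)) :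
        Matrix (Fin 3) (Fin 3) (GaloisField 2 2))
    rw [Matrix.SpecialLinearGroup.det_coe, one_smul] at h2
    have h3 := left_inv_eq_right_inv h1 h2
    rw [← h3]
    rfl
  refine Subtype.ext (Subtype.ext (Matrix.ext fun k j => ?_))
  by_cases hj : j = 2
  · subst hj
    refine frobenius_inj (GaloisField 2 2) 2 ?_
    rw [frobenius_def, frobenius_def, key U k, key U' k]
    have h0 := fun k => h k 0 (by decide)
    have h1 := fun k => h k 1 (by decide)
    rw [Matrix.adjugate_fin_three, Matrix.adjugate_fin_three]
    fin_cases k <;> simp [h0, h1]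
  · exact h k j hj

/-- The first two columns of a unitary matrix form one of the 216 orthonormal pairs, and determine
the third column if the determinant is 1. -/
theorem card_SU_le : Nat.card (SU 3 2) ≤ 216 := by
  obtain ⟨e⟩ := nonempty_ringEquiv_F4
  let c : SU 3 2 → Fin 3 → F4 × F4 × F4 := fun U j =>
    (e.symm ((U : Matrix.SpecialLinearGroup (Fin 3) (GaloisField 2 2)) 0 j),
      e.symm ((U : Matrix.SpecialLinearGroup (Fin 3) (GaloisField 2 2)) 1 j),
      e.symm ((U : Matrix.SpecialLinearGroup (Fin 3) (GaloisField 2 2)) 2 j))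
  have hherm : ∀ U i j, herm (c U i) (c U j) = if i = j then 1 else 0 := by
    intro U i j
    have h1 := congrArg e.symm (SU.entry U i j)
    rw [Fin.sum_univ_three] at h1
    simp only [map_add, map_mul, map_pow] at h1
    refine h1.trans ?_
    split_ifs <;> simp
  let F : SU 3 2 → {p : (F4 × F4 × F4) × (F4 × F4 × F4) //
      herm p.1 p.1 = 1 ∧ herm p.1 p.2 = 0 ∧ herm p.2 p.2 = 1} := fun U =>
    ⟨(c U 0, c U 1), by rw [hherm, if_pos rfl], by rw [hherm, if_neg (by decide)],
      by rw [hherm, if_pos rfl]⟩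
  have hF : Function.Injective F := by
    intro U U' hUU
    have h0 : c U 0 = c U' 0 := congrArg (fun p => p.1.1) hUU
    have h1 : c U 1 = c U' 1 := congrArg (fun p => p.1.2) hUU
    have key : ∀ j, c U j = c U' j → ∀ k,
        (U : Matrix.SpecialLinearGroup (Fin 3) (GaloisField 2 2)) k j =
        (U' : Matrix.SpecialLinearGroup (Fin 3) (GaloisField 2 2)) k j := by
      intro j hj k
      have h2 := congrArg Prod.fst hj
      have h3 := congrArg (fun p => p.2.1) hj
      have h4 := congrArg (fun p => p.2.2) hj
      fin_cases k
      · exact e.symm.injective h2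
      · exact e.symm.injective h3
      · exact e.symm.injective h4
    refine SU.ext_columns fun k j hj => ?_
    fin_cases j
    · exact key 0 h0 k
    · exact key 1 h1 k
    · exact absurd rfl hj
  have h1 := Nat.card_le_card_of_injective F hF
  refine h1.trans (le_of_eq ?_)
  rw [Nat.card_eq_fintype_card, Fintype.card_subtype, card_orthonormal_pairs]

/-- The inclusion of the special unitary group in the matrices. -/
def SU.toMatrix : SU 3 2 →* Matrix (Fin 3) (Fin 3) (GaloisField 2 2) where
  toFun U := U.1.1
  map_one' := rfl
  map_mul' _ _ := rfl

theorem SU.toMatrix_injective : Function.Injective SU.toMatrix := fun _ _ h =>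
  Subtype.ext (Subtype.ext h)

theorem SU.exists_toMatrix_eq (e : F4 ≃+* GaloisField 2 2) {M : Matrix (Fin 3) (Fin 3) F4}
    (hd : M.det = 1) (hM : (M.map (· ^ 2)).transpose * M = 1) :
    ∃ U : SU 3 2, SU.toMatrix U = e.toRingHom.mapMatrix M := by
  refine ⟨⟨⟨e.toRingHom.mapMatrix M, by rw [← RingHom.map_det, hd, map_one]⟩, ?_⟩, rfl⟩
  have h1 := congrArg e.toRingHom.mapMatrix hM
  rw [map_mul, map_one] at h1
  refine Eq.trans ?_ h1
  congr 1
  ext i j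
  exact (map_pow e (M j i) 2).symm

/-- A primitive element of the field with four elements. -/
def omega4 : F4 := ⟨0, 1⟩

/-- A diagonal matrix. -/
def matV : Matrix (Fin 3) (Fin 3) F4 := !![1, 0, 0; 0, omega4, 0; 0, 0, omega4 ^ 2]

/-- A cyclic permutation matrix. -/
def matW : Matrix (Fin 3) (Fin 3) F4 := !![0, 0, 1; 1, 0, 0; 0, 1, 0]

/-- The matrix of the discrete Fourier transform, which maps `matV` to `matW`. -/
def matX : Matrix (Fin 3) (Fin 3) F4 :=
  !![1, 1, 1; 1, omega4 ^ 2, omega4; 1, omega4, omega4 ^ 2]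

/-- A unitary matrix that maps `matV` to `matV * matW` up to a scalar. -/
def matY : Matrix (Fin 3) (Fin 3) F4 :=
  !![1, omega4, omega4; omega4 ^ 2, omega4 ^ 2, omega4; omega4 ^ 2, omega4, omega4 ^ 2]

/-- A scalar matrix. -/
def matZ : Matrix (Fin 3) (Fin 3) F4 := omega4 • 1

/-- Diagonal matrices and permutation matrices generate an extraspecial group, and two further
unitary matrices act on it as a quaternion group modulo scalars. -/
theorem SU.exists_generators : ∃ V W X Y Z : SU 3 2, Z ∈ Subgroup.center (SU 3 2) ∧ Z ≠ 1 ∧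
    Z ^ 3 = 1 ∧ V ^ 3 = 1 ∧ W ^ 3 = 1 ∧ X ^ 4 = 1 ∧ V * W = Z * (W * V) ∧ X * V = W * X ∧
    V * (X * W) = X ∧ Y * V = Z * (V * W * Y) ∧ Y * W = Z * Z * (V * (W * W) * Y) ∧
    X * (Y * X) = Y ∧ Y * Y = X * X := by
  obtain ⟨e⟩ := nonempty_ringEquiv_F4
  obtain ⟨V, hV⟩ := SU.exists_toMatrix_eq e (M := matV) (by decide +kernel) (by decide +kernel)
  obtain ⟨W, hW⟩ := SU.exists_toMatrix_eq e (M := matW) (by decide +kernel) (by decide +kernel)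
  obtain ⟨X, hX⟩ := SU.exists_toMatrix_eq e (M := matX) (by decide +kernel) (by decide +kernel)
  obtain ⟨Y, hY⟩ := SU.exists_toMatrix_eq e (M := matY) (by decide +kernel) (by decide +kernel)
  obtain ⟨Z, hZ⟩ := SU.exists_toMatrix_eq e (M := matZ) (by decide +kernel) (by decide +kernel)
  -- an identity between the matrices over `F4` is transported along the isomorphism of fields
  have key : ∀ {U U' : SU 3 2} {M M' : Matrix (Fin 3) (Fin 3) F4},
      SU.toMatrix U = e.toRingHom.mapMatrix M → SU.toMatrix U' = e.toRingHom.mapMatrix M' →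
      M = M' → U = U' := fun hU hU' hM => SU.toMatrix_injective (by rw [hU, hU', hM])
  have hmul : ∀ {U U' : SU 3 2} {M M' : Matrix (Fin 3) (Fin 3) F4},
      SU.toMatrix U = e.toRingHom.mapMatrix M → SU.toMatrix U' = e.toRingHom.mapMatrix M' →
      SU.toMatrix (U * U') = e.toRingHom.mapMatrix (M * M') := fun hU hU' => by
    rw [map_mul, map_mul, hU, hU']
  have hpow : ∀ {U : SU 3 2} {M : Matrix (Fin 3) (Fin 3) F4} (n : ℕ),
      SU.toMatrix U = e.toRingHom.mapMatrix M →
      SU.toMatrix (U ^ n) = e.toRingHom.mapMatrix (M ^ n) := fun n hU => by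
    rw [map_pow, map_pow, hU]
  have hone : SU.toMatrix 1 = e.toRingHom.mapMatrix (1 : Matrix (Fin 3) (Fin 3) F4) := by
    rw [map_one, map_one]
  refine ⟨V, W, X, Y, Z, ?_, ?_, key (hpow 3 hZ) hone (by decide +kernel),
    key (hpow 3 hV) hone (by decide +kernel), key (hpow 3 hW) hone (by decide +kernel),
    key (hpow 4 hX) hone (by decide +kernel),
    key (hmul hV hW) (hmul hZ (hmul hW hV)) (by decide +kernel),
    key (hmul hX hV) (hmul hW hX) (by decide +kernel),
    key (hmul hV (hmul hX hW)) hX (by decide +kernel),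
    key (hmul hY hV) (hmul hZ (hmul (hmul hV hW) hY)) (by decide +kernel),
    key (hmul hY hW) (hmul (hmul hZ hZ) (hmul (hmul hV (hmul hW hW)) hY)) (by decide +kernel),
    key (hmul hX (hmul hY hX)) hY (by decide +kernel),
    key (hmul hY hY) (hmul hX hX) (by decide +kernel)⟩
  · rw [Subgroup.mem_center_iff]
    intro U
    refine SU.toMatrix_injective ?_
    have h1 : e.toRingHom.mapMatrix matZ =
        e omega4 • (1 : Matrix (Fin 3) (Fin 3) (GaloisField 2 2)) := by
      ext i j
      change e (omega4 • (1 : Matrix (Fin 3) (Fin 3) F4) i j) = _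
      rw [smul_eq_mul, map_mul, Matrix.smul_apply, smul_eq_mul, Matrix.one_apply, Matrix.one_apply]
      split_ifs <;> simp
    rw [map_mul, map_mul, hZ, h1, Matrix.mul_smul, Matrix.smul_mul, mul_one, one_mul]
  · intro h1
    rw [h1, hone] at hZ
    have h2 : (1 : Matrix (Fin 3) (Fin 3) F4) = matZ := Matrix.map_injective e.injective hZ
    revert h2
    decide +kernel

theorem exists_frobeniusRelations_PSU :
    ∃ v w x y : PSU 3 2, HasFrobeniusRelations v w x y ∧ v ≠ 1 := by
  obtain ⟨V, W, X, Y, Z, hZc, hZ1, -, hV, hW, hX, hVW, hXV, hVXW, hYV, hYW, hXYX, hYY⟩ :=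
    SU.exists_generators
  let π : SU 3 2 →* PSU 3 2 := QuotientGroup.mk' _
  have hπ : π Z = 1 := (QuotientGroup.eq_one_iff Z).2 hZc
  have hW' : π W ^ 3 = 1 := by rw [← map_pow, hW, map_one]
  refine ⟨π V, π W, π X, π Y, ⟨by rw [← map_pow, hV, map_one], hW', ?_, ?_, ?_, ?_, ?_,
    by rw [← map_pow, hX, map_one], ?_, ?_⟩, ?_⟩
  · rw [← map_mul, hVW, map_mul, hπ, one_mul, map_mul]
  · rw [← map_mul, hXV, map_mul]
  · rw [eq_inv_mul_iff_mul_eq, ← map_mul, ← map_mul, hVXW]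
  · rw [← map_mul, hYV, map_mul, hπ, one_mul, map_mul, map_mul]
  · have h1 : (π W)⁻¹ = π W * π W := inv_eq_of_mul_eq_one_left (by
      rw [← hW', pow_succ, pow_two])
    rw [← map_mul, hYW, map_mul, map_mul, hπ, one_mul, one_mul, map_mul, map_mul, map_mul, h1]
  · rw [mul_inv_eq_iff_eq_mul, eq_inv_mul_iff_mul_eq, ← map_mul, ← map_mul, hXYX]
  · rw [← map_mul, hYY, map_mul, pow_two]
  · intro h1
    have h2 := Subgroup.mem_center_iff.1 ((QuotientGroup.eq_one_iff V).1 h1) W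
    rw [h2] at hVW
    exact hZ1 (right_eq_mul.1 hVW)

theorem card_PSU_le : Nat.card (PSU 3 2) ≤ 72 := by
  obtain ⟨-, -, -, -, Z, hZc, hZ1, hZ3, -⟩ := SU.exists_generators
  have h1 := Subgroup.card_eq_card_quotient_mul_card_subgroup (Subgroup.center (SU 3 2))
  have h2 : 3 ≤ Nat.card (Subgroup.center (SU 3 2)) := by
    have : Fact (Nat.Prime 3) := ⟨Nat.prime_three⟩
    have h3 := Subgroup.orderOf_dvd_natCard _ hZc
    rw [orderOf_eq_prime hZ3 hZ1] at h3
    exact Nat.le_of_dvd Nat.card_pos h3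
  have h3 := card_SU_le
  rw [h1] at h3
  have h4 := Nat.mul_le_mul_left (Nat.card (PSU 3 2)) h2
  change Nat.card (PSU 3 2) * _ ≤ _ at h3
  omega

theorem iso_PSU_semidirect :
    Iso (PSU 3 2) ((Fin 2 → Cyc 3) ⋊[quaternionAut] QuaternionGroup 2) := by
  obtain ⟨v, w, x, y, h, hv⟩ := exists_frobeniusRelations_PSU
  exact h.iso hv card_PSU_le

theorem isFaithfulSemidirect_PSU :
    IsFaithfulSemidirect (PSU 3 2) (Fin 2 → Cyc 3) (QuaternionGroup 2) :=
  ⟨quaternionAut, quaternionAut_injective, iso_PSU_semidirect⟩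

theorem Good.iso_PSU {A X : Type*} [Group A] [MulAction A X] (h : Good A X)
    (hA : IsFaithfulSemidirect A (Fin 2 → Cyc 3) (QuaternionGroup 2)) : Iso A (PSU 3 2) := by
  have := h.finite
  have hc : Nat.card A = 72 := by
    obtain ⟨φ, -, hi⟩ := hA
    rw [hi.card_eq, SemidirectProduct.card, pi_cyc_natCard, Nat.card_eq_fintype_card,
      QuaternionGroup.card]
    norm_num
  obtain ⟨v, w, x, y, hr, hv⟩ := h.exists_frobeniusRelations hA
  exact (hr.iso hv hc.le).trans iso_PSU_semidirect.symm

/-! ### Isomorphism types and descriptions -/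

/-- The isomorphism type that an entry of the list prescribes. The trivial group is described by
its order. -/
def Entry.IsoType (i : Entry) (A : Type*) [Group A] : Prop :=
  match i with
  | row1 => IsNontrivialSemidirect A (Fin 3 → Cyc 3) (Cyc 13)
  | row2 => Iso A (Fin 3 → Cyc 3)
  | row3 => IsHeisenberg3 A
  | row4 => IsExtraspecialMinus3 A
  | row5 => IsFaithfulSemidirect A (Cyc 13) (Cyc 4)
  | row6 => IsFaithfulSemidirect A (Fin 2 → Cyc 3) (Cyc 4)
  | row7 => Iso A (DihedralGroup 13)
  | row8 => Iso A (DihedralGroup 11)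
  | row9 => IsNontrivialSemidirect A (Cyc 3) (Equiv.Perm (Fin 3))
  | row10 => Iso A (DihedralGroup 9)
  | row11 => Iso A (Cyc 13)
  | row12 => Iso A (alternatingGroup (Fin 4))
  | row13 => Iso A (Cyc 11)
  | row14 => Iso A (Fin 2 → Cyc 3)
  | row15 => Iso A (Cyc 9)
  | row16 => Iso A (Fin 3 → Cyc 2)
  | row17 | row18 => Iso A (DihedralGroup 4)
  | row19 => Iso A (QuaternionGroup 2)
  | row20 => Iso A (Equiv.Perm (Fin 3))
  | row21 | row22 => Iso A (Fin 2 → Cyc 2)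
  | row23 => Iso A (Cyc 4)
  | row24 => Iso A (Cyc 3)
  | row25 => Iso A (Cyc 2)
  | row26 => Nat.card A = 1
  | psu => Iso A (PSU 3 2)

/-- The condition on the number of points fixed by the whole group that distinguishes the entries
with the same isomorphism type. -/
def Entry.FixedPointCount (i : Entry) (n : ℕ) : Prop :=
  match i with
  | row17 | row21 => n = 3
  | row18 | row22 => n = 1
  | _ => True

/-- The order of the groups that an entry describes. -/
def Entry.order (i : Entry) : ℕ :=
  match i with
  | row1 => 351
  | row2 | row3 | row4 => 27
  | row5 => 52
  | row6 => 36
  | row7 => 26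
  | row8 => 22
  | row9 | row10 => 18
  | row11 => 13
  | row12 => 12
  | row13 => 11
  | row14 | row15 => 9
  | row16 | row17 | row18 | row19 => 8
  | row20 => 6
  | row21 | row22 | row23 => 4
  | row24 => 3
  | row25 => 2
  | row26 => 1
  | psu => 72

theorem IsExtraspecial27.card_eq {A : Type*} [Group A] (h : IsExtraspecial27 A) :
    Nat.card A = 27 := by
  rw [Subgroup.card_eq_card_quotient_mul_card_subgroup (Subgroup.center A), h.2.card_eq,
    h.1.card_eq, Nat.card_prod, Cyc.natCard]

theorem IsFaithfulSemidirect.card_eq {A N H : Type*} [Group A] [Group N] [Group H]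
    (h : IsFaithfulSemidirect A N H) : Nat.card A = Nat.card N * Nat.card H := by
  obtain ⟨φ, -, h⟩ := h
  rw [h.card_eq, SemidirectProduct.card]

theorem IsNontrivialSemidirect.card_eq {A N H : Type*} [Group A] [Group N] [Group H]
    (h : IsNontrivialSemidirect A N H) : Nat.card A = Nat.card N * Nat.card H := by
  obtain ⟨φ, -, h⟩ := h
  rw [h.card_eq, SemidirectProduct.card]

theorem card_quaternion : Nat.card (QuaternionGroup 2) = 8 := by
  rw [Nat.card_eq_fintype_card, QuaternionGroup.card]

theorem card_perm_three : Nat.card (Equiv.Perm (Fin 3)) = 6 := by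
  rw [Nat.card_eq_fintype_card, Fintype.card_perm]; rfl

theorem card_PSU : Nat.card (PSU 3 2) = 72 := by
  rw [isFaithfulSemidirect_PSU.card_eq, pi_cyc_natCard, card_quaternion]; norm_num

theorem Entry.IsoType.card_eq {i : Entry} {A : Type*} [Group A] (h : i.IsoType A) :
    Nat.card A = i.order := by
  cases i
  case row3 | row4 => exact h.1.card_eq
  case row26 => exact h
  all_goals
    rw [Entry.IsoType] at h
    rw [h.card_eq]
    simp only [Entry.order, card_quaternion, card_perm_three, card_alternating_four,
      DihedralGroup.nat_card, Cyc.natCard, pi_cyc_natCard, card_PSU]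
    try norm_num

theorem IsExtraspecial27.exists_not_comm {A : Type*} [Group A] (h : IsExtraspecial27 A) :
    ∃ a b : A, a * b ≠ b * a := by
  by_contra! hc
  have h1 : Subgroup.center A = ⊤ := by
    rw [Subgroup.eq_top_iff']
    exact fun a => Subgroup.mem_center_iff.2 fun b => hc b a
  have h2 := h.1.card_eq
  rw [h1, Subgroup.card_top, h.card_eq, Cyc.natCard] at h2
  omega

theorem IsExtraspecial27.of_mulEquiv {A B : Type*} [Group A] [Group B] (h : IsExtraspecial27 A)
    (e : A ≃* B) : IsExtraspecial27 B := by
  obtain ⟨a, b, hab⟩ := h.exists_not_comm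
  refine isExtraspecial27_of_not_comm (by rw [← Nat.card_congr e.toEquiv, h.card_eq])
    (a := e a) (b := e b) fun h1 => hab (e.injective ?_)
  rw [map_mul, map_mul, h1]

theorem Entry.IsoType.of_mulEquiv {i : Entry} {A B : Type*} [Group A] [Group B]
    (h : i.IsoType A) (e : A ≃* B) : i.IsoType B := by
  have he : Iso B A := ⟨e.symm⟩
  cases i
  case row3 => exact ⟨h.1.of_mulEquiv e, by rw [← Monoid.exponent_eq_of_mulEquiv e, h.2]⟩
  case row4 =>
    obtain ⟨a, ha⟩ := h.2
    exact ⟨h.1.of_mulEquiv e, e a, by rw [MulEquiv.orderOf_eq, ha]⟩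
  case row26 => exact (Nat.card_congr e.toEquiv).symm.trans h
  case row1 | row5 | row6 | row9 =>
    obtain ⟨φ, hφ, h1⟩ := h
    exact ⟨φ, hφ, he.trans h1⟩
  all_goals exact he.trans h

/-- For a good action, the isomorphism type and the number of points fixed by the whole group
determine the orbit lengths and the stabilizers. -/
theorem Good.describes {G : Subgroup S27} (h : Good G (Fin 27)) {i : Entry} (hi : i.IsoType G)
    (hf : i.FixedPointCount (fixedPoints G (Fin 27)).ncard) : i.Describes G := by
  have hc := hi.card_eq
  have hreg : Nat.card G = 27 → ActsRegularly G := fun h1 =>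
    ⟨h.actsTransitively (by rw [h1]), h.actsFreely (k := 3) h1⟩
  cases i
  case row1 => exact ⟨hi, h.actsTransitively (by rw [hc, Entry.order]; norm_num)⟩
  case row2 | row3 | row4 => exact ⟨hi, hreg hc⟩
  case row5 => exact ⟨hi, h.orbitLengths_thirteen (k := 4) (by norm_num) hc⟩
  case row6 => exact ⟨hi, h.orbitLengths_nine (k := 4) (by norm_num) hc⟩
  case row7 => exact ⟨hi, h.orbitLengths_thirteen (k := 2) (by norm_num) hc⟩
  case row8 => exact ⟨hi, h.orbitLengths_dihedral hi⟩
  case row9 | row10 => exact ⟨hi, h.orbitLengths_nine (k := 2) (by norm_num) hc⟩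
  case row11 => exact ⟨hi, h.orbitLengths_thirteen (k := 1) (by norm_num) hc⟩
  case row12 => exact ⟨hi, h.orbitLengths_alternating hi⟩
  case row13 => exact ⟨hi, h.orbitLengths_eleven hc⟩
  case row14 | row15 => exact ⟨hi, h.orbitLengths_nine (k := 1) (by norm_num) hc⟩
  case row16 =>
    refine ⟨hi, h.orbitLengths_eight_of_central hc fun t _ g => ?_⟩
    obtain ⟨e⟩ := hi
    exact e.injective (by rw [map_mul, map_mul, mul_comm])
  case row17 =>
    rcases h.orbitLengths_eight hc with h1 | h1
    · exact ⟨hi, h1.2⟩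
    · rw [Entry.FixedPointCount, h1.1] at hf
      omega
  case row18 =>
    obtain ⟨φ⟩ := id hi
    rcases h.orbitLengths_eight hc with h1 | h1
    · rw [Entry.FixedPointCount, h1.1] at hf
      omega
    · exact ⟨hi, h1.2, fun u v => h.not_areConjugate_stabilizer φ,
        fun u => h.stabilizer_ne_center φ, fun w => h.iso_stabilizer_cyc φ⟩
  case row19 =>
    refine ⟨hi, h.orbitLengths_eight_of_central hc fun t ht g => ?_⟩
    obtain ⟨e⟩ := hi
    have h1 : ∀ t : QuaternionGroup 2, t ^ 2 = 1 → ∀ g, g * t = t * g := by decide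
    exact e.injective (by rw [map_mul, map_mul, h1 _ (by rw [← map_pow, ht, map_one])])
  case row20 => exact ⟨hi, h.orbitLengths_six hc⟩
  case row21 =>
    rcases h.orbitLengths_four hc with h1 | h1
    · exact ⟨hi, h1.2⟩
    · rw [Entry.FixedPointCount, h1.1] at hf
      omega
  case row22 =>
    rcases h.orbitLengths_four hc with h1 | h1
    · rw [Entry.FixedPointCount, h1.1] at hf
      omega
    · refine ⟨hi, h1.2, fun u v => h.stabilizer_ne_of_klein hi, fun u hu => ?_⟩
      have : Fact (Nat.Prime 2) := ⟨Nat.prime_two⟩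
      refine iso_cyc_of_prime ?_
      rw [card_stabilizer_eq_div, hu, hc]; rfl
  case row23 =>
    rcases h.orbitLengths_four hc with h1 | h1
    · exact ⟨hi, h1.2⟩
    · have h2 := h.fixedPoints_of_cyclic hi
      omega
  case row24 => exact ⟨hi, h.actsFreely (k := 1) hc⟩
  case row25 => exact ⟨hi, h.ncard_fixedPoints_of_card_two hc⟩
  case row26 => exact Subgroup.eq_bot_of_card_eq G hi
  case psu => exact ⟨hi, h.orbitLengths_nine (k := 8) (by norm_num) hc⟩

theorem Entry.Describes.isoType {i : Entry} {G : Subgroup S27} (h : i.Describes G) :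
    i.IsoType G := by
  cases i
  case row26 =>
    obtain rfl : G = ⊥ := h
    exact Subgroup.card_bot
  all_goals exact h.1

section
variable {A X : Type*} [Group A] [MulAction A X]

theorem Good.exists_isoType_of_thirteen_dvd (h : Good A X) (hd : 13 ∣ Nat.card A) :
    ∃ i : Entry, i.IsoType A := by
  have : Finite A := h.finite
  have : Fact (Nat.Prime 13) := ⟨by norm_num⟩
  by_cases hn : Nat.card (Sylow 13 A) = 1
  · obtain ⟨k, hk, h1⟩ := h.card_of_thirteen_dvd hd
    have hA : Nat.card A = 13 * k := by omega
    have hk4 := Nat.le_of_dvd (by norm_num) hk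
    interval_cases k
    · omega
    · exact ⟨.row11, iso_cyc_of_prime hA⟩
    · exact ⟨.row7, h.iso_dihedral_of_card_eq (by decide) (by rw [hA])⟩
    · omega
    · exact ⟨.row5, h.faithful_semidirect_thirteen hA⟩
  · exact ⟨.row1, h.semidirect_of_card_eq (h.card_eq_of_thirteen_dvd hd hn).1⟩

theorem Good.exists_isoType_of_eleven_dvd (h : Good A X) (hd : 11 ∣ Nat.card A)
    (hd' : ¬ 13 ∣ Nat.card A) : ∃ i : Entry, i.IsoType A := by
  have : Finite A := h.finite
  have : Fact (Nat.Prime 11) := ⟨by norm_num⟩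
  obtain ⟨k, hk, -, hA⟩ := h.card_of_eleven_dvd hd hd'
  have hk2 := Nat.le_of_dvd (by norm_num) hk
  interval_cases k
  · omega
  · exact ⟨.row13, iso_cyc_of_prime hA⟩
  · exact ⟨.row8, h.iso_dihedral_of_card_eq (by decide) (by rw [hA])⟩

theorem Good.exists_isoType_of_six_dvd (h : Good A X) (h2 : 2 ∣ Nat.card A) (h3 : 3 ∣ Nat.card A)
    (hd : Nat.card A ∣ 8 * 27) : ∃ i : Entry, i.IsoType A := by
  have : Fact (Nat.Prime 3) := ⟨Nat.prime_three⟩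
  by_cases hn : ∃ P : Sylow 3 A, (P : Subgroup A).Normal
  · obtain ⟨P, hP⟩ := hn
    rcases h.iso_of_normal_sylow_three h2 h3 hd P with h1 | h1 | h1 | h1 | h1
    · exact ⟨.row20, h1⟩
    · exact ⟨.row10, h1⟩
    · exact ⟨.row9, h1⟩
    · exact ⟨.row6, h1⟩
    · exact ⟨.psu, h.iso_PSU h1⟩
  · push Not at hn
    exact ⟨.row12, h.iso_alternating h2 h3 hd hn⟩

theorem Good.exists_isoType_of_three_group (h : Good A X) (hd : Nat.card A ∣ 27)
    (h3 : 3 ∣ Nat.card A) : ∃ i : Entry, i.IsoType A := by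
  have : Finite A := h.finite
  have : Fact (Nat.Prime 3) := ⟨Nat.prime_three⟩
  obtain ⟨k, hk, hA⟩ := (Nat.dvd_prime_pow Nat.prime_three (m := 3)).1 hd
  interval_cases k
  · omega
  · exact ⟨.row24, iso_cyc_of_prime hA⟩
  · rcases h.iso_of_card_nine hA with h1 | h1
    · exact ⟨.row15, h1⟩
    · exact ⟨.row14, h1⟩
  · rcases h.iso_of_card_twenty_seven hA with h1 | h1 | h1
    · exact ⟨.row2, h1⟩
    · exact ⟨.row3, h1⟩
    · exact ⟨.row4, h1⟩

theorem Good.exists_isoType_of_two_group (h : Good A X) (hd : Nat.card A ∣ 8) :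
    ∃ i : Entry, i.IsoType A := by
  have : Finite A := h.finite
  have : Fact (Nat.Prime 2) := ⟨Nat.prime_two⟩
  rcases mem_divisors_eight hd with hA | hA | hA | hA
  · exact ⟨.row26, hA⟩
  · exact ⟨.row25, iso_cyc_of_prime hA⟩
  · by_cases hx : ∃ x : A, orderOf x = 4
    · obtain ⟨x, hx⟩ := hx
      exact ⟨.row23, iso_cyc hx hA⟩
    · push Not at hx
      have hsq : ∀ a : A, a ^ 2 = 1 := fun a => by
        have h1 := orderOf_dvd_natCard a
        rw [hA, show 4 = 2 ^ 2 by rfl, Nat.dvd_prime_pow Nat.prime_two] at h1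
        obtain ⟨k, hk, h1⟩ := h1
        have := hx a
        rw [← orderOf_dvd_iff_pow_eq_one]
        interval_cases k <;> simp_all
      exact ⟨.row21, iso_pi_cyc (mul_comm_of_mul_self fun a => by rw [← pow_two, hsq]) hsq hA⟩
  · rcases h.iso_of_card_eight hA with h1 | h1 | h1
    · exact ⟨.row16, h1⟩
    · exact ⟨.row17, h1⟩
    · exact ⟨.row19, h1⟩

theorem Good.exists_isoType (h : Good A X) : ∃ i : Entry, i.IsoType A := by
  by_cases h13 : 13 ∣ Nat.card A
  · exact h.exists_isoType_of_thirteen_dvd h13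
  by_cases h11 : 11 ∣ Nat.card A
  · exact h.exists_isoType_of_eleven_dvd h11 h13
  have hd : Nat.card A ∣ 8 * 27 := by
    have h1 := ((Nat.Prime.coprime_iff_not_dvd (by norm_num)).2 h13).symm.dvd_of_dvd_mul_right
      h.card_dvd
    exact ((Nat.Prime.coprime_iff_not_dvd (by norm_num)).2 h11).symm.dvd_of_dvd_mul_right h1
  by_cases h3 : 3 ∣ Nat.card A
  · by_cases h2 : 2 ∣ Nat.card A
    · exact h.exists_isoType_of_six_dvd h2 h3 hd
    · refine h.exists_isoType_of_three_group ?_ h3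
      have h1 : (Nat.card A).Coprime (2 ^ 3) :=
        (((Nat.Prime.coprime_iff_not_dvd Nat.prime_two).2 h2).symm).pow_right 3
      exact h1.dvd_of_dvd_mul_left hd
  · have h1 : (Nat.card A).Coprime (3 ^ 3) :=
      (((Nat.Prime.coprime_iff_not_dvd Nat.prime_three).2 h3).symm).pow_right 3
    exact h.exists_isoType_of_two_group (h1.dvd_of_dvd_mul_right hd)

end

theorem Good.exists_describes {G : Subgroup S27} (h : Good G (Fin 27)) :
    ∃ i : Entry, i.Describes G := by
  obtain ⟨i, hi⟩ := h.exists_isoType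
  have hc := hi.card_eq
  cases i
  case row17 | row18 =>
    rcases h.orbitLengths_eight hc with h1 | h1
    · exact ⟨.row17, h.describes hi h1.1⟩
    · exact ⟨.row18, h.describes hi h1.1⟩
  case row21 | row22 =>
    rcases h.orbitLengths_four hc with h1 | h1
    · exact ⟨.row21, h.describes hi h1.1⟩
    · exact ⟨.row22, h.describes hi h1.1⟩
  all_goals exact ⟨_, h.describes hi trivial⟩

theorem card_mulAut_cyc (p : ℕ) [hp : Fact p.Prime] : Nat.card (MulAut (Cyc p)) = p - 1 := by
  rw [IsCyclic.card_mulAut, Cyc.natCard, Nat.totient_prime hp.out]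

/-- A square in `S_3` acts trivially on `C_3`, so a semidirect product of `C_3` by `S_3` has
exponent dividing 6. -/
theorem pow_six_of_semidirect {A : Type*} [Group A]
    (h : IsNontrivialSemidirect A (Cyc 3) (Equiv.Perm (Fin 3))) (a : A) : a ^ 6 = 1 := by
  obtain ⟨φ, -, ⟨e⟩⟩ := h
  refine e.injective ?_
  rw [map_pow, map_one]
  generalize e a = x
  have h1 : ∀ f : MulAut (Cyc 3), f ^ 2 = 1 := fun f => by
    have : Fact (Nat.Prime 3) := ⟨Nat.prime_three⟩
    rw [show 2 = Nat.card (MulAut (Cyc 3)) by rw [card_mulAut_cyc], pow_card_eq_one']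
  have h2 : φ (x ^ 2).right = 1 := by
    rw [← SemidirectProduct.rightHom_eq_right, map_pow, map_pow, h1]
  have h3 : ∀ n : Cyc 3, n * (n * n) = 1 := by decide
  have h4 : ∀ s : Equiv.Perm (Fin 3), s ^ 6 = 1 := by decide +kernel
  have h5 : (x ^ 6).right = 1 := by
    rw [← SemidirectProduct.rightHom_eq_right, map_pow, h4]
  refine SemidirectProduct.ext ?_ h5
  rw [show x ^ 6 = x ^ 2 * (x ^ 2 * x ^ 2) by group, SemidirectProduct.mul_left,
    SemidirectProduct.mul_left, h2]
  exact h3 _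

theorem Entry.IsoType.pow_six {i : Entry} {A : Type*} [Group A] (h : i.IsoType A)
    (hi : i ∈ ({row2, row3, row9, row14, row16, row21, row22} : Set Entry)) (a : A) :
    a ^ 6 = 1 := by
  have key : ∀ {n p : ℕ}, p ∣ 6 → Iso A (Fin n → Cyc p) → a ^ 6 = 1 := by
    rintro n p ⟨m, hm⟩ ⟨e⟩
    exact e.injective (by rw [map_pow, map_one, hm, pow_mul, pi_cyc_pow, one_pow])
  rcases hi with rfl | rfl | rfl | rfl | rfl | rfl | rfl
  · exact key (by norm_num) h
  · rw [show 6 = Monoid.exponent A * 2 by rw [h.2], pow_mul, Monoid.pow_exponent_eq_one, one_pow]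
  · exact pow_six_of_semidirect h a
  · exact key (by norm_num) h
  · exact key (by norm_num) h
  · exact key (by norm_num) h
  · exact key (by norm_num) h

theorem Entry.IsoType.exists_pow_six_ne {i : Entry} {A : Type*} [Group A] (h : i.IsoType A)
    (hi : i ∈ ({row4, row10, row15, row17, row18, row19, row23} : Set Entry)) :
    ∃ a : A, a ^ 6 ≠ 1 := by
  have key : ∀ {B : Type} [Group B], Iso A B → (∃ b : B, b ^ 6 ≠ 1) → ∃ a : A, a ^ 6 ≠ 1 := by
    rintro B _ ⟨e⟩ ⟨b, hb⟩
    exact ⟨e.symm b, fun h1 => hb (e.symm.injective (by rw [map_pow, h1, map_one]))⟩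
  rcases hi with rfl | rfl | rfl | rfl | rfl | rfl | rfl
  · obtain ⟨a, ha⟩ := h.2
    refine ⟨a, fun h1 => ?_⟩
    have := orderOf_dvd_of_pow_eq_one h1
    rw [ha] at this
    omega
  · exact key h ⟨.r 1, by decide⟩
  · exact key h ⟨.ofAdd 1, by decide⟩
  · exact key h ⟨.r 1, by decide⟩
  · exact key h ⟨.r 1, by decide⟩
  · exact key h ⟨.a 1, by decide⟩
  · exact key h ⟨.ofAdd 1, by decide⟩

theorem Entry.IsoType.commute {i : Entry} {A : Type*} [Group A] (h : i.IsoType A)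
    (hi : i ∈ ({row2, row19} : Set Entry)) (a b : A) (ha : a ^ 6 = 1) : a * b = b * a := by
  rcases hi with rfl | rfl
  · obtain ⟨e⟩ := h
    exact e.injective (by rw [map_mul, map_mul, mul_comm])
  · obtain ⟨e⟩ := h
    have h1 : ∀ t : QuaternionGroup 2, t ^ 6 = 1 → ∀ g, t * g = g * t := by decide
    exact e.injective (by rw [map_mul, map_mul, h1 _ (by rw [← map_pow, ha, map_one])])

theorem Entry.IsoType.exists_not_commute {i : Entry} {A : Type*} [Group A] (h : i.IsoType A)
    (hi : i ∈ ({row3, row17, row18} : Set Entry)) : ∃ a b : A, a ^ 6 = 1 ∧ a * b ≠ b * a := by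
  have key : Iso A (DihedralGroup 4) → ∃ a b : A, a ^ 6 = 1 ∧ a * b ≠ b * a := by
    rintro ⟨e⟩
    refine ⟨e.symm (.sr 0), e.symm (.r 1), ?_, fun h1 => ?_⟩
    · rw [← map_pow, ← map_one e.symm]; congr 1
    · rw [← map_mul, ← map_mul] at h1
      exact absurd (e.symm.injective h1) (by decide)
  rcases hi with rfl | rfl | rfl
  · obtain ⟨a, b, hab⟩ := h.1.exists_not_comm
    exact ⟨a, b, h.pow_six (by simp) a, hab⟩
  · exact key h
  · exact key h

theorem eq_of_isoType {i j : Entry} {A : Type*} [Group A] (hi : i.IsoType A) (hj : j.IsoType A) :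
    i = j ∨ i = .row17 ∧ j = .row18 ∨ i = .row18 ∧ j = .row17 ∨ i = .row21 ∧ j = .row22 ∨
      i = .row22 ∧ j = .row21 := by
  have hc : i.order = j.order := by rw [← hi.card_eq, hj.card_eq]
  have h1 : ∀ {i j : Entry}, i.IsoType A → j.IsoType A →
      i ∈ ({.row2, .row3, .row9, .row14, .row16, .row21, .row22} : Set Entry) →
      j ∉ ({.row4, .row10, .row15, .row17, .row18, .row19, .row23} : Set Entry) := by
    intro i j hi hj h1 h2
    obtain ⟨a, ha⟩ := hj.exists_pow_six_ne h2
    exact ha (hi.pow_six h1 a)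
  have h2 : ∀ {i j : Entry}, i.IsoType A → j.IsoType A →
      i ∈ ({.row2, .row19} : Set Entry) → j ∉ ({.row3, .row17, .row18} : Set Entry) := by
    intro i j hi hj h1 h2
    obtain ⟨a, b, ha, hab⟩ := hj.exists_not_commute h2
    exact hab (hi.commute h1 a b ha)
  have h3 := h1 hi hj
  have h4 := h1 hj hi
  have h5 := h2 hi hj
  have h6 := h2 hj hi
  clear hi hj h1 h2
  cases i <;> cases j <;>
    first
    | exact Or.inl rfl
    | exact absurd hc (by decide)
    | (clear hc; simp at *)

theorem Entry.Describes.eq {i j : Entry} {G : Subgroup S27} (hi : i.Describes G)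
    (hj : j.Describes G) : i = j := by
  have key : ∀ s t : Multiset ℕ, s ≠ t → orbitLengths G = s → orbitLengths G ≠ t :=
    fun s t hst hs ht => hst (hs.symm.trans ht)
  rcases eq_of_isoType hi.isoType hj.isoType with h | ⟨rfl, rfl⟩ | ⟨rfl, rfl⟩ | ⟨rfl, rfl⟩ |
    ⟨rfl, rfl⟩
  · exact h
  · exact absurd hj.2.1 (key _ _ (by decide) hi.2)
  · exact absurd hj.2 (key _ _ (by decide) hi.2.1)
  · exact absurd hj.2.1 (key _ _ (by decide) hi.2)
  · exact absurd hj.2 (key _ _ (by decide) hi.2.1)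

/-! ### Uniqueness of the isomorphism types -/

theorem iso_semidirect_of_range {N H : Type*} [Group N] [Group H] {φ φ' : H →* MulAut N}
    (hφ : Function.Injective φ) (hφ' : Function.Injective φ') (θ : MulAut N)
    (h : φ.range.map (MulAut.conj θ).toMonoidHom = φ'.range) : Iso (N ⋊[φ] H) (N ⋊[φ'] H) := by
  let η : H ≃* H := (MonoidHom.ofInjective hφ).trans <|
    ((MulAut.conj θ).subgroupMap φ.range).trans <|
    (MulEquiv.subgroupCongr h).trans (MonoidHom.ofInjective hφ').symm
  have hη : ∀ x, φ' (η x) = θ * φ x * θ⁻¹ := fun x => by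
    have h1 : (MonoidHom.ofInjective hφ' (η x) : MulAut N) = θ * φ x * θ⁻¹ := by
      change (MonoidHom.ofInjective hφ' ((MonoidHom.ofInjective hφ').symm _) : MulAut N) = _
      rw [MulEquiv.apply_symm_apply]
      rfl
    exact h1
  refine ⟨SemidirectProduct.congr θ η fun x => ?_⟩
  rw [hη]
  ext n
  change θ (φ x n) = θ (φ x (θ⁻¹ (θ n)))
  rw [MulAut.inv_apply_self]

theorem isFaithfulSemidirect_unique_thirteen {A B : Type*} [Group A] [Group B]
    (hA : IsFaithfulSemidirect A (Cyc 13) (Cyc 4)) (hB : IsFaithfulSemidirect B (Cyc 13) (Cyc 4)) :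
    Iso A B := by
  have : Fact (Nat.Prime 13) := ⟨by norm_num⟩
  obtain ⟨φ, hφ, hA⟩ := hA
  obtain ⟨φ', hφ', hB⟩ := hB
  have := isCyclic_mulAut_of_prime (Cyc.natCard 13)
  refine (hA.trans (iso_semidirect_of_range hφ hφ' 1 ?_)).trans hB.symm
  rw [map_one]
  have key : ∀ φ : Cyc 4 →* MulAut (Cyc 13), Function.Injective φ →
      (φ.range : Set (MulAut (Cyc 13))) = {x | x ^ 4 = 1} := by
    classical
    intro φ hφ
    have := Fintype.ofFinite (MulAut (Cyc 13))
    refine Set.eq_of_subset_of_ncard_le ?_ ?_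
    · rintro _ ⟨a, rfl⟩
      change φ a ^ 4 = 1
      rw [← map_pow, (by decide : ∀ a : Cyc 4, a ^ 4 = 1), map_one]
    · have h1 := IsCyclic.card_pow_eq_one_le (α := MulAut (Cyc 13)) (n := 4) (by norm_num)
      have h2 : (φ.range : Set (MulAut (Cyc 13))).ncard = 4 :=
        (iso_range_of_injective hφ).card_eq.trans (Cyc.natCard 4)
      rw [h2, Set.ncard_eq_toFinset_card']
      simpa using h1
  rw [← SetLike.coe_injective ((key φ hφ).trans (key φ' hφ').symm)]
  exact Subgroup.map_id _

/-- An automorphism of order 13 of the elementary abelian group of order 27 fixes only the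
identity, as the number of its fixed points is a power of 3 that is 1 modulo 13. -/
theorem eq_one_of_fixed {t : MulAut (Fin 3 → Cyc 3)} (ht : orderOf t = 13) {n : Fin 3 → Cyc 3}
    (hn : t n = n) : n = 1 := by
  have : Fact (Nat.Prime 13) := ⟨by norm_num⟩
  by_contra hn1
  let F : Subgroup (Fin 3 → Cyc 3) :=
    { carrier := {n | t n = n}
      one_mem' := map_one t
      mul_mem' := fun {a b} ha hb => by
        change t (a * b) = a * b
        rw [map_mul, show t a = a from ha, show t b = b from hb]
      inv_mem' := fun {a} ha => by
        change t a⁻¹ = a⁻¹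
        rw [map_inv, show t a = a from ha] }
  have hF : (fixedPoints (Subgroup.zpowers t) (Fin 3 → Cyc 3)) = (F : Set (Fin 3 → Cyc 3)) := by
    ext m
    refine ⟨fun h => h ⟨t, Subgroup.mem_zpowers t⟩, fun h => ?_⟩
    have h1 : Subgroup.zpowers t ≤ stabilizer (MulAut (Fin 3 → Cyc 3)) m := by
      rw [Subgroup.zpowers_le]; exact h
    exact fun x => h1 x.2
  have hP : IsPGroup 13 (Subgroup.zpowers t) := IsPGroup.of_card (n := 1)
    (by rw [Nat.card_zpowers, ht, pow_one])
  have h1 := hP.card_modEq_card_fixedPoints (Fin 3 → Cyc 3)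
  rw [hF, pi_cyc_natCard] at h1
  have h2 := Subgroup.card_subgroup_dvd_card F
  rw [pi_cyc_natCard] at h2
  obtain ⟨k, hk, h3⟩ := (Nat.dvd_prime_pow Nat.prime_three).1 h2
  change 3 ^ 3 % 13 = Nat.card F % 13 at h1
  rw [h3] at h1
  have hk3 : k = 0 ∨ k = 3 := by interval_cases k <;> omega
  rcases hk3 with rfl | rfl
  · rw [pow_zero, Subgroup.card_eq_one] at h3
    have h4 : n ∈ F := hn
    rw [h3, Subgroup.mem_bot] at h4
    exact hn1 h4
  · have h4 : F = ⊤ := Subgroup.eq_top_of_card_eq F (by rw [h3, pi_cyc_natCard])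
    have h5 : t = 1 := MulEquiv.ext fun m => show m ∈ F by rw [h4]; trivial
    rw [h5, orderOf_one] at ht
    omega

/-- The order of the automorphism group of the elementary abelian group of order 27 is not
divisible by 169, because a Sylow subgroup for 13 acts freely on the 26 nontrivial elements. -/
theorem card_sylow_mulAut [Fact (Nat.Prime 13)] (P : Sylow 13 (MulAut (Fin 3 → Cyc 3)))
    (hP : 13 ∣ Nat.card P) : Nat.card P = 13 := by
  obtain ⟨k, hk⟩ := P.2.exists_card_eq
  have hs : stabilizer P (![Multiplicative.ofAdd 1, 1, 1] : Fin 3 → Cyc 3) = ⊥ := by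
    rw [Subgroup.eq_bot_iff_forall]
    intro s hs
    by_contra hs1
    obtain ⟨m, hm⟩ := P.2.exists_orderOf_eq_pow s
    cases m with
    | zero => exact hs1 (orderOf_eq_one_iff.1 hm)
    | succ m =>
      have h1 : orderOf (((s ^ 13 ^ m : P)) : MulAut (Fin 3 → Cyc 3)) = 13 := by
        rw [Subgroup.orderOf_coe, orderOf_pow_of_dvd (by positivity) (by rw [hm, pow_succ]; simp),
          hm, pow_succ, Nat.mul_div_cancel_left _ (by positivity)]
      exact absurd (eq_one_of_fixed h1 (pow_mem hs (13 ^ m))) (by decide)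
  have h1 := ncard_orbit_mul_card_stabilizer (A := P)
    (![Multiplicative.ofAdd 1, 1, 1] : Fin 3 → Cyc 3)
  rw [hs, Subgroup.card_bot, mul_one] at h1
  have h2 : (orbit P (![Multiplicative.ofAdd 1, 1, 1] : Fin 3 → Cyc 3)) ⊆ {1}ᶜ := by
    rintro _ ⟨s, rfl⟩ h3
    have h4 : (s : MulAut (Fin 3 → Cyc 3)) ![Multiplicative.ofAdd 1, 1, 1] = 1 := h3
    rw [map_eq_one_iff _ (MulEquiv.injective _)] at h4
    exact absurd h4 (by decide)
  have h3 := Set.ncard_le_ncard h2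
  rw [Set.ncard_compl, Set.ncard_singleton, pi_cyc_natCard, h1, hk] at h3
  rw [hk] at hP ⊢
  have hk2 : k < 2 := by
    by_contra h4
    have := Nat.pow_le_pow_right (n := 13) (by norm_num) (not_lt.1 h4)
    omega
  interval_cases k <;> omega

theorem isNontrivialSemidirect_unique_thirteen {A B : Type*} [Group A] [Group B]
    (hA : IsNontrivialSemidirect A (Fin 3 → Cyc 3) (Cyc 13))
    (hB : IsNontrivialSemidirect B (Fin 3 → Cyc 3) (Cyc 13)) : Iso A B := by
  have : Fact (Nat.Prime 13) := ⟨by norm_num⟩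
  have key : ∀ φ : Cyc 13 →* MulAut (Fin 3 → Cyc 3), φ ≠ 1 → Function.Injective φ ∧
      ∃ P : Sylow 13 (MulAut (Fin 3 → Cyc 3)), φ.range = P := by
    intro φ hφ
    have h1 : Function.Injective φ := by
      rw [← MonoidHom.ker_eq_bot_iff]
      have : Fact (Nat.card (Cyc 13)).Prime := ⟨by rw [Cyc.natCard]; norm_num⟩
      rcases Subgroup.eq_bot_or_eq_top_of_prime_card φ.ker with h | h
      · exact h
      · exact absurd (MonoidHom.ker_eq_top_iff.1 h) hφ
    have h2 : Nat.card φ.range = 13 := by rw [(iso_range_of_injective h1).card_eq, Cyc.natCard]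
    obtain ⟨P, hP⟩ := (IsPGroup.of_card (p := 13) (n := 1) h2).exists_le_sylow
    refine ⟨h1, P, Subgroup.eq_of_le_of_card_ge hP ?_⟩
    rw [h2]
    refine (card_sylow_mulAut P ?_).le
    have h3 := Subgroup.card_dvd_of_le hP
    rwa [h2] at h3
  obtain ⟨φ, hφ, hA⟩ := hA
  obtain ⟨φ', hφ', hB⟩ := hB
  obtain ⟨h1, P, hP⟩ := key φ hφ
  obtain ⟨h2, Q, hQ⟩ := key φ' hφ'
  obtain ⟨θ, hθ⟩ := exists_smul_eq (MulAut (Fin 3 → Cyc 3)) P Q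
  refine (hA.trans (iso_semidirect_of_range h1 h2 θ ?_)).trans hB.symm
  rw [hP, hQ, ← hθ]
  rfl

theorem isNontrivialSemidirect_unique_perm {A B : Type*} [Group A] [Group B]
    (hA : IsNontrivialSemidirect A (Cyc 3) (Equiv.Perm (Fin 3)))
    (hB : IsNontrivialSemidirect B (Cyc 3) (Equiv.Perm (Fin 3))) : Iso A B := by
  have : Fact (Nat.Prime 3) := ⟨Nat.prime_three⟩
  have : Fact (Nat.Prime 2) := ⟨Nat.prime_two⟩
  have h2 : Nat.card (MulAut (Cyc 3)) = 2 := card_mulAut_cyc 3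
  have h3 : Nat.card ℤˣ = 2 := by rw [Nat.card_eq_fintype_card]; rfl
  obtain ⟨e⟩ := (iso_cyc_of_prime h2).trans (iso_cyc_of_prime h3).symm
  have key : ∀ φ : Equiv.Perm (Fin 3) →* MulAut (Cyc 3), φ ≠ 1 →
      e.toMonoidHom.comp φ = Equiv.Perm.sign := by
    intro φ hφ
    refine Equiv.Perm.eq_sign_of_surjective_hom ?_
    obtain ⟨s, hs⟩ : ∃ s, φ s ≠ 1 := by
      by_contra! h
      exact hφ (MonoidHom.ext h)
    have h4 : e (φ s) = -1 := by
      rcases Int.units_eq_one_or (e (φ s)) with h | h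
      · exact absurd ((map_eq_one_iff e e.injective).1 h) hs
      · exact h
    intro u
    rcases Int.units_eq_one_or u with rfl | rfl
    · exact ⟨1, map_one _⟩
    · exact ⟨s, h4⟩
  obtain ⟨φ, hφ, hA⟩ := hA
  obtain ⟨φ', hφ', hB⟩ := hB
  have h4 : φ = φ' := MonoidHom.ext fun s => e.injective
    (DFunLike.congr_fun ((key φ hφ).trans (key φ' hφ').symm) s)
  subst h4
  exact hA.trans hB.symm

/-- The endomorphism of the elementary abelian group of order 9 that sends the standard
generators to `u` and `w`. -/
def linComb (u w n : Fin 2 → Cyc 3) : Fin 2 → Cyc 3 :=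
  u ^ (n 0).toAdd.val * w ^ (n 1).toAdd.val

theorem eq_linComb (f : MulAut (Fin 2 → Cyc 3)) (n : Fin 2 → Cyc 3) :
    f n = linComb (f ![Multiplicative.ofAdd 1, 1]) (f ![1, Multiplicative.ofAdd 1]) n := by
  have h : ∀ n : Fin 2 → Cyc 3, n = linComb ![Multiplicative.ofAdd 1, 1]
    ![1, Multiplicative.ofAdd 1] n := by decide +kernel
  conv_lhs => rw [h n, linComb, map_mul, map_pow, map_pow]
  rfl

set_option synthInstance.maxHeartbeats 400000 in
set_option synthInstance.maxSize 2000 in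
theorem linComb_linComb : ∀ u w : Fin 2 → Cyc 3,
    (∀ n, linComb u w (linComb u w (linComb u w (linComb u w n))) = n) →
    (∀ n, linComb u w (linComb u w n) = n) ∨ ∀ n, linComb u w (linComb u w n) = n⁻¹ := by
  decide +kernel

set_option synthInstance.maxHeartbeats 400000 in
set_option synthInstance.maxSize 2000 in
theorem linComb_eq_one : ∀ w n : Fin 2 → Cyc 3, w ≠ 1 → w ≠ stdGen → w ≠ stdGen⁻¹ →
    linComb stdGen w n = 1 → n = 1 := by
  decide +kernel

/-- In `GL_2(3)`, the square of an element of order 4 is the central involution, so every such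
element is conjugate to the standard one. -/
theorem exists_conj_autX {f : MulAut (Fin 2 → Cyc 3)} (hf : orderOf f = 4) :
    ∃ θ : MulAut (Fin 2 → Cyc 3), ∀ n, θ (autX n) = f (θ n) := by
  have h4 : f ^ 4 = 1 := hf ▸ pow_orderOf_eq_one f
  have h2 : f ^ 2 ≠ 1 := fun h => by
    have := orderOf_dvd_of_pow_eq_one h
    rw [hf] at this
    omega
  set u := f ![Multiplicative.ofAdd 1, 1] with hu
  set w := f ![1, Multiplicative.ofAdd 1] with hw
  have hfl : ∀ n, linComb u w n = f n := fun n => (eq_linComb f n).symm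
  have hsq : ∀ n, f (f n) = n⁻¹ := by
    rcases linComb_linComb u w fun n => by
      simp only [hfl]
      exact DFunLike.congr_fun h4 n with h | h
    · simp only [hfl] at h
      exact absurd (MulEquiv.ext h) h2
    · simpa only [hfl] using h
  have hs : stdGen ≠ 1 := by decide
  have huu : u ≠ 1 := fun h => hs (f.injective (by rw [map_one]; exact h))
  -- the vectors `stdGen` and `f stdGen` form a basis, in which `f` has the standard form
  let θ : (Fin 2 → Cyc 3) →* (Fin 2 → Cyc 3) :=
    pairHom (v := stdGen) (w := u) (pi_cyc_pow 2 3 _) (pi_cyc_pow 2 3 _) (mul_comm _ _)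
  have hθ0 : θ ![Multiplicative.ofAdd 1, 1] = stdGen := pairHom_fst _ _ _
  have hθ1 : θ ![1, Multiplicative.ofAdd 1] = u := pairHom_snd _ _ _
  have hθ : ∀ n, θ n = linComb stdGen u n := fun n => by
    have h : ∀ n : Fin 2 → Cyc 3, n = linComb ![Multiplicative.ofAdd 1, 1]
      ![1, Multiplicative.ofAdd 1] n := by decide +kernel
    conv_lhs => rw [h n, linComb, map_mul, map_pow, map_pow, hθ0, hθ1]
    rfl
  have hinj : Function.Injective θ := by
    rw [injective_iff_map_eq_one]
    intro n hn
    rw [hθ] at hn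
    have h1 : f stdGen = u := rfl
    have h2 := hsq stdGen
    rw [h1] at h2
    refine linComb_eq_one u n huu (fun h => ?_) (fun h => ?_) hn
    · rw [h, h1, h] at h2
      exact absurd h2 (by decide)
    · rw [h, map_inv, h1, h] at h2
      exact absurd h2 (by decide)
  refine ⟨MulEquiv.ofBijective θ (Finite.injective_iff_bijective.1 hinj), ?_⟩
  have h5 : θ.comp autX.toMonoidHom = f.toMonoidHom.comp θ := by
    refine pi_cyc_hom_ext ?_ ?_
    · change θ (autX _) = f (θ _)
      rw [show autX ![Multiplicative.ofAdd 1, 1] = ![1, Multiplicative.ofAdd 1] by decide, hθ0, hθ1]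
      rfl
    · change θ (autX _) = f (θ _)
      rw [show autX ![1, Multiplicative.ofAdd 1] = ![Multiplicative.ofAdd 1, 1]⁻¹ by decide,
        map_inv, hθ0, hθ1]
      exact (hsq stdGen).symm
  exact DFunLike.congr_fun h5

theorem iso_semidirect_autX {A : Type*} [Group A]
    (hA : IsFaithfulSemidirect A (Fin 2 → Cyc 3) (Cyc 4)) :
    Iso A ((Fin 2 → Cyc 3) ⋊[cycHom 4 autX autX_pow] Cyc 4) := by
  obtain ⟨φ, hφ, hA⟩ := hA
  obtain ⟨θ, hθ⟩ := exists_conj_autX (f := φ (.ofAdd 1))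
    (by rw [orderOf_injective φ hφ, Cyc.orderOf_gen])
  refine (hA.trans (Iso.symm ⟨SemidirectProduct.congr θ (MulEquiv.refl _) fun x => ?_⟩))
  have h1 : (MulAut.conj θ).toMonoidHom.comp (cycHom 4 autX autX_pow) = φ := by
    refine Cyc.hom_ext ?_
    change θ * cycHom 4 autX autX_pow (.ofAdd 1) * θ⁻¹ = _
    rw [cycHom_gen, mul_inv_eq_iff_eq_mul]
    exact MulEquiv.ext hθ
  refine MulEquiv.ext fun n => ?_
  change θ (cycHom 4 autX autX_pow x n) = φ x (θ n)
  rw [← h1]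
  change _ = θ (cycHom 4 autX autX_pow x (θ⁻¹ (θ n)))
  rw [MulAut.inv_apply_self]

section
variable {A : Type*} [Group A]

theorem IsExtraspecial27.pow_three_mem (h : IsExtraspecial27 A) (a : A) :
    a ^ 3 ∈ Subgroup.center A := by
  obtain ⟨e⟩ := h.2
  rw [← QuotientGroup.eq_one_iff]
  refine e.injective ?_
  have h1 : ∀ c : Cyc 3 × Cyc 3, c ^ 3 = 1 := by decide
  rw [QuotientGroup.mk_pow, map_pow, h1, map_one]

theorem IsExtraspecial27.commutator_mem (h : IsExtraspecial27 A) (a b : A) :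
    a⁻¹ * (b * a * b⁻¹) ∈ Subgroup.center A := by
  obtain ⟨e⟩ := h.2
  rw [← QuotientGroup.eq_one_iff]
  refine e.injective ?_
  simp only [QuotientGroup.mk_mul, QuotientGroup.mk_inv, map_mul, map_inv, map_one]
  rw [mul_comm (e b), mul_inv_cancel_right, inv_mul_cancel]

theorem IsExtraspecial27.pow_three_eq_one (h : IsExtraspecial27 A) {c : A}
    (hc : c ∈ Subgroup.center A) : c ^ 3 = 1 := by
  have h1 : Nat.card (Subgroup.center A) = 3 := by rw [h.1.card_eq, Cyc.natCard]
  have h2 : (⟨c, hc⟩ : Subgroup.center A) ^ 3 = 1 := by rw [← h1, pow_card_eq_one']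
  exact congrArg Subtype.val h2

/-- As the commutators are central of exponent 3, cubing is a homomorphism. -/
theorem IsExtraspecial27.mul_pow_three (h : IsExtraspecial27 A) (x y : A) :
    (x * y) ^ 3 = x ^ 3 * y ^ 3 := by
  set e := x⁻¹ * (y * x * y⁻¹) with he
  have hec := Subgroup.mem_center_iff.1 (h.commutator_mem x y)
  rw [← he] at hec
  have he3 := h.pow_three_eq_one (h.commutator_mem x y)
  rw [← he] at he3
  have hyx : y * x = x * y * e := by
    rw [mul_assoc, hec, he]; group
  have pull : ∀ g g', g * e * g' = g * g' * e := fun g g' => by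
    rw [mul_assoc, ← hec, ← mul_assoc]
  calc (x * y) ^ 3 = x * (y * x) * (y * x) * y := by
        simp only [pow_succ, pow_zero, one_mul, mul_assoc]
    _ = x * x * y * e * (x * y) * e * y := by rw [hyx]; simp only [mul_assoc]
    _ = x * x * (y * x) * (y * y) * e * e := by
      rw [pull, pull, pull]; simp only [mul_assoc]
    _ = x * x * (x * y) * e * (y * y) * e * e := by rw [hyx]; simp only [mul_assoc]
    _ = x ^ 3 * y ^ 3 * e ^ 3 := by
      rw [pull (x * x * (x * y)) (y * y)]; simp only [pow_succ, pow_zero, one_mul, mul_assoc]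
    _ = x ^ 3 * y ^ 3 := by rw [he3, mul_one]

end

theorem Cyc.gen_eq_of_ne_one : ∀ c : Cyc 3, c ≠ 1 → Multiplicative.ofAdd 1 = c ∨
    Multiplicative.ofAdd 1 = c * c := by decide

theorem iso_semidirect_cyc_three {A N : Type*} [Group A] [Finite A] [Group N] {θ : MulAut N}
    (hθ : θ ^ 3 = 1) {f : N →* A} (hf : Function.Injective f) {a b : A} (hb : b ^ 3 = 1)
    (hc : ∀ n, f (θ n) = b * f n * b⁻¹) (ha : ∀ n, a * f n = f n * a) (hab : a * b ≠ b * a)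
    (hA : Nat.card A = Nat.card N * 3) : Iso A (N ⋊[cycHom 3 θ hθ] Cyc 3) := by
  have hg : cycHom 3 b hb (.ofAdd 1) = b := cycHom_gen _ _ _
  refine iso_semidirect f (cycHom 3 b hb) ?_ hf ?_ (by rw [hA, Cyc.natCard])
  · have key : ∀ k : ℕ, ∀ n, f ((θ ^ k) n) = b ^ k * f n * (b ^ k)⁻¹ := by
      intro k
      induction k with
      | zero => intro n; simp
      | succ k ih =>
        intro n
        rw [pow_succ, MulAut.mul_apply, ih, hc, pow_succ]
        group
    intro x n
    have h1 : x = Multiplicative.ofAdd ((x.toAdd.val : ℕ) : ZMod 3) := by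
      rw [ZMod.natCast_zmod_val]; rfl
    rw [h1, cycHom_natCast, cycHom_natCast, key]
  · intro n x hx
    by_contra hx1
    have h1 : a * cycHom 3 b hb x = cycHom 3 b hb x * a := by
      rw [eq_inv_of_mul_eq_one_right hx]
      exact (show Commute a (f n) from ha n).inv_right
    rcases Cyc.gen_eq_of_ne_one x hx1 with h2 | h2
    · rw [← h2, hg] at h1
      exact hab h1
    · rw [h2, map_mul] at hg
      rw [← hg] at hab
      exact hab (by rw [← mul_assoc, h1, mul_assoc, h1, mul_assoc])

/-- The automorphism `a ↦ a c`, `c ↦ c` of the elementary abelian group of order 9. -/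
def autShear : MulAut (Fin 2 → Cyc 3) where
  toFun n := ![n 0, n 0 * n 1]
  invFun n := ![n 0, (n 0)⁻¹ * n 1]
  left_inv := by unfold Function.LeftInverse; decide
  right_inv := by unfold Function.RightInverse Function.LeftInverse; decide
  map_mul' := by decide +kernel

theorem autShear_pow : autShear ^ 3 = 1 := MulEquiv.ext (by decide +kernel)

/-- Two elements `a`, `b` that do not commute generate the group; `a` and the commutator `c` span a
normal elementary abelian subgroup, on which `b` acts by `a ↦ a c`, `c ↦ c`. -/
theorem IsHeisenberg3.iso {A : Type*} [Group A] (h : IsHeisenberg3 A) :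
    Iso A ((Fin 2 → Cyc 3) ⋊[cycHom 3 autShear autShear_pow] Cyc 3) := by
  obtain ⟨h, hexp⟩ := h
  have : Finite A := Nat.finite_of_card_ne_zero (by rw [h.card_eq]; norm_num)
  have h3 : ∀ a : A, a ^ 3 = 1 := fun a => by rw [← hexp, Monoid.pow_exponent_eq_one]
  obtain ⟨a, b, hab⟩ := h.exists_not_comm
  set c := a⁻¹ * (b * a * b⁻¹) with hc
  have hcc := Subgroup.mem_center_iff.1 (h.commutator_mem a b)
  rw [← hc] at hcc
  have hba : b * a * b⁻¹ = a * c := by rw [hc]; group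
  have hc1 : c ≠ 1 := fun h1 => by
    rw [h1, mul_one, mul_inv_eq_iff_eq_mul] at hba
    exact hab hba.symm
  let f : (Fin 2 → Cyc 3) →* A := pairHom (h3 a) (h3 c) (hcc a)
  have hf0 : f ![Multiplicative.ofAdd 1, 1] = a := pairHom_fst _ _ _
  have hf1 : f ![1, Multiplicative.ofAdd 1] = c := pairHom_snd _ _ _
  have hff : ∀ n, f n = cycHom 3 a (h3 a) (n 0) * cycHom 3 c (h3 c) (n 1) := fun n => rfl
  refine iso_semidirect_cyc_three autShear_pow (f := f) ?_ (a := a) (h3 b) ?_ (fun n => ?_) hab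
    (by rw [h.card_eq, pi_cyc_natCard]; norm_num)
  · rw [injective_iff_map_eq_one]
    intro n hn
    rw [hff] at hn
    have hcb : cycHom 3 c (h3 c) (n 1) * b = b * cycHom 3 c (h3 c) (n 1) := by
      obtain ⟨k, hk⟩ := Subgroup.mem_zpowers_iff.1 (cycHom_mem_zpowers 3 c (h3 c) (n 1))
      rw [← hk]
      exact ((show Commute b c from hcc b).zpow_right k).symm
    have h0 : n 0 = 1 := by
      by_contra h0
      have h1 : cycHom 3 a (h3 a) (n 0) * b = b * cycHom 3 a (h3 a) (n 0) := by
        rw [eq_inv_of_mul_eq_one_left hn]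
        exact (show Commute _ b from hcb).inv_left
      have hg : cycHom 3 a (h3 a) (.ofAdd 1) = a := cycHom_gen _ _ _
      rcases Cyc.gen_eq_of_ne_one _ h0 with h2 | h2
      · rw [← h2, hg] at h1
        exact hab h1
      · rw [h2, map_mul] at hg
        rw [← hg] at hab
        exact hab (by rw [mul_assoc, h1, ← mul_assoc, h1, mul_assoc])
    have h1 : n 1 = 1 := by
      have : Fact (Nat.Prime 3) := ⟨Nat.prime_three⟩
      rw [h0, map_one, one_mul] at hn
      exact (injective_iff_map_eq_one _).1
        (cycHom_injective 3 c (orderOf_eq_prime (h3 c) hc1)) _ hn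
    funext i
    fin_cases i
    · exact h0
    · exact h1
  · have h1 : f.comp autShear.toMonoidHom = (MulAut.conj b).toMonoidHom.comp f := by
      refine pi_cyc_hom_ext ?_ ?_
      · change f (autShear _) = b * f _ * b⁻¹
        rw [show autShear ![Multiplicative.ofAdd 1, 1] =
          ![Multiplicative.ofAdd 1, 1] * ![1, Multiplicative.ofAdd 1] by decide, map_mul, hf0, hf1,
          hba]
      · change f (autShear _) = b * f _ * b⁻¹
        rw [show autShear ![1, Multiplicative.ofAdd 1] = ![1, Multiplicative.ofAdd 1] by decide,
          hf1, hcc b, mul_inv_cancel_right]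
    exact DFunLike.congr_fun h1
  · rw [← hf0, ← map_mul, mul_comm, map_mul]

/-- The automorphism `a ↦ a ^ 4` of the cyclic group of order 9. -/
def autFour : MulAut (Cyc 9) where
  toFun n := n ^ 4
  invFun n := n ^ 7
  left_inv := by unfold Function.LeftInverse; decide
  right_inv := by unfold Function.RightInverse Function.LeftInverse; decide
  map_mul' := by decide +kernel

theorem autFour_pow : autFour ^ 3 = 1 := MulEquiv.ext (by decide +kernel)

/-- An element `x` that does not commute with an element `a` of order 9 has a cube in the centre
`⟨a ^ 3⟩`, so multiplying it by a power of `a` gives an element of order 3; this or its square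
conjugates `a` to `a ^ 4`. -/
theorem IsExtraspecialMinus3.exists_generators {A : Type*} [Group A]
    (h : IsExtraspecialMinus3 A) :
    ∃ a b : A, orderOf a = 9 ∧ b ^ 3 = 1 ∧ b * a * b⁻¹ = a ^ 4 := by
  obtain ⟨h, a, ha⟩ := h
  have : Finite A := Nat.finite_of_card_ne_zero (by rw [h.card_eq]; norm_num)
  have : Fact (Nat.Prime 3) := ⟨Nat.prime_three⟩
  have hz : Nat.card (Subgroup.center A) = 3 := by rw [h.1.card_eq, Cyc.natCard]
  have ha3 : orderOf (a ^ 3) = 3 := by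
    rw [orderOf_pow_of_dvd (by norm_num) (by rw [ha]; norm_num), ha]
  have hcen : ∀ c ∈ Subgroup.center A, ∃ k : ℕ, a ^ (3 * k) = c := by
    intro c hc
    have h1 : (⟨a ^ 3, h.pow_three_mem a⟩ : Subgroup.center A) ≠ 1 := fun h1 => by
      have h2 : a ^ 3 = 1 := congrArg Subtype.val h1
      rw [h2, orderOf_one] at ha3
      omega
    obtain ⟨k, hk⟩ := mem_powers_of_prime_card hz h1 (g' := ⟨c, hc⟩)
    refine ⟨k, ?_⟩
    rw [pow_mul]
    exact congrArg Subtype.val hk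
  obtain ⟨x, hx⟩ : ∃ x, x * a ≠ a * x := by
    by_contra! hx
    have h1 : a ∈ Subgroup.center A := Subgroup.mem_center_iff.2 hx
    have h2 := Subgroup.orderOf_dvd_natCard _ h1
    rw [hz, ha] at h2
    omega
  obtain ⟨k, hk⟩ := hcen _ (h.pow_three_mem x)
  obtain ⟨j, hj⟩ := hcen _ (h.commutator_mem a x)
  -- cubing is a homomorphism and `x ^ 3 = a ^ (3 * k)`, so `b` has order 3
  set b := x * (a ^ k)⁻¹ with hb
  have hb3 : b ^ 3 = 1 := by
    rw [hb, h.mul_pow_three, ← hk, inv_pow, ← pow_mul, mul_comm 3 k, mul_inv_cancel]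
  have hba : b * a * b⁻¹ = a * a ^ (3 * j) := by
    rw [hj, hb]; group
  have hcomm : b * a ≠ a * b := fun h1 => hx (by
    have h2 : x = b * a ^ k := by rw [hb, inv_mul_cancel_right]
    rw [h2, mul_assoc, ← pow_succ, pow_succ', ← mul_assoc, h1, mul_assoc])
  have hmod : a ^ (3 * j) = a ^ (3 * (j % 3)) := by
    rw [pow_eq_pow_iff_modEq, ha, Nat.ModEq]; omega
  rw [hmod] at hba
  have hj3 := Nat.mod_lt j (show 3 > 0 by norm_num)
  have hj0 : j % 3 ≠ 0 := fun h0 => by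
    rw [h0, mul_zero, pow_zero, mul_one, mul_inv_eq_iff_eq_mul] at hba
    exact hcomm hba
  -- `b` conjugates `a` to `a ^ 4` or `a ^ 7`, and in the second case `b ^ 2` conjugates `a` to `a
  -- ^ 4`
  have hj12 : j % 3 = 1 ∨ j % 3 = 2 := by omega
  rcases hj12 with h1 | h1 <;> rw [h1] at hba
  · exact ⟨a, b, ha, hb3, by rw [hba, ← pow_succ']⟩
  · refine ⟨a, b ^ 2, ha, by rw [← pow_mul, mul_comm, pow_mul, hb3, one_pow], ?_⟩
    rw [← pow_succ'] at hba
    calc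
      b ^ 2 * a * (b ^ 2)⁻¹ = b * (b * a * b⁻¹) * b⁻¹ := by
        rw [pow_two, mul_inv_rev]
        simp only [mul_assoc]
      _ = (b * a * b⁻¹) ^ 7 := by rw [conj_pow, hba]
      _ = a ^ 4 := by
        rw [hba, ← pow_mul, pow_eq_pow_iff_modEq, ha]; rfl

theorem IsExtraspecialMinus3.iso {A : Type*} [Group A] (h : IsExtraspecialMinus3 A) :
    Iso A (Cyc 9 ⋊[cycHom 3 autFour autFour_pow] Cyc 3) := by
  obtain ⟨a, b, ha, hb, hba⟩ := h.exists_generators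
  have : Finite A := Nat.finite_of_card_ne_zero (by rw [h.1.card_eq]; norm_num)
  have h9 : a ^ 9 = 1 := ha ▸ pow_orderOf_eq_one a
  have hg : cycHom 9 a h9 (.ofAdd 1) = a := cycHom_gen _ _ _
  refine iso_semidirect_cyc_three autFour_pow (f := cycHom 9 a h9) (cycHom_injective 9 a ha)
    (a := a) hb ?_ (fun n => ?_) (fun hab => ?_) (by rw [h.1.card_eq, Cyc.natCard])
  · have h1 : (cycHom 9 a h9).comp autFour.toMonoidHom =
        (MulAut.conj b).toMonoidHom.comp (cycHom 9 a h9) := by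
      refine Cyc.hom_ext ?_
      change cycHom 9 a h9 ((.ofAdd 1) ^ 4) = b * cycHom 9 a h9 (.ofAdd 1) * b⁻¹
      rw [map_pow, hg, hba]
    exact DFunLike.congr_fun h1
  · obtain ⟨k, hk⟩ := Subgroup.mem_zpowers_iff.1 (cycHom_mem_zpowers 9 a h9 n)
    rw [← hk]
    exact (Commute.refl a).zpow_right k
  · rw [← hab, mul_inv_cancel_right] at hba
    have h1 : a ^ 1 = a ^ 4 := by rw [pow_one]; exact hba
    rw [pow_eq_pow_iff_modEq, ha] at h1
    exact absurd h1 (by decide)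

theorem Entry.IsoType.iso {i : Entry} {A B : Type*} [Group A] [Group B] (hA : i.IsoType A)
    (hB : i.IsoType B) : Iso A B := by
  cases i
  case row1 => exact isNontrivialSemidirect_unique_thirteen hA hB
  case row3 => exact (IsHeisenberg3.iso hA).trans (IsHeisenberg3.iso hB).symm
  case row4 => exact (IsExtraspecialMinus3.iso hA).trans (IsExtraspecialMinus3.iso hB).symm
  case row5 => exact isFaithfulSemidirect_unique_thirteen hA hB
  case row6 => exact (iso_semidirect_autX hA).trans (iso_semidirect_autX hB).symm
  case row9 => exact isNontrivialSemidirect_unique_perm hA hB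
  case row26 =>
    have h1 := (Nat.card_eq_one_iff_unique.1 hA).1
    have h2 := (Nat.card_eq_one_iff_unique.1 hB).1
    exact ⟨MulEquiv.mk' ⟨fun _ => 1, fun _ => 1, fun _ => Subsingleton.elim _ _,
      fun _ => Subsingleton.elim _ _⟩ fun _ _ => Subsingleton.elim _ _⟩
  all_goals exact Iso.trans hA (Iso.symm hB)

/-! ### Uniqueness of the actions -/

section
variable {G G' : Subgroup S27}

theorem orbitLengths_of_actsTransitively (h : ActsTransitively G) : orbitLengths G = {27} := by
  have h1 : ∀ v : Fin 27, (orbit G v).ncard = 27 := fun v => by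
    have : IsPretransitive G (Fin 27) := h
    rw [orbit_eq_univ, Set.ncard_univ, Nat.card_eq_fintype_card, Fintype.card_fin]
  refine orbitLengths_eq_of_pointCount (D := {27}) (by simpa using h1) (by simp) (by simp) ?_
  simp [pointCount, h1]

theorem orbitLengths_of_actsFreely (h : ActsFreely G) (hG : Nat.card G = 3) :
    orbitLengths G = Multiset.replicate 9 3 := by
  have h1 : ∀ v : Fin 27, (orbit G v).ncard = 3 := fun v => by
    have := ncard_orbit_mul_card_stabilizer (A := G) v
    rwa [h v, Subgroup.card_bot, mul_one, hG] at this
  refine orbitLengths_eq_of_pointCount (D := {3}) (by simpa using h1) (by simp) (by simp) ?_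
  simp [pointCount, h1]

theorem orbitLengths_of_card_two (hG : Nat.card G = 2)
    (h : (fixedPoints G (Fin 27)).ncard = 3) :
    orbitLengths G = Multiset.replicate 12 2 + Multiset.replicate 3 1 := by
  have h1 : ∀ v : Fin 27, (orbit G v).ncard ∈ ({1, 2} : Finset ℕ) := fun v => by
    have := ncard_orbit_dvd_card (A := G) v
    rw [hG, Nat.dvd_prime Nat.prime_two] at this
    simpa using this
  have := Fintype.ofFinite G
  have h2 := (sum_ncard_orbit h1).1
  have h3 := pointCount_one G
  rw [h] at h3
  rw [Finset.sum_pair (by norm_num), Fintype.card_fin] at h2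
  change pointCount G 1 + pointCount G 2 = 27 at h2
  refine orbitLengths_eq_of_pointCount h1 (by decide) (by decide) ?_
  have h4 : pointCount G 2 = 24 := by omega
  simp [h3, h4]

/-- The uniqueness of all actions except the second ones of the Klein four-group and of the dihedral
group of order 8: all orbit lengths are 1, the order of the group, or the index of a Sylow subgroup.
-/
theorem areConjugate_of_isoType {i : Entry} (hi : i.IsoType G) (hi' : i.IsoType G')
    {s : Multiset ℕ} (hs : orbitLengths G = s) (hs' : orbitLengths G' = s)
    (hn : ∀ n ∈ s, n = i.order ∨ n = 1 ∨ ∃ p ∈ ({2, 11, 13} : Finset ℕ), ∃ k ∈ Finset.range 5,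
      n * p ^ k = i.order ∧ ¬ p ∣ n) : AreConjugate G G' := by
  refine areConjugate_of_orbitLengths_eq (hi.iso hi') (hs.trans hs'.symm) fun n h => ?_
  rw [hs] at h
  rw [hi.card_eq]
  rcases hn n h with h1 | h1 | ⟨p, hp, k, -, h1⟩
  · exact Or.inl h1
  · exact Or.inr (Or.inl h1)
  · have h2 : ∀ p ∈ ({2, 11, 13} : Finset ℕ), p.Prime := by decide +kernel
    exact Or.inr (Or.inr ⟨p, k, h2 p hp, h1⟩)

end

section
variable {G G' : Subgroup S27}

/-- The number of points with a given stabilizer, for the second action of the Klein four-group: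
as distinct orbits of length 2 have distinct stabilizers, each of the three subgroups of order 2
is the stabilizer of the points of exactly one such orbit. -/
theorem ncard_stabilizer_eq_of_klein (h : Entry.row22.Describes G) (K : Subgroup G) :
    {v : Fin 27 | stabilizer G v = K}.ncard =
      if Nat.card K = 4 then 1 else if Nat.card K = 2 then 2 else if Nat.card K = 1 then 20
      else 0 := by
  classical
  have hc : Nat.card G = 4 := h.isoType.card_eq
  obtain ⟨-, hl, hne, -⟩ := h
  have hm : ∀ v : Fin 27, (orbit G v).ncard * Nat.card (stabilizer G v) = 4 := fun v => by
    rw [ncard_orbit_mul_card_stabilizer, hc]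
  have hcount : ∀ n, pointCount G n =
      ({4, 4, 4, 4, 4, 2, 2, 2, 1} : Multiset ℕ).count n * n := fun n => by
    rw [← hl, count_orbitLengths]; rfl
  have hK := Subgroup.card_subgroup_dvd_card K
  rw [hc] at hK
  have hK4 : Nat.card K = 1 ∨ Nat.card K = 2 ∨ Nat.card K = 4 := by
    have h1 := Nat.le_of_dvd (by norm_num) hK
    interval_cases Nat.card K <;> omega
  rcases hK4 with h1 | h1 | h1
  · rw [if_neg (by omega), if_neg (by omega), if_pos h1]
    have h2 := hcount 4
    rw [show ({4, 4, 4, 4, 4, 2, 2, 2, 1} : Multiset ℕ).count 4 * 4 = 20 by decide] at h2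
    rw [← h2, pointCount]
    congr 1
    ext v
    rw [Set.mem_ofPred_eq, Set.mem_ofPred_eq, Subgroup.card_eq_one.1 h1, ← Subgroup.card_eq_one]
    have := hm v
    constructor
    · intro h3; rw [h3] at this; omega
    · intro h3; rw [h3] at this; omega
  · rw [if_neg (by omega), if_pos h1]
    -- the number of points of `T t`, for `t ≠ 1`, is at most 2, and these numbers add up to 6
    let T : G → Finset (Fin 27) := fun t =>
      Finset.univ.filter fun v => (orbit G v).ncard = 2 ∧ t • v = v
    have hst : ∀ v : Fin 27, (orbit G v).ncard = 2 → ∀ t : G, t ≠ 1 → t • v = v →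
        ∀ L : Subgroup G, Nat.card L = 2 → t ∈ L → stabilizer G v = L := by
      intro v hv t ht htv L hL htL
      have h2 : Nat.card (stabilizer G v) = 2 := by
        have := hm v
        rw [hv] at this
        omega
      have h3 : ∀ M : Subgroup G, Nat.card M = 2 → t ∈ M → Subgroup.zpowers t = M := by
        intro M hM htM
        have : Fact (Nat.Prime 2) := ⟨Nat.prime_two⟩
        refine Subgroup.eq_of_le_of_card_ge (by rwa [Subgroup.zpowers_le]) ?_
        have h4 := Subgroup.orderOf_dvd_natCard M htM
        rw [hM, Nat.dvd_prime Nat.prime_two, orderOf_eq_one_iff] at h4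
        rw [Nat.card_zpowers, hM, h4.resolve_left ht]
      rw [← h3 _ h2 htv, h3 L hL htL]
    have hT2 : ∀ t ∈ (Finset.univ.erase (1 : G)), (T t).card ≤ 2 := by
      intro t ht
      have ht1 := (Finset.mem_erase.1 ht).1
      rcases (T t).eq_empty_or_nonempty with h2 | ⟨u, hu⟩
      · rw [h2]; simp
      · have hu' := (Finset.mem_filter.1 hu).2
        rw [← Set.ncard_coe_finset, ← hu'.1]
        refine Set.ncard_le_ncard fun v hv => ?_
        have hv' := (Finset.mem_filter.1 (Finset.mem_coe.1 hv)).2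
        by_contra h3
        refine hne u v hu'.1 hv'.1 (fun h4 => h3 (h4 ▸ mem_orbit_self v)) ?_
        refine hst u hu'.1 t ht1 hu'.2 _ ?_ hv'.2
        have := hm v
        rw [hv'.1] at this
        omega
    have hsum : ∑ t ∈ Finset.univ.erase (1 : G), (T t).card =
        ∑ t ∈ Finset.univ.erase (1 : G), 2 := by
      have h2 : ∑ t ∈ Finset.univ.erase (1 : G), (T t).card =
          ∑ v ∈ Finset.univ.filter (fun v : Fin 27 => (orbit G v).ncard = 2), 1 := by
        have h3 : ∀ t : G, (T t).card = ∑ v ∈ Finset.univ.filter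
            (fun v : Fin 27 => (orbit G v).ncard = 2), if t • v = v then 1 else 0 := fun t => by
          rw [Finset.sum_boole, Finset.filter_filter, Nat.cast_id]
        simp only [h3]
        rw [Finset.sum_comm]
        refine Finset.sum_congr rfl fun v hv => ?_
        have hv' := (Finset.mem_filter.1 hv).2
        rw [Finset.sum_boole, Nat.cast_id]
        have h4 : (Finset.univ.erase (1 : G)).filter (fun t => t • v = v) =
            ((Finset.univ : Finset G).filter fun t => t • v = v).erase 1 := by
          ext t; simp [and_comm]
        have h5 : ((Finset.univ : Finset G).filter fun t => t • v = v).card = 2 := by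
          rw [← Fintype.card_subtype, ← Nat.card_eq_fintype_card]
          have := hm v
          rw [hv'] at this
          change Nat.card (stabilizer G v) = 2
          omega
        rw [h4, Finset.card_erase_of_mem (by simp), h5]
      rw [h2, Finset.sum_const, Finset.sum_const, Finset.card_erase_of_mem (Finset.mem_univ _),
        Finset.card_univ, ← Nat.card_eq_fintype_card, hc]
      have h3 := hcount 2
      rw [show ({4, 4, 4, 4, 4, 2, 2, 2, 1} : Multiset ℕ).count 2 * 2 = 6 by decide, pointCount,
        Set.ncard_eq_toFinset_card', Set.toFinset_ofPred] at h3
      rw [h3]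
      rfl
    have heq := (Finset.sum_eq_sum_iff_of_le hT2).1 hsum
    have hK1 : K ≠ ⊥ := fun h2 => by
      rw [h2, Subgroup.card_bot] at h1
      omega
    obtain ⟨⟨t, htK⟩, ht1⟩ := Subgroup.ne_bot_iff_exists_ne_one.1 hK1
    have ht1' : t ≠ 1 := fun h2 => ht1 (Subtype.ext h2)
    rw [← heq t (Finset.mem_erase.2 ⟨ht1', Finset.mem_univ t⟩), ← Set.ncard_coe_finset]
    congr 1
    ext v
    simp only [T, Set.mem_ofPred_eq, Finset.coe_filter, Finset.mem_univ, true_and]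
    refine ⟨fun h2 => ⟨?_, ?_⟩, fun h2 => hst v h2.1 t ht1' h2.2 K h1 htK⟩
    · have := hm v
      rw [h2, h1] at this
      omega
    · rw [← mem_stabilizer_iff, h2]
      exact htK
  · rw [if_pos h1]
    have h2 := hcount 1
    rw [show ({4, 4, 4, 4, 4, 2, 2, 2, 1} : Multiset ℕ).count 1 * 1 = 1 by decide] at h2
    rw [← h2, pointCount]
    congr 1
    ext v
    rw [Set.mem_ofPred_eq, Set.mem_ofPred_eq, Subgroup.eq_top_of_card_eq K (by rw [h1, hc]),
      ← Subgroup.card_eq_iff_eq_top, hc]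
    have := hm v
    constructor
    · intro h3; rw [h3] at this; omega
    · intro h3; rw [h3] at this; omega

theorem areConjugate_of_klein (h : Entry.row22.Describes G) (h' : Entry.row22.Describes G') :
    AreConjugate G G' := by
  obtain ⟨φ⟩ := h.isoType.iso h'.isoType
  obtain ⟨e, he⟩ := exists_equiv_of_card_fiber_eq (fun v : Fin 27 => stabilizer G v)
    (fun v : Fin 27 => (stabilizer G' v).comap φ.toMonoidHom) fun K => by
      rw [ncard_stabilizer_eq_of_klein h K]
      have h1 : {v : Fin 27 | (stabilizer G' v).comap φ.toMonoidHom = K} =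
          {v | stabilizer G' v = K.map φ.toMonoidHom} := by
        ext v
        constructor
        · rintro rfl
          exact (Subgroup.map_comap_eq_self_of_surjective φ.surjective _).symm
        · intro h2
          rw [Set.mem_ofPred_eq] at h2 ⊢
          rw [h2]
          exact Subgroup.comap_map_eq_self_of_injective φ.injective K
      rw [h1, ncard_stabilizer_eq_of_klein h']
      rw [Nat.card_congr (K.equivMapOfInjective φ.toMonoidHom φ.injective).toEquiv]
  refine areConjugate_of_equiv φ e fun v => ⟨1, fun g => ?_⟩
  rw [map_one, one_smul, ← mem_stabilizer_iff, ← he v]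
  rfl

/-- The stabilizer of a point, as a subgroup of the dihedral group with which the acting group has
been identified. -/
def dihedralStabilizer (φ : G ≃* DihedralGroup 4) (v : Fin 27) : Subgroup (DihedralGroup 4) :=
  (stabilizer G v).comap φ.symm.toMonoidHom

theorem mem_dihedralStabilizer {φ : G ≃* DihedralGroup 4} {v : Fin 27} {d : DihedralGroup 4} :
    d ∈ dihedralStabilizer φ v ↔ φ.symm d ∈ stabilizer G v := Iff.rfl

theorem card_dihedralStabilizer (φ : G ≃* DihedralGroup 4) (v : Fin 27) :
    (orbit G v).ncard * Nat.card (dihedralStabilizer φ v) = 8 := by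
  have h1 : Nat.card (dihedralStabilizer φ v) = Nat.card (stabilizer G v) :=
    Nat.card_congr (φ.symm.toEquiv.subtypeEquiv fun _ => Iff.rfl)
  rw [h1, ncard_orbit_mul_card_stabilizer, Nat.card_congr φ.toEquiv, DihedralGroup.nat_card]

theorem eq_rotations_of_card_four {K : Subgroup (DihedralGroup 4)} (hK : Nat.card K = 4)
    (h : .r 1 ∈ K) (d : DihedralGroup 4) : d ∈ K ↔ ∃ i, d = .r i := by
  have h1 : Subgroup.zpowers (.r 1 : DihedralGroup 4) = K :=
    Subgroup.eq_of_le_of_card_ge (by rwa [Subgroup.zpowers_le])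
      (by rw [hK, Nat.card_zpowers, DihedralGroup.orderOf_r_one])
  rw [← h1]
  constructor
  · rintro ⟨k, rfl⟩
    exact ⟨k, by simp⟩
  · rintro ⟨i, rfl⟩
    refine ⟨i.val, ?_⟩
    simp

theorem mem_of_card_two {A : Type*} [Group A] {K : Subgroup A} (hK : Nat.card K = 2) {t : A}
    (ht : t ∈ K) (ht1 : t ≠ 1) (d : A) : d ∈ K ↔ d = 1 ∨ d = t := by
  have : Finite K := Nat.finite_of_card_ne_zero (by omega)
  have h1 : ({1, t} : Set A) = K := by
    refine Set.eq_of_subset_of_ncard_le ?_ ?_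
    · rintro x (rfl | rfl)
      · exact K.one_mem
      · exact ht
    · rw [Set.ncard_pair (Ne.symm ht1)]
      exact hK.le
  rw [← SetLike.mem_coe, ← h1]
  simp

/-- The description of the second action of the dihedral group of order 8 in terms of the standard
generators: points in orbits of length 4 are fixed by exactly one reflection, and points in the
orbit of length 2 by exactly the rotations. -/
theorem dihedralStabilizer_eq (h : Entry.row18.Describes G) (φ : G ≃* DihedralGroup 4)
    (v : Fin 27) :
    ((orbit G v).ncard = 4 → ∃ i, ∀ d, d ∈ dihedralStabilizer φ v ↔ d = 1 ∨ d = .sr i) ∧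
    ((orbit G v).ncard = 2 → ∀ d, d ∈ dihedralStabilizer φ v ↔ ∃ i, d = .r i) := by
  obtain ⟨-, -, -, hz, hr⟩ := h
  have hc := card_dihedralStabilizer φ v
  constructor
  · intro hv
    have h1 : Nat.card (dihedralStabilizer φ v) = 2 := by rw [hv] at hc; omega
    have hK1 : dihedralStabilizer φ v ≠ ⊥ := fun h2 => by
      rw [h2, Subgroup.card_bot] at h1
      omega
    obtain ⟨⟨t, htK⟩, ht1⟩ := Subgroup.ne_bot_iff_exists_ne_one.1 hK1
    have ht1' : t ≠ 1 := fun h2 => ht1 (Subtype.ext h2)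
    have hmem := mem_of_card_two h1 htK ht1'
    have htt : t * t = 1 := by
      rcases (hmem _).1 (mul_mem htK htK) with h2 | h2
      · exact h2
      · exact absurd (mul_eq_left.1 h2) ht1'
    have hd : ∀ t : DihedralGroup 4, t ≠ 1 → t * t = 1 → t = .r 2 ∨ ∃ i, t = .sr i := by decide
    -- the stabilizer of order 2 is not the centre `{1, r 2}`, so its involution is a reflection
    rcases hd t ht1' htt with rfl | ⟨i, rfl⟩
    · refine absurd ?_ (hz v hv)
      have hcen : ∀ d : DihedralGroup 4, (∀ g, g * d = d * g) ↔ d = 1 ∨ d = .r 2 := by decide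
      ext g
      have h2 := hmem (φ g)
      rw [mem_dihedralStabilizer, φ.symm_apply_apply] at h2
      rw [h2, ← hcen, Subgroup.mem_center_iff]
      constructor
      · intro h3 x
        exact φ.injective (by rw [map_mul, map_mul, h3])
      · intro h3 x
        have := congrArg φ (h3 (φ.symm x))
        rwa [map_mul, map_mul, φ.apply_symm_apply] at this
    · exact ⟨i, hmem⟩
  · intro hv
    refine eq_rotations_of_card_four (by rw [hv] at hc; omega) ?_
    obtain ⟨ψ⟩ := hr v hv
    set x : stabilizer G v := ψ.symm (.ofAdd 1) with hx
    have ho : orderOf (φ (x : G)) = 4 := by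
      rw [MulEquiv.orderOf_eq, Subgroup.orderOf_coe, hx, MulEquiv.orderOf_eq, Cyc.orderOf_gen]
    have h1 : φ (x : G) ^ 2 ≠ 1 := fun h2 => by
      have := orderOf_dvd_of_pow_eq_one h2
      rw [ho] at this
      omega
    have hd : ∀ d : DihedralGroup 4, d ^ 2 ≠ 1 → d = .r 1 ∨ d ^ 3 = .r 1 := by decide
    have hxm : φ (x : G) ∈ dihedralStabilizer φ v := by
      rw [mem_dihedralStabilizer, φ.symm_apply_apply]
      exact x.2
    rcases hd _ h1 with h2 | h2
    · rwa [← h2]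
    · rw [← h2]
      exact pow_mem hxm 3

/-- Whether a point in an orbit of length 4 is fixed by a reflection of the first of the two
conjugacy classes. -/
def FixedByEven (φ : G ≃* DihedralGroup 4) (v : Fin 27) : Prop :=
  (orbit G v).ncard = 4 ∧ (.sr 0 ∈ dihedralStabilizer φ v ∨ .sr 2 ∈ dihedralStabilizer φ v)

theorem orbit_eq_of_fixedByEven_iff (h : Entry.row18.Describes G) (φ : G ≃* DihedralGroup 4)
    {u v : Fin 27} (hu : (orbit G u).ncard = 4) (hv : (orbit G v).ncard = 4)
    (huv : FixedByEven φ u ↔ FixedByEven φ v) : orbit G u = orbit G v := by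
  by_contra hne
  refine h.2.2.1 u v hu hv hne ?_
  obtain ⟨i, hi⟩ := (dihedralStabilizer_eq h φ u).1 hu
  obtain ⟨j, hj⟩ := (dihedralStabilizer_eq h φ v).1 hv
  simp only [FixedByEven, hu, hv, true_and, hi, hj, DihedralGroup.sr.injEq] at huv
  have h0 : ∀ j : ZMod 4, (DihedralGroup.sr j : DihedralGroup 4) ≠ 1 := by decide
  simp only [h0, false_or] at huv
  have hd : ∀ i j : ZMod 4, (0 = i ∨ 2 = i ↔ 0 = j ∨ 2 = j) →
      ∃ d : DihedralGroup 4, d * .sr i * d⁻¹ = .sr j := by decide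
  obtain ⟨d, hd⟩ := hd i j huv
  refine ⟨φ.symm d, ?_⟩
  ext g
  have h1 := hj (φ g)
  rw [mem_dihedralStabilizer, φ.symm_apply_apply] at h1
  rw [Subgroup.mem_map_equiv, h1]
  have h2 := hi (φ ((MulAut.conj (φ.symm d)).symm g))
  rw [mem_dihedralStabilizer, φ.symm_apply_apply] at h2
  rw [h2, MulAut.conj_symm_apply, map_mul, map_mul, map_inv, φ.apply_symm_apply, ← hd]
  constructor
  · rintro (h3 | h3)
    · exact Or.inl (by simpa [mul_assoc, inv_mul_eq_iff_eq_mul] using h3)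
    · exact Or.inr (by rw [← h3]; group)
  · rintro (h3 | h3)
    · exact Or.inl (by rw [h3]; group)
    · exact Or.inr (by rw [h3]; group)

theorem ncard_fixedByEven (h : Entry.row18.Describes G) (φ : G ≃* DihedralGroup 4) :
    {v : Fin 27 | FixedByEven φ v}.ncard = 4 ∧
    {v : Fin 27 | (orbit G v).ncard = 4 ∧ ¬ FixedByEven φ v}.ncard = 4 := by
  have key : ∀ S : Set (Fin 27), (∀ v ∈ S, (orbit G v).ncard = 4) →
      (∀ u ∈ S, ∀ v ∈ S, (FixedByEven φ u ↔ FixedByEven φ v)) → S.ncard ≤ 4 := by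
    intro S h1 h2
    rcases S.eq_empty_or_nonempty with rfl | ⟨u, hu⟩
    · simp
    · rw [← h1 u hu]
      refine Set.ncard_le_ncard fun v hv => ?_
      rw [orbit_eq_of_fixedByEven_iff h φ (h1 u hu) (h1 v hv) (h2 u hu v hv)]
      exact mem_orbit_self v
  have h1 := key {v : Fin 27 | FixedByEven φ v} (fun v hv => hv.1)
    fun u hu v hv => iff_of_true hu hv
  have h2 := key {v : Fin 27 | (orbit G v).ncard = 4 ∧ ¬ FixedByEven φ v} (fun v hv => hv.1)
    fun u hu v hv => iff_of_false hu.2 hv.2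
  have h3 : pointCount G 4 = 8 := by
    rw [pointCount, ← count_orbitLengths, h.2.1]; rfl
  have h4 : {v : Fin 27 | (orbit G v).ncard = 4} = {v : Fin 27 | FixedByEven φ v} ∪
      {v : Fin 27 | (orbit G v).ncard = 4 ∧ ¬ FixedByEven φ v} := by
    ext v
    simp only [FixedByEven, Set.mem_ofPred_eq, Set.mem_union]
    tauto
  rw [pointCount, h4, Set.ncard_union_eq
    (Set.disjoint_left.2 fun v h5 h6 => h6.2 h5)] at h3
  omega

open Classical in
theorem ncard_label (h : Entry.row18.Describes G) (φ : G ≃* DihedralGroup 4) (c : ℕ × Prop) :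
    {v : Fin 27 | ((orbit G v).ncard, FixedByEven φ v) = c}.ncard =
      if c.1 = 4 then 4 else if c.2 then 0 else
        ({8, 8, 4, 4, 2, 1} : Multiset ℕ).count c.1 * c.1 := by
  obtain ⟨n, p⟩ := c
  have h1 := ncard_fixedByEven h φ
  simp only [Prod.mk.injEq, eq_iff_iff]
  by_cases hp : p
  · by_cases hn : n = 4
    · rw [if_pos hn]
      rw [← h1.1]
      congr 1
      ext v
      simp only [hp, iff_true, hn, Set.mem_ofPred_eq]
      exact ⟨fun h2 => h2.2, fun h2 => ⟨h2.1, h2⟩⟩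
    · rw [if_neg hn, if_pos hp, Set.ncard_eq_zero, Set.eq_empty_iff_forall_notMem]
      rintro v ⟨h2, h3⟩
      exact hn (h2.symm.trans (h3.2 hp).1)
  · by_cases hn : n = 4
    · rw [if_pos hn]
      rw [← h1.2]
      congr 1
      ext v
      simp only [hp, iff_false, hn, Set.mem_ofPred_eq]
    · rw [if_neg hn, if_neg hp, ← h.2.1, count_orbitLengths]
      congr 1
      ext v
      simp only [hp, iff_false, Set.mem_ofPred_eq]
      exact ⟨fun h2 => h2.1, fun h2 => ⟨h2, fun h3 => hn (h2.symm.trans h3.1)⟩⟩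

theorem exists_conj_dihedralStabilizer (h : Entry.row18.Describes G)
    (h' : Entry.row18.Describes G') (φ : G ≃* DihedralGroup 4) (φ' : G' ≃* DihedralGroup 4)
    {v w : Fin 27} (hn : (orbit G v).ncard = (orbit G' w).ncard)
    (he : FixedByEven φ v ↔ FixedByEven φ' w) :
    ∃ d : DihedralGroup 4, ∀ x, x ∈ dihedralStabilizer φ v ↔
      d⁻¹ * x * d ∈ dihedralStabilizer φ' w := by
  have hc := card_dihedralStabilizer φ v
  have hc' := card_dihedralStabilizer φ' w
  have hn8 : (orbit G v).ncard ∣ 8 := Dvd.intro _ hc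
  rcases mem_divisors_eight hn8 with h1 | h1 | h1 | h1
  · refine ⟨1, fun x => ?_⟩
    rw [Subgroup.eq_top_of_card_eq (dihedralStabilizer φ v)
        (by rw [DihedralGroup.nat_card]; rw [h1] at hc; omega),
      Subgroup.eq_top_of_card_eq (dihedralStabilizer φ' w)
        (by rw [DihedralGroup.nat_card]; rw [← hn, h1] at hc'; omega)]
    exact iff_of_true trivial trivial
  · refine ⟨1, fun x => ?_⟩
    rw [(dihedralStabilizer_eq h φ v).2 h1, (dihedralStabilizer_eq h' φ' w).2 (hn ▸ h1), inv_one,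
      one_mul, mul_one]
  · obtain ⟨i, hi⟩ := (dihedralStabilizer_eq h φ v).1 h1
    obtain ⟨j, hj⟩ := (dihedralStabilizer_eq h' φ' w).1 (hn ▸ h1)
    simp only [FixedByEven, ← hn, h1, true_and, hi, hj, DihedralGroup.sr.injEq] at he
    have h0 : ∀ j : ZMod 4, (DihedralGroup.sr j : DihedralGroup 4) ≠ 1 := by decide
    simp only [h0, false_or] at he
    have hd : ∀ i j : ZMod 4, (0 = i ∨ 2 = i ↔ 0 = j ∨ 2 = j) →
        ∃ d : DihedralGroup 4, d⁻¹ * .sr i * d = .sr j := by decide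
    obtain ⟨d, hd⟩ := hd i j he
    refine ⟨d, fun x => ?_⟩
    rw [hi, hj, ← hd, mul_left_inj, mul_right_inj]
    refine or_congr_left ⟨fun h3 => by rw [h3]; group, fun h3 => ?_⟩
    rwa [mul_eq_one_iff_eq_inv, inv_mul_eq_iff_eq_mul, mul_inv_cancel] at h3
  · refine ⟨1, fun x => ?_⟩
    rw [Subgroup.card_eq_one.1 (show Nat.card (dihedralStabilizer φ v) = 1 by
        rw [h1] at hc; omega),
      Subgroup.card_eq_one.1 (show Nat.card (dihedralStabilizer φ' w) = 1 by
        rw [← hn, h1] at hc'; omega), inv_one, one_mul, mul_one]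

theorem areConjugate_of_dihedral (h : Entry.row18.Describes G) (h' : Entry.row18.Describes G') :
    AreConjugate G G' := by
  obtain ⟨φ⟩ := id h.1
  obtain ⟨φ'⟩ := id h'.1
  obtain ⟨e, he⟩ := exists_equiv_of_card_fiber_eq
    (fun v : Fin 27 => ((orbit G v).ncard, FixedByEven φ v))
    (fun v : Fin 27 => ((orbit G' v).ncard, FixedByEven φ' v)) fun c => by
      rw [ncard_label h φ, ncard_label h' φ']
  refine areConjugate_of_equiv (φ.trans φ'.symm) e fun v => ?_
  have h1 := he v
  rw [Prod.mk.injEq] at h1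
  obtain ⟨d, hd⟩ := exists_conj_dihedralStabilizer h h' φ φ' h1.1.symm (Iff.of_eq h1.2.symm)
  refine ⟨φ.symm d, fun g => ?_⟩
  have h2 := hd (φ g)
  rw [mem_dihedralStabilizer, φ.symm_apply_apply, mem_stabilizer_iff] at h2
  rw [h2, mem_dihedralStabilizer, mem_stabilizer_iff]
  simp only [MulEquiv.trans_apply, map_mul, map_inv, φ.apply_symm_apply, mul_smul]
  rw [inv_smul_eq_iff]

theorem Entry.Describes.areConjugate {i : Entry} (h : i.Describes G) (h' : i.Describes G') :
    AreConjugate G G' := by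
  have hi := h.isoType
  have hi' := h'.isoType
  cases i
  case row1 | row2 | row3 | row4 =>
    have key : ∀ {G : Subgroup S27}, ActsTransitively G → orbitLengths G = {27} :=
      orbitLengths_of_actsTransitively
    first
    | exact areConjugate_of_isoType hi hi' (key h.2) (key h'.2) (by decide +kernel)
    | exact areConjugate_of_isoType hi hi' (key h.2.1) (key h'.2.1) (by decide +kernel)
  case row18 => exact areConjugate_of_dihedral h h'
  case row22 => exact areConjugate_of_klein h h'
  case row24 =>
    exact areConjugate_of_isoType hi hi' (orbitLengths_of_actsFreely h.2 hi.card_eq)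
      (orbitLengths_of_actsFreely h'.2 hi'.card_eq) (by decide +kernel)
  case row25 =>
    exact areConjugate_of_isoType hi hi' (orbitLengths_of_card_two hi.card_eq h.2)
      (orbitLengths_of_card_two hi'.card_eq h'.2) (by decide +kernel)
  case row26 =>
    obtain rfl : G = ⊥ := h
    obtain rfl : G' = ⊥ := h'
    exact ⟨1, Subgroup.map_bot _⟩
  all_goals exact areConjugate_of_isoType hi hi' h.2 h'.2 (by decide +kernel)

end

/-! ### Construction of actions -/

/-- An abstract group with the properties of a good action can be realized as a group of
permutations of 27 points. -/
theorem Good.exists_subgroup {A X : Type*} [Group A] [MulAction A X] (h : Good A X) :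
    ∃ G : Subgroup S27, Good G (Fin 27) ∧ Iso A G ∧
      (fixedPoints G (Fin 27)).ncard = (fixedPoints A X).ncard := by
  have := h.finite_set
  let e : X ≃ Fin 27 := Finite.equivFinOfCardEq h.natCard
  let ρ : A →* S27 := e.permCongrHom.toMonoidHom.comp (toPermHom A X)
  have hρ : ∀ a x, ρ a (e x) = e (a • x) := fun a x => by
    change e (a • e.symm (e x)) = _
    rw [e.symm_apply_apply]
  have hinj : Function.Injective ρ := by
    rw [injective_iff_map_eq_one]
    intro a ha
    have h1 : fixedBy X a = Set.univ := by
      ext x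
      refine iff_of_true (e.injective ?_) trivial
      rw [← hρ, ha]
      rfl
    have h2 : Nat.card (fixedBy X a) = 27 := by
      rw [h1, ← h.natCard]; exact Nat.card_congr (Equiv.Set.univ X)
    have h3 := h.card_fixedBy a
    rw [← orderOf_eq_one_iff]
    omega
  let f : A ≃* ρ.range := MonoidHom.ofInjective hinj
  have hf : ∀ (g : ρ.range) (v : Fin 27), e.symm (g • v) = f.symm g • e.symm v := by
    intro g v
    obtain ⟨a, rfl⟩ := f.surjective g
    obtain ⟨x, rfl⟩ := e.surjective v
    rw [f.symm_apply_apply, e.symm_apply_apply]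
    exact e.injective (by rw [e.apply_symm_apply]; exact hρ a x)
  refine ⟨ρ.range, h.of_injective f.symm.toMonoidHom f.symm.injective e.symm hf, ⟨f⟩, ?_⟩
  rw [← Set.ncard_image_of_injective _ e.symm.injective]
  congr 1
  ext x
  constructor
  · rintro ⟨v, hv, rfl⟩ a
    rw [← f.symm_apply_apply a, ← hf, hv]
  · intro hx
    refine ⟨e x, fun g => e.symm.injective ?_, e.symm_apply_apply x⟩
    rw [hf, e.symm_apply_apply, hx]

/-- The disjoint union of `k` copies of `Y` and `l` additional points. -/
def Copies (Y : Type*) (k l : ℕ) : Type _ := (Y × Fin k) ⊕ Fin l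

/-- A group acting on `Y` acts on `k` copies of `Y` and fixes the additional points. -/
instance Copies.mulAction (A Y : Type*) [Group A] [MulAction A Y] (k l : ℕ) :
    MulAction A (Copies Y k l) where
  smul a := Sum.map (Prod.map (a • ·) id) id
  one_smul x := by
    rcases x with ⟨y, i⟩ | i
    · exact congrArg Sum.inl (Prod.ext (one_smul A y) rfl)
    · rfl
  mul_smul a b x := by
    rcases x with ⟨y, i⟩ | i
    · exact congrArg Sum.inl (Prod.ext (mul_smul a b y) rfl)
    · rfl

theorem Copies.card_fixedBy {A Y : Type*} [Group A] [MulAction A Y] [Finite Y] (k l : ℕ) (a : A) :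
    Nat.card (fixedBy (Copies Y k l) a) = Nat.card (fixedBy Y a) * k + l := by
  let e : fixedBy (Copies Y k l) a ≃ (fixedBy Y a × Fin k) ⊕ Fin l :=
    { toFun := fun x => match x with
        | ⟨.inl (y, i), h⟩ => .inl (⟨y, (congrArg Prod.fst (Sum.inl_injective h))⟩, i)
        | ⟨.inr i, _⟩ => .inr i
      invFun := fun x => match x with
        | .inl (y, i) => ⟨.inl (y, i), congrArg Sum.inl (Prod.ext y.2 rfl)⟩
        | .inr i => ⟨.inr i, rfl⟩
      left_inv := by rintro ⟨⟨y, i⟩ | i, h⟩ <;> rfl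
      right_inv := by rintro (⟨y, i⟩ | i) <;> rfl }
  rw [Nat.card_congr e, Nat.card_sum, Nat.card_prod, Nat.card_fin, Nat.card_fin]

theorem Copies.le_ncard_fixedPoints {A Y : Type*} [Group A] [MulAction A Y] [Finite Y] (k l : ℕ) :
    l ≤ (fixedPoints A (Copies Y k l)).ncard := by
  have : Finite (Copies Y k l) := inferInstanceAs (Finite ((Y × Fin k) ⊕ Fin l))
  have h1 : (Set.range fun i : Fin l => (Sum.inr i : Copies Y k l)).ncard = l := by
    rw [← Set.image_univ, Set.ncard_image_of_injective _ Sum.inr_injective, Set.ncard_univ,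
      Nat.card_fin]
  conv_lhs => rw [← h1]
  refine Set.ncard_le_ncard ?_
  rintro _ ⟨i, rfl⟩ a
  rfl

/-- The actions modelled on Frobenius groups: the kernel of `π` acts freely on `Y`, and the other
elements have exactly one fixed point. -/
theorem good_copies {A H Y : Type*} [Group A] [Group H] [MulAction A Y] [Finite A] [Finite Y]
    (π : A →* H) {k l : ℕ} (hA : Nat.card A ∣ 8 * 27 * 11 * 13) (hY : Nat.card Y * k + l = 27)
    (hfree : ∀ a, π a = 1 → a ≠ 1 → ∀ y : Y, a • y ≠ y)
    (hfix : ∀ a, π a ≠ 1 → ∃! y : Y, a • y = y)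
    (hK : ∀ a, π a = 1 → a ≠ 1 → l = 0 ∧ (orderOf a = 3 ∨ orderOf a = 9) ∨
      l = 1 ∧ orderOf a = 13 ∨ l = 3 ∧ (orderOf a = 2 ∨ orderOf a = 4))
    (hH : ∀ h : H, h ≠ 1 → k + l = 1 ∧ orderOf h = 13 ∨
      k + l = 3 ∧ (orderOf h = 2 ∨ orderOf h = 4))
    (h4K : ∀ x y, π x = 1 → π y = 1 → orderOf x = 4 → orderOf y = 2 → Commute x y →
      y ∈ Subgroup.zpowers x)
    (h4H : ∀ x y : H, orderOf x = 4 → orderOf y = 2 → Commute x y → y ∈ Subgroup.zpowers x)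
    (h9K : ∀ x y, π x = 1 → π y = 1 → orderOf x = 9 → orderOf y = 3 → Commute x y →
      y ∈ Subgroup.zpowers x) : Good A (Copies Y k l) := by
  -- `π` is injective on stabilizers
  have hinj : ∀ y : Y, Function.Injective (π.comp (stabilizer A y).subtype) := by
    intro y
    rw [injective_iff_map_eq_one]
    rintro ⟨a, ha⟩ h1
    by_contra h2
    exact hfree a h1 (fun h3 => h2 (Subtype.ext h3)) y ha
  have hord : ∀ a, π a ≠ 1 → orderOf a = orderOf (π a) := by
    intro a ha
    obtain ⟨y, hy, -⟩ := hfix a ha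
    rw [← Subgroup.orderOf_mk a (show a ∈ stabilizer A y from hy), ← orderOf_injective _ (hinj y)]
    rfl
  -- an element that commutes with `x` fixes the unique fixed point of `x`
  have hcomm : ∀ x y, π x ≠ 1 → Commute x y → ∃ p : Y, x • p = p ∧ y • p = p := by
    intro x y hx hxy
    obtain ⟨p, hp, hp'⟩ := hfix x hx
    refine ⟨p, hp, hp' _ ?_⟩
    change x • y • p = y • p
    rw [← mul_smul, hxy.eq, mul_smul, hp]
  have hfc : ∀ a, (π a ≠ 1 → Nat.card (fixedBy Y a) = 1) ∧
      (π a = 1 → a ≠ 1 → Nat.card (fixedBy Y a) = 0) := by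
    refine fun a => ⟨fun h1 => ?_, fun h1 h2 => ?_⟩
    · obtain ⟨p, hp, hp'⟩ := hfix a h1
      rw [Nat.card_eq_one_iff_exists]
      exact ⟨⟨p, hp⟩, fun q => Subtype.ext (hp' _ q.2)⟩
    · rw [Nat.card_eq_zero]
      exact Or.inl ⟨fun q => hfree a h1 h2 _ q.2⟩
  refine ⟨hA, fun a => ?_, fun x y hx hy hxy => ?_, fun x y hx hy hxy => ?_, fun x t hx => ?_⟩
  · rw [Copies.card_fixedBy]
    by_cases ha : a = 1
    · subst ha
      rw [orderOf_one, fixedBy_one_eq_univ, Nat.card_congr (Equiv.Set.univ Y), hY]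
      simp
    · by_cases h1 : π a = 1
      · rw [(hfc a).2 h1 ha]
        have := hK a h1 ha
        omega
      · rw [(hfc a).1 h1, hord a h1]
        have := hH _ h1
        omega
  · by_cases h1 : π x = 1
    · by_cases h2 : π y = 1
      · exact h4K x y h1 h2 hx hy hxy
      · obtain ⟨p, -, hp⟩ := hcomm y x h2 hxy.symm
        refine absurd hp (hfree x h1 (fun h3 => ?_) p)
        rw [h3, orderOf_one] at hx
        omega
    · obtain ⟨p, hxp, hyp⟩ := hcomm x y h1 hxy
      have h2 : π y ≠ 1 := fun h2 => hfree y h2 (fun h3 => by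
        rw [h3, orderOf_one] at hy
        omega) p hyp
      obtain ⟨m, hm⟩ := h4H (π x) (π y) (by rw [← hord x h1, hx]) (by rw [← hord y h2, hy])
        (hxy.map π)
      refine ⟨m, ?_⟩
      have h3 := @hinj p ⟨x ^ m, zpow_mem (show x ∈ stabilizer A p from hxp) m⟩
        ⟨y, hyp⟩ ((map_zpow π x m).trans hm)
      exact congrArg Subtype.val h3
  · have h1 : ∀ z : A, orderOf z = 9 ∨ orderOf z = 3 → π z = 1 := by
      intro z hz
      by_contra h1
      rw [hord z h1] at hz
      have := hH _ h1
      omega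
    exact h9K x y (h1 x (Or.inl hx)) (h1 y (Or.inr hy)) hx hy hxy
  · exfalso
    by_cases h1 : π x = 1
    · have := hK x h1 fun h2 => by
        rw [h2, orderOf_one] at hx
        omega
      omega
    · have := hH _ h1
      rw [← hord x h1] at this
      omega

/-- The group `N`, on which the semidirect product `N ⋊ H` acts by affine transformations. -/
def AffineSpace {N H : Type*} [Group N] [Group H] (_φ : H →* MulAut N) : Type _ := N

instance AffineSpace.mulAction {N H : Type*} [Group N] [Group H] (φ : H →* MulAut N) :
    MulAction (N ⋊[φ] H) (AffineSpace φ) where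
  smul a m := (a.left * φ a.right m : N)
  one_smul (m : N) := by
    change (1 : N ⋊[φ] H).left * φ (1 : N ⋊[φ] H).right m = m
    rw [SemidirectProduct.one_left, SemidirectProduct.one_right, map_one, one_mul]
    rfl
  mul_smul a b (m : N) := by
    change (a * b).left * φ (a * b).right m = a.left * φ a.right (b.left * φ b.right m)
    rw [SemidirectProduct.mul_left, SemidirectProduct.mul_right, map_mul, map_mul, mul_assoc]
    rfl

/-- The affine action of a Frobenius group, with an abelian kernel `N` and a complement `H` that
acts without nontrivial fixed points. -/
theorem good_affine {N H : Type*} [CommGroup N] [Group H] [Finite N] [Finite H]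
    {φ : H →* MulAut N} (hφ : ∀ h, h ≠ 1 → ∀ n, φ h n = n → n = 1) {k l : ℕ}
    (hA : Nat.card N * Nat.card H ∣ 8 * 27 * 11 * 13) (hN : Nat.card N * k + l = 27)
    (hK : ∀ n : N, n ≠ 1 → l = 0 ∧ (orderOf n = 3 ∨ orderOf n = 9) ∨ l = 1 ∧ orderOf n = 13)
    (hH : ∀ h : H, h ≠ 1 → k + l = 1 ∧ orderOf h = 13 ∨
      k + l = 3 ∧ (orderOf h = 2 ∨ orderOf h = 4))
    (h4 : ∀ x y : H, orderOf x = 4 → orderOf y = 2 → Commute x y → y ∈ Subgroup.zpowers x)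
    (h9 : ∀ x y : N, orderOf x = 9 → orderOf y = 3 → y ∈ Subgroup.zpowers x) :
    Good (N ⋊[φ] H) (Copies (AffineSpace φ) k l) := by
  have : Finite (AffineSpace φ) := inferInstanceAs (Finite N)
  have : Finite (N ⋊[φ] H) := Finite.of_equiv _ SemidirectProduct.equivProd.symm
  have hker : ∀ a : N ⋊[φ] H, SemidirectProduct.rightHom a = 1 →
      ∃ n, a = SemidirectProduct.inl n := by
    intro a ha
    exact ⟨a.left, SemidirectProduct.ext rfl ha⟩
  have hinl : ∀ n : N, orderOf (SemidirectProduct.inl n : N ⋊[φ] H) = orderOf n := fun n =>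
    orderOf_injective _ SemidirectProduct.inl_injective n
  refine good_copies SemidirectProduct.rightHom (by rwa [SemidirectProduct.card]) hN ?_ ?_ ?_ hH ?_
    h4 ?_
  · rintro ⟨n, h⟩ h1 h2 (m : N) h3
    obtain rfl : h = 1 := h1
    have h4 : n * φ 1 m = m := h3
    rw [map_one, MulAut.one_apply, mul_eq_right] at h4
    subst h4
    exact h2 rfl
  · rintro ⟨n, h⟩ (h1 : h ≠ 1)
    -- a solution of `n * φ h m = m` is unique, hence exists by counting
    have hinj : Function.Injective fun m => m * (φ h m)⁻¹ := by
      intro m m' hm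
      have h2 : m * (φ h m)⁻¹ = m' * (φ h m')⁻¹ := hm
      have h3 : φ h (m'⁻¹ * m) = m'⁻¹ * m := by
        rw [mul_inv_eq_mul_inv_iff_mul_eq_mul] at h2
        rw [map_mul, map_inv, inv_mul_eq_iff_eq_mul, ← mul_assoc, mul_comm _ m'⁻¹, mul_assoc,
          eq_inv_mul_iff_mul_eq, ← h2, mul_comm]
      exact (inv_mul_eq_one.1 (hφ h h1 _ h3)).symm
    obtain ⟨m, hm⟩ := Finite.surjective_of_injective hinj n
    have key : ∀ m' : N, n * φ h m' = m' ↔ m' * (φ h m')⁻¹ = n := fun m' => by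
      rw [mul_inv_eq_iff_eq_mul, eq_comm]
    exact ⟨m, (key m).2 hm, fun m' hm' => hinj (((key m').1 hm').trans hm.symm)⟩
  · intro a ha ha1
    obtain ⟨n, rfl⟩ := hker a ha
    rw [hinl]
    have := hK n fun h1 => ha1 (by rw [h1, map_one])
    tauto
  · intro x y hx _ hx4
    obtain ⟨n, rfl⟩ := hker x hx
    rw [hinl] at hx4
    have := hK n fun h1 => by
      rw [h1, orderOf_one] at hx4
      omega
    omega
  · intro x y hx hy hx9 hy3 _
    obtain ⟨n, rfl⟩ := hker x hx
    obtain ⟨m, rfl⟩ := hker y hy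
    rw [hinl] at hx9 hy3
    obtain ⟨j, hj⟩ := h9 n m hx9 hy3
    exact ⟨j, by rw [← hj]; exact (map_zpow _ _ _).symm⟩

theorem good_regular {A : Type*} [Group A] [Finite A] {k l : ℕ}
    (hA : Nat.card A * k + l = 27) (hd : Nat.card A ∣ 8 * 27 * 11 * 13)
    (hK : ∀ a : A, a ≠ 1 → l = 0 ∧ (orderOf a = 3 ∨ orderOf a = 9) ∨
      l = 3 ∧ (orderOf a = 2 ∨ orderOf a = 4))
    (h4 : ∀ x y : A, orderOf x = 4 → orderOf y = 2 → Commute x y → y ∈ Subgroup.zpowers x)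
    (h9 : ∀ x y : A, orderOf x = 9 → orderOf y = 3 → Commute x y → y ∈ Subgroup.zpowers x) :
    Good A (Copies A k l) := by
  refine good_copies (1 : A →* Unit) hd hA (fun a _ ha y h => ha ?_) (fun a ha => (ha rfl).elim)
    (fun a _ ha => ?_) (fun h hh => (hh rfl).elim) (fun x y _ _ => h4 x y)
    (fun x y hx => ?_) (fun x y _ _ => h9 x y)
  · exact mul_eq_right.1 h
  · have := hK a ha
    tauto
  · rw [Subsingleton.elim x 1, orderOf_one] at hx
    omega

/-! ### Existence of the groups in the list -/

theorem orderOf_eq_or_eq_sq {A : Type*} [Group A] {p : ℕ} (hp : p.Prime) {a : A}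
    (h : a ^ p ^ 2 = 1) (ha : a ≠ 1) : orderOf a = p ∨ orderOf a = p ^ 2 := by
  obtain ⟨k, hk, h1⟩ := (Nat.dvd_prime_pow hp).1 (orderOf_dvd_of_pow_eq_one h)
  interval_cases k
  · exact absurd (orderOf_eq_one_iff.1 h1) ha
  · exact Or.inl (by rw [h1, pow_one])
  · exact Or.inr h1

theorem orderOf_of_card_eq_prime {A : Type*} [Group A] {p : ℕ} (hp : p.Prime)
    (hA : Nat.card A = p) {a : A} (ha : a ≠ 1) : orderOf a = p := by
  have h := orderOf_dvd_natCard a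
  rw [hA, Nat.dvd_prime hp, orderOf_eq_one_iff] at h
  exact h.resolve_left ha

theorem orderOf_pi_cyc {n p : ℕ} (hp : p.Prime) {a : Fin n → Cyc p} (ha : a ≠ 1) :
    orderOf a = p := by
  have : Fact p.Prime := ⟨hp⟩
  exact orderOf_eq_prime (pi_cyc_pow n p a) ha

theorem pow_ne_one_of_orderOf {A : Type*} [Group A] {n m : ℕ} {a : A} (h : orderOf a = n)
    (hm : ¬ n ∣ m) : a ^ m ≠ 1 := fun h1 => hm (h ▸ orderOf_dvd_of_pow_eq_one h1)

/-- An automorphism of order 13 of the elementary abelian group of order 27: multiplication by a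
root of `X ^ 3 - X - 1` in the field with 27 elements, with respect to the basis of its powers. -/
def autThirteen : MulAut (Fin 3 → Cyc 3) where
  toFun n := ![n 2, n 0 * n 2, n 1]
  invFun n := ![n 1 * (n 0)⁻¹, n 2, n 0]
  left_inv := by unfold Function.LeftInverse; decide
  right_inv := by unfold Function.RightInverse Function.LeftInverse; decide
  map_mul' := by
    intro a b
    funext i
    fin_cases i
    · rfl
    · exact mul_mul_mul_comm _ _ _ _
    · rfl

theorem autThirteen_pow : autThirteen ^ 13 = 1 := MulEquiv.ext (by decide +kernel)

theorem good_thirteen : Good ((Fin 3 → Cyc 3) ⋊[cycHom 13 autThirteen autThirteen_pow] Cyc 13)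
    (Copies (AffineSpace (cycHom 13 autThirteen autThirteen_pow)) 1 0) := by
  have h1 : autThirteen ≠ 1 := fun h => by
    have := DFunLike.congr_fun h ![Multiplicative.ofAdd 1, 1, 1]
    exact absurd this (by decide)
  have ho : orderOf autThirteen = 13 := by
    have : Fact (Nat.Prime 13) := ⟨by norm_num⟩
    exact orderOf_eq_prime autThirteen_pow h1
  have h13 : ∀ h : Cyc 13, h ≠ 1 → orderOf h = 13 := fun h hh =>
    orderOf_of_card_eq_prime (by norm_num) (Cyc.natCard 13) hh
  have h3 : ∀ n : Fin 3 → Cyc 3, n ≠ 1 → orderOf n = 3 := fun n hn =>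
    orderOf_pi_cyc (by norm_num) hn
  refine good_affine (fun h hh n hn => ?_) ?_ ?_ (fun n hn => Or.inl ⟨rfl, Or.inl (h3 n hn)⟩)
    (fun h hh => Or.inl ⟨rfl, h13 h hh⟩) (fun x y hx => ?_) (fun x y hx => ?_)
  · exact eq_one_of_fixed (by rw [orderOf_injective _ (cycHom_injective 13 _ ho), h13 h hh]) hn
  · rw [pi_cyc_natCard, Cyc.natCard]; norm_num
  · rw [pi_cyc_natCard]; norm_num
  · rw [h13 x (by rintro rfl; simp at hx)] at hx
    omega
  · rw [h3 x (by rintro rfl; simp at hx)] at hx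
    omega

/-- The automorphism `a ↦ a ^ 5` of order 4 of the cyclic group of order 13. -/
def autFive : MulAut (Cyc 13) where
  toFun n := n ^ 5
  invFun n := n ^ 8
  left_inv := by unfold Function.LeftInverse; decide
  right_inv := by unfold Function.RightInverse Function.LeftInverse; decide
  map_mul' := by decide +kernel

theorem autFive_pow : autFive ^ 4 = 1 := MulEquiv.ext (by decide +kernel)

theorem cycHom_apply {A : Type*} [Group A] (n : ℕ) [NeZero n] (x : A) (hx : x ^ n = 1)
    (a : Cyc n) : cycHom n x hx a = x ^ a.toAdd.val := by
  rw [← cycHom_natCast n x hx, ZMod.natCast_zmod_val]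
  rfl

theorem good_fiftyTwo : Good (Cyc 13 ⋊[cycHom 4 autFive autFive_pow] Cyc 4)
    (Copies (AffineSpace (cycHom 4 autFive autFive_pow)) 2 1) := by
  have h13 : ∀ h : Cyc 13, h ≠ 1 → orderOf h = 13 := fun h hh =>
    orderOf_of_card_eq_prime (by norm_num) (Cyc.natCard 13) hh
  refine good_affine (fun h hh n hn => ?_) ?_ ?_ (fun n hn => Or.inr ⟨rfl, h13 n hn⟩)
    (fun h hh => Or.inr ⟨rfl, orderOf_eq_or_eq_sq Nat.prime_two ?_ hh⟩)
    (fun x y hx _ _ => ?_) (fun x y hx => ?_)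
  · have key : ∀ h : Cyc 4, h ≠ 1 → ∀ n : Cyc 13, (autFive ^ h.toAdd.val) n = n → n = 1 := by
      decide +kernel
    rw [cycHom_apply] at hn
    exact key h hh n hn
  · rw [Cyc.natCard, Cyc.natCard]; norm_num
  · rw [Cyc.natCard]
  · exact (by decide : ∀ h : Cyc 4, h ^ 2 ^ 2 = 1) h
  · have h1 : Subgroup.zpowers x = ⊤ := by
      rw [← Subgroup.card_eq_iff_eq_top, Nat.card_zpowers, hx, Cyc.natCard]
    rw [h1]; trivial
  · rw [h13 x (by rintro rfl; simp at hx)] at hx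
    omega

theorem inv_sq_nine : (MulEquiv.inv (Cyc 9) : MulAut (Cyc 9)) ^ 2 = 1 :=
  MulEquiv.ext (by decide +kernel)

theorem good_eighteen : Good (Cyc 9 ⋊[cycHom 2 (MulEquiv.inv (Cyc 9)) inv_sq_nine] Cyc 2)
    (Copies (AffineSpace (cycHom 2 (MulEquiv.inv (Cyc 9)) inv_sq_nine)) 3 0) := by
  refine good_affine (fun h hh n hn => ?_) ?_ ?_
    (fun n hn => Or.inl ⟨rfl, orderOf_eq_or_eq_sq Nat.prime_three ?_ hn⟩)
    (fun h hh => Or.inr ⟨rfl, orderOf_eq_or_eq_sq Nat.prime_two ?_ hh⟩)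
    (fun x y hx _ _ => ?_) (fun x y hx _ => ?_)
  · have key : ∀ h : Cyc 2, h ≠ 1 → h = .ofAdd 1 := by decide
    have key' : ∀ n : Cyc 9, n⁻¹ = n → n = 1 := by decide
    rw [key h hh, cycHom_gen] at hn
    exact key' n hn
  · rw [Cyc.natCard, Cyc.natCard]; norm_num
  · rw [Cyc.natCard]
  · exact (by decide : ∀ h : Cyc 9, h ^ 3 ^ 2 = 1) n
  · exact (by decide : ∀ h : Cyc 2, h ^ 2 ^ 2 = 1) h
  · exact absurd ((by decide : ∀ h : Cyc 2, h ^ 2 = 1) x) (pow_ne_one_of_orderOf hx (by norm_num))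
  · have h1 : Subgroup.zpowers x = ⊤ := by
      rw [← Subgroup.card_eq_iff_eq_top, Nat.card_zpowers, hx, Cyc.natCard]
    rw [h1]; trivial

theorem good_seventyTwo : Good ((Fin 2 → Cyc 3) ⋊[quaternionAut] QuaternionGroup 2)
    (Copies (AffineSpace quaternionAut) 3 0) := by
  have h3 : ∀ n : Fin 2 → Cyc 3, n ≠ 1 → orderOf n = 3 := fun n hn =>
    orderOf_pi_cyc (by norm_num) hn
  refine good_affine (fun h hh n hn => ?_) ?_ ?_ (fun n hn => Or.inl ⟨rfl, Or.inl (h3 n hn)⟩)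
    (fun h hh => Or.inr ⟨rfl, orderOf_eq_or_eq_sq Nat.prime_two ?_ hh⟩)
    (fun x y hx hy _ => ?_) (fun x y hx => ?_)
  · obtain i | i := h
    · have key : ∀ i : ZMod (2 * 2), i ≠ 0 → ∀ n, (autX ^ i.val) n = n → n = 1 := by
        decide +kernel
      rw [quaternionAut_a] at hn
      exact key i (by rintro rfl; exact hh rfl) n hn
    · have key : ∀ i : ZMod (2 * 2), ∀ n, (autY * autX ^ i.val) n = n → n = 1 := by
        decide +kernel
      rw [quaternionAut_xa] at hn
      exact key i n hn
  · rw [pi_cyc_natCard, card_quaternion]; norm_num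
  · rw [pi_cyc_natCard]; norm_num
  · exact (by decide : ∀ h : QuaternionGroup 2, h ^ 2 ^ 2 = 1) h
  · have hy1 : y ^ 2 = 1 := orderOf_dvd_iff_pow_eq_one.1 (by rw [hy])
    have key : ∀ x y : QuaternionGroup 2, x ^ 2 ≠ 1 → y ^ 2 = 1 → y ^ 1 ≠ 1 → x ^ 2 = y := by
      decide
    rw [← key x y (pow_ne_one_of_orderOf hx (by norm_num)) hy1
      (pow_ne_one_of_orderOf hy (by norm_num))]
    exact pow_mem (Subgroup.mem_zpowers x) 2
  · rw [h3 x (by rintro rfl; simp at hx)] at hx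
    omega

theorem inl_mul_inr_ne {N H : Type*} [Group N] [Group H] {φ : H →* MulAut N} {n : N} {h : H}
    (hn : φ h n ≠ n) : (SemidirectProduct.inl n * SemidirectProduct.inr h : N ⋊[φ] H) ≠
      SemidirectProduct.inr h * SemidirectProduct.inl n := by
  intro h1
  have h2 := congrArg SemidirectProduct.left h1
  simp at h2
  exact hn h2.symm

theorem isHeisenberg3_model :
    IsHeisenberg3 ((Fin 2 → Cyc 3) ⋊[cycHom 3 autShear autShear_pow] Cyc 3) := by
  have hc : Nat.card ((Fin 2 → Cyc 3) ⋊[cycHom 3 autShear autShear_pow] Cyc 3) = 27 := by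
    rw [SemidirectProduct.card, pi_cyc_natCard, Cyc.natCard]; norm_num
  have h3 : ∀ a : (Fin 2 → Cyc 3) ⋊[cycHom 3 autShear autShear_pow] Cyc 3, a ^ 3 = 1 := by
    rintro ⟨n, h⟩
    have key : ∀ (h : Cyc 3) (n : Fin 2 → Cyc 3), n * (autShear ^ h.toAdd.val)
        (n * (autShear ^ h.toAdd.val) n) = 1 := by decide +kernel
    have key' : ∀ h : Cyc 3, h * (h * h) = 1 := by decide
    rw [pow_succ', pow_two]
    refine SemidirectProduct.ext ?_ (key' h)
    rw [SemidirectProduct.mul_left, SemidirectProduct.mul_left, cycHom_apply]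
    exact key h n
  refine ⟨isExtraspecial27_of_not_comm hc (inl_mul_inr_ne (n := ![Multiplicative.ofAdd 1, 1])
    (h := .ofAdd 1) ?_), ?_⟩
  · rw [cycHom_gen]; decide
  · rcases (Nat.dvd_prime Nat.prime_three).1
      (Monoid.exponent_dvd_of_forall_pow_eq_one h3) with h | h
    · have h1 := (Nat.card_eq_one_iff_unique (α :=
        (Fin 2 → Cyc 3) ⋊[cycHom 3 autShear autShear_pow] Cyc 3)).2
        ⟨Monoid.exp_eq_one_iff.1 h, ⟨1⟩⟩
      omega
    · exact h

theorem isExtraspecialMinus3_model :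
    IsExtraspecialMinus3 (Cyc 9 ⋊[cycHom 3 autFour autFour_pow] Cyc 3) := by
  have hc : Nat.card (Cyc 9 ⋊[cycHom 3 autFour autFour_pow] Cyc 3) = 27 := by
    rw [SemidirectProduct.card, Cyc.natCard, Cyc.natCard]
  refine ⟨isExtraspecial27_of_not_comm hc (inl_mul_inr_ne (n := .ofAdd 1) (h := .ofAdd 1) ?_),
    SemidirectProduct.inl (.ofAdd 1), ?_⟩
  · rw [cycHom_gen]; decide
  · rw [orderOf_injective _ SemidirectProduct.inl_injective, Cyc.orderOf_gen]

theorem IsExtraspecialMinus3.pow_nine {A : Type*} [Group A] (h : IsExtraspecialMinus3 A) (a : A) :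
    a ^ 9 = 1 := by
  rw [show 9 = 3 * 3 by norm_num, pow_mul]
  exact h.1.pow_three_eq_one (h.1.pow_three_mem a)

theorem IsExtraspecial27.mem_zpowers {A : Type*} [Group A] (h : IsExtraspecial27 A) {x y : A}
    (hx : orderOf x = 9) (hxy : Commute x y) : y ∈ Subgroup.zpowers x := by
  have : Finite A := Nat.finite_of_card_ne_zero (by rw [h.card_eq]; norm_num)
  by_contra hy
  have hle : Subgroup.zpowers x ≤ Subgroup.centralizer {x} := by
    rw [Subgroup.zpowers_le, Subgroup.mem_centralizer_singleton_iff]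
  have hyc : y ∈ Subgroup.centralizer {x} := Subgroup.mem_centralizer_singleton_iff.2 hxy.eq.symm
  have h1 := Subgroup.card_subgroup_dvd_card (Subgroup.centralizer {x})
  have h2 := Subgroup.card_dvd_of_le hle
  have h3 : Nat.card (Subgroup.centralizer {x}) ≠ 9 := fun h3 => by
    have := Subgroup.eq_of_le_of_card_ge hle (by rw [h3, Nat.card_zpowers, hx])
    exact hy (this ▸ hyc)
  rw [Nat.card_zpowers, hx] at h2
  rw [h.card_eq] at h1
  have h4 : Nat.card (Subgroup.centralizer {x}) = 27 := by
    obtain ⟨k, hk⟩ := h2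
    rw [hk] at h1 h3 ⊢
    have : k ∣ 3 := Nat.dvd_of_mul_dvd_mul_left (k := 9) (by norm_num) h1
    rcases (Nat.dvd_prime Nat.prime_three).1 this with rfl | rfl <;> omega
  have h5 : x ∈ Subgroup.center A := by
    rw [Subgroup.mem_center_iff]
    intro g
    have h6 : g ∈ Subgroup.centralizer {x} := by
      rw [Subgroup.eq_top_of_card_eq _ (h4.trans h.card_eq.symm)]; trivial
    exact Subgroup.mem_centralizer_singleton_iff.1 h6
  have h6 := Subgroup.orderOf_dvd_natCard _ h5
  rw [hx, h.1.card_eq, Cyc.natCard] at h6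
  omega

theorem IsHeisenberg3.good {A : Type*} [Group A] (h : IsHeisenberg3 A) :
    Good A (Copies A 1 0) := by
  have : Finite A := Nat.finite_of_card_ne_zero (by rw [h.1.card_eq]; norm_num)
  have : Fact (Nat.Prime 3) := ⟨by norm_num⟩
  have h3 : ∀ a : A, a ≠ 1 → orderOf a = 3 := fun a ha =>
    orderOf_eq_prime (by rw [← h.2, Monoid.pow_exponent_eq_one]) ha
  refine good_regular (by rw [h.1.card_eq]) (by rw [h.1.card_eq]; norm_num)
    (fun a ha => Or.inl ⟨rfl, Or.inl (h3 a ha)⟩) (fun x y hx => ?_) (fun x y hx => ?_)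
  · rw [h3 x (by rintro rfl; simp at hx)] at hx
    omega
  · rw [h3 x (by rintro rfl; simp at hx)] at hx
    omega

theorem IsExtraspecialMinus3.good {A : Type*} [Group A] (h : IsExtraspecialMinus3 A) :
    Good A (Copies A 1 0) := by
  have : Finite A := Nat.finite_of_card_ne_zero (by rw [h.1.card_eq]; norm_num)
  have h3 : ∀ a : A, a ≠ 1 → orderOf a = 3 ∨ orderOf a = 3 ^ 2 := fun a ha =>
    orderOf_eq_or_eq_sq Nat.prime_three (h.pow_nine a) ha
  refine good_regular (by rw [h.1.card_eq]) (by rw [h.1.card_eq]; norm_num)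
    (fun a ha => Or.inl ⟨rfl, h3 a ha⟩) (fun x y hx => ?_)
    (fun x y hx _ => h.1.mem_zpowers hx)
  have := h3 x (by rintro rfl; simp at hx)
  omega

theorem good_elementary_eight : Good (Fin 3 → Cyc 2) (Copies (Fin 3 → Cyc 2) 3 3) := by
  have h2 : ∀ a : Fin 3 → Cyc 2, a ≠ 1 → orderOf a = 2 := fun a ha =>
    orderOf_pi_cyc (by norm_num) ha
  refine good_regular (by rw [pi_cyc_natCard]; norm_num) (by rw [pi_cyc_natCard]; norm_num)
    (fun a ha => Or.inr ⟨rfl, Or.inl (h2 a ha)⟩) (fun x y hx => ?_) (fun x y hx => ?_)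
  · rw [h2 x (by rintro rfl; simp at hx)] at hx
    omega
  · rw [h2 x (by rintro rfl; simp at hx)] at hx
    omega

theorem good_dihedral_eight : Good (DihedralGroup 4) (Copies (DihedralGroup 4) 3 3) := by
  have h2 : ∀ a : DihedralGroup 4, a ≠ 1 → orderOf a = 2 ∨ orderOf a = 2 ^ 2 := fun a ha =>
    orderOf_eq_or_eq_sq Nat.prime_two ((by decide : ∀ a : DihedralGroup 4, a ^ 2 ^ 2 = 1) a) ha
  refine good_regular (by rw [DihedralGroup.nat_card]) (by rw [DihedralGroup.nat_card]; norm_num)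
    (fun a ha => Or.inr ⟨rfl, h2 a ha⟩) (fun x y hx hy hxy => ?_) (fun x y hx => ?_)
  · have key : ∀ x y : DihedralGroup 4, x ^ 2 ≠ 1 → y ^ 2 = 1 → y ^ 1 ≠ 1 → x * y = y * x →
        x ^ 2 = y := by decide
    rw [← key x y (pow_ne_one_of_orderOf hx (by norm_num)) (hy ▸ pow_orderOf_eq_one y)
      (pow_ne_one_of_orderOf hy (by norm_num)) hxy.eq]
    exact pow_mem (Subgroup.mem_zpowers x) 2
  · have := h2 x (by rintro rfl; simp at hx)
    omega

/-- A criterion for `Good A X` that consists of finite tables: orders of elements are expressed by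
powers, and `c` counts the fixed points. -/
theorem good_of_table {A X : Type*} [Group A] [Fintype A] [Fintype X] [DecidableEq X]
    [MulAction A X] {c : A → ℕ} (hc : ∀ a, (Finset.univ.filter fun x : X => a • x = x).card = c a)
    (hd : Nat.card A ∣ 8 * 27 * 11 * 13)
    (h : ∀ a : A, (a = 1 ∧ c a = 27) ∨ (a ≠ 1 ∧ a ^ 2 = 1 ∧ c a = 3) ∨
      (a ≠ 1 ∧ a ^ 3 = 1 ∧ c a = 0) ∨ (a ^ 2 ≠ 1 ∧ a ^ 4 = 1 ∧ c a = 3) ∨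
      (a ≠ 1 ∧ a ^ 11 = 1 ∧ c a = 5))
    (h4 : ∀ x y : A, x ^ 2 ≠ 1 → x ^ 4 = 1 → y ≠ 1 → y ^ 2 = 1 → x * y = y * x → x ^ 2 = y)
    (h11 : ∀ x t : A, x ≠ 1 → x ^ 11 = 1 → t ≠ 1 → t ^ 2 = 1 →
      ∃ v : X, (x • v = v ∧ t • v = v) ∧ ∀ w : X, x • w = w ∧ t • w = w → w = v) :
    Good A X := by
  have hfix : ∀ a : A, Nat.card (fixedBy X a) = c a := fun a => by
    rw [← hc, ← Fintype.card_subtype, ← Nat.card_eq_fintype_card]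
    rfl
  have ho : ∀ a : A, (orderOf a = 1 ∧ c a = 27) ∨ (orderOf a = 2 ∧ c a = 3) ∨
      (orderOf a = 3 ∧ c a = 0) ∨ (orderOf a = 4 ∧ c a = 3) ∨ (orderOf a = 11 ∧ c a = 5) := by
    have : Fact (Nat.Prime 2) := ⟨by norm_num⟩
    have : Fact (Nat.Prime 3) := ⟨by norm_num⟩
    have : Fact (Nat.Prime 11) := ⟨by norm_num⟩
    intro a
    rcases h a with ⟨h1, h2⟩ | ⟨h1, h2, h3⟩ | ⟨h1, h2, h3⟩ | ⟨h1, h2, h3⟩ | ⟨h1, h2, h3⟩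
    · exact Or.inl ⟨orderOf_eq_one_iff.2 h1, h2⟩
    · exact Or.inr (Or.inl ⟨orderOf_eq_prime h2 h1, h3⟩)
    · exact Or.inr (Or.inr (Or.inl ⟨orderOf_eq_prime h2 h1, h3⟩))
    · exact Or.inr (Or.inr (Or.inr (Or.inl ⟨orderOf_eq_prime_pow (p := 2) (n := 1)
        (by simpa using h1) (by simpa using h2), h3⟩)))
    · exact Or.inr (Or.inr (Or.inr (Or.inr ⟨orderOf_eq_prime h2 h1, h3⟩)))
  have hne : ∀ {a : A} {n : ℕ}, orderOf a = n → n ≠ 1 → a ≠ 1 := by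
    rintro a n rfl hn rfl
    simp at hn
  refine ⟨hd, fun a => ?_, fun x y hx hy hxy => ?_, fun x y hx => ?_, fun x t hx ht _ => ?_⟩
  · rw [hfix]
    have := ho a
    tauto
  · rw [← h4 x y (pow_ne_one_of_orderOf hx (by norm_num)) (hx ▸ pow_orderOf_eq_one x)
      (hne hy (by norm_num)) (hy ▸ pow_orderOf_eq_one y) hxy.eq]
    exact pow_mem (Subgroup.mem_zpowers x) 2
  · have := ho x
    omega
  · exact h11 x t (hne hx (by norm_num)) (hx ▸ pow_orderOf_eq_one x) (hne ht (by norm_num))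
      (ht ▸ pow_orderOf_eq_one t)

/-- The dihedral group of order `2 * n` acts on `ZMod n` by the maps `k ↦ k + i` and
`k ↦ c - k - i`; the parameter `c` chooses between the two classes of reflections for even `n`. -/
def DihedralPoints (n : ℕ) (_c : ZMod n) : Type := ZMod n

instance (n : ℕ) (c : ZMod n) : MulAction (DihedralGroup n) (DihedralPoints n c) where
  smul d k := (fun x : ZMod n => match d with
    | .r i => x + i
    | .sr i => c - (x + i)) k
  one_smul k := add_zero (M := ZMod n) k
  mul_smul := by
    rintro (i | i) (j | j) k
    · exact (by intros; ring : ∀ k i j : ZMod n, k + (i + j) = k + j + i) k i j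
    · exact (by intros; ring : ∀ k i j : ZMod n, c - (k + (j - i)) = c - (k + j) + i) k i j
    · exact (by intros; ring : ∀ k i j : ZMod n, c - (k + (i + j)) = c - (k + j + i)) k i j
    · exact (by intros; ring : ∀ k i j : ZMod n, k + (j - i) = c - (c - (k + j) + i)) k i j

instance (n : ℕ) (c : ZMod n) : DecidableEq (DihedralPoints n c) :=
  inferInstanceAs (DecidableEq (ZMod n))

instance (n : ℕ) [NeZero n] (c : ZMod n) : Fintype (DihedralPoints n c) :=
  inferInstanceAs (Fintype (ZMod n))

/-- Two points that are exchanged by the reflections of a dihedral group. -/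
def DihedralSigns (_n : ℕ) : Type := Bool

instance (n : ℕ) : MulAction (DihedralGroup n) (DihedralSigns n) where
  smul d b := match d with
    | .r _ => b
    | .sr _ => Bool.not b
  one_smul _ := rfl
  mul_smul := by
    rintro (i | i) (j | j) b <;> first | rfl | exact (Bool.not_not b).symm

instance (n : ℕ) : DecidableEq (DihedralSigns n) := inferInstanceAs (DecidableEq Bool)

instance (n : ℕ) : Fintype (DihedralSigns n) := inferInstanceAs (Fintype Bool)

/-- The 27 points on which the dihedral group of order 22 acts with orbits of length
11, 11, 2, 2, 1. -/
abbrev DihedralElevenPoints : Type := DihedralPoints 11 0 ⊕ DihedralPoints 11 0 ⊕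
  DihedralSigns 11 ⊕ DihedralSigns 11 ⊕ Unit

set_option synthInstance.maxSize 1000 in
theorem good_dihedralElevenPoints : Good (DihedralGroup 11) DihedralElevenPoints := by
  refine good_of_table (fun _ => rfl) ?_ ?_ ?_ ?_
  · rw [DihedralGroup.nat_card]; norm_num
  · decide +kernel
  · decide +kernel
  · intro x t hx _ ht ht2
    have key : ∀ x t : DihedralGroup 11, x ≠ 1 → x ^ 11 = 1 → t ≠ 1 → t ^ 2 = 1 →
        ∀ w : DihedralElevenPoints, x • w = w ∧ t • w = w → w = .inr (.inr (.inr (.inr ()))) := by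
      decide +kernel
    exact ⟨.inr (.inr (.inr (.inr ()))), ⟨rfl, rfl⟩, key x t hx ‹_› ht ht2⟩

/-- The 27 points on which the dihedral group of order 8 acts with orbits of length
8, 8, 4, 4, 2, 1. -/
abbrev DihedralEightPoints : Type := DihedralGroup 4 ⊕ DihedralGroup 4 ⊕ DihedralPoints 4 0 ⊕
  DihedralPoints 4 1 ⊕ DihedralSigns 4 ⊕ Unit

theorem good_dihedralEightPoints : Good (DihedralGroup 4) DihedralEightPoints := by
  refine good_of_table (fun _ => rfl) ?_ ?_ ?_ ?_
  · rw [DihedralGroup.nat_card]; norm_num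
  · decide +kernel
  · decide +kernel
  · exact fun x _ h1 h11 => absurd h11
      ((by decide : ∀ x : DihedralGroup 4, x ≠ 1 → x ^ 11 ≠ 1) x h1)

/-- The set of the elements of order two of a group, on which the group acts by conjugation. -/
def Involutions (A : Type*) [Group A] : Type _ := {x : A // x ≠ 1 ∧ x * x = 1}

instance (A : Type*) [Group A] : MulAction A (Involutions A) where
  smul a x := ⟨a * x.1 * a⁻¹, fun h => x.2.1 (by simpa using conj_eq_one_iff.1 h),
    by rw [show a * x.1 * a⁻¹ * (a * x.1 * a⁻¹) = a * (x.1 * x.1) * a⁻¹ by group, x.2.2]; simp⟩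
  one_smul x := Subtype.ext (by change 1 * x.1 * 1⁻¹ = x.1; simp)
  mul_smul a b x := Subtype.ext (by
    change a * b * x.1 * (a * b)⁻¹ = a * (b * x.1 * b⁻¹) * a⁻¹
    group)

instance (A : Type*) [Group A] [DecidableEq A] : DecidableEq (Involutions A) :=
  inferInstanceAs (DecidableEq {x : A // x ≠ 1 ∧ x * x = 1})

instance (A : Type*) [Group A] [DecidableEq A] [Fintype A] : Fintype (Involutions A) :=
  inferInstanceAs (Fintype {x : A // x ≠ 1 ∧ x * x = 1})

theorem card_filter_sum_smul_eq {A X Y : Type*} [Group A] [MulAction A X] [MulAction A Y]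
    [Fintype X] [Fintype Y] [DecidableEq X] [DecidableEq Y] (a : A) :
    (Finset.univ.filter fun x : X ⊕ Y => a • x = x).card =
      (Finset.univ.filter fun x : X => a • x = x).card +
        (Finset.univ.filter fun y : Y => a • y = y).card := by
  simp only [Finset.card_filter, Fintype.sum_sum_type, Sum.smul_inl, Sum.smul_inr,
    Sum.inl.injEq, Sum.inr.injEq]

theorem good_alternating_twelve : Good (alternatingGroup (Fin 4))
    (alternatingGroup (Fin 4) ⊕ alternatingGroup (Fin 4) ⊕
      Involutions (alternatingGroup (Fin 4))) := by
  refine good_of_table (fun a => by rw [card_filter_sum_smul_eq, card_filter_sum_smul_eq]) ?_ ?_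
    ?_ ?_
  · rw [card_alternating_four]; norm_num
  · decide +kernel
  · exact fun x _ h2 h4 => absurd h4
      ((by decide +kernel : ∀ x : alternatingGroup (Fin 4), x ^ 2 ≠ 1 → x ^ 4 ≠ 1) x h2)
  · exact fun x _ h1 h11 => absurd h11
      ((by decide +kernel : ∀ x : alternatingGroup (Fin 4), x ≠ 1 → x ^ 11 ≠ 1) x h1)

/-! ### All entries of the list are realized -/

/-- An entry of the list is realized by a subgroup with the properties (a)–(g), expressed in terms
of data that are visibly invariant under conjugation. -/
def Entry.Realized (i : Entry) : Prop := ∃ G : Subgroup S27, Good G (Fin 27) ∧ i.IsoType G ∧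
  i.FixedPointCount (fixedPoints G (Fin 27)).ncard

/-- An entry of the list is realized if some good action of some group on some set has the
isomorphism type and the number of fixed points of the entry. -/
theorem Good.realized {A X : Type*} [Group A] [MulAction A X] (h : Good A X) {i : Entry}
    (hi : i.IsoType A)
    (hf : ∀ G : Subgroup S27, Good G (Fin 27) → Nat.card G = i.order →
      (fixedPoints G (Fin 27)).ncard = (fixedPoints A X).ncard →
      i.FixedPointCount (fixedPoints G (Fin 27)).ncard) :
    i.Realized := by
  obtain ⟨G, hG, ⟨e⟩, hn⟩ := h.exists_subgroup
  have hiG := hi.of_mulEquiv e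
  exact ⟨G, hG, hiG, hf G hG hiG.card_eq hn⟩

theorem Good.realized_of_injective {A B X : Type*} [Group A] [Group B] [MulAction A X]
    (h : Good A X) (f : B →* A) (hf : Function.Injective f) {i : Entry} (hi : i.IsoType B)
    (hF : ∀ n, i.FixedPointCount n) : i.Realized :=
  (h.subgroup f.range).realized (hi.of_mulEquiv (MonoidHom.ofInjective hf)) fun _ _ _ _ => hF _

/-- A good action of a group realizes an entry of the list if no other entry has groups of
the same order. -/
theorem Good.realized_of_card {A X : Type*} [Group A] [MulAction A X] (h : Good A X) {i : Entry}
    (hA : Nat.card A = i.order) (hu : ∀ j : Entry, j.order = i.order → j = i)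
    (hF : ∀ n, i.FixedPointCount n) : i.Realized := by
  obtain ⟨j, hj⟩ := h.exists_isoType
  obtain rfl := hu j (hj.card_eq.symm.trans hA)
  exact h.realized hj fun _ _ _ _ => hF _

theorem Good.realized_of_card_subgroup {A X : Type*} [Group A] [MulAction A X] (h : Good A X)
    {i : Entry} {p n : ℕ} (hp : p.Prime) (hi : i.order = p ^ n) (hd : p ^ n ∣ Nat.card A)
    (hu : ∀ j : Entry, j.order = i.order → j = i) (hF : ∀ n, i.FixedPointCount n) :
    i.Realized := by
  have : Fact p.Prime := ⟨hp⟩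
  have := h.finite
  obtain ⟨K, hK⟩ := Sylow.exists_subgroup_card_pow_prime p hd
  exact (h.subgroup K).realized_of_card (hK.trans hi.symm) hu hF

/-- A good action of a group of order 4 or 8 has one or three fixed points. -/
theorem Good.ncard_fixedPoints_of_three_le {G : Subgroup S27} (h : Good G (Fin 27))
    (hc : Nat.card G = 4 ∨ Nat.card G = 8) (hn : 3 ≤ (fixedPoints G (Fin 27)).ncard) :
    (fixedPoints G (Fin 27)).ncard = 3 := by
  rcases hc with hc | hc
  · rcases h.orbitLengths_four hc with h1 | h1 <;> omega
  · rcases h.orbitLengths_eight hc with h1 | h1 <;> omega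

theorem card_comap_rightHom {N H : Type*} [Group N] [Group H] (φ : H →* MulAut N)
    (K : Subgroup H) :
    Nat.card (K.comap (SemidirectProduct.rightHom (φ := φ))) = Nat.card N * Nat.card K := by
  rw [← Nat.card_prod]
  exact Nat.card_congr
    { toFun := fun x => (x.1.left, ⟨x.1.right, x.2⟩)
      invFun := fun y => ⟨⟨y.1, y.2.1⟩, y.2.2⟩
      left_inv := fun _ => rfl
      right_inv := fun _ => rfl }

/-- The elements of the noncyclic subgroup of order 4 of the dihedral group of order 8 that
contains the reflection `sr 0`. -/
def kleinFinset : Finset (DihedralGroup 4) := {.r 0, .r 2, .sr 0, .sr 2}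

/-- The subgroup with the set of elements `kleinFinset`. -/
def kleinSubgroup : Subgroup (DihedralGroup 4) where
  carrier := {d | d ∈ kleinFinset}
  one_mem' := (by decide : 1 ∈ kleinFinset)
  mul_mem' {a b} := (by decide : ∀ a b, a ∈ kleinFinset → b ∈ kleinFinset → a * b ∈ kleinFinset) a b
  inv_mem' {a} := (by decide : ∀ a, a ∈ kleinFinset → a⁻¹ ∈ kleinFinset) a

/-- The subgroup of index 4 in the Frobenius group of order 72, in which every element has order
dividing 6. -/
theorem realized_row9 : Entry.row9.Realized := by
  have hc : Nat.card ((Subgroup.zpowers (QuaternionGroup.a 2 : QuaternionGroup 2)).comap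
      (SemidirectProduct.rightHom (φ := quaternionAut))) = 18 := by
    rw [card_comap_rightHom, pi_cyc_natCard, Nat.card_zpowers,
      orderOf_eq_prime (p := 2) (by decide) (by decide)]
    norm_num
  have h := good_seventyTwo.subgroup
    ((Subgroup.zpowers (QuaternionGroup.a 2 : QuaternionGroup 2)).comap
      (SemidirectProduct.rightHom (φ := quaternionAut)))
  obtain ⟨i, hi⟩ := h.exists_isoType
  have hi' : i = .row9 ∨ i = .row10 := by
    have := hi.card_eq
    rw [hc] at this
    cases i <;> simp [Entry.order] at this ⊢
  rcases hi' with rfl | rfl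
  · exact h.realized hi fun _ _ _ _ => trivial
  · obtain ⟨⟨⟨n, q⟩, hq⟩, ha⟩ := hi.exists_pow_six_ne (by simp)
    obtain ⟨k, hk⟩ := hq
    have h2 : q ^ 2 = 1 := by
      rw [show q = QuaternionGroup.a 2 ^ k from hk.symm, ← zpow_natCast, zpow_comm]
      exact (congrArg (· ^ k) (by decide : (QuaternionGroup.a 2 : QuaternionGroup 2) ^ 2 = 1)).trans
        (one_zpow k)
    -- the square lies in the normal subgroup of exponent 3
    obtain ⟨m, hm⟩ : ∃ m, (⟨n, q⟩ : (Fin 2 → Cyc 3) ⋊[quaternionAut] QuaternionGroup 2) ^ 2 =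
        SemidirectProduct.inl m := by
      refine ⟨_, SemidirectProduct.ext rfl ?_⟩
      rw [SemidirectProduct.right_inl, ← h2]
      exact map_pow SemidirectProduct.rightHom _ 2
    refine absurd (Subtype.ext ?_) ha
    change (⟨n, q⟩ : (Fin 2 → Cyc 3) ⋊[quaternionAut] QuaternionGroup 2) ^ (2 * 3) = 1
    rw [pow_mul, hm, ← map_pow, pi_cyc_pow, map_one]

set_option synthInstance.maxSize 1000 in
theorem realized_row18 : Entry.row18.Realized := by
  refine good_dihedralEightPoints.realized (i := .row18) ⟨MulEquiv.refl _⟩ fun _ _ _ hn => ?_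
  have h1 : fixedPoints (DihedralGroup 4) DihedralEightPoints =
      {.inr (.inr (.inr (.inr (.inr ()))))} := by
    have key : ∀ x : DihedralEightPoints,
        (∀ a : DihedralGroup 4, a • x = x) ↔ x = .inr (.inr (.inr (.inr (.inr ())))) := by
      decide +kernel
    exact Set.ext key
  rw [hn, h1, Set.ncard_singleton]
  rfl

set_option synthInstance.maxSize 1000 in
theorem realized_row22 : Entry.row22.Realized := by
  have : Fact (Nat.Prime 2) := ⟨by norm_num⟩
  have hc : Nat.card kleinSubgroup = 2 ^ 2 := Nat.subtype_card kleinFinset fun _ => Iff.rfl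
  have hk : ∀ a b : kleinSubgroup, a * b = b * a ∧ a ^ 2 = 1 := by
    rintro ⟨a, ha⟩ ⟨b, hb⟩
    have key : ∀ a ∈ kleinFinset,
      ∀ b ∈ kleinFinset,
        a * b = b * a ∧ a ^ 2 = 1 := by decide
    have h1 := key a ha b hb
    exact ⟨Subtype.ext h1.1, Subtype.ext h1.2⟩
  refine (good_dihedralEightPoints.subgroup kleinSubgroup).realized (i := .row22)
    (iso_pi_cyc (fun a b => (hk a b).1) (fun a => (hk a a).2) hc) fun _ _ _ hn => ?_
  have h1 : fixedPoints kleinSubgroup DihedralEightPoints =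
      {.inr (.inr (.inr (.inr (.inr ()))))} := by
    ext x
    rw [Set.mem_singleton_iff, mem_fixedPoints, Subtype.forall]
    have key : ∀ x : DihedralEightPoints,
        (∀ a ∈ kleinFinset, a • x = x) ↔
        x = .inr (.inr (.inr (.inr (.inr ())))) := by decide +kernel
    exact key x
  rw [hn, h1, Set.ncard_singleton]
  rfl

theorem realized_row21 : Entry.row21.Realized := by
  have : Fact (Nat.Prime 2) := ⟨by norm_num⟩
  obtain ⟨K, hK⟩ := Sylow.exists_subgroup_card_pow_prime (G := Fin 3 → Cyc 2) 2 (n := 2)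
    (by rw [pi_cyc_natCard]; norm_num)
  have := good_elementary_eight.finite_set
  refine (good_elementary_eight.subgroup K).realized (i := .row21)
    (iso_pi_cyc (fun a b => mul_comm a b) (fun a => Subtype.ext (pi_cyc_pow 3 2 a.1)) hK)
    fun _ hG hGc hn => hG.ncard_fixedPoints_of_three_le (Or.inl hGc) ?_
  rw [hn]
  exact (Copies.le_ncard_fixedPoints 3 3).trans
    (Set.ncard_le_ncard (fun x hx k => hx k.1) (Set.toFinite _))

theorem realized_row17 : Entry.row17.Realized :=
  good_dihedral_eight.realized (i := .row17) ⟨MulEquiv.refl _⟩ fun _ hG hGc hn =>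
    hG.ncard_fixedPoints_of_three_le (Or.inr hGc) (hn ▸ Copies.le_ncard_fixedPoints 3 3)

/-- The subgroup of index 2 in the Frobenius group of order 72. -/
theorem realized_row6 : Entry.row6.Realized := by
  refine (good_seventyTwo.subgroup
    ((Subgroup.zpowers (QuaternionGroup.a 1 : QuaternionGroup 2)).comap
      (SemidirectProduct.rightHom (φ := quaternionAut)))).realized_of_card (i := .row6) ?_
      (fun j => by cases j <;> simp [Entry.order]) (fun _ => trivial)
  rw [card_comap_rightHom, pi_cyc_natCard, Nat.card_zpowers,
      QuaternionGroup.orderOf_a_one]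
  rfl

/-- The dihedral subgroup of the Frobenius group of order 52. -/
theorem realized_row7 : Entry.row7.Realized := by
  obtain ⟨f, hf, -⟩ := exists_dihedralHom (n := 13)
    (x := (SemidirectProduct.inl (.ofAdd 1) : Cyc 13 ⋊[cycHom 4 autFive autFive_pow] Cyc 4))
    (t := SemidirectProduct.inr (.ofAdd 2))
    (by rw [orderOf_injective _ SemidirectProduct.inl_injective, Cyc.orderOf_gen])
    (by rw [← map_mul]; exact map_one _)
    (by rw [← map_inv, ← SemidirectProduct.inl_aut, cycHom_apply, ← map_inv]; rfl)
    (by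
      rw [← MonoidHom.map_zpowers]
      rintro ⟨a, -, ha⟩
      exact absurd (congrArg SemidirectProduct.right ha) (by decide : (1 : Cyc 4) ≠ .ofAdd 2))
  exact good_fiftyTwo.realized_of_injective f hf (i := .row7) ⟨MulEquiv.refl _⟩ fun _ => trivial

/-- The dihedral subgroup of order 6 in the dihedral group of order 18. -/
theorem realized_row20 : Entry.row20.Realized := by
  obtain ⟨f, hf, -⟩ := exists_dihedralHom (n := 3)
    (x := (SemidirectProduct.inl (.ofAdd 3) :
      Cyc 9 ⋊[cycHom 2 (MulEquiv.inv (Cyc 9)) inv_sq_nine] Cyc 2))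
    (t := SemidirectProduct.inr (.ofAdd 1))
    (by
      rw [orderOf_injective _ SemidirectProduct.inl_injective]
      exact orderOf_eq_prime (by decide) (by decide))
    (by rw [← map_mul]; exact map_one _)
    (by rw [← map_inv, ← SemidirectProduct.inl_aut, cycHom_gen, ← map_inv]; rfl)
    (by
      rw [← MonoidHom.map_zpowers]
      rintro ⟨a, -, ha⟩
      exact absurd (congrArg SemidirectProduct.right ha) (by decide : (1 : Cyc 2) ≠ .ofAdd 1))
  refine (good_eighteen.subgroup f.range).realized_of_card (i := .row20) ?_
    (fun j => by cases j <;> simp [Entry.order]) (fun _ => trivial)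
  rw [← Nat.card_congr (MonoidHom.ofInjective hf).toEquiv, DihedralGroup.nat_card]
  rfl

/-- The generalized dihedral group of `C_9` has an element of order 9, so it is not isomorphic to
the other group of order 18 in the list. -/
theorem realized_row10 : Entry.row10.Realized := by
  obtain ⟨i, hi⟩ := good_eighteen.exists_isoType
  have hi' : i = .row9 ∨ i = .row10 := by
    have := hi.card_eq
    rw [SemidirectProduct.card, Cyc.natCard, Cyc.natCard] at this
    cases i <;> simp [Entry.order] at this ⊢
  rcases hi' with rfl | rfl
  · have h1 := pow_six_of_semidirect hi (SemidirectProduct.inl (.ofAdd 1))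
    rw [← map_pow] at h1
    exact absurd (SemidirectProduct.inl_injective (h1.trans (map_one _).symm)) (by decide)
  · exact good_eighteen.realized hi fun _ _ _ _ => trivial

theorem Entry.realized (i : Entry) : i.Realized := by
  have c52 : Nat.card (Cyc 13 ⋊[cycHom 4 autFive autFive_pow] Cyc 4) = 52 := by
    rw [SemidirectProduct.card, Cyc.natCard, Cyc.natCard]
  have c18 : Nat.card (Cyc 9 ⋊[cycHom 2 (MulEquiv.inv (Cyc 9)) inv_sq_nine] Cyc 2) = 18 := by
    rw [SemidirectProduct.card, Cyc.natCard, Cyc.natCard]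
  cases i with
  | row1 =>
    refine good_thirteen.realized_of_card ?_ (fun j => by cases j <;> simp [Entry.order])
      (fun _ => trivial)
    rw [SemidirectProduct.card, pi_cyc_natCard, Cyc.natCard]
    rfl
  | row2 =>
    exact good_thirteen.realized_of_injective _ SemidirectProduct.inl_injective
      (i := .row2) ⟨MulEquiv.refl _⟩ (fun _ => trivial)
  | row3 =>
    exact isHeisenberg3_model.good.realized (i := .row3) isHeisenberg3_model
      (fun _ _ _ _ => trivial)
  | row4 =>
    exact isExtraspecialMinus3_model.good.realized (i := .row4) isExtraspecialMinus3_model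
      (fun _ _ _ _ => trivial)
  | row5 =>
    exact good_fiftyTwo.realized_of_card c52
      (fun j => by cases j <;> simp [Entry.order]) (fun _ => trivial)
  | row6 => exact realized_row6
  | row7 => exact realized_row7
  | row8 =>
    exact good_dihedralElevenPoints.realized (i := .row8) ⟨MulEquiv.refl _⟩
      (fun _ _ _ _ => trivial)
  | row9 => exact realized_row9
  | row10 => exact realized_row10
  | row11 =>
    exact good_fiftyTwo.realized_of_card_subgroup (p := 13) (n := 1) (by norm_num) rfl
      (by rw [c52]; norm_num) (fun j => by cases j <;> simp [Entry.order]) (fun _ => trivial)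
  | row12 =>
    exact good_alternating_twelve.realized (i := .row12) ⟨MulEquiv.refl _⟩
      (fun _ _ _ _ => trivial)
  | row13 =>
    exact good_dihedralElevenPoints.realized_of_card_subgroup (p := 11) (n := 1)
      (by norm_num) rfl (by rw [DihedralGroup.nat_card]; norm_num)
      (fun j => by cases j <;> simp [Entry.order]) (fun _ => trivial)
  | row14 =>
    exact good_seventyTwo.realized_of_injective _ SemidirectProduct.inl_injective
      (i := .row14) ⟨MulEquiv.refl _⟩ (fun _ => trivial)
  | row15 =>
    exact good_eighteen.realized_of_injective _ SemidirectProduct.inl_injective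
      (i := .row15) ⟨MulEquiv.refl _⟩ (fun _ => trivial)
  | row16 =>
    exact good_elementary_eight.realized (i := .row16) ⟨MulEquiv.refl _⟩
      (fun _ _ _ _ => trivial)
  | row17 => exact realized_row17
  | row18 => exact realized_row18
  | row19 =>
    exact good_seventyTwo.realized_of_injective _ SemidirectProduct.inr_injective
      (i := .row19) ⟨MulEquiv.refl _⟩ (fun _ => trivial)
  | row20 => exact realized_row20
  | row21 => exact realized_row21
  | row22 => exact realized_row22
  | row23 =>
    exact good_fiftyTwo.realized_of_injective _ SemidirectProduct.inr_injective
      (i := .row23) ⟨MulEquiv.refl _⟩ (fun _ => trivial)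
  | row24 =>
    exact good_eighteen.realized_of_card_subgroup (p := 3) (n := 1) (by norm_num) rfl
      (by rw [c18]; norm_num) (fun j => by cases j <;> simp [Entry.order]) (fun _ => trivial)
  | row25 =>
    exact good_eighteen.realized_of_card_subgroup (p := 2) (n := 1) (by norm_num) rfl
      (by rw [c18]; norm_num) (fun j => by cases j <;> simp [Entry.order]) (fun _ => trivial)
  | row26 =>
    exact good_eighteen.realized_of_card_subgroup (p := 2) (n := 0) (by norm_num) rfl
      (by simp) (fun j => by cases j <;> simp [Entry.order]) (fun _ => trivial)
  | psu =>
    refine good_seventyTwo.realized_of_card ?_ (fun j => by cases j <;> simp [Entry.order])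
      (fun _ => trivial)
    rw [SemidirectProduct.card, pi_cyc_natCard, card_quaternion]
    rfl

/-! ### The conjugacy classes -/

theorem ncard_fixedPoints_of_areConjugate {G G' : Subgroup S27} (h : AreConjugate G G') :
    (fixedPoints G' (Fin 27)).ncard = (fixedPoints G (Fin 27)).ncard := by
  obtain ⟨g, rfl⟩ := h
  rw [← Set.ncard_image_of_injective (fixedPoints G (Fin 27)) g.injective]
  congr 1
  ext v
  rw [g.image_eq_preimage_symm, Set.mem_preimage, mem_fixedPoints, mem_fixedPoints]
  have key : ∀ a : S27, g (a (g.symm v)) = v ↔ a (g.symm v) = g.symm v := fun a =>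
    g.eq_symm_apply.symm
  constructor
  · rintro hv ⟨a, ha⟩
    exact (key a).1 (hv ⟨_, a, ha, rfl⟩)
  · rintro hv ⟨_, a, ha, rfl⟩
    exact (key a).2 (hv ⟨a, ha⟩)

/-- Each entry describes exactly one conjugacy class. -/
theorem exists_describes_iff_areConjugate (i : Entry) : ∃ G : Subgroup S27, HasPropertiesAG G ∧
    ∀ G' : Subgroup S27, i.Describes G' ↔ AreConjugate G G' := by
  obtain ⟨G, hG, hi, hf⟩ := i.realized
  refine ⟨G, hG.hasPropertiesAG, fun G' => ⟨fun h => (hG.describes hi hf).areConjugate h,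
    fun h => ?_⟩⟩
  refine (hG.hasPropertiesAG.of_areConjugate h).good.describes ?_
    (by rwa [ncard_fixedPoints_of_areConjugate h])
  obtain ⟨g, rfl⟩ := h
  exact hi.of_mulEquiv (G.equivMapOfInjective _ (MulAut.conj g).injective)

theorem hasPropertiesAG_iff_exists_describes (G : Subgroup S27) :
    HasPropertiesAG G ↔ ∃ i : Entry, i.Describes G := by
  refine ⟨fun h => h.good.exists_describes, ?_⟩
  rintro ⟨i, hi⟩
  obtain ⟨G₀, h₀, h⟩ := exists_describes_iff_areConjugate i
  exact h₀.of_areConjugate ((h G).1 hi)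

theorem areConjugate_refl (G : Subgroup S27) : AreConjugate G G :=
  ⟨1, by ext; simp⟩

theorem AreConjugate.trans {G G' G'' : Subgroup S27} (h : AreConjugate G G')
    (h' : AreConjugate G' G'') : AreConjugate G G'' := by
  obtain ⟨g, rfl⟩ := h
  obtain ⟨g', rfl⟩ := h'
  refine ⟨g' * g, ?_⟩
  rw [Subgroup.map_map, map_mul]
  rfl

open Entry in
theorem card_entry : Nat.card Entry = 27 := by
  rw [← Nat.card_fin 27]
  exact Nat.card_congr
    { toFun := fun i => ⟨i.ctorIdx, by cases i <;> decide⟩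
      invFun := ![row1, row2, row3, row4, row5, row6, row7, row8, row9, row10, row11, row12, row13,
        row14, row15, row16, row17, row18, row19, row20, row21, row22, row23, row24, row25, row26,
        psu]
      left_inv := fun i => by cases i <;> rfl
      right_inv := by unfold Function.RightInverse Function.LeftInverse; decide }

theorem ncard_conjugacyClasses : {C : Set (Subgroup S27) | ∃ G : Subgroup S27, HasPropertiesAG G ∧
    C = {G' : Subgroup S27 | AreConjugate G G'}}.ncard = 27 := by
  have h : {C : Set (Subgroup S27) | ∃ G : Subgroup S27, HasPropertiesAG G ∧
      C = {G' : Subgroup S27 | AreConjugate G G'}} =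
      Set.range fun i : Entry => {G' : Subgroup S27 | i.Describes G'} := by
    ext C
    constructor
    · rintro ⟨G, hG, rfl⟩
      obtain ⟨i, hi⟩ := (hasPropertiesAG_iff_exists_describes G).1 hG
      refine ⟨i, Set.ext fun G' => ⟨fun h => hi.areConjugate h, fun h => ?_⟩⟩
      obtain ⟨G₀, -, h₀⟩ := exists_describes_iff_areConjugate i
      exact (h₀ G').2 (((h₀ G).1 hi).trans h)
    · rintro ⟨i, rfl⟩
      obtain ⟨G₀, h, h₀⟩ := exists_describes_iff_areConjugate i
      exact ⟨G₀, h, Set.ext h₀⟩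
  rw [h, ← Set.image_univ, Set.ncard_image_of_injective, Set.ncard_univ, card_entry]
  intro i j hij
  obtain ⟨G₀, -, h₀⟩ := exists_describes_iff_areConjugate i
  have hi := (h₀ G₀).2 (areConjugate_refl G₀)
  exact hi.eq ((Set.ext_iff.1 hij G₀).1 hi)

end PermGroups27

theorem mainTheorem4 :
    -- each entry of the list determines exactly one conjugacy class of subgroups
    (∀ i : Entry, ∃ G : Subgroup S27, ∀ G' : Subgroup S27,
      i.Describes G' ↔ AreConjugate G G') ∧
    -- the subgroups with properties (a)–(g) are exactly those in the list, without repetitions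
    (∀ G : Subgroup S27, HasPropertiesAG G ↔ ∃ i : Entry, i.Describes G) ∧
    (∀ (G : Subgroup S27) (i j : Entry), i.Describes G → j.Describes G → i = j) ∧
    -- there are exactly 27 conjugacy classes of such subgroups
    {C : Set (Subgroup S27) | ∃ G : Subgroup S27, HasPropertiesAG G ∧
      C = {G' : Subgroup S27 | AreConjugate G G'}}.ncard = 27 ∧
    -- the structure of PSU(3, 2)
    IsFaithfulSemidirect (PSU 3 2) (Fin 2 → Cyc 3) (QuaternionGroup 2) :=
  ⟨fun i => (exists_describes_iff_areConjugate i).imp fun _ h => h.2,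
    hasPropertiesAG_iff_exists_describes, fun _ _ _ => Entry.Describes.eq,
    ncard_conjugacyClasses, isFaithfulSemidirect_PSU⟩
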